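/- **Setting.** Let $n\in\mathbb N$, $F\in\mathbb R^{n\times n}$, $b,c\in\mathbb R^n$, $q_0,q_1\in\mathbb R$. Let $\lambda_1,\lambda_2:[0,1]\to(0,\infty)$ be continuous (in particular, they may be piecewise continuously differentiable), and let the entries $A_{ij}:[0,1]\to\mathbb R$ of $A\in\mathbb R^{2\times 2}$ be bounded and Borel (in particular, continuous or piecewise continuous). Put $\Lambda=\operatorname{diag}(\lambda_1,-\lambda_2)$ and consider, with state $(x(\cdot,t),\xi(t))$, $x(z,t)\in\mathbb R^2$, $\xi(t)\in\mathbb R^n$, and input $u(t)\in\mathbb R$, the system $$\dot\xi=F\xi+b\,x_1(0,t),\quad x_2(0,t)=q_0x_1(0,t)+c^\top\xi,\quad \partial_t x=\Lambda(z)\partial_z x+A(z)x,\quad x_1(1,t)=q_1x_2(1,t)+u(t)\tag{1}$$ on $z\in[0,1]$, $t\ge0$ (boundary conditions for $t>0$). Solutions are Borel, bounded on $[0,1]\times[0,T]$ for every $T$, and satisfy the PDE by integration along the characteristics. A reference is any solution $(x_{\mathrm r},\xi_{\mathrm r},u_{\mathrm r})$ of (1). **Transformation.** Let $\alpha_i(z)=\int_0^zA_{ii}/\lambda_i$,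 $E=\operatorname{diag}(e^{\alpha_1},e^{-\alpha_2})$, $\bar q_1=q_1e^{\alpha_1(1)+\alpha_2(1)}$, and let $\tilde A$ have zero diagonal and $\tilde A_{12}=A_{12}e^{\alpha_1+\alpha_2}$, $\tilde A_{21}=A_{21}e^{-\alpha_1-\alpha_2}$. On $0\le\zeta\le z\le1$ let $K(z,\zeta)\in\mathbb R^{2\times2}$ be a bounded Borel solution, along characteristics, of $$\Lambda(z)\partial_zK+\partial_\zeta\big(K\Lambda(\zeta)\big)=K\tilde A(\zeta),\quad K_{11}(z,0)=\tfrac{q_0\lambda_2(0)}{\lambda_1(0)}K_{12}(z,0),\quad K_{22}(z,0)=\tfrac{\lambda_1(0)}{q_0\lambda_2(0)}K_{21}(z,0),$$ $$K_{12}(z,z)=-\tfrac{\tilde A_{12}(z)}{\lambda_1(z)+\lambda_2(z)},\qquad K_{21}(z,z)=\tfrac{\tilde A_{21}(z)}{\lambda_1(z)+\lambda_2(z)}.$$ Put $\tilde x=Ex$, $\bar x(z,t)=\tilde x(z,t)-\int_0^zK(z,\zeta)\tilde x(\zeta,t)\,d\zeta$, $\bar u=e^{\alpha_1(1)}u+\int_0^1(\bar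 q_1e_2^\top-e_1^\top)K(1,z)\tilde x(z,t)\,dz$, and $C(z)=K(z,0)\Lambda(0)e_2c^\top$; $\bar x_{\mathrm r},\bar u_{\mathrm r}$ are obtained in the same way from $x_{\mathrm r},u_{\mathrm r}$. Write $e_\xi=\xi-\xi_{\mathrm r}$ and $\varepsilon=\bar x-\bar x_{\mathrm r}$. **Controller.** For $k\in\mathbb R^n$ let $N:[0,1]\to\mathbb R^{2\times n}$ be the continuous solution of $\Lambda N'=N(F+bk^\top)-C$ (in integrated form) with rows $k^\top$ and $c^\top+q_0k^\top$ of $N(0)$, and let $P(z,\zeta)\in\mathbb R^{2\times2}$ be a bounded Borel solution, along characteristics, of $$\Lambda(z)\partial_zP+\partial_\zeta\big(P\Lambda(\zeta)\big)=0,\quad P(z,z)\Lambda(z)=\Lambda(z)P(z,z),\quad P(z,0)\Lambda(0)(e_1+q_0e_2)+\int_0^zP(z,\zeta)N(\zeta)b\,d\zeta=N(z)b.$$ The backstepping tracking controller with parameter $\bar q_{1,\mathrm{cl}}\in\mathbb R$ is $$\bar u=\bar u_{\mathrm r}+(\bar q_{1,\mathrm{cl}}-\bar q_1)\varepsilon_2(1,t)+\int_0^1(e_1^\top-\bar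 q_{1,\mathrm{cl}}e_2^\top)P(1,z)\varepsilon(z,t)\,dz+(e_1^\top-\bar q_{1,\mathrm{cl}}e_2^\top)\Big[N(1)-\int_0^1P(1,z)N(z)\,dz\Big]e_\xi(t).\tag{2}$$ **Theorem (closed-loop stability).** Let $(F,b)$ be controllable and $q_0\ne0$, let $F+bk^\top$ be Hurwitz and $|q_0\bar q_{1,\mathrm{cl}}|<1$. Then $K,N,P$ as above exist, and for all such $K,N,P$ the state feedback (2) exponentially stabilizes (1) along reference trajectories: for every reference and every initial state $(x_0,\xi_0)$ with bounded Borel $x_0:[0,1]\to\mathbb R^2$, the closed loop (1), (2) has a solution on $t\ge0$, and there are $M,\omega>0$ such that for every reference, every closed-loop solution and all $t\ge0$ $$\big\|(x-x_{\mathrm r},\,\xi-\xi_{\mathrm r})(t)\big\|_{L^2(0,1)^2\times\mathbb R^n}\le Me^{-\omega t}\big\|(x-x_{\mathrm r},\,\xi-\xi_{\mathrm r})(0)\big\|_{L^2(0,1)^2\times\mathbb R^n},$$ and the same estimate holds with $\max\{\sup_{z\in[0,1]}\|x(z,t)-x_{\mathrm r}(z,t)\|,\ \|\xi(t)-\xi_{\mathrm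 r}(t)\|\}$ (maximum norms) in place of the norm of $L^2(0,1)^2\times\mathbb R^n$, on both sides. -/

import Mathlib

open Set MeasureTheory Matrix

noncomputable section

/-- Data of the PDE-ODE system
`ξ' = F ξ + b x₁(0,t)`, `x₂(0,t) = q₀ x₁(0,t) + cᵀ ξ`, `∂ₜ x = Λ(z) ∂_z x + A(z) x`,
`x₁(1,t) = q₁ x₂(1,t) + u(t)` on `z ∈ [0,1]`, with `Λ = diag(λ₁, -λ₂)`.
The PDE components `1, 2` are indexed by `0, 1 : Fin 2`. Only the values of `lam`, `A` on `[0,1]`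
matter. -/
structure HyperbolicPDEODE (n : ℕ) where
  lam : Fin 2 → ℝ → ℝ
  A : ℝ → Matrix (Fin 2) (Fin 2) ℝ
  F : Matrix (Fin n) (Fin n) ℝ
  b : Fin n → ℝ
  c : Fin n → ℝ
  q0 : ℝ
  q1 : ℝ
  lam_cont : ∀ i, ContinuousOn (lam i) (Icc 0 1)
  lam_pos : ∀ i, ∀ z ∈ Icc (0 : ℝ) 1, 0 < lam i z
  A_meas : ∀ i j, Measurable ((Icc (0 : ℝ) 1).domRestrict fun z => A z i j)
  A_bdd : ∃ B : ℝ, ∀ i j, ∀ z ∈ Icc (0 : ℝ) 1, |A z i j| ≤ B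

/-- Signs of the diagonal entries of `Λ = diag(λ₁, -λ₂)`. -/
def charSign : Fin 2 → ℝ := ![1, -1]

/-- The triangle `0 ≤ ζ ≤ z ≤ 1`, with points written `(z, ζ)`. -/
def kernelTriangle : Set (ℝ × ℝ) := {p | 0 ≤ p.2 ∧ p.2 ≤ p.1 ∧ p.1 ≤ 1}

/-- All complex eigenvalues have negative real part. -/
def IsHurwitz {n : ℕ} (M : Matrix (Fin n) (Fin n) ℝ) : Prop :=
  ∀ μ ∈ spectrum ℂ (M.map (algebraMap ℝ ℂ)), μ.re < 0

/-- Controllability of `(F, b)`: the Kalman matrix `[b, F b, …, F ^ (n-1) b]` has rank `n`. -/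
def IsControllablePair {n : ℕ} (F : Matrix (Fin n) (Fin n) ℝ) (b : Fin n → ℝ) : Prop :=
  (Matrix.of fun i j : Fin n => ((F ^ (j : ℕ)) *ᵥ b) i).rank = n

namespace HyperbolicPDEODE

variable {n : ℕ} (S : HyperbolicPDEODE n)

/-- `Λ(z)`. -/
def Lam (z : ℝ) : Matrix (Fin 2) (Fin 2) ℝ := diagonal fun i => charSign i * S.lam i z

/-- `φᵢ(z) = ∫₀ᶻ dζ / λᵢ(ζ)`. -/
def phi (i : Fin 2) (z : ℝ) : ℝ := ∫ ζ in (0 : ℝ)..z, (S.lam i ζ)⁻¹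

/-- `αᵢ(z) = ∫₀ᶻ Aᵢᵢ(ζ) / λᵢ(ζ) dζ`. -/
def alpha (i : Fin 2) (z : ℝ) : ℝ := ∫ ζ in (0 : ℝ)..z, S.A ζ i i / S.lam i ζ

/-- A solution on `t ≥ 0`, in the sense of integration along characteristics; `x t z` is the value
of the PDE state at time `t` and place `z`. The component `xᵢ` is propagated along the curves
`σᵢ φᵢ(z) + t = const` (with `σ = (1, -1)`), here parametrized by `z`, where it has the rate
`(A x)ᵢ` with respect to time. The state is Borel and locally bounded in time, so jumps, and
initial values that are incompatible with the boundary conditions, are allowed. -/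
structure IsSolution (x : ℝ → ℝ → Fin 2 → ℝ) (ξ : ℝ → Fin n → ℝ) (u : ℝ → ℝ) : Prop where
  meas : ∀ i, Measurable ((Ici (0 : ℝ) ×ˢ Icc (0 : ℝ) 1).domRestrict fun p => x p.1 p.2 i)
  bdd : ∀ T : ℝ, ∃ B : ℝ, ∀ t ∈ Icc 0 T, ∀ z ∈ Icc (0 : ℝ) 1, ∀ i, |x t z i| ≤ B
  ode_cont : ContinuousOn ξ (Ici 0)
  ode : ∀ t, 0 ≤ t → ξ t = ξ 0 + ∫ s in (0 : ℝ)..t, (S.F *ᵥ ξ s + x s 0 0 • S.b)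
  bc0 : ∀ t, 0 < t → x t 0 1 = S.q0 * x t 0 0 + S.c ⬝ᵥ ξ t
  pde : ∀ i, ∀ z₀ ∈ Icc (0 : ℝ) 1, ∀ z₁ ∈ Icc (0 : ℝ) 1, ∀ t₀ t₁ : ℝ, 0 ≤ t₀ → 0 ≤ t₁ →
    charSign i * S.phi i z₁ + t₁ = charSign i * S.phi i z₀ + t₀ →
    x t₁ z₁ i = x t₀ z₀ i - charSign i * ∫ ζ in z₀..z₁,
      (S.A ζ *ᵥ x (t₀ + charSign i * (S.phi i z₀ - S.phi i ζ)) ζ) i / S.lam i ζ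
  bc1 : ∀ t, 0 < t → x t 1 0 = S.q1 * x t 1 1 + u t

/-- The scaling matrix `E(z) = diag(exp α₁(z), exp (-α₂(z)))`. -/
def E (z : ℝ) : Matrix (Fin 2) (Fin 2) ℝ :=
  diagonal ![Real.exp (S.alpha 0 z), Real.exp (-S.alpha 1 z)]

/-- The coupling matrix `Ã(z)` that remains after the scaling by `E`. -/
def Atilde (z : ℝ) : Matrix (Fin 2) (Fin 2) ℝ :=
  !![0, S.A z 0 1 * Real.exp (S.alpha 0 z + S.alpha 1 z);
     S.A z 1 0 * Real.exp (-S.alpha 0 z - S.alpha 1 z), 0]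

/-- `q̄₁ = q₁ exp (α₁(1) + α₂(1))`. -/
def q1bar : ℝ := S.q1 * Real.exp (S.alpha 0 1 + S.alpha 1 1)

/-- `Q` is a bounded Borel solution, along characteristics, of
`Λ(z) ∂_z Q(z,ζ) + ∂_ζ (Q(z,ζ) Λ(ζ)) = Q(z,ζ) B(ζ)` on the triangle. A characteristic of the
`(i,j)` entry is a curve `ζ ↦ (Z ζ, ζ)` with `σᵢ φᵢ(Z ζ) - σⱼ φⱼ(ζ)` constant; along it
`d/dζ (Qᵢⱼ λⱼ) = σⱼ (Q B)ᵢⱼ`. -/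
structure IsTransportKernel (B : ℝ → Matrix (Fin 2) (Fin 2) ℝ)
    (Q : ℝ → ℝ → Matrix (Fin 2) (Fin 2) ℝ) : Prop where
  meas : ∀ i j, Measurable (kernelTriangle.domRestrict fun p => Q p.1 p.2 i j)
  bdd : ∃ M : ℝ, ∀ i j, ∀ p ∈ kernelTriangle, |Q p.1 p.2 i j| ≤ M
  pde : ∀ (i j : Fin 2) (ζ₀ ζ₁ : ℝ) (Z : ℝ → ℝ), ζ₀ ≤ ζ₁ →
    (∀ ζ ∈ Icc ζ₀ ζ₁, (Z ζ, ζ) ∈ kernelTriangle ∧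
      charSign i * S.phi i (Z ζ) - charSign j * S.phi j ζ =
        charSign i * S.phi i (Z ζ₀) - charSign j * S.phi j ζ₀) →
    Q (Z ζ₁) ζ₁ i j * S.lam j ζ₁ = Q (Z ζ₀) ζ₀ i j * S.lam j ζ₀ +
      charSign j * ∫ ζ in ζ₀..ζ₁, (Q (Z ζ) ζ * B ζ) i j

/-- `K` solves the kernel equations of the preliminary Volterra transformation. -/
structure IsPreKernel (K : ℝ → ℝ → Matrix (Fin 2) (Fin 2) ℝ) : Prop where
  transport : S.IsTransportKernel S.Atilde K
  bc11 : ∀ z ∈ Icc (0 : ℝ) 1, K z 0 0 0 = S.q0 * S.lam 1 0 / S.lam 0 0 * K z 0 0 1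
  bc12 : ∀ z ∈ Icc (0 : ℝ) 1, K z z 0 1 = -(S.Atilde z 0 1 / (S.lam 0 z + S.lam 1 z))
  bc21 : ∀ z ∈ Icc (0 : ℝ) 1, K z z 1 0 = S.Atilde z 1 0 / (S.lam 0 z + S.lam 1 z)
  bc22 : ∀ z ∈ Icc (0 : ℝ) 1, K z 0 1 1 = S.lam 0 0 / (S.q0 * S.lam 1 0) * K z 0 1 0

/-- `C(z) = K(z,0) Λ(0) e₂ cᵀ`. -/
def C (K : ℝ → ℝ → Matrix (Fin 2) (Fin 2) ℝ) (z : ℝ) : Matrix (Fin 2) (Fin n) ℝ :=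
  vecMulVec ((K z 0 * S.Lam 0) *ᵥ ![0, 1]) S.c

/-- `N` solves `Λ N' = N (F + b kᵀ) - C`, `N(0) = [kᵀ; cᵀ + q₀ kᵀ]` on `[0,1]`
(in integrated form, since `C` need not be continuous). -/
structure IsDecoupling (k : Fin n → ℝ) (K : ℝ → ℝ → Matrix (Fin 2) (Fin 2) ℝ)
    (N : ℝ → Matrix (Fin 2) (Fin n) ℝ) : Prop where
  cont : ContinuousOn N (Icc 0 1)
  init : N 0 = Matrix.of ![k, S.c + S.q0 • k]
  ode : ∀ z ∈ Icc (0 : ℝ) 1, ∀ i m, N z i m = N 0 i m + ∫ ζ in (0 : ℝ)..z,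
    (charSign i * S.lam i ζ)⁻¹ * (N ζ * (S.F + vecMulVec S.b k) - S.C K ζ) i m

/-- `P` solves the kernel equations of the backstepping Volterra transformation. -/
structure IsBacksteppingKernel (N : ℝ → Matrix (Fin 2) (Fin n) ℝ)
    (P : ℝ → ℝ → Matrix (Fin 2) (Fin 2) ℝ) : Prop where
  transport : S.IsTransportKernel 0 P
  bc_diag : ∀ z ∈ Icc (0 : ℝ) 1, P z z * S.Lam z - S.Lam z * P z z = 0
  bc_zero : ∀ z ∈ Icc (0 : ℝ) 1, ∀ i,
    ((P z 0 * S.Lam 0) *ᵥ ![1, S.q0]) i + ∫ ζ in (0 : ℝ)..z, ((P z ζ * N ζ) *ᵥ S.b) i =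
      (N z *ᵥ S.b) i

/-- `x̃(z) = E(z) x(z)`. -/
def tilde (w : ℝ → Fin 2 → ℝ) (z : ℝ) : Fin 2 → ℝ := S.E z *ᵥ w z

/-- `x̄(z) = x̃(z) - ∫₀ᶻ K(z,ζ) x̃(ζ) dζ`. -/
def bar (K : ℝ → ℝ → Matrix (Fin 2) (Fin 2) ℝ) (w : ℝ → Fin 2 → ℝ) (z : ℝ) : Fin 2 → ℝ :=
  fun i => S.tilde w z i - ∫ ζ in (0 : ℝ)..z, (K z ζ *ᵥ S.tilde w ζ) i

/-- The transformed input
`ū = exp(α₁(1)) u + ∫₀¹ (q̄₁ e₂ᵀ - e₁ᵀ) K(1,z) x̃(z) dz` for the PDE state `w`. -/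
def inputBar (K : ℝ → ℝ → Matrix (Fin 2) (Fin 2) ℝ) (w : ℝ → Fin 2 → ℝ) (u : ℝ) : ℝ :=
  Real.exp (S.alpha 0 1) * u +
    ∫ z in (0 : ℝ)..1, ![-1, S.q1bar] ⬝ᵥ (K 1 z *ᵥ S.tilde w z)

/-- The value of `ū` demanded by the backstepping tracking controller in the state `(w, ξ)`, when
the reference is in the state `(wr, ξr)` with input `ur`. -/
def backsteppingController (K P : ℝ → ℝ → Matrix (Fin 2) (Fin 2) ℝ)
    (N : ℝ → Matrix (Fin 2) (Fin n) ℝ) (qcl : ℝ)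
    (w : ℝ → Fin 2 → ℝ) (ξ : Fin n → ℝ) (wr : ℝ → Fin 2 → ℝ) (ξr : Fin n → ℝ) (ur : ℝ) : ℝ :=
  S.inputBar K wr ur + (qcl - S.q1bar) * (S.bar K w 1 - S.bar K wr 1) 1 +
    (∫ z in (0 : ℝ)..1, ![1, -qcl] ⬝ᵥ (P 1 z *ᵥ (S.bar K w z - S.bar K wr z))) +
    ![1, -qcl] ⬝ᵥ ((Matrix.of fun i m =>
      N 1 i m - ∫ z in (0 : ℝ)..1, (P 1 z * N z) i m) *ᵥ (ξ - ξr))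

/-- `(x, ξ)` is a solution of the system under the backstepping tracking controller, for the
reference `(xr, ξr, ur)`: the input `u` is the one whose transform `ū` is prescribed by the
controller. -/
def IsClosedLoopSolution (K P : ℝ → ℝ → Matrix (Fin 2) (Fin 2) ℝ)
    (N : ℝ → Matrix (Fin 2) (Fin n) ℝ) (qcl : ℝ)
    (xr : ℝ → ℝ → Fin 2 → ℝ) (ξr : ℝ → Fin n → ℝ) (ur : ℝ → ℝ)
    (x : ℝ → ℝ → Fin 2 → ℝ) (ξ : ℝ → Fin n → ℝ) : Prop :=
  ∃ u : ℝ → ℝ, S.IsSolution x ξ u ∧ ∀ t, 0 < t →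
    S.inputBar K (x t) (u t) =
      S.backsteppingController K P N qcl (x t) (ξ t) (xr t) (ξr t) (ur t)

end HyperbolicPDEODE

/-- The norm of `ℝⁿ × L²(0,1)²`. -/
def stateNormL2 {n : ℕ} (w : ℝ → Fin 2 → ℝ) (ξ : Fin n → ℝ) : ℝ :=
  Real.sqrt (ξ ⬝ᵥ ξ + ∫ z in (0 : ℝ)..1, w z ⬝ᵥ w z)

end

noncomputable section

/-! ### Measurability helpers -/

theorem measurable_indicator_of_domRestrict {α : Type*} [MeasurableSpace α] {s : Set α}
    (hs : MeasurableSet s) {f : α → ℝ} (hf : Measurable (s.domRestrict f)) :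
    Measurable (s.indicator f) := by
  refine measurable_of_restrict_of_restrict_compl hs ?_ ?_
  · convert hf using 1
    ext x; simp [Set.domRestrict]
  · have : (sᶜ).domRestrict (s.indicator f) = fun _ => 0 := by
      ext x; exact Set.indicator_of_notMem x.2 f
    rw [this]; exact measurable_const

theorem measurable_domRestrict_congr {α : Type*} [MeasurableSpace α] {s : Set α} {f g : α → ℝ}
    (hf : Measurable f) (h : ∀ x ∈ s, g x = f x) : Measurable (s.domRestrict g) := by
  have : s.domRestrict g = fun x : s => f x := by
    ext x; exact h x x.2
  rw [this]; exact hf.comp measurable_subtype_coe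

theorem measurable_intervalIntegral_param {α : Type*} [MeasurableSpace α] {F : α → ℝ → ℝ}
    (hF : Measurable (Function.uncurry F)) {a b : α → ℝ} (ha : Measurable a) (hb : Measurable b) :
    Measurable fun x => ∫ s in a x..b x, F x s := by
  have key : ∀ {a b : α → ℝ}, Measurable a → Measurable b →
      Measurable fun x => ∫ s in Ioc (a x) (b x), F x s := by
    intro a b ha hb
    have h1 : ∀ x, ∫ s in Ioc (a x) (b x), F x s =
        ∫ s, {p : α × ℝ | a p.1 < p.2 ∧ p.2 ≤ b p.1}.indicator (Function.uncurry F) (x, s) := by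
      intro x
      rw [← integral_indicator measurableSet_Ioc]
      congr 1
    simp_rw [h1]
    refine (StronglyMeasurable.integral_prod_right (f := fun x s =>
      {p : α × ℝ | a p.1 < p.2 ∧ p.2 ≤ b p.1}.indicator (Function.uncurry F) (x, s))
      ?_).measurable
    refine (Measurable.indicator hF ?_).stronglyMeasurable
    exact (measurableSet_lt (ha.comp measurable_fst) measurable_snd).inter
      (measurableSet_le measurable_snd (hb.comp measurable_fst))
  simp only [intervalIntegral]
  exact (key ha hb).sub (key hb ha)

theorem intervalIntegrable_of_bdd {f : ℝ → ℝ} {a b C : ℝ}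
    (hf : AEStronglyMeasurable f (volume.restrict (uIcc a b))) (hC : ∀ x ∈ uIcc a b, |f x| ≤ C) :
    IntervalIntegrable f volume a b := by
  rw [intervalIntegrable_iff]
  have h1 : AEStronglyMeasurable f (volume.restrict (uIoc a b)) :=
    AEStronglyMeasurable.mono_measure hf (Measure.restrict_mono uIoc_subset_uIcc le_rfl)
  refine Integrable.mono' (g := fun _ => C) (by rw [uIoc]; exact integrable_const C) h1 ?_
  filter_upwards [ae_restrict_mem measurableSet_uIoc] with x hx
  exact hC x (uIoc_subset_uIcc hx)

theorem Measurable.intervalIntegrable_of_bdd {f : ℝ → ℝ} (hf : Measurable f) {a b C : ℝ}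
    (hC : ∀ x ∈ uIcc a b, |f x| ≤ C) : IntervalIntegrable f volume a b :=
  _root_.intervalIntegrable_of_bdd hf.aestronglyMeasurable hC

/-! ### Primitives of bounded functions -/

/-- `f` is a primitive on `[a, b]` of the bounded measurable function `g`. -/
structure IsBddPrimitive (f g : ℝ → ℝ) (a b : ℝ) : Prop where
  meas : AEStronglyMeasurable g (volume.restrict (Icc a b))
  bdd : ∃ C, ∀ t ∈ Icc a b, |g t| ≤ C
  eq : ∀ t ∈ Icc a b, f t = f a + ∫ s in a..t, g s

namespace IsBddPrimitive

variable {f g f₁ g₁ f₂ g₂ : ℝ → ℝ} {a b : ℝ}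

theorem intervalIntegrable (h : IsBddPrimitive f g a b) {s t : ℝ} (hs : s ∈ Icc a b)
    (ht : t ∈ Icc a b) : IntervalIntegrable g volume s t := by
  obtain ⟨C, hC⟩ := h.bdd
  have hsub : uIcc s t ⊆ Icc a b := (convex_Icc a b).ordConnected.uIcc_subset hs ht
  exact intervalIntegrable_of_bdd (h.meas.mono_measure (Measure.restrict_mono hsub le_rfl))
    fun x hx => hC x (hsub hx)

theorem sub_eq (h : IsBddPrimitive f g a b) {s t : ℝ} (hs : s ∈ Icc a b) (ht : t ∈ Icc a b) :
    f t - f s = ∫ r in s..t, g r := by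
  have ha : a ∈ Icc a b := ⟨le_rfl, hs.1.trans hs.2⟩
  rw [h.eq t ht, h.eq s hs, ← intervalIntegral.integral_add_adjacent_intervals
    (h.intervalIntegrable ha hs) (h.intervalIntegrable hs ht)]
  ring

theorem lipschitz (h : IsBddPrimitive f g a b) : ∃ K, LipschitzOnWith K f (Icc a b) := by
  obtain ⟨C, hC⟩ := h.bdd
  refine ⟨(max C 0).toNNReal, LipschitzOnWith.of_dist_le_mul fun s hs t ht => ?_⟩
  rw [dist_comm, Real.dist_eq, h.sub_eq hs ht, Real.coe_toNNReal _ (le_max_right _ _), dist_comm,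
    Real.dist_eq]
  refine intervalIntegral.norm_integral_le_of_norm_le_const (f := g) fun x hx => ?_
  have hsub : uIcc s t ⊆ Icc a b := (convex_Icc a b).ordConnected.uIcc_subset hs ht
  exact (hC x (hsub (uIoc_subset_uIcc hx))).trans (le_max_left _ _)

theorem continuousOn (h : IsBddPrimitive f g a b) : ContinuousOn f (Icc a b) :=
  h.lipschitz.choose_spec.continuousOn

theorem bdd_fun (h : IsBddPrimitive f g a b) : ∃ C, ∀ t ∈ Icc a b, |f t| ≤ C :=
  (isCompact_Icc.exists_bound_of_continuousOn h.continuousOn)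

theorem ae_hasDerivAt (h : IsBddPrimitive f g a b) :
    ∀ᵐ x, x ∈ Ioo a b → HasDerivAt f (g x) x := by
  rcases le_or_gt b a with hab | hab
  · simp [Ioo_eq_empty (not_lt.2 hab)]
  have ha : a ∈ Icc a b := ⟨le_rfl, hab.le⟩
  have hb : b ∈ Icc a b := ⟨hab.le, le_rfl⟩
  filter_upwards [(h.intervalIntegrable ha hb).ae_hasDerivAt_integral] with x hx hx'
  have h1 := (hx (by rw [uIcc_of_le hab.le]; exact Ioo_subset_Icc_self hx') a
    (by simp)).const_add (f a)
  refine h1.congr_of_eventuallyEq ?_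
  filter_upwards [Ioo_mem_nhds hx'.1 hx'.2] with y hy
  exact h.eq y (Ioo_subset_Icc_self hy)

theorem of_lipschitz {K : NNReal} (hf : LipschitzOnWith K f (Icc a b))
    (hg : AEStronglyMeasurable g (volume.restrict (Icc a b))) (hbdd : ∃ C, ∀ t ∈ Icc a b, |g t| ≤ C)
    (h : ∀ᵐ x, x ∈ Ioo a b → HasDerivAt f (g x) x) : IsBddPrimitive f g a b := by
  refine ⟨hg, hbdd, fun t ht => ?_⟩
  have hac : AbsolutelyContinuousOnInterval f a t := by
    apply LipschitzOnWith.absolutelyContinuousOnInterval (K := K)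
    rw [uIcc_of_le ht.1]
    exact hf.mono (Icc_subset_Icc_right ht.2)
  have h1 := hac.integral_deriv_eq_sub
  rw [← sub_eq_iff_eq_add', ← h1]
  refine intervalIntegral.integral_congr_ae ?_
  filter_upwards [h, (measure_eq_zero_iff_ae_notMem.1 (Real.volume_singleton (a := t)))]
    with x hx hxt hxm
  rw [uIoc_of_le ht.1] at hxm
  have hne : x ≠ t := fun h => hxt (by simp [h])
  exact (hx ⟨hxm.1, (lt_of_le_of_ne hxm.2 hne).trans_le ht.2⟩).deriv

theorem mul (h₁ : IsBddPrimitive f₁ g₁ a b) (h₂ : IsBddPrimitive f₂ g₂ a b) :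
    IsBddPrimitive (fun t => f₁ t * f₂ t) (fun t => g₁ t * f₂ t + f₁ t * g₂ t) a b := by
  obtain ⟨K₁, hK₁⟩ := h₁.lipschitz
  obtain ⟨K₂, hK₂⟩ := h₂.lipschitz
  obtain ⟨B₁, hB₁⟩ := h₁.bdd_fun
  obtain ⟨B₂, hB₂⟩ := h₂.bdd_fun
  obtain ⟨C₁, hC₁⟩ := h₁.bdd
  obtain ⟨C₂, hC₂⟩ := h₂.bdd
  refine of_lipschitz (K := K₁ * B₂.toNNReal + B₁.toNNReal * K₂) ?_ ?_ ?_ ?_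
  · refine LipschitzOnWith.of_dist_le_mul fun s hs t ht => ?_
    have e1 := hK₁.dist_le_mul s hs t ht
    have e2 := hK₂.dist_le_mul s hs t ht
    rw [Real.dist_eq] at e1 e2 ⊢
    have p1 : 0 ≤ B₁ := (abs_nonneg _).trans (hB₁ s hs)
    have p2 : 0 ≤ B₂ := (abs_nonneg _).trans (hB₂ s hs)
    simp only [NNReal.coe_add, NNReal.coe_mul, Real.coe_toNNReal _ p1, Real.coe_toNNReal _ p2]
    calc |f₁ s * f₂ s - f₁ t * f₂ t| = |(f₁ s - f₁ t) * f₂ t + f₁ s * (f₂ s - f₂ t)| := by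
          congr 1; ring
      _ ≤ |f₁ s - f₁ t| * |f₂ t| + |f₁ s| * |f₂ s - f₂ t| := by
          rw [← abs_mul, ← abs_mul]; exact abs_add_le _ _
      _ ≤ (K₁ * dist s t) * B₂ + B₁ * (K₂ * dist s t) := by
          gcongr
          · exact hB₂ t ht
          · exact hB₁ s hs
      _ = _ := by ring
  · exact (h₁.meas.mul (h₂.continuousOn.aestronglyMeasurable measurableSet_Icc)).add
      ((h₁.continuousOn.aestronglyMeasurable measurableSet_Icc).mul h₂.meas)
  · refine ⟨C₁ * B₂ + B₁ * C₂, fun t ht => (abs_add_le _ _).trans ?_⟩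
    rw [abs_mul, abs_mul]
    have p1 : 0 ≤ B₁ := (abs_nonneg _).trans (hB₁ t ht)
    have p2 : 0 ≤ C₁ := (abs_nonneg _).trans (hC₁ t ht)
    gcongr
    exacts [hC₁ t ht, hB₂ t ht, hB₁ t ht, hC₂ t ht]
  · filter_upwards [h₁.ae_hasDerivAt, h₂.ae_hasDerivAt] with x hx₁ hx₂ hx
    exact (hx₁ hx).mul (hx₂ hx)

theorem exp (h : IsBddPrimitive f g a b) :
    IsBddPrimitive (fun t => Real.exp (f t)) (fun t => Real.exp (f t) * g t) a b := by
  obtain ⟨K, hK⟩ := h.lipschitz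
  obtain ⟨B, hB⟩ := h.bdd_fun
  obtain ⟨C, hC⟩ := h.bdd
  have hexp : LipschitzOnWith (Real.exp B).toNNReal Real.exp (Icc (-B) B) := by
    refine Convex.lipschitzOnWith_of_nnnorm_deriv_le (fun x _ => Real.differentiableAt_exp)
      (fun x hx => ?_) (convex_Icc _ _)
    rw [← NNReal.coe_le_coe, Real.coe_toNNReal _ (Real.exp_pos _).le]
    simpa using hx.2
  refine of_lipschitz (hexp.comp hK fun t ht => abs_le.1 (hB t ht)) ?_ ?_ ?_
  · exact (Real.continuous_exp.comp_continuousOn h.continuousOn).aestronglyMeasurable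
      measurableSet_Icc |>.mul h.meas
  · refine ⟨Real.exp B * C, fun t ht => ?_⟩
    rw [abs_mul, abs_of_pos (Real.exp_pos _)]
    exact mul_le_mul (Real.exp_le_exp.2 (abs_le.1 (hB t ht)).2) (hC t ht) (abs_nonneg _)
      (Real.exp_pos _).le
  · filter_upwards [h.ae_hasDerivAt] with x hx hx'
    exact (hx hx').exp

theorem congr {f' g' : ℝ → ℝ} (h : IsBddPrimitive f g a b) (hf : ∀ t ∈ Icc a b, f' t = f t)
    (hg : ∀ t ∈ Icc a b, g' t = g t) : IsBddPrimitive f' g' a b := by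
  refine ⟨h.meas.congr ?_, ?_, fun t ht => ?_⟩
  · filter_upwards [ae_restrict_mem measurableSet_Icc] with t ht
    exact (hg t ht).symm
  · obtain ⟨C, hC⟩ := h.bdd
    exact ⟨C, fun t ht => by rw [hg t ht]; exact hC t ht⟩
  · rw [hf t ht, hf a ⟨le_rfl, ht.1.trans ht.2⟩, h.eq t ht]
    congr 1
    refine intervalIntegral.integral_congr fun s hs => ?_
    rw [uIcc_of_le ht.1] at hs
    exact (hg s ⟨hs.1, hs.2.trans ht.2⟩).symm

theorem add (h₁ : IsBddPrimitive f₁ g₁ a b) (h₂ : IsBddPrimitive f₂ g₂ a b) :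
    IsBddPrimitive (fun t => f₁ t + f₂ t) (fun t => g₁ t + g₂ t) a b := by
  obtain ⟨C₁, hC₁⟩ := h₁.bdd
  obtain ⟨C₂, hC₂⟩ := h₂.bdd
  refine ⟨h₁.meas.add h₂.meas, ⟨C₁ + C₂, fun t ht => (abs_add_le _ _).trans
    (add_le_add (hC₁ t ht) (hC₂ t ht))⟩, fun t ht => ?_⟩
  have ha : a ∈ Icc a b := ⟨le_rfl, ht.1.trans ht.2⟩
  rw [intervalIntegral.integral_add (h₁.intervalIntegrable ha ht) (h₂.intervalIntegrable ha ht),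
    h₁.eq t ht, h₂.eq t ht]
  ring

theorem sum {ι : Type*} (s : Finset ι) {f g : ι → ℝ → ℝ}
    (h : ∀ i ∈ s, IsBddPrimitive (f i) (g i) a b) :
    IsBddPrimitive (fun t => ∑ i ∈ s, f i t) (fun t => ∑ i ∈ s, g i t) a b := by
  classical
  induction s using Finset.induction_on with
  | empty => exact ⟨by simpa using aestronglyMeasurable_const, ⟨0, by simp⟩, by simp⟩
  | insert i s hi ih =>
    simp_rw [Finset.sum_insert hi]
    exact (h i (Finset.mem_insert_self _ _)).add
      (ih fun j hj => h j (Finset.mem_insert_of_mem hj))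

theorem const_mul (h : IsBddPrimitive f g a b) (c : ℝ) :
    IsBddPrimitive (fun t => c * f t) (fun t => c * g t) a b := by
  obtain ⟨C, hC⟩ := h.bdd
  refine ⟨h.meas.const_mul c, ⟨|c| * C, fun t ht => ?_⟩, fun t ht => ?_⟩
  · rw [abs_mul]; exact mul_le_mul_of_nonneg_left (hC t ht) (abs_nonneg _)
  · rw [intervalIntegral.integral_const_mul, h.eq t ht]; ring

theorem of_hasDerivAt (h : ∀ t ∈ Icc a b, HasDerivAt f (g t) t) (hg : ContinuousOn g (Icc a b)) :
    IsBddPrimitive f g a b := by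
  refine ⟨hg.aestronglyMeasurable measurableSet_Icc, isCompact_Icc.exists_bound_of_continuousOn hg,
    fun t ht => ?_⟩
  have hsub : uIcc a t ⊆ Icc a b := by
    rw [uIcc_of_le ht.1]; exact Icc_subset_Icc_right ht.2
  rw [intervalIntegral.integral_eq_sub_of_hasDerivAt (fun x hx => h x (hsub hx))
    (hg.mono hsub).intervalIntegrable]
  ring

end IsBddPrimitive

/-! ### A fixed point theorem in weighted spaces of measurable functions -/

/-- A map that contracts a weighted sup norm on measurable functions has a fixed point. -/
theorem exists_measurable_fixedPoint {ι Y : Type*} [MeasurableSpace Y] (w : ι → Y → ℝ)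
    (hw : ∀ i y, 0 ≤ w i y)
    (T : (ι → Y → ℝ) → ι → Y → ℝ)
    (hmeas : ∀ f, (∀ i, Measurable (f i)) → (∃ C, ∀ i y, |f i y| ≤ C * w i y) →
      (∀ i, Measurable (T f i)) ∧ ∃ C, ∀ i y, |T f i y| ≤ C * w i y)
    (hcontr : ∀ f g, (∀ i, Measurable (f i)) → (∀ i, Measurable (g i)) →
      (∃ C, ∀ i y, |f i y| ≤ C * w i y) → (∃ C, ∀ i y, |g i y| ≤ C * w i y) →
      ∀ C, 0 ≤ C → (∀ i y, |f i y - g i y| ≤ C * w i y) →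
        ∀ i y, |T f i y - T g i y| ≤ C / 2 * w i y) :
    ∃ f, (∀ i, Measurable (f i)) ∧ (∃ C, ∀ i y, |f i y| ≤ C * w i y) ∧ T f = f := by
  let u : ℕ → ι → Y → ℝ := fun n => T^[n] 0
  have hu0 : u 0 = 0 := rfl
  have hus : ∀ n, u (n + 1) = T (u n) := fun n => Function.iterate_succ_apply' T n 0
  have hu : ∀ n, (∀ i, Measurable (u n i)) ∧ ∃ C, ∀ i y, |u n i y| ≤ C * w i y := by
    intro n
    induction n with
    | zero => exact ⟨fun i => measurable_const, 0, fun i y => by simp [hu0]⟩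
    | succ n ih => rw [hus]; exact hmeas _ ih.1 ih.2
  obtain ⟨C₀, hC₀⟩ := (hu 1).2
  have hC0 : ∃ C, 0 ≤ C ∧ ∀ i y, |u 1 i y| ≤ C * w i y :=
    ⟨max C₀ 0, le_max_right _ _, fun i y => (hC₀ i y).trans
      (mul_le_mul_of_nonneg_right (le_max_left _ _) (hw i y))⟩
  obtain ⟨C, hCn, hC⟩ := hC0
  have hstep : ∀ n i y, |u (n + 1) i y - u n i y| ≤ C * (1 / 2) ^ n * w i y := by
    intro n
    induction n with
    | zero => intro i y; simpa [hu0] using hC i y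
    | succ n ih =>
      intro i y
      have := hcontr (u (n + 1)) (u n) (hu _).1 (hu _).1 (hu _).2 (hu _).2 _ (by positivity) ih i y
      rw [← hus, ← hus] at this
      refine this.trans (le_of_eq ?_)
      ring
  have hcau : ∀ i y, CauchySeq fun n => u n i y := fun i y => by
    refine cauchySeq_of_le_geometric (1 / 2) (C * w i y) (by norm_num) fun n => ?_
    rw [dist_comm, Real.dist_eq]
    exact (hstep n i y).trans (le_of_eq (by ring))
  choose f hf using fun i y => cauchySeq_tendsto_of_complete (hcau i y)
  have hlim : ∀ n i y, |u n i y - f i y| ≤ 2 * C * (1 / 2) ^ n * w i y := by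
    intro n i y
    have := dist_le_of_le_geometric_of_tendsto (1 / 2) (C * w i y) (by norm_num) (fun n => by
      rw [dist_comm, Real.dist_eq]
      exact (hstep n i y).trans (le_of_eq (by ring))) (hf i y) n
    rw [Real.dist_eq] at this
    refine this.trans (le_of_eq ?_)
    ring
  have hfm : ∀ i, Measurable (f i) := fun i =>
    measurable_of_tendsto_metrizable (fun n => (hu n).1 i) (tendsto_pi_nhds.2 fun y => hf i y)
  have hfb : ∃ C, ∀ i y, |f i y| ≤ C * w i y := by
    refine ⟨2 * C, fun i y => ?_⟩
    have := hlim 0 i y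
    simpa [hu0] using this
  refine ⟨f, hfm, hfb, ?_⟩
  ext i y
  have h1 : Filter.Tendsto (fun n => u (n + 1) i y) Filter.atTop (nhds (T f i y)) := by
    rw [tendsto_iff_dist_tendsto_zero]
    have h2 : Filter.Tendsto (fun n : ℕ => C * w i y * (1 / 2 : ℝ) ^ n) Filter.atTop (nhds 0) := by
      simpa using (tendsto_pow_atTop_nhds_zero_of_lt_one (r := (1 / 2 : ℝ)) (by norm_num)
        (by norm_num)).const_mul (C * w i y)
    refine squeeze_zero (fun _ => dist_nonneg) (fun n => ?_) h2
    have := hcontr (u n) f (hu _).1 hfm (hu _).2 hfb _ (by positivity) (hlim n) i y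
    rw [← hus] at this
    rw [Real.dist_eq]
    exact this.trans (le_of_eq (by ring))
  exact tendsto_nhds_unique h1 ((hf i y).comp (Filter.tendsto_add_atTop_nat 1))

/-- Gronwall's inequality for Volterra inequalities between bounded functions. -/
theorem le_of_volterra_le {f g : ℝ → ℝ} {C : ℝ} (hC : 0 ≤ C)
    (hf : IntervalIntegrable f volume 0 1) (hg : IntervalIntegrable g volume 0 1)
    (hg0 : ∀ z ∈ Icc (0 : ℝ) 1, 0 ≤ g z)
    (h : ∀ z ∈ Icc (0 : ℝ) 1, f z ≤ g z + C * ∫ s in (0 : ℝ)..z, f s) :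
    ∀ z ∈ Icc (0 : ℝ) 1, f z ≤ g z + C * Real.exp C * ∫ s in (0 : ℝ)..1, g s := by
  set G := ∫ s in (0 : ℝ)..1, g s with hG
  have hi : ∀ {k : ℝ → ℝ}, IntervalIntegrable k volume 0 1 → ∀ z ∈ Icc (0 : ℝ) 1,
      IntervalIntegrable k volume 0 z := fun hk z hz => hk.mono_set (by
    rw [uIcc_of_le hz.1, uIcc_of_le zero_le_one]; exact Icc_subset_Icc_right hz.2)
  have hGz : ∀ z ∈ Icc (0 : ℝ) 1, ∫ s in (0 : ℝ)..z, g s ≤ G := by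
    intro z hz
    refine intervalIntegral.integral_mono_interval le_rfl hz.1 hz.2 ?_ hg
    filter_upwards [ae_restrict_mem measurableSet_Ioc] with x hx
    exact hg0 x ⟨hx.1.le, hx.2⟩
  have hGn : 0 ≤ G := by simpa using hGz 0 ⟨le_rfl, zero_le_one⟩
  let Y : ℝ → ℝ := fun z => ∫ s in (0 : ℝ)..z, f s
  have hYc : ContinuousOn Y (Icc 0 1) := by
    have := intervalIntegral.continuousOn_primitive_interval (μ := volume) (f := f) (a := 0) (b := 1)
      ((intervalIntegrable_iff_integrableOn_Icc_of_le zero_le_one).1 hf |>.mono_set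
        (by rw [uIcc_of_le zero_le_one]))
    rwa [uIcc_of_le zero_le_one] at this
  have hYi : IntervalIntegrable Y volume 0 1 :=
    ContinuousOn.intervalIntegrable (by rwa [uIcc_of_le zero_le_one])
  have hY : ∀ z ∈ Icc (0 : ℝ) 1, Y z ≤ G + C * ∫ s in (0 : ℝ)..z, Y s := by
    intro z hz
    have h1 : Y z ≤ ∫ s in (0 : ℝ)..z, (g s + C * Y s) :=
      intervalIntegral.integral_mono_on hz.1 (hi hf z hz)
        ((hi hg z hz).add ((hi hYi z hz).const_mul C))
        fun x hx => h x ⟨hx.1, hx.2.trans hz.2⟩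
    rw [intervalIntegral.integral_add (hi hg z hz) ((hi hYi z hz).const_mul C),
      intervalIntegral.integral_const_mul] at h1
    linarith [hGz z hz]
  -- `H z = exp (-C z) * (G + C ∫₀ᶻ Y)` is antitone
  have hYb : ∀ z ∈ Icc (0 : ℝ) 1, Y z ≤ G * Real.exp C := by
    intro z hz
    let H : ℝ → ℝ := fun z => Real.exp (-C * z) * (G + C * ∫ s in (0 : ℝ)..z, Y s)
    have hd : ∀ x ∈ Ioo (0 : ℝ) 1, HasDerivAt H (Real.exp (-C * x) * C *
        (Y x - (G + C * ∫ s in (0 : ℝ)..x, Y s))) x := by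
      intro x hx
      have hxi : Icc (0 : ℝ) 1 ∈ nhds x := Icc_mem_nhds hx.1 hx.2
      have d1 : HasDerivAt (fun z => ∫ s in (0 : ℝ)..z, Y s) (Y x) x :=
        intervalIntegral.integral_hasDerivAt_right (hi hYi x (Ioo_subset_Icc_self hx))
          (hYc.stronglyMeasurableAtFilter_nhdsWithin measurableSet_Icc x |>.filter_mono (by
            rw [nhdsWithin_eq_nhds.2 hxi])) (hYc.continuousAt hxi)
      have d2 : HasDerivAt (fun z : ℝ => Real.exp (-C * z)) (Real.exp (-C * x) * (-C)) x := by
        simpa using ((hasDerivAt_id x).const_mul (-C)).exp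
      exact (d2.mul ((d1.const_mul C).const_add G)).congr_deriv (by ring)
    have hcont : ContinuousOn H (Icc 0 1) := by
      refine ContinuousOn.mul (by fun_prop) (continuousOn_const.add (continuousOn_const.mul ?_))
      have := intervalIntegral.continuousOn_primitive_interval (μ := volume) (f := Y) (a := 0) (b := 1)
        (by rw [uIcc_of_le zero_le_one]; exact hYc.integrableOn_Icc)
      rwa [uIcc_of_le zero_le_one] at this
    have hanti : AntitoneOn H (Icc 0 1) := by
      refine antitoneOn_of_deriv_nonpos (convex_Icc 0 1) hcont (fun x hx => ?_) fun x hx => ?_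
      · rw [interior_Icc] at hx
        exact (hd x hx).differentiableAt.differentiableWithinAt
      · rw [interior_Icc] at hx
        rw [(hd x hx).deriv]
        refine mul_nonpos_of_nonneg_of_nonpos (by positivity) ?_
        linarith [hY x (Ioo_subset_Icc_self hx)]
    have h3 := hanti ⟨le_rfl, zero_le_one⟩ hz hz.1
    have h4 : H 0 = G := by simp [H]
    rw [h4] at h3
    refine (hY z hz).trans ?_
    have h5 : G + C * ∫ s in (0 : ℝ)..z, Y s = Real.exp (C * z) * H z := by
      simp only [H]
      rw [← mul_assoc, ← Real.exp_add]
      simp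
    rw [h5, mul_comm G]
    have h6 : Real.exp (C * z) ≤ Real.exp C :=
      Real.exp_le_exp.2 (mul_le_of_le_one_right hC hz.2)
    calc Real.exp (C * z) * H z ≤ Real.exp (C * z) * G := by gcongr
      _ ≤ _ := by gcongr
  intro z hz
  have := mul_le_mul_of_nonneg_left (hYb z hz) hC
  calc f z ≤ g z + C * Y z := h z hz
    _ ≤ _ := by linarith

/-! ### Functions that are bounded and measurable on a set -/

/-- `f` is measurable and bounded on `s`. -/
structure BddMeasOn {α : Type*} [MeasurableSpace α] (f : α → ℝ) (s : Set α) : Prop where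
  meas : Measurable (s.domRestrict f)
  bdd : ∃ C, ∀ x ∈ s, |f x| ≤ C

namespace BddMeasOn

variable {α β : Type*} [MeasurableSpace α] [MeasurableSpace β] {f g : α → ℝ} {s t : Set α}

theorem of_measurable (hf : Measurable f) (hb : ∃ C, ∀ x ∈ s, |f x| ≤ C) : BddMeasOn f s :=
  ⟨hf.comp measurable_subtype_coe, hb⟩

theorem const (c : ℝ) : BddMeasOn (fun _ : α => c) s :=
  of_measurable measurable_const ⟨|c|, fun _ _ => le_rfl⟩

theorem congr (hf : BddMeasOn f s) (h : ∀ x ∈ s, g x = f x) : BddMeasOn g s := by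
  refine ⟨?_, ?_⟩
  · have : s.domRestrict g = s.domRestrict f := by ext x; exact h x x.2
    rw [this]; exact hf.meas
  · obtain ⟨C, hC⟩ := hf.bdd
    exact ⟨C, fun x hx => by rw [h x hx]; exact hC x hx⟩

theorem add (hf : BddMeasOn f s) (hg : BddMeasOn g s) : BddMeasOn (fun x => f x + g x) s := by
  obtain ⟨C, hC⟩ := hf.bdd
  obtain ⟨D, hD⟩ := hg.bdd
  exact ⟨hf.meas.add hg.meas, C + D, fun x hx => (abs_add_le _ _).trans
    (add_le_add (hC x hx) (hD x hx))⟩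

theorem mul (hf : BddMeasOn f s) (hg : BddMeasOn g s) : BddMeasOn (fun x => f x * g x) s := by
  obtain ⟨C, hC⟩ := hf.bdd
  obtain ⟨D, hD⟩ := hg.bdd
  refine ⟨hf.meas.mul hg.meas, C * D, fun x hx => ?_⟩
  rw [abs_mul]
  exact mul_le_mul (hC x hx) (hD x hx) (abs_nonneg _) ((abs_nonneg _).trans (hC x hx))

theorem const_mul (hf : BddMeasOn f s) (c : ℝ) : BddMeasOn (fun x => c * f x) s :=
  (const c).mul hf

theorem neg (hf : BddMeasOn f s) : BddMeasOn (fun x => -f x) s :=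
  (hf.const_mul (-1)).congr fun x _ => by ring

theorem sub (hf : BddMeasOn f s) (hg : BddMeasOn g s) : BddMeasOn (fun x => f x - g x) s :=
  (hf.add hg.neg).congr fun x _ => by ring

theorem abs (hf : BddMeasOn f s) : BddMeasOn (fun x => |f x|) s := by
  obtain ⟨C, hC⟩ := hf.bdd
  exact ⟨continuous_abs.measurable.comp hf.meas, C, fun x hx => by rw [abs_abs]; exact hC x hx⟩

theorem sum {ι : Type*} (I : Finset ι) {f : ι → α → ℝ} (h : ∀ i ∈ I, BddMeasOn (f i) s) :
    BddMeasOn (fun x => ∑ i ∈ I, f i x) s := by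
  classical
  induction I using Finset.induction_on with
  | empty => simpa using const 0
  | insert i I hi ih =>
    simp_rw [Finset.sum_insert hi]
    exact (h i (Finset.mem_insert_self _ _)).add
      (ih fun j hj => h j (Finset.mem_insert_of_mem hj))

theorem comp {h : β → α} {t : Set β} (hf : BddMeasOn f s) (hh : Measurable h)
    (hts : MapsTo h t s) : BddMeasOn (fun x => f (h x)) t := by
  obtain ⟨C, hC⟩ := hf.bdd
  refine ⟨?_, C, fun x hx => hC _ (hts hx)⟩
  exact hf.meas.comp ((hh.comp measurable_subtype_coe).subtype_mk (h := fun x => hts x.2))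

theorem mono (hf : BddMeasOn f s) (hts : t ⊆ s) : BddMeasOn f t := hf.comp measurable_id hts

theorem indicator (hf : BddMeasOn f s) (hs : MeasurableSet s) :
    Measurable (s.indicator f) ∧ ∃ C, ∀ x, |s.indicator f x| ≤ C := by
  refine ⟨measurable_indicator_of_domRestrict hs hf.meas, ?_⟩
  obtain ⟨C, hC⟩ := hf.bdd
  refine ⟨max C 0, fun x => ?_⟩
  by_cases hx : x ∈ s
  · rw [indicator_of_mem hx]; exact (hC x hx).trans (le_max_left _ _)
  · rw [indicator_of_notMem hx, abs_zero]; exact le_max_right _ _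

theorem aestronglyMeasurable (hf : BddMeasOn f s) (hs : MeasurableSet s) (μ : Measure α) :
    AEStronglyMeasurable f (μ.restrict s) := by
  refine ⟨s.indicator f, (hf.indicator hs).1.stronglyMeasurable, ?_⟩
  filter_upwards [ae_restrict_mem hs] with x hx
  rw [indicator_of_mem hx]

theorem of_continuousOn {f : ℝ → ℝ} {s : Set ℝ} (hf : ContinuousOn f s) (hs : IsCompact s) :
    BddMeasOn f s :=
  ⟨(continuousOn_iff_continuous_domRestrict.1 hf).measurable, hs.exists_bound_of_continuousOn hf⟩

theorem intervalIntegrable {f : ℝ → ℝ} {a b : ℝ} {s : Set ℝ} (hf : BddMeasOn f s)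
    (hs : uIcc a b ⊆ s) : IntervalIntegrable f volume a b := by
  obtain ⟨C, hC⟩ := hf.bdd
  exact intervalIntegrable_of_bdd ((hf.mono hs).aestronglyMeasurable measurableSet_uIcc _)
    fun x hx => hC x (hs hx)

/-- Integrals depending on a parameter, with variable bounds. -/
theorem integral {F : α × ℝ → ℝ} {D : Set (α × ℝ)} (hF : BddMeasOn F D) (hD : MeasurableSet D)
    {a b : α → ℝ} (ha : Measurable a) (hb : Measurable b)
    (h : ∀ x ∈ s, ∀ r ∈ uIcc (a x) (b x), (x, r) ∈ D) (hL : ∃ L, ∀ x ∈ s, |b x - a x| ≤ L) :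
    BddMeasOn (fun x => ∫ r in a x..b x, F (x, r)) s := by
  obtain ⟨hm, C, hC⟩ := hF.indicator hD
  obtain ⟨L, hL⟩ := hL
  refine BddMeasOn.congr (f := fun x => ∫ r in a x..b x, D.indicator F (x, r)) ?_ ?_
  · refine of_measurable (measurable_intervalIntegral_param (F := fun x r => D.indicator F (x, r))
      hm ha hb) ⟨C * L, fun x hx => ?_⟩
    refine (intervalIntegral.norm_integral_le_of_norm_le_const
      (f := fun r => D.indicator F (x, r)) fun r _ => hC _).trans ?_
    exact mul_le_mul_of_nonneg_left (hL x hx) ((abs_nonneg _).trans (hC (x, 0)))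
  · intro x hx
    refine intervalIntegral.integral_congr fun r hr => ?_
    exact (indicator_of_mem (h x hx r hr) F).symm

end BddMeasOn

theorem BddMeasOn.isBddPrimitive {f g : ℝ → ℝ} {a b : ℝ} (hg : BddMeasOn g (Icc a b))
    (h : ∀ t ∈ Icc a b, f t = f a + ∫ s in a..t, g s) : IsBddPrimitive f g a b :=
  ⟨hg.aestronglyMeasurable measurableSet_Icc _, hg.bdd, h⟩

theorem uIcc_subset_Icc' {a b x y : ℝ} (hx : x ∈ Icc a b) (hy : y ∈ Icc a b) :
    uIcc x y ⊆ Icc a b := (convex_Icc a b).ordConnected.uIcc_subset hx hy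

theorem charSign_mul_self (i : Fin 2) : charSign i * charSign i = 1 := by
  fin_cases i <;> simp [charSign]

theorem abs_charSign (i : Fin 2) : |charSign i| = 1 := by
  fin_cases i <;> simp [charSign]

theorem charSign_cases (i : Fin 2) : charSign i = 1 ∨ charSign i = -1 := by
  fin_cases i <;> simp [charSign]

namespace HyperbolicPDEODE

variable {n : ℕ} (S : HyperbolicPDEODE n)

/-! ### Travel times and characteristics -/

/-- The continuous extension of `λᵢ` to `ℝ` that is constant outside `[0,1]`. -/
def speed (i : Fin 2) (z : ℝ) : ℝ := S.lam i (projIcc 0 1 zero_le_one z)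

theorem speed_eq (i : Fin 2) {z : ℝ} (hz : z ∈ Icc (0 : ℝ) 1) : S.speed i z = S.lam i z := by
  rw [speed, projIcc_of_mem zero_le_one hz]

theorem continuous_speed (i : Fin 2) : Continuous (S.speed i) :=
  (continuousOn_iff_continuous_domRestrict.1 (S.lam_cont i)).comp continuous_projIcc

theorem speed_pos (i : Fin 2) (z : ℝ) : 0 < S.speed i z := S.lam_pos i _ (projIcc 0 1 _ z).2

theorem exists_speed_bounds : ∃ m M : ℝ, 0 < m ∧ 0 < M ∧ ∀ i z, m ≤ S.speed i z ∧ S.speed i z ≤ M := by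
  have h : ∀ i, ∃ m M : ℝ, 0 < m ∧ 0 < M ∧ ∀ z, m ≤ S.speed i z ∧ S.speed i z ≤ M := by
    intro i
    obtain ⟨a, ha, hmin⟩ := isCompact_Icc.exists_isMinOn (nonempty_Icc.2 zero_le_one) (S.lam_cont i)
    obtain ⟨b, hb, hmax⟩ := isCompact_Icc.exists_isMaxOn (nonempty_Icc.2 zero_le_one) (S.lam_cont i)
    exact ⟨S.lam i a, S.lam i b, S.lam_pos i a ha, S.lam_pos i b hb,
      fun z => ⟨hmin (projIcc 0 1 zero_le_one z).2, hmax (projIcc 0 1 zero_le_one z).2⟩⟩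
  choose m M hm hM h using h
  refine ⟨min (m 0) (m 1), max (M 0) (M 1), lt_min (hm 0) (hm 1), lt_max_of_lt_left (hM 0), ?_⟩
  intro i z
  fin_cases i
  · exact ⟨(min_le_left _ _).trans (h 0 z).1, (h 0 z).2.trans (le_max_left _ _)⟩
  · exact ⟨(min_le_right _ _).trans (h 1 z).1, (h 1 z).2.trans (le_max_right _ _)⟩

/-- The extension of `φᵢ` to `ℝ`. -/
def travel (i : Fin 2) (z : ℝ) : ℝ := ∫ ζ in (0 : ℝ)..z, (S.speed i ζ)⁻¹

theorem continuous_inv_speed (i : Fin 2) : Continuous fun z => (S.speed i z)⁻¹ :=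
  (S.continuous_speed i).inv₀ fun z => (S.speed_pos i z).ne'

theorem hasDerivAt_travel (i : Fin 2) (z : ℝ) : HasDerivAt (S.travel i) (S.speed i z)⁻¹ z :=
  intervalIntegral.integral_hasDerivAt_right ((S.continuous_inv_speed i).intervalIntegrable _ _)
    (S.continuous_inv_speed i).stronglyMeasurable.stronglyMeasurableAtFilter
    (S.continuous_inv_speed i).continuousAt

theorem continuous_travel (i : Fin 2) : Continuous (S.travel i) :=
  continuous_iff_continuousAt.2 fun z => (S.hasDerivAt_travel i z).continuousAt

@[simp] theorem travel_zero (i : Fin 2) : S.travel i 0 = 0 := by simp [travel]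

theorem strictMono_travel (i : Fin 2) : StrictMono (S.travel i) :=
  strictMono_of_deriv_pos fun z => by
    rw [(S.hasDerivAt_travel i z).deriv]; exact inv_pos.2 (S.speed_pos i z)

theorem phi_eq_travel (i : Fin 2) {z : ℝ} (hz : z ∈ Icc (0 : ℝ) 1) : S.phi i z = S.travel i z := by
  refine intervalIntegral.integral_congr fun ζ hζ => ?_
  have := uIcc_subset_Icc' (left_mem_Icc.2 zero_le_one) hz hζ
  simp only [S.speed_eq i this]

theorem travel_sub_le {M : ℝ} (hM : ∀ i z, S.speed i z ≤ M) (i : Fin 2) {a b : ℝ}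
    (hab : a ≤ b) : (b - a) / M ≤ S.travel i b - S.travel i a := by
  have h1 : S.travel i b - S.travel i a = ∫ ζ in a..b, (S.speed i ζ)⁻¹ :=
    intervalIntegral.integral_interval_sub_left
      ((S.continuous_inv_speed i).intervalIntegrable _ _)
      ((S.continuous_inv_speed i).intervalIntegrable _ _)
  rw [h1]
  have h2 : ∫ ζ in a..b, M⁻¹ ≤ ∫ ζ in a..b, (S.speed i ζ)⁻¹ :=
    intervalIntegral.integral_mono_on hab (by simp)
      ((S.continuous_inv_speed i).intervalIntegrable _ _)
      fun x _ => inv_anti₀ (S.speed_pos i x) (hM i x)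
  simpa [div_eq_mul_inv] using h2

theorem surjective_travel (i : Fin 2) : Function.Surjective (S.travel i) := by
  obtain ⟨m, M, hm, hM, h⟩ := S.exists_speed_bounds
  refine (S.continuous_travel i).surjective ?_ ?_
  · refine Filter.tendsto_atTop_mono' _ ?_ (Filter.tendsto_id.atTop_div_const hM)
    filter_upwards [Filter.eventually_ge_atTop 0] with z hz
    simpa using S.travel_sub_le (fun i z => (h i z).2) i hz
  · refine Filter.tendsto_atBot_mono' _ ?_ (Filter.tendsto_id.atBot_div_const hM)
    filter_upwards [Filter.eventually_le_atBot 0] with z hz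
    have := S.travel_sub_le (fun i z => (h i z).2) i hz
    simp only [travel_zero, zero_sub, neg_div] at this
    simpa using this

/-- `travel i` as an order isomorphism. -/
def travelIso (i : Fin 2) : ℝ ≃o ℝ :=
  (S.strictMono_travel i).orderIsoOfSurjective _ (S.surjective_travel i)

/-- The place that is reached from `0` in a given travel time. -/
def place (i : Fin 2) (s : ℝ) : ℝ := (S.travelIso i).symm s

@[simp] theorem travel_place (i : Fin 2) (s : ℝ) : S.travel i (S.place i s) = s :=
  (S.travelIso i).apply_symm_apply s

@[simp] theorem place_travel (i : Fin 2) (z : ℝ) : S.place i (S.travel i z) = z :=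
  (S.travelIso i).symm_apply_apply z

@[simp] theorem place_zero (i : Fin 2) : S.place i 0 = 0 := by
  conv_lhs => rw [← S.travel_zero i, place_travel]

theorem continuous_place (i : Fin 2) : Continuous (S.place i) := (S.travelIso i).symm.continuous

theorem strictMono_place (i : Fin 2) : StrictMono (S.place i) := (S.travelIso i).symm.strictMono

theorem hasDerivAt_place (i : Fin 2) (s : ℝ) :
    HasDerivAt (S.place i) (S.speed i (S.place i s)) s := by
  have := (S.hasDerivAt_travel i (S.place i s)).of_local_left_inverse
    (S.continuous_place i).continuousAt (inv_ne_zero (S.speed_pos i _).ne')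
    (Filter.Eventually.of_forall fun s => S.travel_place i s)
  simpa using this

theorem travel_nonneg (i : Fin 2) {z : ℝ} (hz : 0 ≤ z) : 0 ≤ S.travel i z := by
  simpa using (S.strictMono_travel i).monotone hz

theorem place_mem_Icc {i : Fin 2} {s : ℝ} :
    S.place i s ∈ Icc (0 : ℝ) 1 ↔ s ∈ Icc 0 (S.travel i 1) := by
  constructor
  · intro h
    have h1 := (S.strictMono_travel i).monotone h.1
    have h2 := (S.strictMono_travel i).monotone h.2
    simpa using And.intro h1 h2
  · intro h
    have h1 := (S.strictMono_place i).monotone h.1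
    have h2 := (S.strictMono_place i).monotone h.2
    simpa using And.intro h1 h2

theorem travel_mem_Icc {i : Fin 2} {z : ℝ} (hz : z ∈ Icc (0 : ℝ) 1) :
    S.travel i z ∈ Icc 0 (S.travel i 1) := by
  rw [← S.place_mem_Icc, place_travel]; exact hz

/-- Change of variables from place to travel time. -/
theorem integral_comp_travel (i : Fin 2) (f : ℝ → ℝ) (a b : ℝ) :
    ∫ ζ in a..b, f (S.travel i ζ) * (S.speed i ζ)⁻¹ = ∫ s in S.travel i a..S.travel i b, f s := by
  have key : ∀ a b, a ≤ b →
      ∫ ζ in a..b, f (S.travel i ζ) * (S.speed i ζ)⁻¹ =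
        ∫ s in S.travel i a..S.travel i b, f s := by
    intro a b hab
    rw [intervalIntegral.integral_of_le hab,
      intervalIntegral.integral_of_le ((S.strictMono_travel i).monotone hab)]
    have h1 : Ioc (S.travel i a) (S.travel i b) = S.travel i '' Ioc a b :=
      ((S.travelIso i).image_Ioc a b).symm
    rw [h1, integral_image_eq_integral_deriv_smul_of_monotoneOn measurableSet_Ioc
      (fun x _ => (S.hasDerivAt_travel i x).hasDerivWithinAt)
      ((S.strictMono_travel i).monotone.monotoneOn _) f]
    refine integral_congr_ae (Filter.Eventually.of_forall fun x => ?_)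
    simp [mul_comm]
  rcases le_total a b with h | h
  · exact key a b h
  · rw [intervalIntegral.integral_symm, key b a h, ← intervalIntegral.integral_symm]

/-- The `i`-th characteristic with label `c`: its place at time `t`. -/
def char (i : Fin 2) (c t : ℝ) : ℝ := S.place i (charSign i * (c - t))

/-- The label of the `i`-th characteristic through `(t, z)`. -/
def label (i : Fin 2) (t z : ℝ) : ℝ := charSign i * S.travel i z + t

@[simp] theorem char_label (i : Fin 2) (t z : ℝ) : S.char i (S.label i t z) t = z := by
  have : charSign i * (charSign i * S.travel i z + t - t) = S.travel i z := by
    rw [add_sub_cancel_right, ← mul_assoc, charSign_mul_self, one_mul]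
  rw [char, label, this, place_travel]

@[simp] theorem travel_char (i : Fin 2) (c t : ℝ) :
    S.travel i (S.char i c t) = charSign i * (c - t) := by rw [char, travel_place]

@[simp] theorem label_char (i : Fin 2) (c t : ℝ) : S.label i t (S.char i c t) = c := by
  rw [label, travel_char, ← mul_assoc, charSign_mul_self]; ring

theorem continuous_char (i : Fin 2) : Continuous fun p : ℝ × ℝ => S.char i p.1 p.2 :=
  (S.continuous_place i).comp (by fun_prop)

theorem continuous_label (i : Fin 2) : Continuous fun p : ℝ × ℝ => S.label i p.1 p.2 :=
  ((continuous_const.mul ((S.continuous_travel i).comp continuous_snd)).add continuous_fst)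

theorem char_mem_Icc (i : Fin 2) {c t₀ t₁ t : ℝ} (h₀ : S.char i c t₀ ∈ Icc (0 : ℝ) 1)
    (h₁ : S.char i c t₁ ∈ Icc (0 : ℝ) 1) (ht : t ∈ uIcc t₀ t₁) : S.char i c t ∈ Icc (0 : ℝ) 1 := by
  rw [char, place_mem_Icc] at h₀ h₁ ⊢
  rw [mem_uIcc] at ht
  simp only [mem_Icc] at *
  rcases charSign_cases i with h | h <;> rw [h] at h₀ h₁ ⊢ <;> rcases ht with ht | ht <;>
    constructor <;> linarith [h₀.1, h₀.2, h₁.1, h₁.2, ht.1, ht.2]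

theorem hasDerivAt_char (i : Fin 2) (c t : ℝ) :
    HasDerivAt (S.char i c) (-charSign i * S.speed i (S.char i c t)) t := by
  have h : HasDerivAt (fun t => charSign i * (c - t)) (-charSign i) t := by
    simpa using ((hasDerivAt_id t).const_sub c).const_mul (charSign i)
  have := (S.hasDerivAt_place i (charSign i * (c - t))).comp t h
  exact this.congr_deriv (by rw [char]; ring)

/-- Change of variables from place to time along a characteristic. -/
theorem integral_along_char (i : Fin 2) (f : ℝ → ℝ → ℝ) (c t₀ t₁ : ℝ) :
    ∫ ζ in S.char i c t₀..S.char i c t₁, f (c - charSign i * S.travel i ζ) ζ * (S.speed i ζ)⁻¹ =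
      -charSign i * ∫ t in t₀..t₁, f t (S.char i c t) := by
  have h1 := S.integral_comp_travel i (fun s => f (c - charSign i * s) (S.place i s))
    (S.char i c t₀) (S.char i c t₁)
  simp only [place_travel, travel_char] at h1
  rw [h1]
  have h2 : ∀ t, f t (S.char i c t) =
      (fun s => f (c - charSign i * s) (S.place i s)) (charSign i * c - charSign i * t) := by
    intro t
    have : c - charSign i * (charSign i * c - charSign i * t) = t := by
      linear_combination (t - c) * charSign_mul_self i
    show _ = f (c - charSign i * (charSign i * c - charSign i * t)) _
    rw [this, char, mul_sub]
  simp_rw [h2]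
  have hne : charSign i ≠ 0 := by rcases charSign_cases i with h | h <;> rw [h] <;> norm_num
  rw [intervalIntegral.integral_comp_sub_mul (fun s => f (c - charSign i * s) (S.place i s)) hne,
    intervalIntegral.integral_symm]
  simp only [smul_eq_mul, ← mul_sub, neg_mul]
  rw [← mul_assoc, mul_inv_cancel₀ hne, one_mul]

end HyperbolicPDEODE

/-! ### A transport identity on a domain with a moving boundary -/

theorem integral_transport_of_speed_neg_one {R D : ℝ → ℝ → ℝ} {t₀ t₁ : ℝ} (ht : t₀ ≤ t₁)
    {s s' : ℝ → ℝ} (hs : ∀ t, HasDerivAt s (s' t) t) (hs0 : ∀ t ∈ Icc t₀ t₁, 0 ≤ s t)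
    (hm : (∀ t ∈ Icc t₀ t₁, s t + t = s t₀ + t₀) ∨ StrictMonoOn (fun t => s t + t) (Icc t₀ t₁))
    (hRm : BddMeasOn (fun p : ℝ × ℝ => R p.1 p.2) {p | p.1 ∈ Icc t₀ t₁ ∧ p.2 ∈ Icc 0 (s p.1)})
    (hDm : BddMeasOn (fun p : ℝ × ℝ => D p.1 p.2) {p | p.1 ∈ Icc t₀ t₁ ∧ p.2 ∈ Icc 0 (s p.1)})
    (hR : ∀ a p q, p ≤ q → (∀ r ∈ Icc p q, r ∈ Icc t₀ t₁ ∧ a - r ∈ Icc 0 (s r)) →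
      R q (a - q) = R p (a - p) + ∫ r in p..q, D r (a - r)) :
    (∫ r in (0 : ℝ)..s t₁, R t₁ r) - (∫ r in (0 : ℝ)..s t₀, R t₀ r) =
      (∫ t in t₀..t₁, ∫ r in (0 : ℝ)..s t, D t r) + (∫ t in t₀..t₁, R t (s t) * (s' t + 1)) -
        ∫ t in t₀..t₁, R t 0 := by
  have hsc : Continuous s := continuous_iff_continuousAt.2 fun t => (hs t).continuousAt
  set m : ℝ → ℝ := fun t => s t + t with hmdef
  have hmc : Continuous m := hsc.add continuous_id
  have hmono : MonotoneOn m (Icc t₀ t₁) := by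
    rcases hm with h | h
    · intro x hx y hy _
      exact ((h x hx).trans (h y hy).symm).le
    · exact h.monotoneOn
  have h0 : t₀ ∈ Icc t₀ t₁ := left_mem_Icc.2 ht
  have h1 : t₁ ∈ Icc t₀ t₁ := right_mem_Icc.2 ht
  have hle : ∀ t ∈ Icc t₀ t₁, t ≤ m t := fun t h => by simpa [hmdef] using hs0 t h
  have hm01 : m t₀ ≤ m t₁ := hmono h0 h1 ht
  have hG : MeasurableSet {p : ℝ × ℝ | p.1 ∈ Icc t₀ t₁ ∧ p.2 ∈ Icc 0 (s p.1)} := by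
    refine (measurable_fst measurableSet_Icc).inter ?_
    exact (measurableSet_le measurable_const measurable_snd).inter
      (measurableSet_le measurable_snd (hsc.measurable.comp measurable_fst))
  set G : Set (ℝ × ℝ) := {p | p.1 ∈ Icc t₀ t₁ ∧ p.2 ∈ Icc 0 (s p.1)} with hGdef
  obtain ⟨hDi, C, hC⟩ := hDm.indicator hG
  -- the rate as a function of time and label
  let d : ℝ → ℝ → ℝ := fun t a => G.indicator (fun p : ℝ × ℝ => D p.1 p.2) (t, a - t)
  have hdm : Measurable (Function.uncurry d) :=
    hDi.comp (measurable_fst.prodMk (measurable_snd.sub measurable_fst))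
  have hdint : Integrable (Function.uncurry d)
      ((volume.restrict (Ioc t₀ t₁)).prod (volume.restrict (Ioc t₀ (m t₁)))) :=
    Integrable.mono' (integrable_const C) hdm.aestronglyMeasurable
      (Filter.Eventually.of_forall fun p => hC _)
  have hswap : ∫ t in t₀..t₁, ∫ a in t₀..m t₁, d t a = ∫ a in t₀..m t₁, ∫ t in t₀..t₁, d t a := by
    simp only [intervalIntegral.integral_of_le ht,
      intervalIntegral.integral_of_le (ht.trans (hle t₁ h1))]
    exact integral_integral_swap hdint
  have hGmem : ∀ t a, (t, a - t) ∈ G ↔ t ∈ Icc t₀ t₁ ∧ t ≤ a ∧ a ≤ m t := by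
    intro t a
    simp only [hGdef, hmdef, mem_ofPred_eq, mem_Icc, sub_nonneg, sub_le_iff_le_add]
  have hin1 : ∀ t ∈ Icc t₀ t₁, ∫ a in t₀..m t₁, d t a = ∫ r in (0 : ℝ)..s t, D t r := by
    intro t h
    have e1 : ∫ r in (0 : ℝ)..s t, D t r = ∫ a in t..m t, D t (a - t) := by
      rw [intervalIntegral.integral_comp_sub_right (fun r => D t r)]
      simp [hmdef]
    rw [e1, intervalIntegral.integral_of_le (ht.trans (hle t₁ h1)),
      intervalIntegral.integral_of_le (hle t h), ← integral_Icc_eq_integral_Ioc,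
      ← integral_Icc_eq_integral_Ioc]
    have e2 : ∀ a, d t a = (Icc t (m t)).indicator (fun a => D t (a - t)) a := by
      intro a
      by_cases ha : a ∈ Icc t (m t)
      · rw [indicator_of_mem ha]
        exact indicator_of_mem ((hGmem t a).2 ⟨h, ha⟩) _
      · rw [indicator_of_notMem ha]
        exact indicator_of_notMem (fun h' => ha ((hGmem t a).1 h').2) _
    simp_rw [e2]
    rw [setIntegral_indicator measurableSet_Icc, inter_eq_self_of_subset_right]
    exact Icc_subset_Icc h.1 (hmono h h1 h.2)
  -- entry and exit times of the characteristic with label `a`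
  have hentry : ∀ a ∈ Icc t₀ (m t₁), ∃ p ∈ Icc t₀ t₁, p ≤ a ∧ (a ≤ m t₀ → p = t₀) ∧
      (m t₀ < a → m p = a) ∧ ∀ t ∈ Icc t₀ t₁, a ≤ m t ↔ p ≤ t := by
    intro a ha
    rcases le_or_gt a (m t₀) with h | h
    · exact ⟨t₀, h0, ha.1, fun _ => rfl, fun h' => absurd h' (not_lt.2 h),
        fun t ht' => ⟨fun _ => ht'.1, fun _ => h.trans (hmono h0 ht' ht'.1)⟩⟩
    · have hst : StrictMonoOn m (Icc t₀ t₁) := by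
        rcases hm with h' | h'
        · exact absurd (ha.2.trans (h' t₁ h1).le) (not_le.2 h)
        · exact h'
      obtain ⟨p, hp, hpa⟩ := intermediate_value_Icc ht hmc.continuousOn ⟨h.le, ha.2⟩
      refine ⟨p, hp, hpa ▸ hle p hp, fun h' => absurd h' (not_le.2 h), fun _ => hpa, fun t ht' => ?_⟩
      rw [← hpa]
      exact hst.le_iff_le hp ht'
  choose! p hp hpa hp0 hpm hpt using hentry
  let E : ℝ → ℝ := fun a => R (min a t₁) (a - min a t₁)
  let W : ℝ → ℝ := fun a => R (p a) (a - p a)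
  have hin2 : ∀ a ∈ Icc t₀ (m t₁), ∫ t in t₀..t₁, d t a = E a - W a := by
    intro a ha
    have hq : min a t₁ ∈ Icc t₀ t₁ := ⟨le_min ha.1 ht, min_le_right _ _⟩
    have hpq : p a ≤ min a t₁ := le_min (hpa a ha) (hp a ha).2
    have e := hR a (p a) (min a t₁) hpq fun r hr => by
      have hr' : r ∈ Icc t₀ t₁ := ⟨(hp a ha).1.trans hr.1, hr.2.trans (min_le_right _ _)⟩
      refine (hGmem r a).2 ⟨hr', hr.2.trans (min_le_left _ _), (hpt a ha r hr').2 hr.1⟩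
    simp only [E, W]
    rw [e, add_sub_cancel_left, intervalIntegral.integral_of_le ht,
      intervalIntegral.integral_of_le hpq, ← integral_Icc_eq_integral_Ioc,
      ← integral_Icc_eq_integral_Ioc]
    have e2 : ∀ t ∈ Icc t₀ t₁, d t a = (Icc (p a) (min a t₁)).indicator (fun t => D t (a - t)) t := by
      intro t h
      by_cases hta : t ∈ Icc (p a) (min a t₁)
      · rw [indicator_of_mem hta]
        exact indicator_of_mem ((hGmem t a).2 ⟨h, hta.2.trans (min_le_left _ _),
          (hpt a ha t h).2 hta.1⟩) _
      · rw [indicator_of_notMem hta]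
        refine indicator_of_notMem (fun h' => hta ?_) _
        obtain ⟨_, h2, h3⟩ := (hGmem t a).1 h'
        exact ⟨(hpt a ha t h).1 h3, le_min h2 h.2⟩
    rw [setIntegral_congr_fun measurableSet_Icc e2, setIntegral_indicator measurableSet_Icc,
      inter_eq_self_of_subset_right]
    exact Icc_subset_Icc (hp a ha).1 hq.2
  have htm : t₁ ≤ m t₁ := hle t₁ h1
  have hEi1 : IntervalIntegrable E volume t₀ t₁ := by
    refine (BddMeasOn.congr (f := fun a => R a 0) (s := Icc t₀ t₁) ?_ ?_).intervalIntegrable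
      (uIcc_of_le ht).le
    · exact hRm.comp (h := fun a : ℝ => (a, (0 : ℝ))) (by fun_prop)
        fun a ha => ⟨ha, le_rfl, hs0 a ha⟩
    · intro a ha
      simp [E, min_eq_left ha.2]
  have hEi2 : IntervalIntegrable E volume t₁ (m t₁) := by
    refine (BddMeasOn.congr (f := fun a => R t₁ (a - t₁)) (s := Icc t₁ (m t₁)) ?_
      ?_).intervalIntegrable (uIcc_of_le htm).le
    · exact hRm.comp (h := fun a : ℝ => (t₁, a - t₁)) (by fun_prop)
        fun a ha => ⟨h1, sub_nonneg.2 ha.1, by simpa [hmdef] using ha.2⟩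
    · intro a ha
      simp [E, min_eq_right ha.1]
  have hE : ∫ a in t₀..m t₁, E a = (∫ t in t₀..t₁, R t 0) + ∫ r in (0 : ℝ)..s t₁, R t₁ r := by
    rw [← intervalIntegral.integral_add_adjacent_intervals hEi1 hEi2]
    congr 1
    · refine intervalIntegral.integral_congr fun a ha => ?_
      rw [uIcc_of_le ht] at ha
      simp [E, min_eq_left ha.2]
    · have e1 : ∫ r in (0 : ℝ)..s t₁, R t₁ r = ∫ a in t₁..m t₁, R t₁ (a - t₁) := by
        rw [intervalIntegral.integral_comp_sub_right (fun r => R t₁ r)]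
        simp [hmdef]
      rw [e1]
      refine intervalIntegral.integral_congr fun a ha => ?_
      rw [uIcc_of_le htm] at ha
      simp [E, min_eq_right ha.1]
  have hEi : IntervalIntegrable E volume t₀ (m t₁) := hEi1.trans hEi2
  have hdi : IntervalIntegrable (fun a => ∫ t in t₀..t₁, d t a) volume t₀ (m t₁) := by
    rw [intervalIntegrable_iff_integrableOn_Ioc_of_le (ht.trans htm)]
    simp only [intervalIntegral.integral_of_le ht]
    exact hdint.integral_prod_right
  have hWi : IntervalIntegrable W volume t₀ (m t₁) := by
    refine (hEi.sub hdi).congr fun a ha => ?_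
    rw [uIoc_of_le (ht.trans htm)] at ha
    simp only [hin2 a (Ioc_subset_Icc_self ha)]
    ring
  have hm0 : m t₀ ∈ Icc t₀ (m t₁) := ⟨hle t₀ h0, hm01⟩
  have hW : ∫ a in t₀..m t₁, W a =
      (∫ r in (0 : ℝ)..s t₀, R t₀ r) + ∫ t in t₀..t₁, R t (s t) * (s' t + 1) := by
    rw [← intervalIntegral.integral_add_adjacent_intervals
      (hWi.mono_set (uIcc_subset_uIcc left_mem_uIcc (by rwa [uIcc_of_le (ht.trans htm)])))
      (hWi.mono_set (uIcc_subset_uIcc (by rwa [uIcc_of_le (ht.trans htm)]) right_mem_uIcc))]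
    congr 1
    · have e1 : ∫ r in (0 : ℝ)..s t₀, R t₀ r = ∫ a in t₀..m t₀, R t₀ (a - t₀) := by
        rw [intervalIntegral.integral_comp_sub_right (fun r => R t₀ r)]
        simp [hmdef]
      rw [e1]
      refine intervalIntegral.integral_congr fun a ha => ?_
      rw [uIcc_of_le (hle t₀ h0)] at ha
      simp only [W]
      rw [hp0 a ⟨ha.1, ha.2.trans hm01⟩ ha.2]
    · have himg : Icc (m t₀) (m t₁) = m '' Icc t₀ t₁ := by
        refine Subset.antisymm (intermediate_value_Icc ht hmc.continuousOn) ?_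
        rintro _ ⟨t, h, rfl⟩
        exact ⟨hmono h0 h h.1, hmono h h1 h.2⟩
      rw [intervalIntegral.integral_of_le hm01, intervalIntegral.integral_of_le ht,
        ← integral_Icc_eq_integral_Ioc, ← integral_Icc_eq_integral_Ioc, himg,
        integral_image_eq_integral_deriv_smul_of_monotoneOn (f := m) measurableSet_Icc
          (fun x _ => ((hs x).add (hasDerivAt_id x)).hasDerivWithinAt) hmono W]
      refine setIntegral_congr_ae measurableSet_Icc ?_
      have hne := measure_eq_zero_iff_ae_notMem.1 (Real.volume_singleton (a := t₀))
      have hne' := measure_eq_zero_iff_ae_notMem.1 (Real.volume_singleton (a := t₁))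
      filter_upwards [hne, hne'] with t htn htn' h
      have hto : t ∈ Ioo t₀ t₁ :=
        ⟨lt_of_le_of_ne h.1 fun h' => htn h'.symm, lt_of_le_of_ne h.2 fun h' => htn' h'⟩
      rcases hm with hm | hm
      · have : s' t + 1 = 0 := by
          refine ((hs t).add (hasDerivAt_id t)).unique
            ((hasDerivAt_const t (s t₀ + t₀)).congr_of_eventuallyEq ?_)
          filter_upwards [Ioo_mem_nhds hto.1 hto.2] with x hx
          exact hm x (Ioo_subset_Icc_self hx)
        simp [this]
      · have hmt : m t ∈ Icc t₀ (m t₁) := ⟨h.1.trans (hle t h), hmono h h1 h.2⟩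
        have : p (m t) = t := hm.injOn (hp _ hmt) h (hpm _ hmt (hm h0 h hto.1))
        simp only [W, this, smul_eq_mul]
        simp only [hmdef, add_sub_cancel_right]
        ring
  have e1 : ∫ t in t₀..t₁, ∫ r in (0 : ℝ)..s t, D t r = ∫ t in t₀..t₁, ∫ a in t₀..m t₁, d t a :=
    intervalIntegral.integral_congr fun t h => by
      rw [uIcc_of_le ht] at h
      exact (hin1 t h).symm
  have e2 : ∫ a in t₀..m t₁, ∫ t in t₀..t₁, d t a = (∫ a in t₀..m t₁, E a) - ∫ a in t₀..m t₁, W a := by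
    rw [← intervalIntegral.integral_sub hEi hWi]
    refine intervalIntegral.integral_congr fun a ha => ?_
    rw [uIcc_of_le (ht.trans htm)] at ha
    exact hin2 a ha
  rw [e1, hswap, e2, hE, hW]
  ring

/-- Rate of change of the integral of a function that is transported with the speed `-σ`. -/
theorem integral_transport {R D : ℝ → ℝ → ℝ} {t₀ t₁ σ : ℝ} (hσ : σ = 1 ∨ σ = -1) (ht : t₀ ≤ t₁)
    {s s' : ℝ → ℝ} (hs : ∀ t, HasDerivAt s (s' t) t) (hs0 : ∀ t ∈ Icc t₀ t₁, 0 ≤ s t)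
    (hm : (∀ t ∈ Icc t₀ t₁, σ * s t + t = σ * s t₀ + t₀) ∨
      StrictMonoOn (fun t => σ * s t + t) (Icc t₀ t₁))
    (hRm : BddMeasOn (fun p : ℝ × ℝ => R p.1 p.2) {p | p.1 ∈ Icc t₀ t₁ ∧ p.2 ∈ Icc 0 (s p.1)})
    (hDm : BddMeasOn (fun p : ℝ × ℝ => D p.1 p.2) {p | p.1 ∈ Icc t₀ t₁ ∧ p.2 ∈ Icc 0 (s p.1)})
    (hR : ∀ a p q, p ≤ q → (∀ r ∈ Icc p q, r ∈ Icc t₀ t₁ ∧ σ * (a - r) ∈ Icc 0 (s r)) →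
      R q (σ * (a - q)) = R p (σ * (a - p)) + ∫ r in p..q, D r (σ * (a - r))) :
    (∫ r in (0 : ℝ)..s t₁, R t₁ r) - (∫ r in (0 : ℝ)..s t₀, R t₀ r) =
      (∫ t in t₀..t₁, ∫ r in (0 : ℝ)..s t, D t r) + (∫ t in t₀..t₁, R t (s t) * (s' t + σ)) -
        σ * ∫ t in t₀..t₁, R t 0 := by
  rcases hσ with rfl | rfl
  · simp only [one_mul] at hm hR ⊢
    exact integral_transport_of_speed_neg_one ht hs hs0 hm hRm hDm hR
  · have hmem : ∀ t, t ∈ Icc (-t₁) (-t₀) ↔ -t ∈ Icc t₀ t₁ := fun t => by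
      simp only [mem_Icc]; constructor <;> rintro ⟨h1, h2⟩ <;> constructor <;> linarith
    have key := integral_transport_of_speed_neg_one (R := fun t r => R (-t) r)
      (D := fun t r => -D (-t) r) (t₀ := -t₁) (t₁ := -t₀) (neg_le_neg ht) (s := fun t => s (-t))
      (s' := fun t => -s' (-t)) (fun t => by
        exact ((hs (-t)).scomp t (hasDerivAt_neg t)).congr_deriv (by simp))
      (fun t h => hs0 _ ((hmem t).1 h)) ?_ ?_ ?_ ?_
    · simp only [neg_neg] at key
      rw [intervalIntegral.integral_comp_neg (fun t => ∫ r in (0 : ℝ)..s t, -D t r),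
        intervalIntegral.integral_comp_neg (fun t => R t (s t) * (-s' t + 1)),
        intervalIntegral.integral_comp_neg (fun t => R t 0)] at key
      simp only [neg_neg, intervalIntegral.integral_neg] at key
      have e : ∫ t in t₀..t₁, R t (s t) * (-s' t + 1) = -∫ t in t₀..t₁, R t (s t) * (s' t + -1) := by
        rw [← intervalIntegral.integral_neg]
        congr 1; ext t; ring
      rw [e] at key
      linarith
    · rcases hm with hm | hm
      · left
        intro t h
        have h1 := hm _ ((hmem t).1 h)
        have h2 := hm t₁ (right_mem_Icc.2 ht)
        simp only [neg_neg]
        linarith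
      · right
        intro x hx y hy hxy
        have := hm ((hmem y).1 hy) ((hmem x).1 hx) (neg_lt_neg hxy)
        simp only at this ⊢
        linarith
    · exact hRm.comp (h := fun p : ℝ × ℝ => (-p.1, p.2)) (by fun_prop)
        fun p hp => ⟨(hmem _).1 hp.1, hp.2⟩
    · exact (hDm.comp (h := fun p : ℝ × ℝ => (-p.1, p.2)) (by fun_prop)
        fun p hp => ⟨(hmem _).1 hp.1, hp.2⟩).neg
    · intro a p q hpq h
      have := hR (-a) (-q) (-p) (neg_le_neg hpq) fun r hr => by
        have := h (-r) ⟨by linarith [hr.2], by linarith [hr.1]⟩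
        rw [hmem, neg_neg] at this
        refine ⟨this.1, ?_⟩
        convert this.2 using 1; ring
      have e : ∫ r in p..q, -D (-r) (a - r) = -∫ r in -q..-p, D r (-1 * (-a - r)) := by
        rw [← intervalIntegral.integral_neg, ← intervalIntegral.integral_comp_neg]
        congr 1; ext r
        congr 2; ring
      rw [e]
      have e1 : -1 * (-a - -p) = a - p := by ring
      have e2 : -1 * (-a - -q) = a - q := by ring
      rw [e1, e2] at this
      linarith [this]

/-! ### Locally bounded measurable functions of time and place -/

/-- `g t z` is measurable and bounded for `0 ≤ t ≤ T`, `z ∈ [0,1]`, for every `T`. -/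
def IsLocBdd (g : ℝ → ℝ → ℝ) : Prop :=
  ∀ T : ℝ, BddMeasOn (fun p : ℝ × ℝ => g p.1 p.2) (Icc 0 T ×ˢ Icc 0 1)

theorem measurableSet_kernelTriangle : MeasurableSet kernelTriangle :=
  (measurableSet_le measurable_const measurable_snd).inter
    ((measurableSet_le measurable_snd measurable_fst).inter
      (measurableSet_le measurable_fst measurable_const))

theorem mem_kernelTriangle {z ζ : ℝ} (hz : z ∈ Icc (0 : ℝ) 1) (hζ : ζ ∈ Icc 0 z) :
    (z, ζ) ∈ kernelTriangle := ⟨hζ.1, hζ.2, hz.2⟩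

theorem kernelTriangle.mem_Icc {p : ℝ × ℝ} (hp : p ∈ kernelTriangle) :
    p.1 ∈ Icc (0 : ℝ) 1 ∧ p.2 ∈ Icc (0 : ℝ) 1 :=
  ⟨⟨hp.1.trans hp.2.1, hp.2.2⟩, ⟨hp.1, hp.2.1.trans hp.2.2⟩⟩

namespace IsLocBdd

variable {f g : ℝ → ℝ → ℝ}

theorem add (hf : IsLocBdd f) (hg : IsLocBdd g) : IsLocBdd fun t z => f t z + g t z :=
  fun T => (hf T).add (hg T)

theorem sub (hf : IsLocBdd f) (hg : IsLocBdd g) : IsLocBdd fun t z => f t z - g t z :=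
  fun T => (hf T).sub (hg T)

theorem mul (hf : IsLocBdd f) (hg : IsLocBdd g) : IsLocBdd fun t z => f t z * g t z :=
  fun T => (hf T).mul (hg T)

theorem neg (hf : IsLocBdd f) : IsLocBdd fun t z => -f t z := fun T => (hf T).neg

theorem sum {ι : Type*} (I : Finset ι) {f : ι → ℝ → ℝ → ℝ} (h : ∀ i ∈ I, IsLocBdd (f i)) :
    IsLocBdd fun t z => ∑ i ∈ I, f i t z :=
  fun T => BddMeasOn.sum I fun i hi => h i hi T

theorem congr (hf : IsLocBdd f) (h : ∀ t, 0 ≤ t → ∀ z ∈ Icc (0 : ℝ) 1, g t z = f t z) :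
    IsLocBdd g := fun T => (hf T).congr fun p hp => h p.1 hp.1.1 p.2 hp.2

theorem zero : IsLocBdd fun _ _ => 0 := fun _ => BddMeasOn.const 0

theorem of_space {k : ℝ → ℝ} (hk : BddMeasOn k (Icc 0 1)) : IsLocBdd fun _ z => k z :=
  fun _ => hk.comp measurable_snd fun _ hp => hp.2

theorem of_time {k : ℝ → ℝ} (hk : ∀ T, BddMeasOn k (Icc 0 T)) : IsLocBdd fun t _ => k t :=
  fun T => (hk T).comp measurable_fst fun _ hp => hp.1

theorem slice (hf : IsLocBdd f) {t : ℝ} (ht : 0 ≤ t) : BddMeasOn (f t) (Icc 0 1) :=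
  (hf t).comp (h := fun z : ℝ => (t, z)) (by fun_prop) fun _ hz => ⟨⟨ht, le_rfl⟩, hz⟩

theorem trace (hf : IsLocBdd f) {z : ℝ} (hz : z ∈ Icc (0 : ℝ) 1) (T : ℝ) :
    BddMeasOn (fun t => f t z) (Icc 0 T) :=
  (hf T).comp (h := fun t : ℝ => (t, z)) (by fun_prop) fun _ ht => ⟨ht, hz⟩

theorem volterra {Q : ℝ → ℝ → ℝ} (hQ : BddMeasOn (fun p : ℝ × ℝ => Q p.1 p.2) kernelTriangle)
    (hf : IsLocBdd f) : IsLocBdd fun t z => ∫ ζ in (0 : ℝ)..z, Q z ζ * f t ζ := by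
  intro T
  refine BddMeasOn.integral (F := fun q : (ℝ × ℝ) × ℝ => Q q.1.2 q.2 * f q.1.1 q.2)
    (D := {q | q.1.1 ∈ Icc 0 T ∧ (q.1.2, q.2) ∈ kernelTriangle}) (a := fun _ => 0)
    (b := fun p => p.2) ?_ ?_ measurable_const measurable_snd ?_ ?_
  · refine (hQ.comp (h := fun q : (ℝ × ℝ) × ℝ => (q.1.2, q.2)) (by fun_prop) fun q hq => hq.2).mul
      ((hf T).comp (h := fun q : (ℝ × ℝ) × ℝ => (q.1.1, q.2)) (by fun_prop) fun q hq =>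
        ⟨hq.1, (kernelTriangle.mem_Icc hq.2).2⟩)
  · have m1 : Measurable fun q : (ℝ × ℝ) × ℝ => q.1.1 := by fun_prop
    have m2 : Measurable fun q : (ℝ × ℝ) × ℝ => (q.1.2, q.2) := by fun_prop
    exact (m1 measurableSet_Icc).inter (m2 measurableSet_kernelTriangle)
  · rintro ⟨t, z⟩ ⟨ht, hz⟩ r hr
    rw [uIcc_of_le hz.1] at hr
    exact ⟨ht, mem_kernelTriangle hz hr⟩
  · refine ⟨1, ?_⟩
    rintro ⟨t, z⟩ ⟨ht, hz⟩
    rw [sub_zero, abs_of_nonneg hz.1]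
    exact hz.2

end IsLocBdd

namespace HyperbolicPDEODE

variable {n : ℕ} (S : HyperbolicPDEODE n)

/-- `y` is transported along the characteristics with the source `f`: the component `yᵢ` has the
rate `fᵢ` with respect to time along the `i`-th characteristics. -/
structure IsTransported (y f : ℝ → ℝ → Fin 2 → ℝ) : Prop where
  bdd : ∀ i, IsLocBdd fun t z => y t z i
  bdd_source : ∀ i, IsLocBdd fun t z => f t z i
  along : ∀ i c t₀ t₁, 0 ≤ t₀ → t₀ ≤ t₁ → S.char i c t₀ ∈ Icc (0 : ℝ) 1 →
    S.char i c t₁ ∈ Icc (0 : ℝ) 1 →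
    y t₁ (S.char i c t₁) i = y t₀ (S.char i c t₀) i + ∫ t in t₀..t₁, f t (S.char i c t) i

theorem char_mapsTo {i : Fin 2} {c t₀ t₁ : ℝ} (h : 0 ≤ t₀) (h0 : S.char i c t₀ ∈ Icc (0 : ℝ) 1)
    (h1 : S.char i c t₁ ∈ Icc (0 : ℝ) 1) :
    MapsTo (fun t => (t, S.char i c t)) (Icc t₀ t₁) (Icc 0 t₁ ×ˢ Icc 0 1) := fun _ ht =>
  ⟨⟨h.trans ht.1, ht.2⟩, S.char_mem_Icc i h0 h1 (Icc_subset_uIcc ht)⟩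

theorem measurable_char (i : Fin 2) (c : ℝ) : Measurable fun t => S.char i c t :=
  ((S.continuous_char i).comp (by fun_prop : Continuous fun t : ℝ => (c, t))).measurable

theorem bddMeasOn_along {f : ℝ → ℝ → ℝ} (hf : IsLocBdd f) {i : Fin 2} {c t₀ t₁ : ℝ} (h : 0 ≤ t₀)
    (h0 : S.char i c t₀ ∈ Icc (0 : ℝ) 1) (h1 : S.char i c t₁ ∈ Icc (0 : ℝ) 1) :
    BddMeasOn (fun t => f t (S.char i c t)) (Icc t₀ t₁) :=
  (hf t₁).comp (measurable_id.prodMk (S.measurable_char i c)) (S.char_mapsTo h h0 h1)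

variable {S}

theorem IsTransported.isBddPrimitive {y f : ℝ → ℝ → Fin 2 → ℝ} (hy : S.IsTransported y f)
    {i : Fin 2} {c t₀ t₁ : ℝ} (h : 0 ≤ t₀) (h0 : S.char i c t₀ ∈ Icc (0 : ℝ) 1)
    (h1 : S.char i c t₁ ∈ Icc (0 : ℝ) 1) :
    IsBddPrimitive (fun t => y t (S.char i c t) i) (fun t => f t (S.char i c t) i) t₀ t₁ :=
  (S.bddMeasOn_along (hy.bdd_source i) h h0 h1).isBddPrimitive fun t ht =>
    hy.along i c t₀ t h ht.1 h0 (S.char_mem_Icc i h0 h1 (Icc_subset_uIcc ht))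

theorem IsTransported.congr {y f y' f' : ℝ → ℝ → Fin 2 → ℝ} (hy : S.IsTransported y f)
    (h : ∀ t, 0 ≤ t → ∀ z ∈ Icc (0 : ℝ) 1, y' t z = y t z)
    (h' : ∀ t, 0 < t → ∀ z ∈ Icc (0 : ℝ) 1, f' t z = f t z) 
    (hb : ∀ i, IsLocBdd fun t z => f' t z i) : S.IsTransported y' f' := by
  refine ⟨fun i => (hy.bdd i).congr fun t ht z hz => by rw [h t ht z hz], hb, ?_⟩
  intro i c t₀ t₁ ht0 ht h0 h1
  rw [h t₁ (ht0.trans ht) _ h1, h t₀ ht0 _ h0, hy.along i c t₀ t₁ ht0 ht h0 h1]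
  congr 1
  refine intervalIntegral.integral_congr_ae (Filter.Eventually.of_forall fun t htm => ?_)
  rw [uIoc_of_le ht] at htm
  rw [h' t (ht0.trans_lt htm.1) _ (S.char_mem_Icc i h0 h1 (Icc_subset_uIcc (Ioc_subset_Icc_self htm)))]

variable (S)

/-- The characteristic integrals of the definition of a solution, with time as parameter. -/
theorem integral_pde_eq (i : Fin 2) (f : ℝ → ℝ → ℝ) {z₀ z₁ t₀ t₁ : ℝ} (hz₀ : z₀ ∈ Icc (0 : ℝ) 1)
    (hz₁ : z₁ ∈ Icc (0 : ℝ) 1) (h : charSign i * S.phi i z₁ + t₁ = charSign i * S.phi i z₀ + t₀) :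
    charSign i * ∫ ζ in z₀..z₁, f (t₀ + charSign i * (S.phi i z₀ - S.phi i ζ)) ζ / S.lam i ζ =
      -∫ t in t₀..t₁, f t (S.char i (S.label i t₀ z₀) t) := by
  have e0 := S.char_label i t₀ z₀
  have hlab : S.label i t₁ z₁ = S.label i t₀ z₀ := by
    rw [label, label, ← S.phi_eq_travel i hz₀, ← S.phi_eq_travel i hz₁, h]
  have e1 : S.char i (S.label i t₀ z₀) t₁ = z₁ := by rw [← hlab, char_label]
  have key := S.integral_along_char i f (S.label i t₀ z₀) t₀ t₁
  rw [e0, e1] at key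
  have : ∫ ζ in z₀..z₁, f (t₀ + charSign i * (S.phi i z₀ - S.phi i ζ)) ζ / S.lam i ζ =
      ∫ ζ in z₀..z₁, f (S.label i t₀ z₀ - charSign i * S.travel i ζ) ζ * (S.speed i ζ)⁻¹ := by
    refine intervalIntegral.integral_congr fun ζ hζ => ?_
    have hζ' := uIcc_subset_Icc' hz₀ hz₁ hζ
    simp only [S.phi_eq_travel i hz₀, S.phi_eq_travel i hζ', S.speed_eq i hζ', label, div_eq_mul_inv]
    congr 2; ring
  rw [this, key, ← mul_assoc, mul_neg, charSign_mul_self]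
  ring

theorem isLocBdd_A (i j : Fin 2) : IsLocBdd fun _ z => S.A z i j :=
  IsLocBdd.of_space ⟨S.A_meas i j, S.A_bdd.imp fun _ h => h i j⟩

theorem mulVec_two (M : Matrix (Fin 2) (Fin 2) ℝ) (v : Fin 2 → ℝ) (i : Fin 2) :
    (M *ᵥ v) i = ∑ j, M i j * v j := rfl

theorem isLocBdd_mulVec {M : ℝ → ℝ → Matrix (Fin 2) (Fin 2) ℝ} {y : ℝ → ℝ → Fin 2 → ℝ}
    (hM : ∀ i j, IsLocBdd fun t z => M t z i j) (hy : ∀ i, IsLocBdd fun t z => y t z i) (i : Fin 2) :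
    IsLocBdd fun t z => (M t z *ᵥ y t z) i := by
  simp only [mulVec_two]
  exact IsLocBdd.sum _ fun j _ => (hM i j).mul (hy j)

variable {S}

theorem IsSolution.isTransported {x : ℝ → ℝ → Fin 2 → ℝ} {ξ : ℝ → Fin n → ℝ} {u : ℝ → ℝ}
    (hx : S.IsSolution x ξ u) : S.IsTransported x fun t z => S.A z *ᵥ x t z := by
  have hb : ∀ i, IsLocBdd fun t z => x t z i := by
    intro i T
    refine BddMeasOn.mono (s := Icc 0 T ×ˢ Icc 0 1) ⟨?_, ?_⟩ Subset.rfl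
    · exact (hx.meas i).comp (measurable_inclusion (prod_mono_left Icc_subset_Ici_self))
    · obtain ⟨B, hB⟩ := hx.bdd T
      exact ⟨B, fun p hp => hB p.1 hp.1 p.2 hp.2 i⟩
  refine ⟨hb, fun i => isLocBdd_mulVec (fun i j => S.isLocBdd_A i j) hb i, ?_⟩
  intro i c t₀ t₁ ht0 ht h0 h1
  have hlab : charSign i * S.phi i (S.char i c t₁) + t₁ =
      charSign i * S.phi i (S.char i c t₀) + t₀ := by
    rw [S.phi_eq_travel i h0, S.phi_eq_travel i h1]
    have e1 := S.label_char i c t₁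
    have e0 := S.label_char i c t₀
    rw [label] at e0 e1
    rw [e0, e1]
  rw [hx.pde i _ h0 _ h1 t₀ t₁ ht0 (ht0.trans ht) hlab,
    S.integral_pde_eq i (fun t z => (S.A z *ᵥ x t z) i) h0 h1 hlab, label_char]
  ring

/-! ### Transport kernels -/

theorem IsTransportKernel.bddMeasOn {B : ℝ → Matrix (Fin 2) (Fin 2) ℝ}
    {Q : ℝ → ℝ → Matrix (Fin 2) (Fin 2) ℝ} (hQ : S.IsTransportKernel B Q) (i j : Fin 2) :
    BddMeasOn (fun p : ℝ × ℝ => Q p.1 p.2 i j) kernelTriangle :=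
  ⟨hQ.meas i j, hQ.bdd.imp fun _ h => h i j⟩

theorem IsTransportKernel.sub_eq {B : ℝ → Matrix (Fin 2) (Fin 2) ℝ}
    {Q : ℝ → ℝ → Matrix (Fin 2) (Fin 2) ℝ} (hQ : S.IsTransportKernel B Q) {i j : Fin 2}
    {c a t₀ t₁ : ℝ}
    (h : ∀ t ∈ uIcc t₀ t₁, (S.char i c t, S.char j a t) ∈ kernelTriangle) :
    Q (S.char i c t₁) (S.char j a t₁) i j * S.lam j (S.char j a t₁) =
      Q (S.char i c t₀) (S.char j a t₀) i j * S.lam j (S.char j a t₀) -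
        ∫ t in t₀..t₁, (Q (S.char i c t) (S.char j a t) * B (S.char j a t)) i j *
          S.speed j (S.char j a t) := by
  -- it suffices to treat the case in which the second coordinate increases
  have key : ∀ t₀ t₁, (∀ t ∈ uIcc t₀ t₁, (S.char i c t, S.char j a t) ∈ kernelTriangle) →
      S.char j a t₀ ≤ S.char j a t₁ →
      Q (S.char i c t₁) (S.char j a t₁) i j * S.lam j (S.char j a t₁) =
        Q (S.char i c t₀) (S.char j a t₀) i j * S.lam j (S.char j a t₀) -
          ∫ t in t₀..t₁, (Q (S.char i c t) (S.char j a t) * B (S.char j a t)) i j *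
            S.speed j (S.char j a t) := by
    intro t₀ t₁ h hle
    have htime : ∀ t, a - charSign j * S.travel j (S.char j a t) = t := fun t => by
      rw [travel_char, ← mul_assoc, charSign_mul_self]; ring
    have hmono : ∀ ζ ∈ Icc (S.char j a t₀) (S.char j a t₁),
        a - charSign j * S.travel j ζ ∈ uIcc t₀ t₁ ∧
          S.char j a (a - charSign j * S.travel j ζ) = ζ := by
      intro ζ hζ
      have m0 := (S.strictMono_travel j).monotone hζ.1
      have m1 := (S.strictMono_travel j).monotone hζ.2
      rw [travel_char] at m0 m1
      constructor
      · rw [mem_uIcc]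
        rcases charSign_cases j with hj | hj <;> rw [hj] at m0 m1 ⊢
        · right; constructor <;> linarith
        · left; constructor <;> linarith
      · rw [char, sub_sub_cancel, ← mul_assoc, charSign_mul_self, one_mul, place_travel]
    have hp := hQ.pde i j (S.char j a t₀) (S.char j a t₁)
      (fun ζ => S.char i c (a - charSign j * S.travel j ζ)) hle (by
        intro ζ hζ
        obtain ⟨e1, e2⟩ := hmono ζ hζ
        have hm := h _ e1
        rw [e2] at hm
        refine ⟨hm, ?_⟩
        have hm0 := h t₀ left_mem_uIcc
        have i1 := kernelTriangle.mem_Icc hm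
        have i0 := kernelTriangle.mem_Icc hm0
        simp only [htime]
        rw [S.phi_eq_travel i i1.1, S.phi_eq_travel j i1.2, S.phi_eq_travel i i0.1,
          S.phi_eq_travel j i0.2]
        simp only [travel_char]
        linear_combination (c - a + charSign j * S.travel j ζ - (c - t₀)) * charSign_mul_self i
          + (a - t₀) * charSign_mul_self j)
    simp only [htime] at hp
    rw [hp]
    have hcv := S.integral_along_char j (fun t ζ => (Q (S.char i c t) ζ * B ζ) i j * S.speed j ζ)
      a t₀ t₁
    have : ∀ ζ, (Q (S.char i c (a - charSign j * S.travel j ζ)) ζ * B ζ) i j * S.speed j ζ *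
        (S.speed j ζ)⁻¹ = (Q (S.char i c (a - charSign j * S.travel j ζ)) ζ * B ζ) i j := fun ζ => by
      rw [mul_assoc, mul_inv_cancel₀ (S.speed_pos j ζ).ne', mul_one]
    simp only [this] at hcv
    rw [hcv, ← mul_assoc, mul_neg, charSign_mul_self]
    ring
  rcases le_total (S.char j a t₀) (S.char j a t₁) with hle | hle
  · exact key t₀ t₁ h hle
  · have := key t₁ t₀ (by rwa [uIcc_comm]) hle
    rw [intervalIntegral.integral_symm, this]
    ring

end HyperbolicPDEODE

namespace HyperbolicPDEODE

variable {n : ℕ} (S : HyperbolicPDEODE n)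

/-! ### Volterra transformations of transported functions -/

theorem integral_comp_place (j : Fin 2) (h : ℝ → ℝ) (z : ℝ) :
    ∫ r in (0 : ℝ)..S.travel j z, h (S.place j r) * S.speed j (S.place j r) =
      ∫ ζ in (0 : ℝ)..z, h ζ := by
  have := S.integral_comp_travel j (fun r => h (S.place j r) * S.speed j (S.place j r)) 0 z
  rw [travel_zero] at this
  rw [← this]
  refine intervalIntegral.integral_congr fun ζ _ => ?_
  simp only [place_travel]
  rw [mul_assoc, mul_inv_cancel₀ (S.speed_pos j ζ).ne', mul_one]

theorem place_mem_Icc_iff (j : Fin 2) {r z : ℝ} :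
    S.place j r ∈ Icc 0 z ↔ r ∈ Icc 0 (S.travel j z) := by
  constructor
  · intro h
    have h1 := (S.strictMono_travel j).monotone h.1
    have h2 := (S.strictMono_travel j).monotone h.2
    simpa using And.intro h1 h2
  · intro h
    have h1 := (S.strictMono_place j).monotone h.1
    have h2 := (S.strictMono_place j).monotone h.2
    simpa using And.intro h1 h2

variable {S}

theorem bddMeasOn_mul_apply {α : Type*} [MeasurableSpace α] {s : Set α}
    {Q B : α → Matrix (Fin 2) (Fin 2) ℝ} (hQ : ∀ i j, BddMeasOn (fun p => Q p i j) s)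
    (hB : ∀ i j, BddMeasOn (fun p => B p i j) s) (i j : Fin 2) :
    BddMeasOn (fun p => (Q p * B p) i j) s := by
  simp only [Matrix.mul_apply]
  exact BddMeasOn.sum _ fun k _ => (hQ i k).mul (hB k j)

/-- One entry of a Volterra integral, followed along a characteristic. -/
theorem IsTransportKernel.volterra_entry_sub {B : ℝ → Matrix (Fin 2) (Fin 2) ℝ}
    {Q : ℝ → ℝ → Matrix (Fin 2) (Fin 2) ℝ} (hQ : S.IsTransportKernel B Q)
    (hB : ∀ i j, BddMeasOn (fun z => B z i j) (Icc 0 1)) {y f : ℝ → ℝ → Fin 2 → ℝ}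
    (hy : S.IsTransported y f) (i j : Fin 2) {c t₀ t₁ : ℝ} (h : 0 ≤ t₀) (ht : t₀ ≤ t₁)
    (h0 : S.char i c t₀ ∈ Icc (0 : ℝ) 1) (h1 : S.char i c t₁ ∈ Icc (0 : ℝ) 1) :
    (∫ ζ in (0 : ℝ)..S.char i c t₁, Q (S.char i c t₁) ζ i j * y t₁ ζ j) -
      (∫ ζ in (0 : ℝ)..S.char i c t₀, Q (S.char i c t₀) ζ i j * y t₀ ζ j) =
    (∫ t in t₀..t₁, ∫ ζ in (0 : ℝ)..S.char i c t,
      (Q (S.char i c t) ζ i j * f t ζ j - (Q (S.char i c t) ζ * B ζ) i j * y t ζ j)) +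
    (∫ t in t₀..t₁, Q (S.char i c t) (S.char i c t) i j * y t (S.char i c t) j *
      (charSign j * S.speed j (S.char i c t) - charSign i * S.speed i (S.char i c t))) -
    charSign j * ∫ t in t₀..t₁, Q (S.char i c t) 0 i j * S.speed j 0 * y t 0 j := by
  have hz : ∀ t ∈ Icc t₀ t₁, S.char i c t ∈ Icc (0 : ℝ) 1 := fun t ht' =>
    S.char_mem_Icc i h0 h1 (Icc_subset_uIcc ht')
  set G : Set (ℝ × ℝ) := {p | p.1 ∈ Icc t₀ t₁ ∧ p.2 ∈ Icc 0 (S.travel j (S.char i c p.1))}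
  have hGt : MapsTo (fun p : ℝ × ℝ => (S.char i c p.1, S.place j p.2)) G kernelTriangle :=
    fun p hp => mem_kernelTriangle (hz _ hp.1) ((S.place_mem_Icc_iff j).2 hp.2)
  have hGy : MapsTo (fun p : ℝ × ℝ => (p.1, S.place j p.2)) G (Icc 0 t₁ ×ˢ Icc 0 1) :=
    fun p hp => ⟨⟨h.trans hp.1.1, hp.1.2⟩, (kernelTriangle.mem_Icc (hGt hp)).2⟩
  have hmz : Measurable fun t => S.char i c t := S.measurable_char i c
  have hmp : Measurable (S.place j) := (S.continuous_place j).measurable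
  have hQG : ∀ i j', BddMeasOn (fun p : ℝ × ℝ => Q (S.char _ c p.1) (S.place j p.2) i j') G :=
    fun i' j' => (hQ.bddMeasOn i' j').comp ((hmz.comp measurable_fst).prodMk
      (hmp.comp measurable_snd)) hGt
  have hBG : ∀ i j', BddMeasOn (fun p : ℝ × ℝ => B (S.place j p.2) i j') G := fun i' j' =>
    (hB i' j').comp (hmp.comp measurable_snd) fun p hp => (hGy hp).2
  obtain ⟨m, M, hm, hM, hsp⟩ := S.exists_speed_bounds
  have hspb : ∀ {α : Type} [MeasurableSpace α] (k : α → ℝ) (_ : Measurable k) (s : Set α),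
      BddMeasOn (fun p => S.speed j (k p)) s := fun k hk s =>
    BddMeasOn.of_measurable ((S.continuous_speed j).measurable.comp hk)
      ⟨M, fun p _ => by rw [abs_of_pos (S.speed_pos j _)]; exact (hsp j _).2⟩
  have hsG : BddMeasOn (fun p : ℝ × ℝ => S.speed j (S.place j p.2)) G :=
    hspb _ (hmp.comp measurable_snd) G
  have hyG : BddMeasOn (fun p : ℝ × ℝ => y p.1 (S.place j p.2) j) G :=
    (hy.bdd j t₁).comp (measurable_fst.prodMk (hmp.comp measurable_snd)) hGy
  have hfG : BddMeasOn (fun p : ℝ × ℝ => f p.1 (S.place j p.2) j) G :=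
    (hy.bdd_source j t₁).comp (measurable_fst.prodMk (hmp.comp measurable_snd)) hGy
  have hds : ∀ t, HasDerivAt (fun t => S.travel j (S.char i c t))
      ((S.speed j (S.char i c t))⁻¹ * (-charSign i * S.speed i (S.char i c t))) t := fun t =>
    (S.hasDerivAt_travel j (S.char i c t)).comp t (S.hasDerivAt_char i c t)
  have key := integral_transport (σ := charSign j) (t₀ := t₀) (t₁ := t₁)
    (R := fun t r => Q (S.char i c t) (S.place j r) i j * y t (S.place j r) j *
      S.speed j (S.place j r))
    (D := fun t r => (Q (S.char i c t) (S.place j r) i j * f t (S.place j r) j -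
      (Q (S.char i c t) (S.place j r) * B (S.place j r)) i j * y t (S.place j r) j) *
      S.speed j (S.place j r))
    (charSign_cases j) ht hds (fun t ht' => S.travel_nonneg j (hz t ht').1) ?_ ?_ ?_ ?_
  · simp only [place_zero, place_travel] at key
    rw [S.integral_comp_place j (fun ζ => Q (S.char i c t₁) ζ i j * y t₁ ζ j),
      S.integral_comp_place j (fun ζ => Q (S.char i c t₀) ζ i j * y t₀ ζ j)] at key
    have e : ∀ t, ∫ r in (0 : ℝ)..S.travel j (S.char i c t),
        (Q (S.char i c t) (S.place j r) i j * f t (S.place j r) j -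
          (Q (S.char i c t) (S.place j r) * B (S.place j r)) i j * y t (S.place j r) j) *
          S.speed j (S.place j r) = _ := fun t =>
      S.integral_comp_place j (fun ζ => Q (S.char i c t) ζ i j * f t ζ j -
        (Q (S.char i c t) ζ * B ζ) i j * y t ζ j) _
    simp only [e] at key
    rw [key]
    congr 1
    · congr 1
      refine intervalIntegral.integral_congr fun t _ => ?_
      have := (S.speed_pos j (S.char i c t)).ne'
      field_simp
      ring
    · congr 1
      refine intervalIntegral.integral_congr fun t _ => ?_
      ring
  · by_cases hij : i = j
    · subst hij
      left
      intro t _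
      have e1 := S.label_char i c t
      have e0 := S.label_char i c t₀
      rw [label] at e0 e1
      rw [e0, e1]
    · right
      have hs : charSign j = -charSign i := by
        fin_cases i <;> fin_cases j <;> simp [charSign] at hij ⊢
      refine StrictMono.strictMonoOn (strictMono_of_deriv_pos fun t => ?_) _
      have hd : HasDerivAt (fun t => charSign j * S.travel j (S.char i c t) + t) _ t :=
        ((hds t).const_mul (charSign j)).add (hasDerivAt_id t)
      rw [hd.deriv, hs]
      have p1 := S.speed_pos j (S.char i c t)
      have p2 := S.speed_pos i (S.char i c t)
      have e : -charSign i * ((S.speed j (S.char i c t))⁻¹ *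
          (-charSign i * S.speed i (S.char i c t))) =
          (S.speed j (S.char i c t))⁻¹ * S.speed i (S.char i c t) := by
        linear_combination ((S.speed j (S.char i c t))⁻¹ * S.speed i (S.char i c t)) *
          charSign_mul_self i
      rw [e]
      positivity
  · exact ((hQG i j).mul hyG).mul hsG
  · exact (((hQG i j).mul hfG).sub ((bddMeasOn_mul_apply hQG hBG i j).mul hyG)).mul hsG
  · intro a p q hpq hin
    have hin' : ∀ r ∈ Icc p q, r ∈ Icc t₀ t₁ ∧ (S.char i c r, S.char j a r) ∈ kernelTriangle :=
      fun r hr => ⟨(hin r hr).1, mem_kernelTriangle (hz r (hin r hr).1)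
        ((S.place_mem_Icc_iff j).2 (hin r hr).2)⟩
    have hp := hin' p (left_mem_Icc.2 hpq)
    have hq := hin' q (right_mem_Icc.2 hpq)
    have hmaps : MapsTo (fun r => (S.char i c r, S.char j a r)) (Icc p q) kernelTriangle :=
      fun r hr => (hin' r hr).2
    have hma := S.measurable_char j a
    have pQ : IsBddPrimitive
        (fun r => Q (S.char i c r) (S.char j a r) i j * S.speed j (S.char j a r))
        (fun r => -((Q (S.char i c r) (S.char j a r) * B (S.char j a r)) i j *
          S.speed j (S.char j a r))) p q := by
      refine BddMeasOn.isBddPrimitive ?_ ?_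
      · refine ((bddMeasOn_mul_apply (fun i j => (hQ.bddMeasOn i j).comp
          (hmz.prodMk hma) hmaps) (fun i j => (hB i j).comp hma fun r hr =>
            (kernelTriangle.mem_Icc (hmaps hr)).2) i j).mul (hspb _ hma _)).neg
      · intro r hr
        have e := hQ.sub_eq (i := i) (j := j) (c := c) (a := a) (t₀ := p) (t₁ := r) fun x hx => by
          rw [uIcc_of_le hr.1] at hx
          exact (hin' x ⟨hx.1, hx.2.trans hr.2⟩).2
        rw [S.speed_eq j (kernelTriangle.mem_Icc (hin' r hr).2).2,
          S.speed_eq j (kernelTriangle.mem_Icc hp.2).2, e, intervalIntegral.integral_neg]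
        ring
    have pY := hy.isBddPrimitive (i := j) (c := a) (h.trans hp.1.1)
      (kernelTriangle.mem_Icc hp.2).2 (kernelTriangle.mem_Icc hq.2).2
    have e := (pQ.mul pY).eq q (right_mem_Icc.2 hpq)
    have hch : ∀ r, S.place j (charSign j * (a - r)) = S.char j a r := fun _ => rfl
    simp only [hch]
    refine Eq.trans (by ring) (e.trans ?_)
    congr 1
    · ring
    · refine intervalIntegral.integral_congr fun r _ => ?_
      ring

theorem IsTransportKernel.isLocBdd_diag {B : ℝ → Matrix (Fin 2) (Fin 2) ℝ}
    {Q : ℝ → ℝ → Matrix (Fin 2) (Fin 2) ℝ} (hQ : S.IsTransportKernel B Q) (i j : Fin 2) :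
    IsLocBdd fun _ z => Q z z i j :=
  IsLocBdd.of_space ((hQ.bddMeasOn i j).comp (h := fun z : ℝ => (z, z)) (by fun_prop)
    fun _ hz => mem_kernelTriangle hz ⟨hz.1, le_rfl⟩)

theorem IsTransportKernel.bddMeasOn_zero {B : ℝ → Matrix (Fin 2) (Fin 2) ℝ}
    {Q : ℝ → ℝ → Matrix (Fin 2) (Fin 2) ℝ} (hQ : S.IsTransportKernel B Q) (i j : Fin 2) :
    BddMeasOn (fun z => Q z 0 i j) (Icc 0 1) :=
  (hQ.bddMeasOn i j).comp (h := fun z : ℝ => (z, 0)) (by fun_prop)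
    fun _ hz => mem_kernelTriangle hz ⟨le_rfl, hz.1⟩

theorem bddMeasOn_lam (i : Fin 2) : BddMeasOn (S.lam i) (Icc 0 1) :=
  BddMeasOn.of_continuousOn (S.lam_cont i) isCompact_Icc

theorem bddMeasOn_Lam (i j : Fin 2) : BddMeasOn (fun z => S.Lam z i j) (Icc 0 1) := by
  simp only [Lam, diagonal_apply]
  by_cases h : i = j
  · simp only [h, if_true]; exact (bddMeasOn_lam j).const_mul _
  · simp only [h, if_false]; exact BddMeasOn.const 0

theorem isLocBdd_volterra {Q : ℝ → ℝ → Matrix (Fin 2) (Fin 2) ℝ}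
    (hQ : ∀ i j, BddMeasOn (fun p : ℝ × ℝ => Q p.1 p.2 i j) kernelTriangle)
    {g : ℝ → ℝ → Fin 2 → ℝ} (hg : ∀ i, IsLocBdd fun t z => g t z i) (i : Fin 2) :
    IsLocBdd fun t z => ∫ ζ in (0 : ℝ)..z, (Q z ζ *ᵥ g t ζ) i := by
  refine (IsLocBdd.sum Finset.univ fun j _ => IsLocBdd.volterra (Q := fun z ζ => Q z ζ i j) (hQ i j) (hg j)).congr
    fun t ht z hz => ?_
  simp only [mulVec_two]
  rw [intervalIntegral.integral_finsetSum]
  intro j _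
  have hsub : uIcc 0 z ⊆ Icc 0 1 := uIcc_subset_Icc' (left_mem_Icc.2 zero_le_one) hz
  refine BddMeasOn.intervalIntegrable (s := Icc 0 z) ?_ (uIcc_of_le hz.1).le
  refine ((hQ i j).comp (h := fun ζ : ℝ => (z, ζ)) (by fun_prop)
    fun ζ hζ => mem_kernelTriangle hz hζ).mul (((hg j).slice ht).mono ?_)
  exact Icc_subset_Icc_right hz.2

/-- A Volterra transformation with a transport kernel maps transported functions to transported
functions, and turns the couplings into boundary terms. -/
theorem IsTransported.volterra {B : ℝ → Matrix (Fin 2) (Fin 2) ℝ}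
    {Q : ℝ → ℝ → Matrix (Fin 2) (Fin 2) ℝ} (hQ : S.IsTransportKernel B Q)
    (hB : ∀ i j, BddMeasOn (fun z => B z i j) (Icc 0 1)) {y g : ℝ → ℝ → Fin 2 → ℝ}
    (hy : S.IsTransported y fun t z => B z *ᵥ y t z + g t z)
    (hg : ∀ i, IsLocBdd fun t z => g t z i) :
    S.IsTransported (fun t z i => y t z i - ∫ ζ in (0 : ℝ)..z, (Q z ζ *ᵥ y t ζ) i)
      (fun t z i => (B z *ᵥ y t z) i + g t z i -
        ((Q z z * S.Lam z - S.Lam z * Q z z) *ᵥ y t z) i + ((Q z 0 * S.Lam 0) *ᵥ y t 0) i -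
          ∫ ζ in (0 : ℝ)..z, (Q z ζ *ᵥ g t ζ) i) := by
  have h01 : (0 : ℝ) ∈ Icc (0 : ℝ) 1 := left_mem_Icc.2 zero_le_one
  have hQb := hQ.bddMeasOn
  have hLam : ∀ i j, IsLocBdd fun _ z => S.Lam z i j := fun i j =>
    IsLocBdd.of_space (bddMeasOn_Lam i j)
  have hdiag : ∀ i, IsLocBdd fun t z => ((Q z z * S.Lam z - S.Lam z * Q z z) *ᵥ y t z) i := by
    refine isLocBdd_mulVec (fun i j => ?_) hy.bdd
    simp only [Matrix.sub_apply, Matrix.mul_apply]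
    exact (IsLocBdd.sum _ fun k _ => (hQ.isLocBdd_diag i k).mul (hLam k j)).sub
      (IsLocBdd.sum _ fun k _ => (hLam i k).mul (hQ.isLocBdd_diag k j))
  have hzero : ∀ i, IsLocBdd fun t z => ((Q z 0 * S.Lam 0) *ᵥ y t 0) i := by
    refine isLocBdd_mulVec (fun i j => ?_) fun i => IsLocBdd.of_time ((hy.bdd i).trace h01)
    exact IsLocBdd.of_space (bddMeasOn_mul_apply (B := fun _ => S.Lam 0) (fun i j => hQ.bddMeasOn_zero i j)
      (fun i j => BddMeasOn.const _) i j)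
  have hBy : ∀ i, IsLocBdd fun t z => (B z *ᵥ y t z) i :=
    isLocBdd_mulVec (fun i j => IsLocBdd.of_space (hB i j)) hy.bdd
  have hQg := isLocBdd_volterra hQb hg
  refine ⟨fun i => (hy.bdd i).sub (isLocBdd_volterra hQb hy.bdd i), fun i =>
    ((((hBy i).add (hg i)).sub (hdiag i)).add (hzero i)).sub (hQg i), ?_⟩
  intro i c t₀ t₁ h ht h0 h1
  have hz : ∀ t ∈ Icc t₀ t₁, S.char i c t ∈ Icc (0 : ℝ) 1 := fun t ht' =>
    S.char_mem_Icc i h0 h1 (Icc_subset_uIcc ht')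
  have hI : ∀ {k : ℝ → ℝ → ℝ}, IsLocBdd k →
      IntervalIntegrable (fun t => k t (S.char i c t)) volume t₀ t₁ := fun hk =>
    (S.bddMeasOn_along hk h h0 h1).intervalIntegrable (uIcc_of_le ht).le
  have hQζ : ∀ z ∈ Icc (0 : ℝ) 1, ∀ j, BddMeasOn (fun ζ => Q z ζ i j) (Icc 0 z) := fun z hz j =>
    (hQb i j).comp (h := fun ζ : ℝ => (z, ζ)) (by fun_prop) fun ζ hζ => mem_kernelTriangle hz hζ
  have hsl : ∀ {k : ℝ → ℝ → ℝ}, IsLocBdd k → ∀ t, 0 ≤ t → ∀ z ∈ Icc (0 : ℝ) 1,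
      BddMeasOn (k t) (Icc 0 z) := fun hk t ht z hz =>
    (hk.slice ht).mono (Icc_subset_Icc_right hz.2)
  have hsplit : ∀ {w : ℝ → ℝ → Fin 2 → ℝ}, (∀ i, IsLocBdd fun t z => w t z i) →
      ∀ t, 0 ≤ t → ∀ z ∈ Icc (0 : ℝ) 1, ∫ ζ in (0 : ℝ)..z, (Q z ζ *ᵥ w t ζ) i =
        ∑ j, ∫ ζ in (0 : ℝ)..z, Q z ζ i j * w t ζ j := by
    intro w hw t ht z hz
    simp only [mulVec_two]
    exact intervalIntegral.integral_finsetSum fun j _ =>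
      ((hQζ z hz j).mul (hsl (hw j) t ht z hz)).intervalIntegrable (uIcc_of_le hz.1).le
  have hent : ∀ j, _ := fun j => hQ.volterra_entry_sub hB hy i j h ht h0 h1
  -- the double integrals
  have hdbl : ∀ j, IsLocBdd fun t z => ∫ ζ in (0 : ℝ)..z,
      (Q z ζ i j * (B ζ *ᵥ y t ζ + g t ζ) j - (Q z ζ * B ζ) i j * y t ζ j) := by
    intro j
    have hQB : BddMeasOn (fun p : ℝ × ℝ => (Q p.1 p.2 * B p.2) i j) kernelTriangle :=
      bddMeasOn_mul_apply hQb (fun i j => (hB i j).comp measurable_snd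
        fun p hp => (kernelTriangle.mem_Icc hp).2) i j
    refine ((IsLocBdd.volterra (Q := fun z ζ => Q z ζ i j) (hQb i j) (hy.bdd_source j)).sub
      (IsLocBdd.volterra (Q := fun z ζ => (Q z ζ * B ζ) i j) hQB (hy.bdd j))).congr fun t ht z hz => ?_
    rw [← intervalIntegral.integral_sub]
    · exact ((hQζ z hz j).mul (hsl (hy.bdd_source j) t ht z hz)).intervalIntegrable
        (uIcc_of_le hz.1).le
    · exact ((hQB.comp (h := fun ζ : ℝ => (z, ζ)) (by fun_prop)
        fun ζ hζ => mem_kernelTriangle hz hζ).mul (hsl (hy.bdd j) t ht z hz)).intervalIntegrable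
        (uIcc_of_le hz.1).le
  have hsum : ∀ t, 0 ≤ t → ∀ z ∈ Icc (0 : ℝ) 1, ∑ j, ∫ ζ in (0 : ℝ)..z,
      (Q z ζ i j * (B ζ *ᵥ y t ζ + g t ζ) j - (Q z ζ * B ζ) i j * y t ζ j) =
        ∫ ζ in (0 : ℝ)..z, (Q z ζ *ᵥ g t ζ) i := by
    intro t ht z hz
    rw [← intervalIntegral.integral_finsetSum]
    · refine intervalIntegral.integral_congr fun ζ _ => ?_
      simp only [mulVec_two, Pi.add_apply, Matrix.mul_apply, Fin.sum_univ_two]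
      ring
    · intro j _
      refine (((hQζ z hz j).mul (hsl (hy.bdd_source j) t ht z hz)).sub
        ((bddMeasOn_mul_apply (Q := fun ζ => Q z ζ) (fun i j => (hQb i j).comp
          (h := fun ζ : ℝ => (z, ζ)) (by fun_prop) fun ζ hζ => mem_kernelTriangle hz hζ)
          (fun i j => (hB i j).mono (Icc_subset_Icc_right hz.2)) i j).mul
          (hsl (hy.bdd j) t ht z hz))).intervalIntegrable (uIcc_of_le hz.1).le
  have hd2 : ∀ j, IsLocBdd fun t z => Q z z i j * y t z j *
      (charSign j * S.speed j z - charSign i * S.speed i z) := by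
    intro j
    refine ((hQ.isLocBdd_diag i j).mul (hy.bdd j)).mul ?_
    have : ∀ k, IsLocBdd fun _ z => charSign k * S.speed k z := fun k =>
      IsLocBdd.of_space ((BddMeasOn.of_continuousOn (S.continuous_speed k).continuousOn
        isCompact_Icc).const_mul _)
    exact (this j).sub (this i)
  have hd3 : ∀ j, IsLocBdd fun t z => charSign j * (Q z 0 i j * S.speed j 0 * y t 0 j) := by
    intro j
    exact (IsLocBdd.of_space (BddMeasOn.const (charSign j))).mul
      (((IsLocBdd.of_space (hQ.bddMeasOn_zero i j)).mul (IsLocBdd.of_space (BddMeasOn.const _))).mul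
        (IsLocBdd.of_time ((hy.bdd j).trace h01)))
  have hy' := hy.along i c t₀ t₁ h ht h0 h1
  have hvol : (∫ ζ in (0 : ℝ)..S.char i c t₁, (Q (S.char i c t₁) ζ *ᵥ y t₁ ζ) i) -
      (∫ ζ in (0 : ℝ)..S.char i c t₀, (Q (S.char i c t₀) ζ *ᵥ y t₀ ζ) i) =
      ∫ t in t₀..t₁, ∑ j, ((∫ ζ in (0 : ℝ)..S.char i c t, (Q (S.char i c t) ζ i j *
        (B ζ *ᵥ y t ζ + g t ζ) j - (Q (S.char i c t) ζ * B ζ) i j * y t ζ j)) +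
        Q (S.char i c t) (S.char i c t) i j * y t (S.char i c t) j *
          (charSign j * S.speed j (S.char i c t) - charSign i * S.speed i (S.char i c t)) -
        charSign j * (Q (S.char i c t) 0 i j * S.speed j 0 * y t 0 j)) := by
    rw [hsplit hy.bdd t₁ (h.trans ht) _ h1, hsplit hy.bdd t₀ h _ h0, ← Finset.sum_sub_distrib,
      intervalIntegral.integral_finsetSum fun j _ =>
        ((hI (hdbl j)).add (hI (hd2 j))).sub (hI (hd3 j))]
    refine Finset.sum_congr rfl fun j _ => ?_
    rw [hent j, intervalIntegral.integral_sub ((hI (hdbl j)).add (hI (hd2 j))) (hI (hd3 j)),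
      intervalIntegral.integral_add (hI (hdbl j)) (hI (hd2 j)), intervalIntegral.integral_const_mul]
  have hfin : ∫ t in t₀..t₁, ((B (S.char i c t) *ᵥ y t (S.char i c t)) i + g t (S.char i c t) i -
      ((Q (S.char i c t) (S.char i c t) * S.Lam (S.char i c t) -
        S.Lam (S.char i c t) * Q (S.char i c t) (S.char i c t)) *ᵥ y t (S.char i c t)) i +
      ((Q (S.char i c t) 0 * S.Lam 0) *ᵥ y t 0) i -
      ∫ ζ in (0 : ℝ)..S.char i c t, (Q (S.char i c t) ζ *ᵥ g t ζ) i) =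
      (∫ t in t₀..t₁, (B (S.char i c t) *ᵥ y t (S.char i c t) + g t (S.char i c t)) i) -
      ∫ t in t₀..t₁, ∑ j, ((∫ ζ in (0 : ℝ)..S.char i c t, (Q (S.char i c t) ζ i j *
        (B ζ *ᵥ y t ζ + g t ζ) j - (Q (S.char i c t) ζ * B ζ) i j * y t ζ j)) +
        Q (S.char i c t) (S.char i c t) i j * y t (S.char i c t) j *
          (charSign j * S.speed j (S.char i c t) - charSign i * S.speed i (S.char i c t)) -
        charSign j * (Q (S.char i c t) 0 i j * S.speed j 0 * y t 0 j)) := by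
    rw [← intervalIntegral.integral_sub (hI (hy.bdd_source i))
      (hI (IsLocBdd.sum _ fun j _ => ((hdbl j).add (hd2 j)).sub (hd3 j)))]
    refine intervalIntegral.integral_congr fun t htm => ?_
    rw [uIcc_of_le ht] at htm
    have hzt := hz t htm
    rw [Finset.sum_sub_distrib, Finset.sum_add_distrib, hsum t (h.trans htm.1) _ hzt]
    have hLamz : ∀ z ∈ Icc (0 : ℝ) 1, S.Lam z = diagonal fun k => charSign k * S.speed k z :=
      fun z hz => by rw [Lam]; congr 1; ext k; rw [S.speed_eq k hz]
    rw [hLamz _ hzt, hLamz 0 h01]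
    simp only [mulVec_two, Matrix.sub_apply, Matrix.mul_diagonal, Matrix.diagonal_mul,
      Fin.sum_univ_two, Pi.add_apply]
    ring
  rw [hfin, hy']
  linarith [hvol]

end HyperbolicPDEODE

namespace HyperbolicPDEODE

variable {n : ℕ} {S : HyperbolicPDEODE n}

/-! ### Linear combinations of solutions -/

theorem IsTransported.add_const_mul {y f y' f' : ℝ → ℝ → Fin 2 → ℝ} (hy : S.IsTransported y f)
    (hy' : S.IsTransported y' f') (a : ℝ) :
    S.IsTransported (fun t z i => y t z i + a * y' t z i) fun t z i => f t z i + a * f' t z i := by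
  have hc : ∀ {k : ℝ → ℝ → ℝ}, IsLocBdd k → IsLocBdd fun t z => a * k t z := fun hk T =>
    (hk T).const_mul a
  refine ⟨fun i => (hy.bdd i).add (hc (hy'.bdd i)), fun i =>
    (hy.bdd_source i).add (hc (hy'.bdd_source i)), fun i c t₀ t₁ h ht h0 h1 => ?_⟩
  have e := ((hy.isBddPrimitive h h0 h1).add ((hy'.isBddPrimitive h h0 h1).const_mul a)).eq t₁
    (right_mem_Icc.2 ht)
  exact e

theorem IsTransported.pde {x f : ℝ → ℝ → Fin 2 → ℝ} (hx : S.IsTransported x f) (i : Fin 2) :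
    ∀ z₀ ∈ Icc (0 : ℝ) 1, ∀ z₁ ∈ Icc (0 : ℝ) 1, ∀ t₀ t₁ : ℝ, 0 ≤ t₀ → 0 ≤ t₁ →
    charSign i * S.phi i z₁ + t₁ = charSign i * S.phi i z₀ + t₀ →
    x t₁ z₁ i = x t₀ z₀ i - charSign i * ∫ ζ in z₀..z₁,
      f (t₀ + charSign i * (S.phi i z₀ - S.phi i ζ)) ζ i / S.lam i ζ := by
  intro z₀ hz₀ z₁ hz₁ t₀ t₁ h0 h1 h
  have e0 := S.char_label i t₀ z₀
  have e1 : S.char i (S.label i t₀ z₀) t₁ = z₁ := by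
    have hlab : S.label i t₁ z₁ = S.label i t₀ z₀ := by
      rw [label, label, ← S.phi_eq_travel i hz₀, ← S.phi_eq_travel i hz₁, h]
    rw [← hlab, char_label]
  rw [S.integral_pde_eq i (fun t z => f t z i) hz₀ hz₁ h, sub_neg_eq_add]
  rcases le_total t₀ t₁ with ht | ht
  · have := hx.along i (S.label i t₀ z₀) t₀ t₁ h0 ht (by rwa [e0]) (by rwa [e1])
    rwa [e0, e1] at this
  · have := hx.along i (S.label i t₀ z₀) t₁ t₀ h1 ht (by rwa [e1]) (by rwa [e0])
    rw [e0, e1] at this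
    rw [intervalIntegral.integral_symm, this]
    ring

theorem IsSolution.bddMeasOn {x : ℝ → ℝ → Fin 2 → ℝ} {ξ : ℝ → Fin n → ℝ} {u : ℝ → ℝ}
    (hx : S.IsSolution x ξ u) {t : ℝ} (ht : 0 ≤ t) (i : Fin 2) :
    BddMeasOn (fun z => x t z i) (Icc 0 1) := (hx.isTransported.bdd i).slice ht

theorem continuousOn_pi_apply {ξ : ℝ → Fin n → ℝ} {s : Set ℝ} (h : ContinuousOn ξ s) (m : Fin n) :
    ContinuousOn (fun t => ξ t m) s := (continuous_apply m).comp_continuousOn h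

theorem IsSolution.bddMeasOn_ode {x : ℝ → ℝ → Fin 2 → ℝ} {ξ : ℝ → Fin n → ℝ} {u : ℝ → ℝ}
    (hx : S.IsSolution x ξ u) (T : ℝ) (m : Fin n) : BddMeasOn (fun t => ξ t m) (Icc 0 T) :=
  BddMeasOn.of_continuousOn ((continuousOn_pi_apply hx.ode_cont m).mono Icc_subset_Ici_self)
    isCompact_Icc

theorem bddMeasOn_ode_rhs {x : ℝ → ℝ → Fin 2 → ℝ} {ξ : ℝ → Fin n → ℝ}
    (hx : ∀ i, IsLocBdd fun t z => x t z i) (hξ : ∀ T m, BddMeasOn (fun t => ξ t m) (Icc 0 T))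
    (T : ℝ) (m : Fin n) :
    BddMeasOn (fun t => (S.F *ᵥ ξ t + x t 0 0 • S.b) m) (Icc 0 T) := by
  simp only [Pi.add_apply, Pi.smul_apply, smul_eq_mul]
  refine BddMeasOn.add ?_ (((hx 0).trace (left_mem_Icc.2 zero_le_one) T).mul (BddMeasOn.const _))
  exact BddMeasOn.sum Finset.univ fun k _ => (BddMeasOn.const (S.F m k)).mul (hξ T k)

theorem intervalIntegrable_pi {f : ℝ → Fin n → ℝ} {a b : ℝ}
    (h : ∀ m, IntervalIntegrable (fun t => f t m) volume a b) : IntervalIntegrable f volume a b :=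
  ⟨Integrable.of_eval fun m => (h m).1, Integrable.of_eval fun m => (h m).2⟩

theorem intervalIntegral_pi_apply {f : ℝ → Fin n → ℝ} {a b : ℝ}
    (h : IntervalIntegrable f volume a b) (m : Fin n) :
    (∫ t in a..b, f t) m = ∫ t in a..b, f t m :=
  ((ContinuousLinearMap.proj (R := ℝ) (φ := fun _ : Fin n => ℝ) m).intervalIntegral_comp_comm h).symm

theorem ode_iff {x : ℝ → ℝ → Fin 2 → ℝ} {ξ : ℝ → Fin n → ℝ}
    (hx : ∀ i, IsLocBdd fun t z => x t z i) (hξ : ∀ T m, BddMeasOn (fun t => ξ t m) (Icc 0 T)) :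
    (∀ t, 0 ≤ t → ξ t = ξ 0 + ∫ s in (0 : ℝ)..t, (S.F *ᵥ ξ s + x s 0 0 • S.b)) ↔
    ∀ m T, IsBddPrimitive (fun t => ξ t m) (fun t => (S.F *ᵥ ξ t + x t 0 0 • S.b) m) 0 T := by
  have hint : ∀ t, 0 ≤ t →
      IntervalIntegrable (fun s => S.F *ᵥ ξ s + x s 0 0 • S.b) volume 0 t := fun t ht =>
    intervalIntegrable_pi fun m => (bddMeasOn_ode_rhs hx hξ t m).intervalIntegrable (uIcc_of_le ht).le
  constructor
  · intro h m T
    refine (bddMeasOn_ode_rhs hx hξ T m).isBddPrimitive fun t ht => ?_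
    have := congrFun (h t ht.1) m
    rwa [Pi.add_apply, intervalIntegral_pi_apply (hint t ht.1)] at this
  · intro h t ht
    ext m
    rw [Pi.add_apply, intervalIntegral_pi_apply (hint t ht)]
    exact (h m t).eq t (right_mem_Icc.2 ht)

theorem IsSolution.isBddPrimitive_ode {x : ℝ → ℝ → Fin 2 → ℝ} {ξ : ℝ → Fin n → ℝ} {u : ℝ → ℝ}
    (hx : S.IsSolution x ξ u) (m : Fin n) (T : ℝ) :
    IsBddPrimitive (fun t => ξ t m) (fun t => (S.F *ᵥ ξ t + x t 0 0 • S.b) m) 0 T :=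
  (ode_iff hx.isTransported.bdd hx.bddMeasOn_ode).1 hx.ode m T

theorem IsSolution.add_const_mul {x x' : ℝ → ℝ → Fin 2 → ℝ} {ξ ξ' : ℝ → Fin n → ℝ} {u u' : ℝ → ℝ}
    (hx : S.IsSolution x ξ u) (hx' : S.IsSolution x' ξ' u') (a : ℝ) :
    S.IsSolution (x + a • x') (ξ + a • ξ') (u + a • u') := by
  have ht : S.IsTransported (x + a • x') fun t z => S.A z *ᵥ (x + a • x') t z := by
    have h := hx.isTransported.add_const_mul hx'.isTransported a
    have e : (fun t z i => (S.A z *ᵥ x t z) i + a * (S.A z *ᵥ x' t z) i) =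
        fun t z => S.A z *ᵥ (x + a • x') t z := by
      ext t z i
      simp only [Pi.add_apply, Pi.smul_apply, Matrix.mulVec_add, Matrix.mulVec_smul, smul_eq_mul]
    rw [e] at h
    exact h
  have hξ : ∀ T m, BddMeasOn (fun t => (ξ + a • ξ') t m) (Icc 0 T) := fun T m =>
    (hx.bddMeasOn_ode T m).add ((hx'.bddMeasOn_ode T m).const_mul a)
  refine ⟨fun i => ?_, fun T => ?_, hx.ode_cont.add (hx'.ode_cont.const_smul a), ?_, fun t ht => ?_,
    ht.pde, fun t ht => ?_⟩
  · exact (hx.meas i).add ((hx'.meas i).const_mul a)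
  · obtain ⟨B, hB⟩ := hx.bdd T
    obtain ⟨B', hB'⟩ := hx'.bdd T
    refine ⟨B + |a| * B', fun t ht z hz i => (abs_add_le _ _).trans (add_le_add (hB t ht z hz i) ?_)⟩
    simp only [Pi.smul_apply, smul_eq_mul, abs_mul]
    exact mul_le_mul_of_nonneg_left (hB' t ht z hz i) (abs_nonneg a)
  · refine (ode_iff ht.bdd hξ).2 fun m T => ?_
    refine ((hx.isBddPrimitive_ode m T).add ((hx'.isBddPrimitive_ode m T).const_mul a)).congr
      (fun t _ => rfl) fun t _ => ?_
    simp only [Pi.add_apply, Pi.smul_apply, smul_eq_mul, Matrix.mulVec_add, Matrix.mulVec_smul]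
    ring
  · simp only [Pi.add_apply, Pi.smul_apply, smul_eq_mul, hx.bc0 t ht, hx'.bc0 t ht, dotProduct_add,
      dotProduct_smul]
    ring
  · simp only [Pi.add_apply, Pi.smul_apply, smul_eq_mul, hx.bc1 t ht, hx'.bc1 t ht]
    ring

/-! ### The transformations of the state -/

/-- The Volterra transformation `w(z) - ∫₀ᶻ Q(z,ζ) w(ζ) dζ`. -/
def volterraTransform (Q : ℝ → ℝ → Matrix (Fin 2) (Fin 2) ℝ) (w : ℝ → Fin 2 → ℝ) (z : ℝ) :
    Fin 2 → ℝ := fun i => w z i - ∫ ζ in (0 : ℝ)..z, (Q z ζ *ᵥ w ζ) i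

theorem bar_eq_volterraTransform (K : ℝ → ℝ → Matrix (Fin 2) (Fin 2) ℝ) (w : ℝ → Fin 2 → ℝ) :
    S.bar K w = volterraTransform K (S.tilde w) := rfl

theorem bddMeasOn_mulVec {Q : ℝ → ℝ → Matrix (Fin 2) (Fin 2) ℝ}
    (hQ : ∀ i j, BddMeasOn (fun p : ℝ × ℝ => Q p.1 p.2 i j) kernelTriangle) {w : ℝ → Fin 2 → ℝ}
    (hw : ∀ i, BddMeasOn (fun z => w z i) (Icc 0 1)) {z : ℝ} (hz : z ∈ Icc (0 : ℝ) 1) (i : Fin 2) :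
    BddMeasOn (fun ζ => (Q z ζ *ᵥ w ζ) i) (Icc 0 z) := by
  simp only [mulVec_two]
  exact BddMeasOn.sum _ fun j _ => ((hQ i j).comp (h := fun ζ : ℝ => (z, ζ)) (by fun_prop)
    fun ζ hζ => mem_kernelTriangle hz hζ).mul ((hw j).mono (Icc_subset_Icc_right hz.2))

theorem volterraTransform_add_const_mul {Q : ℝ → ℝ → Matrix (Fin 2) (Fin 2) ℝ}
    (hQ : ∀ i j, BddMeasOn (fun p : ℝ × ℝ => Q p.1 p.2 i j) kernelTriangle) {w w' : ℝ → Fin 2 → ℝ}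
    (hw : ∀ i, BddMeasOn (fun z => w z i) (Icc 0 1))
    (hw' : ∀ i, BddMeasOn (fun z => w' z i) (Icc 0 1)) (a : ℝ) {z : ℝ} (hz : z ∈ Icc (0 : ℝ) 1) :
    volterraTransform Q (w + a • w') z =
      volterraTransform Q w z + a • volterraTransform Q w' z := by
  ext i
  have e : ∫ ζ in (0 : ℝ)..z, (Q z ζ *ᵥ (w + a • w') ζ) i =
      (∫ ζ in (0 : ℝ)..z, (Q z ζ *ᵥ w ζ) i) + a * ∫ ζ in (0 : ℝ)..z, (Q z ζ *ᵥ w' ζ) i := by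
    rw [← intervalIntegral.integral_const_mul, ← intervalIntegral.integral_add
      ((bddMeasOn_mulVec hQ hw hz i).intervalIntegrable (uIcc_of_le hz.1).le)
      (((bddMeasOn_mulVec hQ hw' hz i).const_mul a).intervalIntegrable (uIcc_of_le hz.1).le)]
    refine intervalIntegral.integral_congr fun ζ _ => ?_
    simp only [Pi.add_apply, Pi.smul_apply, Matrix.mulVec_add, Matrix.mulVec_smul, smul_eq_mul]
  simp only [volterraTransform, Pi.add_apply (f := volterraTransform Q w z), Pi.smul_apply]
  rw [e]
  simp only [Pi.add_apply, Pi.smul_apply, smul_eq_mul]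
  ring

theorem bddMeasOn_volterraTransform {Q : ℝ → ℝ → Matrix (Fin 2) (Fin 2) ℝ}
    (hQ : ∀ i j, BddMeasOn (fun p : ℝ × ℝ => Q p.1 p.2 i j) kernelTriangle) {w : ℝ → Fin 2 → ℝ}
    (hw : ∀ i, BddMeasOn (fun z => w z i) (Icc 0 1)) (i : Fin 2) :
    BddMeasOn (fun z => volterraTransform Q w z i) (Icc 0 1) :=
  (hw i).sub ((isLocBdd_volterra hQ (g := fun _ => w) (fun i => IsLocBdd.of_space (hw i)) i).slice
    le_rfl)

theorem bddMeasOn_div_lam {f : ℝ → ℝ} (hf : BddMeasOn f (Icc 0 1)) (i : Fin 2) :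
    BddMeasOn (fun z => f z / S.lam i z) (Icc 0 1) := by
  simp only [div_eq_mul_inv]
  exact hf.mul (BddMeasOn.of_continuousOn ((S.lam_cont i).inv₀ fun z hz => (S.lam_pos i z hz).ne')
    isCompact_Icc)

theorem isBddPrimitive_alpha (i : Fin 2) :
    IsBddPrimitive (S.alpha i) (fun z => S.A z i i / S.lam i z) 0 1 :=
  (bddMeasOn_div_lam (S := S) ⟨S.A_meas i i, S.A_bdd.imp fun _ h => h i i⟩ i).isBddPrimitive
    fun t _ => by simp [alpha]

theorem tilde_apply (w : ℝ → Fin 2 → ℝ) (z : ℝ) (i : Fin 2) :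
    S.tilde w z i = Real.exp (charSign i * S.alpha i z) * w z i := by
  rw [tilde, E, Matrix.mulVec_diagonal]
  fin_cases i <;> simp [charSign]

theorem tilde_add_const_mul (w w' : ℝ → Fin 2 → ℝ) (a : ℝ) :
    S.tilde (w + a • w') = S.tilde w + a • S.tilde w' := by
  ext z i
  simp only [tilde_apply, Pi.add_apply, Pi.smul_apply, smul_eq_mul]
  ring

theorem bddMeasOn_scaling (i : Fin 2) (a : ℝ) :
    BddMeasOn (fun z => Real.exp (a * S.alpha i z)) (Icc 0 1) :=
  BddMeasOn.of_continuousOn (Real.continuous_exp.comp_continuousOn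
    (continuousOn_const.mul (isBddPrimitive_alpha i).continuousOn)) isCompact_Icc

theorem bddMeasOn_tilde {w : ℝ → Fin 2 → ℝ} (hw : ∀ i, BddMeasOn (fun z => w z i) (Icc 0 1))
    (i : Fin 2) : BddMeasOn (fun z => S.tilde w z i) (Icc 0 1) := by
  simp only [tilde_apply]
  exact (bddMeasOn_scaling i _).mul (hw i)

theorem bddMeasOn_Atilde (i j : Fin 2) : BddMeasOn (fun z => S.Atilde z i j) (Icc 0 1) := by
  have hA : ∀ i j, BddMeasOn (fun z => S.A z i j) (Icc 0 1) := fun i j =>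
    ⟨S.A_meas i j, S.A_bdd.imp fun _ h => h i j⟩
  have h1 := (bddMeasOn_scaling (S := S) 0 1).mul (bddMeasOn_scaling (S := S) 1 1)
  have h2 := (bddMeasOn_scaling (S := S) 0 (-1)).mul (bddMeasOn_scaling (S := S) 1 (-1))
  fin_cases i <;> fin_cases j
  · simpa [Atilde] using BddMeasOn.const (0 : ℝ)
  · refine ((hA 0 1).mul h1).congr fun z _ => ?_
    simp [Atilde, Real.exp_add]
  · refine ((hA 1 0).mul h2).congr fun z _ => ?_
    simp [Atilde, Real.exp_add, sub_eq_add_neg]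
  · simpa [Atilde] using BddMeasOn.const (0 : ℝ)

theorem isBddPrimitive_alpha_char (i : Fin 2) {c t₀ t₁ : ℝ} (h0 : S.char i c t₀ ∈ Icc (0 : ℝ) 1)
    (h1 : S.char i c t₁ ∈ Icc (0 : ℝ) 1) :
    IsBddPrimitive (fun t => charSign i * S.alpha i (S.char i c t))
      (fun t => -S.A (S.char i c t) i i) t₀ t₁ := by
  have hA : BddMeasOn (fun z => S.A z i i) (Icc 0 1) := ⟨S.A_meas i i, S.A_bdd.imp fun _ h => h i i⟩
  refine BddMeasOn.isBddPrimitive ((hA.comp (S.measurable_char i c) fun t ht =>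
    S.char_mem_Icc i h0 h1 (Icc_subset_uIcc ht)).neg) fun t ht => ?_
  have ht' := S.char_mem_Icc i h0 h1 (Icc_subset_uIcc ht)
  have e := S.integral_pde_eq i (fun _ z => S.A z i i) (t₀ := t₀) (t₁ := t) h0 ht' (by
    rw [S.phi_eq_travel i h0, S.phi_eq_travel i ht', travel_char, travel_char]
    linear_combination (t₀ - t) * charSign_mul_self i)
  rw [label_char] at e
  rw [intervalIntegral.integral_neg, ← e, ← (isBddPrimitive_alpha i).sub_eq h0 ht']
  ring

theorem IsTransported.tilde {x : ℝ → ℝ → Fin 2 → ℝ}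
    (hx : S.IsTransported x fun t z => S.A z *ᵥ x t z) :
    S.IsTransported (fun t => S.tilde (x t)) fun t z => S.Atilde z *ᵥ S.tilde (x t) z := by
  have hb : ∀ i, IsLocBdd fun t z => S.tilde (x t) z i := by
    intro i
    simp only [tilde_apply]
    exact (IsLocBdd.of_space (bddMeasOn_scaling i _)).mul (hx.bdd i)
  refine ⟨hb, isLocBdd_mulVec (fun i j => IsLocBdd.of_space (bddMeasOn_Atilde i j)) hb, ?_⟩
  intro i c t₀ t₁ h ht h0 h1
  have key := ((isBddPrimitive_alpha_char i h0 h1).exp.mul (hx.isBddPrimitive h h0 h1)).eq t₁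
    (right_mem_Icc.2 ht)
  simp only [tilde_apply]
  rw [key]
  congr 1
  refine intervalIntegral.integral_congr fun t _ => ?_
  generalize S.char i c t = z
  simp only [mulVec_two, Fin.sum_univ_two, tilde_apply]
  fin_cases i
  · simp only [Atilde, charSign, Fin.zero_eta, Fin.isValue, Matrix.of_apply, cons_val', cons_val_zero, cons_val_one, cons_val_fin_one]
    have : Real.exp (S.alpha 0 z + S.alpha 1 z) * Real.exp (-1 * S.alpha 1 z) =
        Real.exp (1 * S.alpha 0 z) := by rw [← Real.exp_add]; congr 1; ring
    linear_combination -(S.A z 0 1 * x t z 1) * this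
  · simp only [Atilde, charSign, Fin.mk_one, Fin.isValue, Matrix.of_apply, cons_val', cons_val_zero, cons_val_one, cons_val_fin_one]
    have : Real.exp (-S.alpha 0 z - S.alpha 1 z) * Real.exp (1 * S.alpha 0 z) =
        Real.exp (-1 * S.alpha 1 z) := by rw [← Real.exp_add]; congr 1; ring
    linear_combination -(S.A z 1 0 * x t z 0) * this

end HyperbolicPDEODE

namespace HyperbolicPDEODE

variable {n : ℕ} {S : HyperbolicPDEODE n}

/-! ### The tracking error and its target system -/

variable (S) in
/-- The state `x̄(z) - N(z) ξ` in which the ODE is decoupled from the PDE. -/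
def decoupled (K : ℝ → ℝ → Matrix (Fin 2) (Fin 2) ℝ) (N : ℝ → Matrix (Fin 2) (Fin n) ℝ)
    (w : ℝ → Fin 2 → ℝ) (ξ : Fin n → ℝ) (z : ℝ) : Fin 2 → ℝ := S.bar K w z - N z *ᵥ ξ

variable (S) in
/-- The state of the target system. -/
def target (K P : ℝ → ℝ → Matrix (Fin 2) (Fin 2) ℝ) (N : ℝ → Matrix (Fin 2) (Fin n) ℝ)
    (w : ℝ → Fin 2 → ℝ) (ξ : Fin n → ℝ) : ℝ → Fin 2 → ℝ :=
  volterraTransform P (S.decoupled K N w ξ)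

variable (S) in
/-- The controller for the zero reference. -/
def feedback (K P : ℝ → ℝ → Matrix (Fin 2) (Fin 2) ℝ) (N : ℝ → Matrix (Fin 2) (Fin n) ℝ) (qcl : ℝ)
    (w : ℝ → Fin 2 → ℝ) (ξ : Fin n → ℝ) : ℝ :=
  (qcl - S.q1bar) * S.bar K w 1 1 + (∫ z in (0 : ℝ)..1, ![1, -qcl] ⬝ᵥ (P 1 z *ᵥ S.bar K w z)) +
    ![1, -qcl] ⬝ᵥ ((Matrix.of fun i m =>
      N 1 i m - ∫ z in (0 : ℝ)..1, (P 1 z * N z) i m) *ᵥ ξ)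

variable (S) in
/-- `(e, ξ)` is a solution of the closed loop for the zero reference. -/
structure IsErrorSolution (K P : ℝ → ℝ → Matrix (Fin 2) (Fin 2) ℝ)
    (N : ℝ → Matrix (Fin 2) (Fin n) ℝ) (qcl : ℝ) (e : ℝ → ℝ → Fin 2 → ℝ) (ξ : ℝ → Fin n → ℝ)
    (u : ℝ → ℝ) : Prop where
  sol : S.IsSolution e ξ u
  feedback : ∀ t, 0 < t → S.inputBar K (e t) (u t) = S.feedback K P N qcl (e t) (ξ t)

/-- Bounded measurable states. -/
def IsBddState (w : ℝ → Fin 2 → ℝ) : Prop := ∀ i, BddMeasOn (fun z => w z i) (Icc 0 1)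

theorem one_mem_Icc : (1 : ℝ) ∈ Icc (0 : ℝ) 1 := right_mem_Icc.2 zero_le_one

theorem zero_mem_Icc : (0 : ℝ) ∈ Icc (0 : ℝ) 1 := left_mem_Icc.2 zero_le_one

section

variable {K P : ℝ → ℝ → Matrix (Fin 2) (Fin 2) ℝ} {N : ℝ → Matrix (Fin 2) (Fin n) ℝ}
  {k : Fin n → ℝ} {qcl : ℝ}

theorem IsPreKernel.bddMeasOn (hK : S.IsPreKernel K) (i j : Fin 2) :
    BddMeasOn (fun p : ℝ × ℝ => K p.1 p.2 i j) kernelTriangle := hK.transport.bddMeasOn i j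

theorem IsBacksteppingKernel.bddMeasOn (hP : S.IsBacksteppingKernel N P) (i j : Fin 2) :
    BddMeasOn (fun p : ℝ × ℝ => P p.1 p.2 i j) kernelTriangle := hP.transport.bddMeasOn i j

theorem IsDecoupling.continuousOn (hN : S.IsDecoupling k K N) (i : Fin 2) (m : Fin n) :
    ContinuousOn (fun z => N z i m) (Icc 0 1) :=
  (continuous_apply_apply i m).comp_continuousOn hN.cont

theorem IsDecoupling.bddMeasOn (hN : S.IsDecoupling k K N) (i : Fin 2) (m : Fin n) :
    BddMeasOn (fun z => N z i m) (Icc 0 1) :=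
  BddMeasOn.of_continuousOn (hN.continuousOn i m) isCompact_Icc

theorem IsBddState.bar (hK : S.IsPreKernel K) {w : ℝ → Fin 2 → ℝ} (hw : IsBddState w) :
    IsBddState (S.bar K w) :=
  bddMeasOn_volterraTransform hK.bddMeasOn (bddMeasOn_tilde hw)

theorem IsDecoupling.bddMeasOn_mulVec (hN : S.IsDecoupling k K N) (ξ : Fin n → ℝ) (i : Fin 2) :
    BddMeasOn (fun z => (N z *ᵥ ξ) i) (Icc 0 1) :=
  BddMeasOn.sum Finset.univ fun m _ => (hN.bddMeasOn i m).mul (BddMeasOn.const (ξ m))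

theorem IsBddState.decoupled (hK : S.IsPreKernel K) (hN : S.IsDecoupling k K N)
    {w : ℝ → Fin 2 → ℝ} (hw : IsBddState w) (ξ : Fin n → ℝ) : IsBddState (S.decoupled K N w ξ) :=
  fun i => (hw.bar hK i).sub (hN.bddMeasOn_mulVec ξ i)

theorem bar_add_const_mul (hK : S.IsPreKernel K) {w w' : ℝ → Fin 2 → ℝ} (hw : IsBddState w)
    (hw' : IsBddState w') (a : ℝ) {z : ℝ} (hz : z ∈ Icc (0 : ℝ) 1) :
    S.bar K (w + a • w') z = S.bar K w z + a • S.bar K w' z := by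
  rw [bar_eq_volterraTransform, tilde_add_const_mul,
    volterraTransform_add_const_mul hK.bddMeasOn (bddMeasOn_tilde hw) (bddMeasOn_tilde hw') a hz]
  rfl

theorem intervalIntegrable_mulVec {Q : ℝ → ℝ → Matrix (Fin 2) (Fin 2) ℝ}
    (hQ : ∀ i j, BddMeasOn (fun p : ℝ × ℝ => Q p.1 p.2 i j) kernelTriangle) {w : ℝ → Fin 2 → ℝ}
    (hw : IsBddState w) (i : Fin 2) :
    IntervalIntegrable (fun z => (Q 1 z *ᵥ w z) i) volume 0 1 :=
  (bddMeasOn_mulVec hQ hw one_mem_Icc i).intervalIntegrable (uIcc_of_le zero_le_one).le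

theorem integral_dotProduct_mulVec {Q : ℝ → ℝ → Matrix (Fin 2) (Fin 2) ℝ}
    (hQ : ∀ i j, BddMeasOn (fun p : ℝ × ℝ => Q p.1 p.2 i j) kernelTriangle) {w : ℝ → Fin 2 → ℝ}
    (hw : IsBddState w) (v : Fin 2 → ℝ) :
    ∫ z in (0 : ℝ)..1, v ⬝ᵥ (Q 1 z *ᵥ w z) =
      v 0 * (∫ z in (0 : ℝ)..1, (Q 1 z *ᵥ w z) 0) + v 1 * ∫ z in (0 : ℝ)..1, (Q 1 z *ᵥ w z) 1 := by
  rw [← intervalIntegral.integral_const_mul, ← intervalIntegral.integral_const_mul,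
    ← intervalIntegral.integral_add ((intervalIntegrable_mulVec hQ hw 0).const_mul _)
      ((intervalIntegrable_mulVec hQ hw 1).const_mul _)]
  refine intervalIntegral.integral_congr fun z _ => ?_
  simp only [dotProduct, Fin.sum_univ_two]

theorem inputBar_add_const_mul (hK : S.IsPreKernel K) {w w' : ℝ → Fin 2 → ℝ} (hw : IsBddState w)
    (hw' : IsBddState w') (a u u' : ℝ) :
    S.inputBar K (w + a • w') (u + a * u') = S.inputBar K w u + a * S.inputBar K w' u' := by
  have hi : ∀ {w : ℝ → Fin 2 → ℝ}, IsBddState w → IntervalIntegrable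
      (fun z => ![-1, S.q1bar] ⬝ᵥ (K 1 z *ᵥ S.tilde w z)) volume 0 1 := fun hw => by
    have : ∀ z w, ![-1, S.q1bar] ⬝ᵥ (K 1 z *ᵥ S.tilde w z) = -1 * (K 1 z *ᵥ S.tilde w z) 0 +
      S.q1bar * (K 1 z *ᵥ S.tilde w z) 1 := fun z w => by simp [dotProduct, Fin.sum_univ_two]
    simp only [this]
    exact ((intervalIntegrable_mulVec hK.bddMeasOn (bddMeasOn_tilde hw) 0).const_mul _).add
      ((intervalIntegrable_mulVec hK.bddMeasOn (bddMeasOn_tilde hw) 1).const_mul _)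
  simp only [inputBar, tilde_add_const_mul]
  have e : ∫ z in (0 : ℝ)..1, ![-1, S.q1bar] ⬝ᵥ (K 1 z *ᵥ (S.tilde w + a • S.tilde w') z) =
      (∫ z in (0 : ℝ)..1, ![-1, S.q1bar] ⬝ᵥ (K 1 z *ᵥ S.tilde w z)) +
        a * ∫ z in (0 : ℝ)..1, ![-1, S.q1bar] ⬝ᵥ (K 1 z *ᵥ S.tilde w' z) := by
    rw [← intervalIntegral.integral_const_mul, ← intervalIntegral.integral_add (hi hw)
      ((hi hw').const_mul a)]
    refine intervalIntegral.integral_congr fun z _ => ?_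
    simp only [Pi.add_apply, Pi.smul_apply, Matrix.mulVec_add, Matrix.mulVec_smul, dotProduct_add,
      dotProduct_smul, smul_eq_mul]
  rw [e]
  ring

theorem backsteppingController_eq (hK : S.IsPreKernel K) {w wr : ℝ → Fin 2 → ℝ} (hw : IsBddState w)
    (hwr : IsBddState wr) (ξ ξr : Fin n → ℝ) (ur : ℝ) :
    S.backsteppingController K P N qcl w ξ wr ξr ur =
      S.inputBar K wr ur + S.feedback K P N qcl (w + (-1 : ℝ) • wr) (ξ - ξr) := by
  have hb : ∀ z ∈ Icc (0 : ℝ) 1, S.bar K (w + (-1 : ℝ) • wr) z = S.bar K w z - S.bar K wr z :=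
    fun z hz => by rw [bar_add_const_mul hK hw hwr _ hz]; module
  have e : ∫ z in (0 : ℝ)..1, ![1, -qcl] ⬝ᵥ (P 1 z *ᵥ (S.bar K w z - S.bar K wr z)) =
      ∫ z in (0 : ℝ)..1, ![1, -qcl] ⬝ᵥ (P 1 z *ᵥ S.bar K (w + (-1 : ℝ) • wr) z) := by
    refine intervalIntegral.integral_congr fun z hz => ?_
    rw [uIcc_of_le zero_le_one] at hz
    simp only [hb z hz]
  rw [backsteppingController, feedback, e, hb 1 one_mem_Icc]
  ring

theorem IsSolution.isBddState {x : ℝ → ℝ → Fin 2 → ℝ} {ξ : ℝ → Fin n → ℝ} {u : ℝ → ℝ}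
    (hx : S.IsSolution x ξ u) {t : ℝ} (ht : 0 ≤ t) : IsBddState (x t) := hx.bddMeasOn ht

theorem IsClosedLoopSolution.isErrorSolution (hK : S.IsPreKernel K) {xr x : ℝ → ℝ → Fin 2 → ℝ}
    {ξr ξ : ℝ → Fin n → ℝ} {ur : ℝ → ℝ} (hr : S.IsSolution xr ξr ur)
    (h : S.IsClosedLoopSolution K P N qcl xr ξr ur x ξ) :
    ∃ u, S.IsErrorSolution K P N qcl (x + (-1 : ℝ) • xr) (ξ + (-1 : ℝ) • ξr) u := by
  obtain ⟨u, hx, hu⟩ := h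
  refine ⟨_, hx.add_const_mul hr (-1), fun t ht => ?_⟩
  have h1 := inputBar_add_const_mul hK (hx.isBddState ht.le) (hr.isBddState ht.le) (-1) (u t) (ur t)
  have h2 := hu t ht
  rw [backsteppingController_eq hK (hx.isBddState ht.le) (hr.isBddState ht.le)] at h2
  have e : ξ t - ξr t = (ξ + (-1 : ℝ) • ξr) t := by
    simp only [Pi.add_apply, Pi.smul_apply]; module
  rw [e] at h2
  refine Eq.trans h1 ?_
  rw [h2]
  show _ = S.feedback K P N qcl (x t + (-1 : ℝ) • xr t) ((ξ + (-1 : ℝ) • ξr) t)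
  ring

theorem IsErrorSolution.isClosedLoopSolution (hK : S.IsPreKernel K) {xr e : ℝ → ℝ → Fin 2 → ℝ}
    {ξr ξ : ℝ → Fin n → ℝ} {ur u : ℝ → ℝ} (hr : S.IsSolution xr ξr ur)
    (h : S.IsErrorSolution K P N qcl e ξ u) :
    S.IsClosedLoopSolution K P N qcl xr ξr ur (e + (1 : ℝ) • xr) (ξ + (1 : ℝ) • ξr) := by
  refine ⟨_, h.sol.add_const_mul hr 1, fun t ht => ?_⟩
  have hs := (h.sol.add_const_mul hr 1).isBddState ht.le
  rw [backsteppingController_eq hK hs (hr.isBddState ht.le)]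
  have h1 := inputBar_add_const_mul hK (h.sol.isBddState ht.le) (hr.isBddState ht.le) 1 (u t) (ur t)
  refine Eq.trans h1 ?_
  have e1 : (ξ + (1 : ℝ) • ξr) t - ξr t = ξ t := by
    simp only [Pi.add_apply, Pi.smul_apply]; module
  have e2 : (e + (1 : ℝ) • xr) t + (-1 : ℝ) • xr t = e t := by
    simp only [Pi.add_apply, Pi.smul_apply]; module
  rw [e1, e2, h.feedback t ht]
  ring

theorem bar_one (hK : S.IsPreKernel K) {w : ℝ → Fin 2 → ℝ} (hw : IsBddState w) {u : ℝ}
    (h : w 1 0 = S.q1 * w 1 1 + u) :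
    S.bar K w 1 0 = S.q1bar * S.bar K w 1 1 + S.inputBar K w u := by
  rw [inputBar, integral_dotProduct_mulVec hK.bddMeasOn (bddMeasOn_tilde hw)]
  simp only [bar, tilde_apply, h, q1bar, charSign, cons_val_zero, cons_val_one]
  have : Real.exp (S.alpha 0 1 + S.alpha 1 1) * Real.exp (-1 * S.alpha 1 1) =
      Real.exp (1 * S.alpha 0 1) := by rw [← Real.exp_add]; congr 1; ring
  rw [one_mul] at this ⊢
  linear_combination (-(S.q1 * w 1 1)) * this

theorem target_one (hK : S.IsPreKernel K) (hN : S.IsDecoupling k K N)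
    (hP : S.IsBacksteppingKernel N P) {w : ℝ → Fin 2 → ℝ} (hw : IsBddState w) (ξ : Fin n → ℝ) :
    S.target K P N w ξ 1 0 - qcl * S.target K P N w ξ 1 1 =
      S.bar K w 1 0 - S.q1bar * S.bar K w 1 1 - S.feedback K P N qcl w ξ := by
  have hPN : ∀ i m, IntervalIntegrable (fun z => (P 1 z * N z) i m) volume 0 1 := by
    intro i m
    simp only [Matrix.mul_apply]
    refine (BddMeasOn.sum Finset.univ fun j _ => BddMeasOn.mul ((hP.bddMeasOn i j).comp
      (h := fun ζ : ℝ => (1, ζ)) (by fun_prop) fun ζ hζ => mem_kernelTriangle one_mem_Icc hζ)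
      (hN.bddMeasOn j m)).intervalIntegrable (uIcc_of_le zero_le_one).le
  have e : ∀ i, S.target K P N w ξ 1 i = S.bar K w 1 i - (N 1 *ᵥ ξ) i -
      (∫ z in (0 : ℝ)..1, (P 1 z *ᵥ S.bar K w z) i) +
        ∑ m, (∫ z in (0 : ℝ)..1, (P 1 z * N z) i m) * ξ m := by
    intro i
    have e1 : ∑ m, (∫ z in (0 : ℝ)..1, (P 1 z * N z) i m) * ξ m =
        ∫ z in (0 : ℝ)..1, ∑ m, (P 1 z * N z) i m * ξ m := by
      rw [intervalIntegral.integral_finsetSum fun m _ => (hPN i m).mul_const _]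
      simp only [intervalIntegral.integral_mul_const]
    have e2 : ∫ z in (0 : ℝ)..1, (P 1 z *ᵥ S.decoupled K N w ξ z) i =
        (∫ z in (0 : ℝ)..1, (P 1 z *ᵥ S.bar K w z) i) -
          ∫ z in (0 : ℝ)..1, ∑ m, (P 1 z * N z) i m * ξ m := by
      rw [← intervalIntegral.integral_sub (intervalIntegrable_mulVec hP.bddMeasOn (hw.bar hK) i)
        (by
          have h1 := IntervalIntegrable.sum Finset.univ fun m _ => (hPN i m).mul_const (ξ m)
          refine h1.congr fun z _ => ?_
          simp only [Finset.sum_apply])]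
      refine intervalIntegral.integral_congr fun z _ => ?_
      simp only [decoupled, Matrix.mulVec_sub, Pi.sub_apply, Matrix.mulVec_mulVec]
      rfl
    rw [target, volterraTransform, e2, e1, decoupled, Pi.sub_apply]
    ring
  rw [e, e, feedback, integral_dotProduct_mulVec hP.bddMeasOn (hw.bar hK)]
  simp only [dotProduct, Fin.sum_univ_two, cons_val_zero, cons_val_one, Matrix.mulVec,
    Matrix.of_apply, sub_mul, Finset.sum_sub_distrib]
  ring

theorem IsErrorSolution.target_one {e : ℝ → ℝ → Fin 2 → ℝ} {ξ : ℝ → Fin n → ℝ} {u : ℝ → ℝ}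
    (hK : S.IsPreKernel K) (hN : S.IsDecoupling k K N) (hP : S.IsBacksteppingKernel N P)
    (h : S.IsErrorSolution K P N qcl e ξ u) {t : ℝ} (ht : 0 < t) :
    S.target K P N (e t) (ξ t) 1 0 = qcl * S.target K P N (e t) (ξ t) 1 1 := by
  have hw := h.sol.isBddState ht.le
  have h1 := HyperbolicPDEODE.target_one (qcl := qcl) hK hN hP hw (ξ t)
  rw [bar_one hK hw (h.sol.bc1 t ht), h.feedback t ht] at h1
  linarith

theorem bar_zero (w : ℝ → Fin 2 → ℝ) : S.bar K w 0 = w 0 := by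
  ext i
  simp [bar, tilde_apply, alpha]

theorem IsSolution.decoupled_zero_zero (hN : S.IsDecoupling k K N) {e : ℝ → ℝ → Fin 2 → ℝ}
    {ξ : ℝ → Fin n → ℝ} (t : ℝ) :
    S.decoupled K N (e t) (ξ t) 0 0 = e t 0 0 - k ⬝ᵥ ξ t := by
  simp [decoupled, bar_zero, hN.init]

theorem IsSolution.decoupled_zero_one {e : ℝ → ℝ → Fin 2 → ℝ} {ξ : ℝ → Fin n → ℝ} {u : ℝ → ℝ}
    (h : S.IsSolution e ξ u) (hN : S.IsDecoupling k K N) {t : ℝ} (ht : 0 < t) :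
    S.decoupled K N (e t) (ξ t) 0 1 = S.q0 * S.decoupled K N (e t) (ξ t) 0 0 := by
  rw [IsSolution.decoupled_zero_zero hN]
  simp [decoupled, bar_zero, hN.init, h.bc0 t ht, add_dotProduct]
  ring

theorem target_zero (w : ℝ → Fin 2 → ℝ) (ξ : Fin n → ℝ) :
    S.target K P N w ξ 0 = S.decoupled K N w ξ 0 := by
  ext i
  simp [target, volterraTransform]

theorem IsPreKernel.bddMeasOn_C (i : Fin 2) (hK : S.IsPreKernel K) (m : Fin n) :
    BddMeasOn (fun z => S.C K z i m) (Icc 0 1) := by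
  simp only [C, vecMulVec_apply, mulVec_two, Matrix.mul_apply]
  refine BddMeasOn.mul (BddMeasOn.sum _ fun j _ => BddMeasOn.mul (BddMeasOn.sum _ fun l _ =>
    BddMeasOn.mul (hK.transport.bddMeasOn_zero i l) (BddMeasOn.const _)) (BddMeasOn.const _))
    (BddMeasOn.const _)

/-- The preliminary transformation removes the couplings in the PDE. -/
theorem IsSolution.isTransported_bar {e : ℝ → ℝ → Fin 2 → ℝ} {ξ : ℝ → Fin n → ℝ} {u : ℝ → ℝ}
    (h : S.IsSolution e ξ u) (hq0 : S.q0 ≠ 0) (hK : S.IsPreKernel K) :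
    S.IsTransported (fun t => S.bar K (e t)) fun t z => S.C K z *ᵥ ξ t := by
  have hz : ∀ i : Fin 2, IsLocBdd fun _ _ => (0 : Fin 2 → ℝ) i := fun i => IsLocBdd.zero
  have h1 := h.isTransported.tilde
  have h2 : S.IsTransported (fun t => S.tilde (e t))
      fun t z => S.Atilde z *ᵥ S.tilde (e t) z + (fun _ _ => 0 : ℝ → ℝ → Fin 2 → ℝ) t z := by
    simpa using h1
  refine (h2.volterra hK.transport bddMeasOn_Atilde hz).congr (fun t ht z hz => rfl) ?_ ?_
  · intro t ht z hz
    have hl0 := S.lam_pos 0 z hz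
    have hl1 := S.lam_pos 1 z hz
    have p0 := S.lam_pos 0 0 zero_mem_Icc
    have p1 := S.lam_pos 1 0 zero_mem_Icc
    have b0 : S.tilde (e t) 0 0 = e t 0 0 := by simp [tilde_apply, alpha]
    have b1 : S.tilde (e t) 0 1 = S.q0 * e t 0 0 + S.c ⬝ᵥ ξ t := by
      simp [tilde_apply, alpha, h.bc0 t ht]
    have k11 := hK.bc11 z hz
    have k12 := hK.bc12 z hz
    have k21 := hK.bc21 z hz
    have k22 := hK.bc22 z hz
    have a00 : S.Atilde z 0 0 = 0 := rfl
    have a11 : S.Atilde z 1 1 = 0 := rfl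
    ext i
    have hC : (S.C K z *ᵥ ξ t) i = ((K z 0 * S.Lam 0) *ᵥ ![0, 1]) i * (S.c ⬝ᵥ ξ t) := by
      rw [C, Matrix.vecMulVec_mulVec]
      simp [mul_comm]
    have hK0 : ∫ ζ in (0 : ℝ)..z, (K z ζ *ᵥ (0 : Fin 2 → ℝ)) i = 0 := by
      have : ∀ ζ, (K z ζ *ᵥ (0 : Fin 2 → ℝ)) i = 0 := fun ζ =>
        congrFun (Matrix.mulVec_zero (K z ζ)) i
      simp only [this, intervalIntegral.integral_zero]
    rw [hC, hK0]
    simp only [Pi.zero_apply, sub_zero, add_zero, Lam, mulVec_two, Matrix.sub_apply, Matrix.mul_diagonal, Matrix.diagonal_mul,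
      Fin.sum_univ_two, b0, b1, charSign, cons_val_zero, cons_val_one]
    fin_cases i
    · simp only [Fin.zero_eta, a00, k11, k12, cons_val_zero]
      field_simp
      ring
    · simp only [Fin.mk_one, a11, k21, k22, cons_val_one, cons_val_zero]
      field_simp
      ring
  · intro i
    exact IsLocBdd.sum Finset.univ fun m _ => (IsLocBdd.of_space (hK.bddMeasOn_C i m)).mul
      (IsLocBdd.of_time fun T => h.bddMeasOn_ode T m)

theorem IsDecoupling.isBddPrimitive_char (hK : S.IsPreKernel K) (hN : S.IsDecoupling k K N)
    {i : Fin 2} (m : Fin n) {c t₀ t₁ : ℝ} (h0 : S.char i c t₀ ∈ Icc (0 : ℝ) 1)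
    (h1 : S.char i c t₁ ∈ Icc (0 : ℝ) 1) :
    IsBddPrimitive (fun t => N (S.char i c t) i m) (fun t =>
      -(N (S.char i c t) * (S.F + vecMulVec S.b k) - S.C K (S.char i c t)) i m) t₀ t₁ := by
  have hG : BddMeasOn (fun z => (N z * (S.F + vecMulVec S.b k) - S.C K z) i m) (Icc 0 1) := by
    simp only [Matrix.sub_apply, Matrix.mul_apply]
    exact (BddMeasOn.sum _ fun l _ => (hN.bddMeasOn i l).mul (BddMeasOn.const _)).sub
      (hK.bddMeasOn_C i m)
  refine BddMeasOn.isBddPrimitive ((hG.comp (S.measurable_char i c) fun t ht =>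
    S.char_mem_Icc i h0 h1 (Icc_subset_uIcc ht)).neg) fun t ht => ?_
  have ht' := S.char_mem_Icc i h0 h1 (Icc_subset_uIcc ht)
  have e := S.integral_pde_eq i (fun _ z => (N z * (S.F + vecMulVec S.b k) - S.C K z) i m)
    (t₀ := t₀) (t₁ := t) h0 ht' (by
    rw [S.phi_eq_travel i h0, S.phi_eq_travel i ht', travel_char, travel_char]
    linear_combination (t₀ - t) * charSign_mul_self i)
  rw [label_char] at e
  have hinv : (charSign i)⁻¹ = charSign i := by
    rcases charSign_cases i with h | h <;> rw [h] <;> norm_num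
  have hp : IsBddPrimitive (fun z => N z i m) (fun z => charSign i *
      ((N z * (S.F + vecMulVec S.b k) - S.C K z) i m / S.lam i z)) 0 1 := by
    refine ((bddMeasOn_div_lam hG i).const_mul _).isBddPrimitive fun z hz => ?_
    rw [hN.ode z hz i m]
    congr 1
    refine intervalIntegral.integral_congr fun ζ _ => ?_
    simp only [mul_inv, hinv, div_eq_mul_inv]
    ring
  rw [intervalIntegral.integral_neg, ← e, ← intervalIntegral.integral_const_mul,
    ← hp.sub_eq h0 ht']
  ring

theorem IsSolution.isTransported_decoupled {e : ℝ → ℝ → Fin 2 → ℝ} {ξ : ℝ → Fin n → ℝ} {u : ℝ → ℝ}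
    (h : S.IsSolution e ξ u) (hq0 : S.q0 ≠ 0) (hK : S.IsPreKernel K) (hN : S.IsDecoupling k K N) :
    S.IsTransported (fun t => S.decoupled K N (e t) (ξ t))
      fun t z => -(S.decoupled K N (e t) (ξ t) 0 0) • (N z *ᵥ S.b) := by
  have hb := h.isTransported_bar hq0 hK
  have hdec : ∀ i, IsLocBdd fun t z => S.decoupled K N (e t) (ξ t) z i := fun i =>
    (hb.bdd i).sub (IsLocBdd.sum Finset.univ fun m _ => (IsLocBdd.of_space (hN.bddMeasOn i m)).mul
      (IsLocBdd.of_time fun T => h.bddMeasOn_ode T m))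
  refine ⟨hdec, fun i => ?_, ?_⟩
  · exact (IsLocBdd.of_time ((hdec 0).trace zero_mem_Icc)).neg.mul
      (IsLocBdd.of_space (hN.bddMeasOn_mulVec S.b i))
  intro i c t₀ t₁ h0 ht hz0 hz1
  have p1 := hb.isBddPrimitive h0 hz0 hz1
  have pξ : ∀ m, IsBddPrimitive (fun t => ξ t m) (fun t => (S.F *ᵥ ξ t + e t 0 0 • S.b) m) t₀ t₁ := by
    intro m
    have hp := h.isBddPrimitive_ode m t₁
    refine BddMeasOn.isBddPrimitive ((bddMeasOn_ode_rhs h.isTransported.bdd h.bddMeasOn_ode t₁ m).mono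
      (Icc_subset_Icc_left h0)) fun t ht' => ?_
    have := hp.sub_eq (s := t₀) (t := t) ⟨h0, ht⟩ ⟨h0.trans ht'.1, ht'.2⟩
    linarith
  have p2 := IsBddPrimitive.sum Finset.univ fun m _ =>
    (hN.isBddPrimitive_char hK m hz0 hz1).mul (pξ m)
  have key := (p1.add (p2.const_mul (-1))).eq t₁ (right_mem_Icc.2 ht)
  have hd : ∀ t z, S.decoupled K N (e t) (ξ t) z i =
      S.bar K (e t) z i + -1 * ∑ m, N z i m * ξ t m := fun t z => by
    rw [decoupled, Pi.sub_apply, sub_eq_add_neg, neg_one_mul]; rfl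
  rw [hd, hd, key]
  congr 1
  refine intervalIntegral.integral_congr fun t _ => ?_
  simp only [IsSolution.decoupled_zero_zero hN]
  generalize S.char i c t = z
  have e1 : ∑ m, (-(N z * (S.F + vecMulVec S.b k) - S.C K z) i m * ξ t m +
      N z i m * (S.F *ᵥ ξ t + e t 0 0 • S.b) m) =
      -((N z * (S.F + vecMulVec S.b k) - S.C K z) *ᵥ ξ t) i +
        (N z *ᵥ (S.F *ᵥ ξ t + e t 0 0 • S.b)) i := by
    rw [Finset.sum_add_distrib]
    simp only [neg_mul, Finset.sum_neg_distrib]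
    rfl
  rw [e1]
  simp only [Matrix.sub_mulVec, Matrix.mulVec_add, Matrix.mulVec_smul, ← Matrix.mulVec_mulVec,
    Matrix.add_mulVec, Matrix.vecMulVec_mulVec, Pi.add_apply, Pi.sub_apply, Pi.smul_apply,
    smul_eq_mul, op_smul_eq_smul]
  ring

/-- The state of the target system is constant along the characteristics. -/
theorem IsSolution.isTransported_target {e : ℝ → ℝ → Fin 2 → ℝ} {ξ : ℝ → Fin n → ℝ} {u : ℝ → ℝ}
    (h : S.IsSolution e ξ u) (hq0 : S.q0 ≠ 0) (hK : S.IsPreKernel K) (hN : S.IsDecoupling k K N)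
    (hP : S.IsBacksteppingKernel N P) :
    S.IsTransported (fun t => S.target K P N (e t) (ξ t)) fun _ _ => 0 := by
  have hd := h.isTransported_decoupled hq0 hK hN
  have h2 : S.IsTransported (fun t => S.decoupled K N (e t) (ξ t))
      fun t z => (0 : ℝ → Matrix (Fin 2) (Fin 2) ℝ) z *ᵥ S.decoupled K N (e t) (ξ t) z +
        -(S.decoupled K N (e t) (ξ t) 0 0) • (N z *ᵥ S.b) := by
    simpa using hd
  refine (h2.volterra hP.transport (fun i j => BddMeasOn.const 0) hd.bdd_source).congr
    (fun t ht z hz => rfl) ?_ fun i => IsLocBdd.zero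
  intro t ht z hz
  ext i
  have b1 := h.decoupled_zero_one hN ht
  rw [hP.bc_diag z hz]
  have e1 : ((P z 0 * S.Lam 0) *ᵥ S.decoupled K N (e t) (ξ t) 0) i =
      S.decoupled K N (e t) (ξ t) 0 0 * ((P z 0 * S.Lam 0) *ᵥ ![1, S.q0]) i := by
    have : S.decoupled K N (e t) (ξ t) 0 = S.decoupled K N (e t) (ξ t) 0 0 • ![1, S.q0] := by
      ext j
      fin_cases j
      · simp
      · simp [b1, mul_comm]
    conv_lhs => rw [this]
    rw [Matrix.mulVec_smul]; rfl
  have e2 : ∫ ζ in (0 : ℝ)..z, (P z ζ *ᵥ -(S.decoupled K N (e t) (ξ t) 0 0) • (N ζ *ᵥ S.b)) i =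
      -(S.decoupled K N (e t) (ξ t) 0 0) * ∫ ζ in (0 : ℝ)..z, ((P z ζ * N ζ) *ᵥ S.b) i := by
    rw [← intervalIntegral.integral_const_mul]
    refine intervalIntegral.integral_congr fun ζ _ => ?_
    simp only [Matrix.mulVec_smul, Matrix.mulVec_mulVec, Pi.smul_apply, smul_eq_mul]
  rw [e1, e2]
  simp only [Pi.zero_apply, Matrix.zero_mulVec, Pi.smul_apply, smul_eq_mul]
  linear_combination (-(S.decoupled K N (e t) (ξ t) 0 0)) * hP.bc_zero z hz i

end

end HyperbolicPDEODE

namespace HyperbolicPDEODE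

variable {n : ℕ} {S : HyperbolicPDEODE n}

/-! ### Decay in the target system -/

variable (S) in
/-- Solutions of the target system. -/
structure IsTargetSolution (qcl : ℝ) (v : ℝ → ℝ → Fin 2 → ℝ) : Prop where
  transported : S.IsTransported v fun _ _ => 0
  bc0 : ∀ t, 0 < t → v t 0 1 = S.q0 * v t 0 0
  bc1 : ∀ t, 0 < t → v t 1 0 = qcl * v t 1 1

variable (S) in
/-- The time a signal needs for a round trip. -/
def loopTime : ℝ := S.travel 0 1 + S.travel 1 1

theorem travel_one_pos (i : Fin 2) : 0 < S.travel i 1 := by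
  simpa using S.strictMono_travel i zero_lt_one

theorem loopTime_pos : 0 < S.loopTime := add_pos (travel_one_pos 0) (travel_one_pos 1)

variable (S) in
/-- The scalar signal that determines a solution of the target system. -/
def signal (v : ℝ → ℝ → Fin 2 → ℝ) (τ : ℝ) : ℝ :=
  if 0 ≤ τ then S.q0 * v τ 0 0 else v 0 (S.place 1 (-τ)) 1

variable (S) in
/-- The exponentially weighted signal. -/
def weightedSignal (μ : ℝ) (v : ℝ → ℝ → Fin 2 → ℝ) (τ : ℝ) : ℝ :=
  Real.exp (μ * τ) * |S.signal v τ|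

namespace IsTargetSolution

variable {qcl μ : ℝ} {v : ℝ → ℝ → Fin 2 → ℝ}

theorem eq_of_label (h : S.IsTargetSolution qcl v) {i : Fin 2} {t t' z z' : ℝ} (ht : 0 ≤ t)
    (ht' : 0 ≤ t') (hz : z ∈ Icc (0 : ℝ) 1) (hz' : z' ∈ Icc (0 : ℝ) 1)
    (hl : S.label i t z = S.label i t' z') : v t z i = v t' z' i := by
  have e0 := S.char_label i t z
  have e1 := S.char_label i t' z'
  rw [← hl] at e1
  have key : ∀ {t t' z z' : ℝ}, 0 ≤ t → t ≤ t' → z ∈ Icc (0 : ℝ) 1 → z' ∈ Icc (0 : ℝ) 1 →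
      S.char i (S.label i t z) t' = z' → v t' z' i = v t z i := by
    intro t t' z z' ht htt hz hz' e
    have := h.transported.along i (S.label i t z) t t' ht htt (by rwa [char_label]) (by rwa [e])
    simpa [e] using this
  rcases le_total t t' with htt | htt
  · exact (key ht htt hz hz' e1).symm
  · exact key ht' htt hz' hz (by rw [← hl, e0])

theorem apply_zero (h : S.IsTargetSolution qcl v) {t z : ℝ} (ht : 0 ≤ t) (hz : z ∈ Icc (0 : ℝ) 1) :
    v t z 0 = v (t + S.travel 0 z) 0 0 := by
  have := S.travel_nonneg 0 hz.1
  refine h.eq_of_label ht (by linarith) hz zero_mem_Icc ?_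
  simp [label, charSign]; ring

theorem q0_mul_apply_zero (h : S.IsTargetSolution qcl v) {t z : ℝ} (ht : 0 ≤ t)
    (hz : z ∈ Icc (0 : ℝ) 1) : S.q0 * v t z 0 = S.signal v (t + S.travel 0 z) := by
  have := S.travel_nonneg 0 hz.1
  rw [h.apply_zero ht hz, signal, if_pos (by linarith)]

theorem apply_one (h : S.IsTargetSolution qcl v) {t z : ℝ} (ht : 0 ≤ t) (hz : z ∈ Icc (0 : ℝ) 1)
    (hne : t ≠ S.travel 1 z) : v t z 1 = S.signal v (t - S.travel 1 z) := by
  have h0 := S.travel_nonneg 1 hz.1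
  rcases lt_or_gt_of_ne hne with hlt | hgt
  · rw [signal, if_neg (by linarith)]
    have hp : S.place 1 (-(t - S.travel 1 z)) ∈ Icc (0 : ℝ) 1 := by
      rw [place_mem_Icc]
      exact ⟨by linarith, by linarith [(S.travel_mem_Icc (i := 1) hz).2]⟩
    refine h.eq_of_label ht le_rfl hz hp ?_
    simp [label, charSign]; ring
  · rw [signal, if_pos (by linarith), ← h.bc0 _ (by linarith)]
    refine h.eq_of_label ht (by linarith) hz zero_mem_Icc ?_
    simp [label, charSign]; ring

theorem apply_one_of_eq (h : S.IsTargetSolution qcl v) {z : ℝ} (hz : z ∈ Icc (0 : ℝ) 1) :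
    v (S.travel 1 z) z 1 = v 0 0 1 := by
  refine h.eq_of_label (S.travel_nonneg 1 hz.1) le_rfl hz zero_mem_Icc ?_
  simp [label, charSign]

theorem signal_eq (h : S.IsTargetSolution qcl v) {τ : ℝ} (hτ : S.travel 0 1 < τ) :
    S.signal v τ = S.q0 * qcl * v (τ - S.travel 0 1) 1 1 := by
  have e := h.q0_mul_apply_zero (t := τ - S.travel 0 1) (by linarith) one_mem_Icc
  rw [sub_add_cancel, h.bc1 _ (by linarith)] at e
  rw [← e]; ring

theorem signal_loop (h : S.IsTargetSolution qcl v) {τ : ℝ} (hτ : S.travel 0 1 < τ)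
    (hne : τ ≠ S.loopTime) : S.signal v τ = S.q0 * qcl * S.signal v (τ - S.loopTime) := by
  rw [h.signal_eq hτ, h.apply_one (by linarith) one_mem_Icc (fun h' => hne (by
    rw [loopTime]; linarith)), loopTime]
  congr 2; ring

theorem abs_le_of_bound (h : S.IsTargetSolution qcl v) (hμ : 0 < μ)
    (hρ : |S.q0 * qcl| * Real.exp (μ * S.loopTime) ≤ 1) {B : ℝ}
    (hB : ∀ z ∈ Icc (0 : ℝ) 1, ∀ i, |v 0 z i| ≤ B) :
    ∀ τ, -S.travel 1 1 ≤ τ →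
      S.weightedSignal μ v τ ≤ Real.exp (μ * S.loopTime) * (1 + |S.q0|) * B := by
  have hB0 : 0 ≤ B := (abs_nonneg _).trans (hB 0 zero_mem_Icc 0)
  have l0 := travel_one_pos (S := S) 0
  have l1 := travel_one_pos (S := S) 1
  have hL : S.loopTime = S.travel 0 1 + S.travel 1 1 := rfl
  have hLe : 1 ≤ Real.exp (μ * S.loopTime) := Real.one_le_exp (by rw [hL]; positivity)
  have hq := abs_nonneg S.q0
  have key : ∀ m : ℕ, ∀ τ, -S.travel 1 1 ≤ τ → τ ≤ S.travel 0 1 + m * S.loopTime →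
      S.weightedSignal μ v τ ≤ Real.exp (μ * S.loopTime) * (1 + |S.q0|) * B := by
    intro m
    induction m with
    | zero =>
      intro τ h1 h2
      simp only [Nat.cast_zero, zero_mul, add_zero] at h2
      rw [weightedSignal, mul_assoc]
      refine mul_le_mul (Real.exp_le_exp.2 (mul_le_mul_of_nonneg_left (by rw [hL]; linarith) hμ.le))
        ?_ (abs_nonneg _) (Real.exp_pos _).le
      rcases le_or_gt 0 τ with hτ | hτ
      · have hp : S.place 0 τ ∈ Icc (0 : ℝ) 1 := S.place_mem_Icc.2 ⟨hτ, h2⟩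
        have e := h.q0_mul_apply_zero (t := 0) le_rfl hp
        rw [travel_place, zero_add] at e
        rw [← e, abs_mul]
        have := mul_le_mul_of_nonneg_left (hB _ hp 0) hq
        nlinarith
      · rw [signal, if_neg (not_le.2 hτ)]
        have := hB _ (S.place_mem_Icc (i := 1).2 (⟨by linarith, by linarith⟩ : -τ ∈ Icc 0 (S.travel 1 1))) 1
        nlinarith [mul_nonneg hq hB0]
    | succ m ih =>
      intro τ h1 h2
      rcases le_or_gt τ (S.travel 0 1) with hτ | hτ
      · exact ih τ h1 (hτ.trans (by
          have := loopTime_pos (S := S); linarith [mul_nonneg (Nat.cast_nonneg (α := ℝ) m) this.le]))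
      · by_cases hne : τ = S.loopTime
        · rw [weightedSignal, h.signal_eq hτ, abs_mul, ← mul_assoc, mul_comm (Real.exp _), hne]
          have e : v (S.loopTime - S.travel 0 1) 1 1 = v 0 0 1 := by
            rw [hL, add_sub_cancel_left]; exact h.apply_one_of_eq one_mem_Icc
          rw [e]
          calc _ ≤ 1 * B := mul_le_mul hρ (hB 0 zero_mem_Icc 1) (abs_nonneg _) zero_le_one
            _ ≤ _ := by gcongr; nlinarith
        · have hi := ih (τ - S.loopTime) (by rw [hL]; linarith) (by
            push_cast at h2; linarith)
          refine le_trans ?_ hi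
          rw [weightedSignal, weightedSignal, h.signal_loop hτ hne, abs_mul]
          have e : Real.exp (μ * τ) = Real.exp (μ * S.loopTime) * Real.exp (μ * (τ - S.loopTime)) := by
            rw [← Real.exp_add]; congr 1; ring
          rw [e]
          calc _ = (|S.q0 * qcl| * Real.exp (μ * S.loopTime)) *
              (Real.exp (μ * (τ - S.loopTime)) * |S.signal v (τ - S.loopTime)|) := by ring
            _ ≤ 1 * (Real.exp (μ * (τ - S.loopTime)) * |S.signal v (τ - S.loopTime)|) := by
              gcongr
            _ = _ := one_mul _
  intro τ hτ
  obtain ⟨m, hm⟩ := exists_nat_ge ((τ - S.travel 0 1) / S.loopTime)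
  rw [div_le_iff₀ loopTime_pos] at hm
  exact key m τ hτ (by linarith)

theorem weightedSignal_loop (h : S.IsTargetSolution qcl v)
    (hρ : |S.q0 * qcl| * Real.exp (μ * S.loopTime) ≤ 1) {τ : ℝ} (hτ : S.travel 0 1 < τ)
    (hne : τ ≠ S.loopTime) : S.weightedSignal μ v τ ≤ S.weightedSignal μ v (τ - S.loopTime) := by
  rw [weightedSignal, weightedSignal, h.signal_loop hτ hne, abs_mul]
  have e : Real.exp (μ * τ) = Real.exp (μ * S.loopTime) * Real.exp (μ * (τ - S.loopTime)) := by
    rw [← Real.exp_add]; congr 1; ring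
  rw [e]
  calc _ = (|S.q0 * qcl| * Real.exp (μ * S.loopTime)) *
      (Real.exp (μ * (τ - S.loopTime)) * |S.signal v (τ - S.loopTime)|) := by ring
    _ ≤ 1 * (Real.exp (μ * (τ - S.loopTime)) * |S.signal v (τ - S.loopTime)|) := by
      gcongr
    _ = _ := one_mul _

theorem weightedSignal_nonneg (τ : ℝ) : 0 ≤ S.weightedSignal μ v τ := by
  rw [weightedSignal]; positivity

theorem bddMeasOn_signal (h : S.IsTargetSolution qcl v) (T : ℝ) :
    BddMeasOn (S.signal v) (Icc (-S.travel 1 1) T) := by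
  have h1 : BddMeasOn (fun τ => S.q0 * v τ 0 0) (Icc 0 T) :=
    ((h.transported.bdd 0).trace zero_mem_Icc T).const_mul _
  have h2 : BddMeasOn (fun τ => v 0 (S.place 1 (-τ)) 1) (Icc (-S.travel 1 1) 0) :=
    ((h.transported.bdd 1).slice le_rfl).comp
      ((S.continuous_place 1).comp continuous_neg).measurable fun τ hτ =>
        S.place_mem_Icc.2 ⟨by linarith [hτ.2], by linarith [hτ.1]⟩
  obtain ⟨m1, C1, b1⟩ := h1.indicator measurableSet_Icc
  obtain ⟨m2, C2, b2⟩ := h2.indicator measurableSet_Icc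
  refine BddMeasOn.congr (f := fun τ => if 0 ≤ τ then (Icc 0 T).indicator (fun τ => S.q0 * v τ 0 0) τ
    else (Icc (-S.travel 1 1) 0).indicator (fun τ => v 0 (S.place 1 (-τ)) 1) τ) ?_ ?_
  · refine BddMeasOn.of_measurable (Measurable.ite measurableSet_Ici m1 m2) ⟨max C1 C2, fun τ _ => ?_⟩
    split_ifs
    · exact (b1 τ).trans (le_max_left _ _)
    · exact (b2 τ).trans (le_max_right _ _)
  · intro τ hτ
    rw [signal]
    split_ifs with h0
    · exact (indicator_of_mem (show τ ∈ Icc 0 T from ⟨h0, hτ.2⟩) fun τ => S.q0 * v τ 0 0).symm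
    · exact (indicator_of_mem (show τ ∈ Icc (-S.travel 1 1) 0 from ⟨hτ.1, (not_le.1 h0).le⟩)
        fun τ => v 0 (S.place 1 (-τ)) 1).symm

theorem bddMeasOn_weightedSignal (h : S.IsTargetSolution qcl v) (T : ℝ) :
    BddMeasOn (S.weightedSignal μ v) (Icc (-S.travel 1 1) T) :=
  (BddMeasOn.of_continuousOn (by fun_prop) isCompact_Icc).mul (h.bddMeasOn_signal T).abs

theorem _root_.BddMeasOn.pow {α : Type*} [MeasurableSpace α] {f : α → ℝ} {s : Set α}
    (hf : BddMeasOn f s) (p : ℕ) : BddMeasOn (fun x => f x ^ p) s := by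
  induction p with
  | zero => simpa using BddMeasOn.const 1
  | succ p ih => simpa only [pow_succ] using ih.mul hf

theorem intervalIntegrable_weightedSignal (h : S.IsTargetSolution qcl v) (p : ℕ) {a b : ℝ}
    (ha : -S.travel 1 1 ≤ a) (hb : -S.travel 1 1 ≤ b) :
    IntervalIntegrable (fun τ => S.weightedSignal μ v τ ^ p) volume a b := by
  refine ((h.bddMeasOn_weightedSignal (μ := μ) (max a b)).pow p).intervalIntegrable ?_
  exact uIcc_subset_Icc' ⟨ha, le_max_left _ _⟩ ⟨hb, le_max_right _ _⟩

theorem integral_window_le (h : S.IsTargetSolution qcl v)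
    (hρ : |S.q0 * qcl| * Real.exp (μ * S.loopTime) ≤ 1) (p : ℕ) {t : ℝ} (ht : 0 ≤ t) :
    ∫ τ in (-S.travel 1 1 + t)..(S.travel 0 1 + t), S.weightedSignal μ v τ ^ p ≤
      ∫ τ in (-S.travel 1 1)..S.travel 0 1, S.weightedSignal μ v τ ^ p := by
  have l0 := travel_one_pos (S := S) 0
  have l1 := travel_one_pos (S := S) 1
  have hi : ∀ {a b}, -S.travel 1 1 ≤ a → -S.travel 1 1 ≤ b →
    IntervalIntegrable (fun τ => S.weightedSignal μ v τ ^ p) volume a b := fun ha hb =>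
      h.intervalIntegrable_weightedSignal p ha hb
  have e1 : ∫ τ in (-S.travel 1 1 + t)..(S.travel 0 1 + t), S.weightedSignal μ v τ ^ p =
      (∫ τ in (-S.travel 1 1)..S.travel 0 1, S.weightedSignal μ v τ ^ p) +
      (∫ τ in S.travel 0 1..(S.travel 0 1 + t), S.weightedSignal μ v τ ^ p) -
      ∫ τ in (-S.travel 1 1)..(-S.travel 1 1 + t), S.weightedSignal μ v τ ^ p := by
    have a1 := intervalIntegral.integral_add_adjacent_intervals
      (hi (a := -S.travel 1 1) (b := S.travel 0 1) (by linarith) (by linarith))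
      (hi (b := S.travel 0 1 + t) (by linarith) (by linarith))
    have a2 := intervalIntegral.integral_add_adjacent_intervals
      (hi (a := -S.travel 1 1) (b := -S.travel 1 1 + t) (by linarith) (by linarith))
      (hi (b := S.travel 0 1 + t) (by linarith) (by linarith))
    linarith
  have e2 : ∫ τ in (-S.travel 1 1)..(-S.travel 1 1 + t), S.weightedSignal μ v τ ^ p =
      ∫ τ in S.travel 0 1..(S.travel 0 1 + t), S.weightedSignal μ v (τ - S.loopTime) ^ p := by
    rw [intervalIntegral.integral_comp_sub_right (fun τ => S.weightedSignal μ v τ ^ p), loopTime]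
    congr 1 <;> ring
  have hi2 : IntervalIntegrable (fun τ => S.weightedSignal μ v (τ - S.loopTime) ^ p) volume
      (S.travel 0 1) (S.travel 0 1 + t) := by
    have := (hi (a := S.travel 0 1 - S.loopTime) (b := S.travel 0 1 + t - S.loopTime)
      (by rw [loopTime]; linarith) (by rw [loopTime]; linarith)).comp_sub_right S.loopTime
    simpa using this
  have e3 : ∫ τ in S.travel 0 1..(S.travel 0 1 + t), S.weightedSignal μ v τ ^ p ≤
      ∫ τ in S.travel 0 1..(S.travel 0 1 + t), S.weightedSignal μ v (τ - S.loopTime) ^ p := by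
    refine intervalIntegral.integral_mono_ae_restrict (by linarith)
      (hi (by linarith) (by linarith)) hi2 ?_
    have hne := measure_eq_zero_iff_ae_notMem.1 (Real.volume_singleton (a := S.travel 0 1))
    have hne' := measure_eq_zero_iff_ae_notMem.1 (Real.volume_singleton (a := S.loopTime))
    filter_upwards [ae_restrict_of_ae hne, ae_restrict_of_ae hne', ae_restrict_mem measurableSet_Icc]
      with τ h1 h2 h3
    exact pow_le_pow_left₀ (weightedSignal_nonneg _) (h.weightedSignal_loop hρ
      (lt_of_le_of_ne h3.1 fun h' => h1 h'.symm) fun h' => h2 h') p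
  linarith

/-- Integrals over `[0,1]` are controlled by integrals over travel times. -/
theorem _root_.HyperbolicPDEODE.integral_comp_travel_le {M : ℝ} (hM : ∀ i z, S.speed i z ≤ M)
    (i : Fin 2) {f : ℝ → ℝ} (hf : ∀ s ∈ Icc 0 (S.travel i 1), 0 ≤ f s)
    (hfi : BddMeasOn f (Icc 0 (S.travel i 1))) :
    ∫ z in (0 : ℝ)..1, f (S.travel i z) ≤ M * ∫ s in (0 : ℝ)..S.travel i 1, f s := by
  have hc : BddMeasOn (fun z => f (S.travel i z)) (Icc 0 1) :=
    hfi.comp (S.continuous_travel i).measurable fun z hz => S.travel_mem_Icc hz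
  have h1 := S.integral_comp_travel i f 0 1
  rw [travel_zero] at h1
  rw [← h1, ← intervalIntegral.integral_const_mul]
  refine intervalIntegral.integral_mono_on zero_le_one
    (hc.intervalIntegrable (uIcc_of_le zero_le_one).le)
    ((((hc.mul (BddMeasOn.of_continuousOn (S.continuous_inv_speed i).continuousOn
      isCompact_Icc)).const_mul M)).intervalIntegrable (uIcc_of_le zero_le_one).le) fun z hz => ?_
  have p := S.speed_pos i z
  have p2 := hf _ (S.travel_mem_Icc (i := i) hz)
  rw [mul_comm, mul_assoc]
  refine le_mul_of_one_le_right p2 ?_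
  rw [inv_mul_eq_div, one_le_div p]
  exact hM i z

theorem _root_.HyperbolicPDEODE.integral_le_comp_travel {m : ℝ} (hm0 : 0 < m)
    (hm : ∀ i z, m ≤ S.speed i z) (i : Fin 2) {f : ℝ → ℝ}
    (hf : ∀ s ∈ Icc 0 (S.travel i 1), 0 ≤ f s) (hfi : BddMeasOn f (Icc 0 (S.travel i 1))) :
    ∫ s in (0 : ℝ)..S.travel i 1, f s ≤ m⁻¹ * ∫ z in (0 : ℝ)..1, f (S.travel i z) := by
  have hc : BddMeasOn (fun z => f (S.travel i z)) (Icc 0 1) :=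
    hfi.comp (S.continuous_travel i).measurable fun z hz => S.travel_mem_Icc hz
  have h1 := S.integral_comp_travel i f 0 1
  rw [travel_zero] at h1
  rw [← h1, ← intervalIntegral.integral_const_mul]
  refine intervalIntegral.integral_mono_on zero_le_one
    ((hc.mul (BddMeasOn.of_continuousOn (S.continuous_inv_speed i).continuousOn
      isCompact_Icc)).intervalIntegrable (uIcc_of_le zero_le_one).le)
    ((hc.const_mul _).intervalIntegrable (uIcc_of_le zero_le_one).le) fun z hz => ?_
  have p2 := hf _ (S.travel_mem_Icc (i := i) hz)
  rw [mul_comm]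
  exact mul_le_mul_of_nonneg_right (inv_anti₀ hm0 (hm i z)) p2

/-- The signal over one round trip is controlled by the initial state. -/
theorem integral_weightedSignal_le (h : S.IsTargetSolution qcl v) (hμ : 0 < μ) {m : ℝ} (hm0 : 0 < m)
    (hm : ∀ i z, m ≤ S.speed i z) (p : ℕ) :
    ∫ τ in (-S.travel 1 1)..S.travel 0 1, S.weightedSignal μ v τ ^ p ≤
      (Real.exp (μ * S.loopTime) * (1 + |S.q0|)) ^ p * m⁻¹ *
        ((∫ z in (0 : ℝ)..1, |v 0 z 0| ^ p) + ∫ z in (0 : ℝ)..1, |v 0 z 1| ^ p) := by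
  have l0 := travel_one_pos (S := S) 0
  have l1 := travel_one_pos (S := S) 1
  have hq := abs_nonneg S.q0
  set C := Real.exp (μ * S.loopTime) * (1 + |S.q0|) with hC
  have hCn : 0 ≤ C := by positivity
  have hexp : ∀ τ, τ ≤ S.travel 0 1 → Real.exp (μ * τ) ≤ Real.exp (μ * S.loopTime) := fun τ hτ =>
    Real.exp_le_exp.2 (mul_le_mul_of_nonneg_left (by rw [loopTime]; linarith) hμ.le)
  have hpl : ∀ i : Fin 2, BddMeasOn (fun τ => |v 0 (S.place i τ) i| ^ p) (Icc 0 (S.travel i 1)) :=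
    fun i => (((h.transported.bdd i).slice le_rfl).comp (S.continuous_place i).measurable
      fun τ hτ => S.place_mem_Icc.2 hτ).abs.pow p
  rw [← intervalIntegral.integral_add_adjacent_intervals
    (h.intervalIntegrable_weightedSignal p (b := 0) le_rfl (by linarith))
    (h.intervalIntegrable_weightedSignal p (by linarith) (by linarith))]
  have e1 : ∫ τ in (-S.travel 1 1)..0, S.weightedSignal μ v τ ^ p ≤
      C ^ p * ∫ τ in (0 : ℝ)..S.travel 1 1, |v 0 (S.place 1 τ) 1| ^ p := by
    have e : ∫ τ in (0 : ℝ)..S.travel 1 1, |v 0 (S.place 1 τ) 1| ^ p =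
        ∫ τ in (-S.travel 1 1)..0, |v 0 (S.place 1 (-τ)) 1| ^ p := by
      rw [intervalIntegral.integral_comp_neg (fun τ => |v 0 (S.place 1 τ) 1| ^ p)]
      simp
    rw [e, ← intervalIntegral.integral_const_mul]
    refine intervalIntegral.integral_mono_ae_restrict (by linarith)
      (h.intervalIntegrable_weightedSignal p le_rfl (by linarith)) ?_ ?_
    · refine (((hpl 1).comp (h := fun τ => -τ) (t := Icc (-S.travel 1 1) 0) measurable_neg
        fun τ hτ => ⟨?_, ?_⟩).const_mul (C ^ p)).intervalIntegrable (uIcc_of_le (by linarith)).le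
      · linarith [hτ.2]
      · linarith [hτ.1]
    · have hne := measure_eq_zero_iff_ae_notMem.1 (Real.volume_singleton (a := (0 : ℝ)))
      filter_upwards [ae_restrict_of_ae hne, ae_restrict_mem measurableSet_Icc] with τ h1 h2
      have hτ : τ < 0 := lt_of_le_of_ne h2.2 h1
      rw [← mul_pow, weightedSignal, signal, if_neg (not_le.2 hτ)]
      refine pow_le_pow_left₀ (by positivity) (mul_le_mul_of_nonneg_right ?_ (abs_nonneg _)) p
      calc Real.exp (μ * τ) ≤ Real.exp (μ * S.loopTime) := hexp τ (by linarith)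
        _ ≤ C := le_mul_of_one_le_right (Real.exp_pos _).le (by linarith)
  have e2 : ∫ τ in (0 : ℝ)..S.travel 0 1, S.weightedSignal μ v τ ^ p ≤
      C ^ p * ∫ τ in (0 : ℝ)..S.travel 0 1, |v 0 (S.place 0 τ) 0| ^ p := by
    rw [← intervalIntegral.integral_const_mul]
    refine intervalIntegral.integral_mono_on l0.le
      (h.intervalIntegrable_weightedSignal p (by linarith) (by linarith))
      (((hpl 0).const_mul _).intervalIntegrable (uIcc_of_le l0.le).le) fun τ hτ => ?_
    have e := h.q0_mul_apply_zero (t := 0) le_rfl (S.place_mem_Icc.2 hτ)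
    rw [travel_place, zero_add] at e
    rw [← mul_pow, weightedSignal, ← e, abs_mul, ← mul_assoc]
    refine pow_le_pow_left₀ (by positivity) (mul_le_mul_of_nonneg_right ?_ (abs_nonneg _)) p
    exact mul_le_mul (hexp τ hτ.2) (by linarith) hq (Real.exp_pos _).le
  have f : ∀ i : Fin 2, ∫ τ in (0 : ℝ)..S.travel i 1, |v 0 (S.place i τ) i| ^ p ≤
      m⁻¹ * ∫ z in (0 : ℝ)..1, |v 0 z i| ^ p := fun i => by
    have := S.integral_le_comp_travel hm0 hm i (f := fun τ => |v 0 (S.place i τ) i| ^ p)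
      (fun _ _ => by positivity) (hpl i)
    simpa using this
  have hCp : 0 ≤ C ^ p := by positivity
  calc _ ≤ C ^ p * (m⁻¹ * ∫ z in (0 : ℝ)..1, |v 0 z 1| ^ p) +
        C ^ p * (m⁻¹ * ∫ z in (0 : ℝ)..1, |v 0 z 0| ^ p) :=
        add_le_add (e1.trans (mul_le_mul_of_nonneg_left (f 1) hCp))
          (e2.trans (mul_le_mul_of_nonneg_left (f 0) hCp))
    _ = _ := by ring

/-- The state at time `t` is controlled by the signal over one round trip. -/
theorem integral_sq_le (h : S.IsTargetSolution qcl v) (hq0 : S.q0 ≠ 0) (hμ : 0 < μ) {M : ℝ}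
    (hM : ∀ i z, S.speed i z ≤ M) {t : ℝ} (ht : 0 ≤ t) :
    (∫ z in (0 : ℝ)..1, |v t z 0| ^ 2) + (∫ z in (0 : ℝ)..1, |v t z 1| ^ 2) ≤
      (Real.exp (μ * S.loopTime) * (1 + |S.q0|⁻¹) * Real.exp (-μ * t)) ^ 2 * M *
        ∫ τ in (-S.travel 1 1 + t)..(S.travel 0 1 + t), S.weightedSignal μ v τ ^ 2 := by
  have l0 := travel_one_pos (S := S) 0
  have l1 := travel_one_pos (S := S) 1
  have hq : 0 < |S.q0| := abs_pos.2 hq0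
  set C := Real.exp (μ * S.loopTime) * (1 + |S.q0|⁻¹) * Real.exp (-μ * t) with hC
  have hexp : ∀ τ, -S.travel 1 1 + t ≤ τ → 1 ≤ Real.exp (μ * S.loopTime) * Real.exp (-μ * t) *
      Real.exp (μ * τ) := fun τ hτ => by
    rw [← Real.exp_add, ← Real.exp_add]
    refine Real.one_le_exp ?_
    have : μ * S.loopTime + -μ * t + μ * τ = μ * (S.loopTime + τ - t) := by ring
    rw [this]
    exact mul_nonneg hμ.le (by rw [loopTime]; linarith)
  have hw0 : BddMeasOn (fun s => S.weightedSignal μ v (t + s) ^ 2) (Icc 0 (S.travel 0 1)) :=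
    (((h.bddMeasOn_weightedSignal (μ := μ) (t + S.travel 0 1)).pow 2).comp
      (h := fun s => t + s) (by fun_prop) fun s hs => ⟨by linarith [hs.1], by linarith [hs.2]⟩)
  have hw1 : BddMeasOn (fun s => S.weightedSignal μ v (t - s) ^ 2) (Icc 0 (S.travel 1 1)) :=
    (((h.bddMeasOn_weightedSignal (μ := μ) t).pow 2).comp
      (h := fun s => t - s) (by fun_prop) fun s hs => ⟨by linarith [hs.2], by linarith [hs.1]⟩)
  have b0 : ∫ z in (0 : ℝ)..1, |v t z 0| ^ 2 ≤
      ∫ z in (0 : ℝ)..1, C ^ 2 * S.weightedSignal μ v (t + S.travel 0 z) ^ 2 := by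
    refine intervalIntegral.integral_mono_on zero_le_one
      ((((h.transported.bdd 0).slice ht).abs.pow 2).intervalIntegrable (uIcc_of_le zero_le_one).le)
      (((hw0.comp (S.continuous_travel 0).measurable fun z hz =>
        S.travel_mem_Icc hz).const_mul _).intervalIntegrable (uIcc_of_le zero_le_one).le)
      fun z hz => ?_
    have e := h.q0_mul_apply_zero ht hz
    rw [← mul_pow, weightedSignal, ← e, abs_mul]
    refine pow_le_pow_left₀ (abs_nonneg _) ?_ 2
    have h1 := hexp (t + S.travel 0 z) (by linarith [S.travel_nonneg 0 hz.1])
    have h2 : 1 ≤ (1 + |S.q0|⁻¹) * |S.q0| := by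
      rw [add_mul, inv_mul_cancel₀ hq.ne']; linarith
    calc |v t z 0| ≤ (Real.exp (μ * S.loopTime) * Real.exp (-μ * t) *
          Real.exp (μ * (t + S.travel 0 z))) * ((1 + |S.q0|⁻¹) * |S.q0|) * |v t z 0| :=
          le_mul_of_one_le_left (abs_nonneg _) (one_le_mul_of_one_le_of_one_le h1 h2)
      _ = _ := by rw [hC]; ring
  have b1 : ∫ z in (0 : ℝ)..1, |v t z 1| ^ 2 ≤
      ∫ z in (0 : ℝ)..1, C ^ 2 * S.weightedSignal μ v (t - S.travel 1 z) ^ 2 := by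
    refine intervalIntegral.integral_mono_ae_restrict zero_le_one
      ((((h.transported.bdd 1).slice ht).abs.pow 2).intervalIntegrable (uIcc_of_le zero_le_one).le)
      (((hw1.comp (S.continuous_travel 1).measurable fun z hz =>
        S.travel_mem_Icc hz).const_mul _).intervalIntegrable (uIcc_of_le zero_le_one).le) ?_
    have hne := measure_eq_zero_iff_ae_notMem.1 (Real.volume_singleton (a := S.place 1 t))
    filter_upwards [ae_restrict_of_ae hne, ae_restrict_mem measurableSet_Icc] with z h1 hz
    have e := h.apply_one ht hz fun h' => h1 (by rw [h', place_travel]; rfl)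
    rw [← mul_pow, weightedSignal, ← e]
    refine pow_le_pow_left₀ (abs_nonneg _) ?_ 2
    have h1 := hexp (t - S.travel 1 z) (by linarith [(S.travel_mem_Icc (i := 1) hz).2])
    have h2 : 1 ≤ 1 + |S.q0|⁻¹ := by linarith [inv_pos.2 hq]
    calc |v t z 1| ≤ (Real.exp (μ * S.loopTime) * Real.exp (-μ * t) *
          Real.exp (μ * (t - S.travel 1 z))) * (1 + |S.q0|⁻¹) * |v t z 1| :=
          le_mul_of_one_le_left (abs_nonneg _) (one_le_mul_of_one_le_of_one_le h1 h2)
      _ = _ := by rw [hC]; ring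
  have c0 := S.integral_comp_travel_le hM 0 (f := fun s => C ^ 2 * S.weightedSignal μ v (t + s) ^ 2)
    (fun _ _ => by positivity) (hw0.const_mul _)
  have c1 := S.integral_comp_travel_le hM 1 (f := fun s => C ^ 2 * S.weightedSignal μ v (t - s) ^ 2)
    (fun _ _ => by positivity) (hw1.const_mul _)
  rw [intervalIntegral.integral_const_mul (r := C ^ 2) (f := fun s => S.weightedSignal μ v (t + s) ^ 2),
    intervalIntegral.integral_comp_add_left (fun τ => S.weightedSignal μ v τ ^ 2)] at c0
  rw [intervalIntegral.integral_const_mul (r := C ^ 2) (f := fun s => S.weightedSignal μ v (t - s) ^ 2),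
    intervalIntegral.integral_comp_sub_left (fun τ => S.weightedSignal μ v τ ^ 2)] at c1
  have e := intervalIntegral.integral_add_adjacent_intervals
    (h.intervalIntegrable_weightedSignal (μ := μ) 2 (a := -S.travel 1 1 + t) (b := t) (by linarith) (by linarith))
    (h.intervalIntegrable_weightedSignal (μ := μ) 2 (b := S.travel 0 1 + t) (by linarith) (by linarith))
  rw [← e]
  have e0 : t + 0 = t := add_zero t
  have e1 : t - 0 = t := sub_zero t
  have e2 : t - S.travel 1 1 = -S.travel 1 1 + t := by ring
  have e3 : t + S.travel 0 1 = S.travel 0 1 + t := by ring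
  rw [e0, e3] at c0
  rw [e1, e2] at c1
  calc _ ≤ M * (C ^ 2 * ∫ τ in t..(S.travel 0 1 + t), S.weightedSignal μ v τ ^ 2) +
        M * (C ^ 2 * ∫ τ in (-S.travel 1 1 + t)..t, S.weightedSignal μ v τ ^ 2) :=
        add_le_add (b0.trans c0) (b1.trans c1)
    _ = _ := by ring

theorem abs_le (h : S.IsTargetSolution qcl v) (hq0 : S.q0 ≠ 0) (hμ : 0 < μ)
    (hρ : |S.q0 * qcl| * Real.exp (μ * S.loopTime) ≤ 1) {B : ℝ}
    (hB : ∀ z ∈ Icc (0 : ℝ) 1, ∀ i, |v 0 z i| ≤ B) {t : ℝ} (ht : 0 ≤ t) {z : ℝ}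
    (hz : z ∈ Icc (0 : ℝ) 1) (i : Fin 2) :
    |v t z i| ≤ Real.exp (μ * S.loopTime) ^ 2 * (1 + |S.q0|) * (1 + |S.q0|⁻¹) *
      Real.exp (-μ * t) * B := by
  have l0 := travel_one_pos (S := S) 0
  have l1 := travel_one_pos (S := S) 1
  have hq : 0 < |S.q0| := abs_pos.2 hq0
  have hB0 : 0 ≤ B := (abs_nonneg _).trans (hB 0 zero_mem_Icc 0)
  have hs := h.abs_le_of_bound hμ hρ hB
  set D := Real.exp (μ * S.loopTime) * (1 + |S.q0|) * B with hD
  have hD0 : 0 ≤ D := by positivity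
  have hsig : ∀ τ, -S.travel 1 1 + t ≤ τ →
      |S.signal v τ| ≤ Real.exp (μ * S.loopTime) * Real.exp (-μ * t) * D := by
    intro τ hτ
    have h1 := hs τ (by linarith)
    rw [weightedSignal] at h1
    have h2 : 1 ≤ Real.exp (μ * S.loopTime) * Real.exp (-μ * t) * Real.exp (μ * τ) := by
      rw [← Real.exp_add, ← Real.exp_add]
      refine Real.one_le_exp ?_
      have : μ * S.loopTime + -μ * t + μ * τ = μ * (S.loopTime + τ - t) := by ring
      rw [this]
      exact mul_nonneg hμ.le (by rw [loopTime]; linarith)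
    calc |S.signal v τ| ≤ (Real.exp (μ * S.loopTime) * Real.exp (-μ * t) * Real.exp (μ * τ)) *
          |S.signal v τ| := le_mul_of_one_le_left (abs_nonneg _) h2
      _ = Real.exp (μ * S.loopTime) * Real.exp (-μ * t) * (Real.exp (μ * τ) * |S.signal v τ|) := by
          ring
      _ ≤ _ := by gcongr
  have hinv := inv_pos.2 hq
  have hi : ∀ i : Fin 2, i = 0 ∨ i = 1 := by decide
  rcases hi i with rfl | rfl
  · have e := h.q0_mul_apply_zero ht hz
    have h1 := hsig (t + S.travel 0 z) (by linarith [S.travel_nonneg 0 hz.1])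
    rw [← e, abs_mul] at h1
    calc |v t z 0| = |S.q0|⁻¹ * (|S.q0| * |v t z 0|) := by field_simp
      _ ≤ |S.q0|⁻¹ * (Real.exp (μ * S.loopTime) * Real.exp (-μ * t) * D) := by gcongr
      _ ≤ (1 + |S.q0|⁻¹) * (Real.exp (μ * S.loopTime) * Real.exp (-μ * t) * D) := by
          gcongr; linarith
      _ = _ := by rw [hD]; ring
  · have h3 : |v t z 1| ≤ Real.exp (μ * S.loopTime) * Real.exp (-μ * t) * D := by
      by_cases hne : t = S.travel 1 z
      · rw [hne, h.apply_one_of_eq hz]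
        have h2 : 1 ≤ Real.exp (μ * S.loopTime) * Real.exp (-μ * S.travel 1 z) := by
          rw [← Real.exp_add]
          refine Real.one_le_exp ?_
          have : μ * S.loopTime + -μ * S.travel 1 z = μ * (S.loopTime - S.travel 1 z) := by ring
          rw [this]
          exact mul_nonneg hμ.le (by rw [loopTime]; linarith [(S.travel_mem_Icc (i := 1) hz).2])
        have h4 : B ≤ D := by
          rw [hD]
          refine le_mul_of_one_le_left hB0 (one_le_mul_of_one_le_of_one_le (Real.one_le_exp ?_) ?_)
          · exact mul_nonneg hμ.le loopTime_pos.le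
          · linarith
        exact (hB 0 zero_mem_Icc 1).trans (h4.trans (le_mul_of_one_le_left hD0 h2))
      · rw [h.apply_one ht hz hne]
        exact hsig _ (by linarith [(S.travel_mem_Icc (i := 1) hz).2])
    calc |v t z 1| ≤ _ := h3
      _ ≤ (1 + |S.q0|⁻¹) * (Real.exp (μ * S.loopTime) * Real.exp (-μ * t) * D) :=
          le_mul_of_one_le_left (by positivity) (by linarith)
      _ = _ := by rw [hD]; ring

/-- The weighted signal grows at most linearly in the mean. -/
theorem integral_weightedSignal_linear (h : S.IsTargetSolution qcl v)
    (hρ : |S.q0 * qcl| * Real.exp (μ * S.loopTime) ≤ 1) {t : ℝ} (ht : 0 ≤ t) :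
    ∫ τ in (0 : ℝ)..t, S.weightedSignal μ v τ ≤
      (t / S.loopTime + 1) * ∫ τ in (-S.travel 1 1)..S.travel 0 1, S.weightedSignal μ v τ := by
  have l0 := travel_one_pos (S := S) 0
  have l1 := travel_one_pos (S := S) 1
  have hL := loopTime_pos (S := S)
  have hLd : S.loopTime = S.travel 0 1 + S.travel 1 1 := rfl
  set W := ∫ τ in (-S.travel 1 1)..S.travel 0 1, S.weightedSignal μ v τ with hW
  have hi : ∀ {a b}, -S.travel 1 1 ≤ a → -S.travel 1 1 ≤ b →
    IntervalIntegrable (S.weightedSignal μ v) volume a b := fun ha hb => by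
      simpa using h.intervalIntegrable_weightedSignal 1 ha hb
  have hW0 : 0 ≤ W := intervalIntegral.integral_nonneg (by linarith) fun _ _ =>
    weightedSignal_nonneg _
  have key : ∀ m : ℕ, ∫ τ in (0 : ℝ)..m * S.loopTime, S.weightedSignal μ v τ ≤ m * W := by
    intro m
    induction m with
    | zero => simp
    | succ m ih =>
      have hm : 0 ≤ (m : ℝ) * S.loopTime := by positivity
      have hw := h.integral_window_le hρ 1 (t := m * S.loopTime + S.travel 1 1) (by linarith)
      simp only [pow_one] at hw
      have e : -S.travel 1 1 + (m * S.loopTime + S.travel 1 1) = m * S.loopTime := by ring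
      have e' : S.travel 0 1 + (m * S.loopTime + S.travel 1 1) = ((m + 1 : ℕ) : ℝ) * S.loopTime := by
        push_cast; rw [hLd]; ring
      rw [e, e'] at hw
      rw [← intervalIntegral.integral_add_adjacent_intervals (hi (b := m * S.loopTime)
        (by linarith) (by linarith)) (hi (by linarith) (by push_cast; linarith))]
      push_cast at hw ⊢
      linarith
  obtain hm := Nat.le_ceil (t / S.loopTime)
  have hm' := (Nat.ceil_lt_add_one (div_nonneg ht hL.le)).le
  have h1 : ∫ τ in (0 : ℝ)..t, S.weightedSignal μ v τ ≤
      ∫ τ in (0 : ℝ)..⌈t / S.loopTime⌉₊ * S.loopTime, S.weightedSignal μ v τ := by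
    rw [div_le_iff₀ hL] at hm
    exact intervalIntegral.integral_mono_interval le_rfl ht hm
      (Filter.Eventually.of_forall fun _ => weightedSignal_nonneg _) (hi (by linarith) (by linarith))
  exact h1.trans ((key _).trans (mul_le_mul_of_nonneg_right hm' hW0))

end IsTargetSolution

theorem exists_decay_rate {ρ L : ℝ} (hρ : |ρ| < 1) (hL : 0 < L) :
    ∃ μ, 0 < μ ∧ |ρ| * Real.exp (μ * L) ≤ 1 := by
  have h1 : 0 < max |ρ| (1 / 2) := lt_max_of_lt_right (by norm_num)
  have h2 : max |ρ| (1 / 2) < 1 := max_lt hρ (by norm_num)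
  refine ⟨-Real.log (max |ρ| (1 / 2)) / L, div_pos (neg_pos.2 (Real.log_neg h1 h2)) hL, ?_⟩
  rw [div_mul_cancel₀ _ hL.ne', Real.exp_neg, Real.exp_log h1, ← div_eq_mul_inv, div_le_one h1]
  exact le_max_left _ _

end HyperbolicPDEODE

/-! ### Exponential decay of the matrix exponential of a Hurwitz matrix -/

section MatrixExponential

attribute [local instance] Matrix.linftyOpNormedRing Matrix.linftyOpNormedAlgebra

variable {n : ℕ}

/-- In finite dimensions, the exponential is a polynomial. -/
theorem exists_aeval_eq_exp (M : Matrix (Fin n) (Fin n) ℂ) :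
    ∃ p : Polynomial ℂ, Polynomial.aeval M p = NormedSpace.exp M := by
  have hM : M ∈ Algebra.adjoin ℂ {M} := Algebra.self_mem_adjoin_singleton ℂ M
  have hc : IsClosed ((Algebra.adjoin ℂ {M} : Subalgebra ℂ _) : Set (Matrix (Fin n) (Fin n) ℂ)) :=
    (Subalgebra.toSubmodule (Algebra.adjoin ℂ {M})).closed_of_finiteDimensional
  have h : NormedSpace.exp M ∈ Algebra.adjoin ℂ {M} := by
    refine hc.mem_of_tendsto (NormedSpace.exp_series_hasSum_exp' (𝕂 := ℂ) M)
      (Filter.Eventually.of_forall fun s => ?_)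
    exact Subalgebra.sum_mem _ fun m _ => Subalgebra.smul_mem _ (Subalgebra.pow_mem _ hM m) _
  rw [Algebra.adjoin_singleton_eq_range_aeval] at h
  exact h

theorem pow_mulVec_of_mulVec {M : Matrix (Fin n) (Fin n) ℂ} {w : Fin n → ℂ} {μ : ℂ}
    (h : M *ᵥ w = μ • w) (m : ℕ) : (M ^ m) *ᵥ w = μ ^ m • w := by
  induction m with
  | zero => simp
  | succ m ih => rw [pow_succ, ← Matrix.mulVec_mulVec, h, Matrix.mulVec_smul, ih, smul_smul,
      pow_succ, mul_comm]

theorem aeval_mulVec_of_mulVec {M : Matrix (Fin n) (Fin n) ℂ} {w : Fin n → ℂ} {μ : ℂ}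
    (h : M *ᵥ w = μ • w) (p : Polynomial ℂ) : Polynomial.aeval M p *ᵥ w = p.eval μ • w := by
  induction p using Polynomial.induction_on' with
  | add p q hp hq => rw [map_add, Matrix.add_mulVec, hp, hq, Polynomial.eval_add, add_smul]
  | monomial m a =>
    rw [Polynomial.aeval_monomial, ← Algebra.smul_def, Matrix.smul_mulVec,
      pow_mulVec_of_mulVec h, Polynomial.eval_monomial, smul_smul]

theorem exp_mulVec_of_mulVec {M : Matrix (Fin n) (Fin n) ℂ} {w : Fin n → ℂ} {μ : ℂ}
    (h : M *ᵥ w = μ • w) : NormedSpace.exp M *ᵥ w = Complex.exp μ • w := by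
  let L : Matrix (Fin n) (Fin n) ℂ →ₗ[ℂ] (Fin n → ℂ) := (Matrix.mulVecBilin ℂ ℂ).flip w
  have hL : Continuous L := L.continuous_of_finiteDimensional
  have h1 := (NormedSpace.exp_series_hasSum_exp' (𝕂 := ℂ) M).map L hL
  have h2 := (NormedSpace.exp_series_hasSum_exp' (𝕂 := ℂ) μ).smul_const w
  rw [Complex.exp_eq_exp_ℂ]
  refine h1.unique ?_
  convert h2 using 2 with m
  simp [L, pow_mulVec_of_mulVec h, smul_smul]

theorem norm_lt_one_of_mem_spectrum_exp {M : Matrix (Fin n) (Fin n) ℂ}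
    (hM : ∀ μ ∈ spectrum ℂ M, μ.re < 0) {z : ℂ} (hz : z ∈ spectrum ℂ (NormedSpace.exp M)) :
    ‖z‖ < 1 := by
  obtain ⟨p, hp⟩ := exists_aeval_eq_exp M
  rcases isEmpty_or_nonempty (Fin n) with hn | hn
  · exact absurd hz (by simp [spectrum.of_subsingleton])
  rw [← hp, spectrum.map_polynomial_aeval_of_nonempty _ _ (spectrum.nonempty M)] at hz
  obtain ⟨μ, hμ, rfl⟩ := hz
  have hμ' := hμ
  rw [← Matrix.spectrum_toLin', ← Module.End.hasEigenvalue_iff_mem_spectrum] at hμ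
  obtain ⟨w, hw, hw0⟩ := hμ.exists_hasEigenvector
  rw [Module.End.mem_eigenspace_iff, Matrix.toLin'_apply] at hw
  have h1 := exp_mulVec_of_mulVec hw
  have h2 : NormedSpace.exp M *ᵥ w = p.eval μ • w := by
    rw [← hp, aeval_mulVec_of_mulVec hw]
  have h3 : Complex.exp μ = p.eval μ := smul_left_injective ℂ hw0 (h1.symm.trans h2)
  show ‖p.eval μ‖ < 1
  rw [← h3, Complex.norm_exp]
  exact Real.exp_lt_one_iff.2 (hM μ hμ')

theorem exists_norm_exp_pow_lt_one {M : Matrix (Fin n) (Fin n) ℂ}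
    (hM : ∀ μ ∈ spectrum ℂ M, μ.re < 0) : ∃ k : ℕ, 0 < k ∧ ‖NormedSpace.exp M ^ k‖ < 1 := by
  rcases isEmpty_or_nonempty (Fin n) with hn | hn
  · exact ⟨1, one_pos, by rw [Subsingleton.elim (NormedSpace.exp M ^ 1) 0]; simp⟩
  have hr := spectrum.spectralRadius_lt_of_forall_lt (NormedSpace.exp M) (r := 1) fun z hz => by
    simpa [← NNReal.coe_lt_coe] using norm_lt_one_of_mem_spectrum_exp hM hz
  have ht := spectrum.pow_nnnorm_pow_one_div_tendsto_nhds_spectralRadius (NormedSpace.exp M)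
  obtain ⟨k, hk, hk0⟩ := ((ht.eventually (gt_mem_nhds hr)).and (Filter.eventually_gt_atTop 0)).exists
  refine ⟨k, hk0, ?_⟩
  have hk1 : (‖NormedSpace.exp M ^ k‖₊ : ENNReal) < 1 := by
    by_contra hcon
    have hkp : (0 : ℝ) < 1 / (k : ℝ) := by positivity
    exact absurd hk (not_lt.2 (ENNReal.one_le_rpow (not_lt.1 hcon) hkp))
  exact_mod_cast hk1

theorem exists_norm_exp_smul_le {M : Matrix (Fin n) (Fin n) ℂ}
    (hM : ∀ μ ∈ spectrum ℂ M, μ.re < 0) :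
    ∃ C ν : ℝ, 0 < C ∧ 0 < ν ∧ ∀ t : ℝ, 0 ≤ t →
      ‖NormedSpace.exp ((t : ℂ) • M)‖ ≤ C * Real.exp (-ν * t) := by
  obtain ⟨k, hk0, hk⟩ := exists_norm_exp_pow_lt_one hM
  have hkp : (0 : ℝ) < k := Nat.cast_pos.2 hk0
  have hcont : Continuous fun s : ℝ => NormedSpace.exp ((s : ℂ) • M) :=
    NormedSpace.exp_continuous.comp (by fun_prop)
  obtain ⟨B, hB⟩ := (isCompact_Icc (a := (0 : ℝ)) (b := k)).exists_bound_of_continuousOn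
    hcont.continuousOn
  set q := max ‖NormedSpace.exp M ^ k‖ (1 / 2) with hq
  have hq0 : 0 < q := lt_max_of_lt_right (by norm_num)
  have hq1 : q < 1 := max_lt hk (by norm_num)
  set ν := -Real.log q / k with hν
  have hνp : 0 < ν := div_pos (neg_pos.2 (Real.log_neg hq0 hq1)) hkp
  have hqe : q = Real.exp (-ν * k) := by
    rw [hν, neg_mul, div_mul_cancel₀ _ hkp.ne', neg_neg, Real.exp_log hq0]
  have hB0 : 0 ≤ B := (norm_nonneg _).trans (hB 0 ⟨le_rfl, hkp.le⟩)
  refine ⟨(B + 1) * Real.exp (ν * k), ν, by positivity, hνp, fun t ht => ?_⟩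
  have key : ∀ m : ℕ, ∀ t : ℝ, m * k ≤ t → t ≤ (m + 1) * k →
      ‖NormedSpace.exp ((t : ℂ) • M)‖ ≤ q ^ m * B := by
    intro m
    induction m with
    | zero => intro t h1 h2; simpa using hB t ⟨by simpa using h1, by simpa using h2⟩
    | succ m ih =>
      intro t h1 h2
      push_cast at h1 h2
      have e : (t : ℂ) • M = k • M + ((t - k : ℝ) : ℂ) • M := by
        rw [← Nat.cast_smul_eq_nsmul ℂ, ← add_smul]; congr 1; push_cast; ring
      have hcomm : Commute (k • M) (((t - k : ℝ) : ℂ) • M) :=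
        ((Commute.refl M).smul_left _).smul_right _
      rw [e, Matrix.exp_add_of_commute _ _ hcomm, Matrix.exp_nsmul]
      calc _ ≤ ‖NormedSpace.exp M ^ k‖ * ‖NormedSpace.exp (((t - k : ℝ) : ℂ) • M)‖ := norm_mul_le _ _
        _ ≤ q * (q ^ m * B) := mul_le_mul (le_max_left _ _)
            (ih (t - k) (by linarith) (by linarith)) (norm_nonneg _) hq0.le
        _ = _ := by ring
  have h1 : (⌊t / k⌋₊ : ℝ) * k ≤ t := by
    rw [← le_div_iff₀ hkp]; exact Nat.floor_le (by positivity)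
  have h2 : t < (⌊t / k⌋₊ + 1) * k := by
    rw [← div_lt_iff₀ hkp]; exact Nat.lt_floor_add_one _
  refine (key _ t h1 h2.le).trans ?_
  have h3 : q ^ ⌊t / k⌋₊ ≤ Real.exp (ν * k) * Real.exp (-ν * t) := by
    rw [hqe, ← Real.exp_nat_mul, ← Real.exp_add, Real.exp_le_exp]
    nlinarith
  calc _ ≤ (Real.exp (ν * k) * Real.exp (-ν * t)) * (B + 1) := by gcongr; linarith
    _ = _ := by ring

theorem abs_entry_exp_smul (M : Matrix (Fin n) (Fin n) ℝ) (t : ℝ) (i j : Fin n) :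
    |NormedSpace.exp (t • M) i j| ≤ ‖NormedSpace.exp ((t : ℂ) • M.map (algebraMap ℝ ℂ))‖ := by
  have e : (NormedSpace.exp (t • M)).map (algebraMap ℝ ℂ) =
      NormedSpace.exp ((t : ℂ) • M.map (algebraMap ℝ ℂ)) := by
    have h1 := NormedSpace.map_exp ((algebraMap ℝ ℂ).mapMatrix (m := Fin n))
      (continuous_id.matrix_map (continuous_algebraMap ℝ ℂ)) (t • M)
    rw [RingHom.mapMatrix_apply, RingHom.mapMatrix_apply] at h1
    refine h1.trans ?_
    congr 1
    ext i j
    simp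
  rw [← e, ← Real.norm_eq_abs]
  have h2 : ‖NormedSpace.exp (t • M) i j‖ = ‖(NormedSpace.exp (t • M)).map (algebraMap ℝ ℂ) i j‖ := by
    simp
  rw [h2]
  set A := (NormedSpace.exp (t • M)).map (algebraMap ℝ ℂ)
  rw [Matrix.linfty_opNorm_def]
  have h3 : ‖A i j‖₊ ≤ ∑ l, ‖A i l‖₊ := Finset.single_le_sum (f := fun l => ‖A i l‖₊)
    (fun _ _ => zero_le) (Finset.mem_univ j)
  exact_mod_cast h3.trans (Finset.le_sup (f := fun i => ∑ l, ‖A i l‖₊) (Finset.mem_univ i))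

theorem hasDerivAt_exp_smul_entry (M : Matrix (Fin n) (Fin n) ℝ) (t : ℝ) (i j : Fin n) :
    HasDerivAt (fun s : ℝ => NormedSpace.exp (s • M) i j) ((NormedSpace.exp (t • M) * M) i j) t := by
  have h1 := hasDerivAt_exp_smul_const (𝕂 := ℝ) M t
  let L : Matrix (Fin n) (Fin n) ℝ →L[ℝ] ℝ :=
    LinearMap.toContinuousLinearMap (Matrix.entryLinearMap ℝ ℝ i j)
  exact L.hasFDerivAt.comp_hasDerivAt t h1

/-- The semigroup of a Hurwitz matrix decays exponentially. -/
theorem IsHurwitz.exists_semigroup {M : Matrix (Fin n) (Fin n) ℝ} (hM : IsHurwitz M) :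
    ∃ (G : ℝ → Matrix (Fin n) (Fin n) ℝ) (C ν : ℝ), G 0 = 1 ∧
      (∀ t i j, HasDerivAt (fun s => G s i j) ((G t * M) i j) t) ∧ 0 < C ∧ 0 < ν ∧
      ∀ t : ℝ, 0 ≤ t → ∀ i j, |G t i j| ≤ C * Real.exp (-ν * t) := by
  obtain ⟨C, ν, hC, hν, h⟩ := exists_norm_exp_smul_le hM
  exact ⟨fun t => NormedSpace.exp (t • M), C, ν, by simp, hasDerivAt_exp_smul_entry M, hC, hν,
    fun t ht i j => (abs_entry_exp_smul M t i j).trans (h t ht)⟩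

end MatrixExponential

/-- Variation of constants. -/
theorem eq_of_linear_ode {n : ℕ} {M : Matrix (Fin n) (Fin n) ℝ} {ξ g : ℝ → Fin n → ℝ} {t : ℝ}
    {G : ℝ → Matrix (Fin n) (Fin n) ℝ} (hG0 : G 0 = 1)
    (hG : ∀ t i j, HasDerivAt (fun s => G s i j) ((G t * M) i j) t) (ht : 0 ≤ t)
    (h : ∀ m, IsBddPrimitive (fun s => ξ s m) (fun s => (M *ᵥ ξ s) m + g s m) 0 t) (i : Fin n) :
    ξ t i = ∑ j, G t i j * ξ 0 j + ∫ s in (0 : ℝ)..t, ∑ j, G (t - s) i j * g s j := by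
  have hcont : ∀ i j, Continuous fun s : ℝ => (G (t - s) * M) i j := fun i j => by
    have hc : ∀ l, Continuous fun s : ℝ => G (t - s) i l := fun l =>
      (continuous_iff_continuousAt.2 fun s => (hG s i l).continuousAt).comp
        (continuous_const.sub continuous_id)
    simp only [Matrix.mul_apply]
    exact continuous_finsetSum _ fun l _ => (hc l).mul continuous_const
  have h1 : ∀ j, IsBddPrimitive (fun s => G (t - s) i j) (fun s => -(G (t - s) * M) i j) 0 t :=
    fun j => IsBddPrimitive.of_hasDerivAt (fun s _ => by
      simpa using (hG (t - s) i j).comp_const_sub t s) (hcont i j).neg.continuousOn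
  have h2 := (IsBddPrimitive.sum Finset.univ fun j _ => (h1 j).mul (h j)).congr
    (f' := fun s => ∑ j, G (t - s) i j * ξ s j)
    (g' := fun s => ∑ j, G (t - s) i j * g s j) (fun _ _ => rfl) fun s _ => by
      have e : ∑ j, (G (t - s) * M) i j * ξ s j = ∑ j, G (t - s) i j * (M *ᵥ ξ s) j :=
        (congrFun (Matrix.mulVec_mulVec (ξ s) (G (t - s)) M) i).symm
      simp only [mul_add, neg_mul, Finset.sum_add_distrib, Finset.sum_neg_distrib]
      rw [e]; ring
  have h3 := h2.eq t ⟨ht, le_rfl⟩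
  simpa [Matrix.one_apply, hG0] using h3

namespace HyperbolicPDEODE

variable {n : ℕ} {S : HyperbolicPDEODE n}

/-- Decay of the ODE state that is driven by a solution of the target system. -/
theorem exists_ode_decay {M : Matrix (Fin n) (Fin n) ℝ} (hM : IsHurwitz M) (b : Fin n → ℝ)
    (hq0 : S.q0 ≠ 0) {qcl μ : ℝ} (hμ : 0 < μ)
    (hρ : |S.q0 * qcl| * Real.exp (μ * S.loopTime) ≤ 1) :
    ∃ C ω : ℝ, 0 < C ∧ 0 < ω ∧ ω ≤ μ ∧ ∀ (v : ℝ → ℝ → Fin 2 → ℝ) (ξ : ℝ → Fin n → ℝ),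
      S.IsTargetSolution qcl v →
      (∀ m T, IsBddPrimitive (fun s => ξ s m) (fun s => (M *ᵥ ξ s) m + v s 0 0 * b m) 0 T) →
      ∀ t, 0 ≤ t → ∀ i, |ξ t i| ≤ C * Real.exp (-ω * t) *
        (∑ j, |ξ 0 j| + ∫ τ in (-S.travel 1 1)..S.travel 0 1, S.weightedSignal μ v τ) := by
  obtain ⟨G, C, ν, hG0, hG, hC, hν, hGb⟩ := hM.exists_semigroup
  set ω := min μ ν with hω
  have hω0 : 0 < ω := lt_min hμ hν
  have hL := loopTime_pos (S := S)
  have hqp : 0 < |S.q0| := abs_pos.2 hq0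
  set β := ∑ j, |b j| with hβ
  have hβ0 : 0 ≤ β := Finset.sum_nonneg fun j _ => abs_nonneg _
  set K := C * (β * |S.q0|⁻¹ * (2 / (ω * S.loopTime) + 1)) with hK
  have hK0 : 0 ≤ K := by positivity
  refine ⟨C + K, ω / 2, by positivity, by positivity, by
    have := min_le_left μ ν; linarith, fun v ξ hv hξ t ht i => ?_⟩
  set W := ∫ τ in (-S.travel 1 1)..S.travel 0 1, S.weightedSignal μ v τ with hW
  have l0 := travel_one_pos (S := S) 0
  have l1 := travel_one_pos (S := S) 1
  have hW0 : 0 ≤ W := intervalIntegral.integral_nonneg (by linarith) fun _ _ =>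
    IsTargetSolution.weightedSignal_nonneg _
  have hX0 : 0 ≤ ∑ j, |ξ 0 j| := Finset.sum_nonneg fun j _ => abs_nonneg _
  have hexp : ∀ s, 0 ≤ s → Real.exp (-ν * s) ≤ Real.exp (-ω * s) := fun s hs =>
    Real.exp_le_exp.2 (by nlinarith [min_le_right μ ν])
  have h1 : |∑ j, G t i j * ξ 0 j| ≤ C * Real.exp (-ω * t) * ∑ j, |ξ 0 j| := by
    refine (Finset.abs_sum_le_sum_abs _ _).trans ?_
    rw [Finset.mul_sum]
    refine Finset.sum_le_sum fun j _ => ?_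
    rw [abs_mul]
    gcongr
    exact (hGb t ht i j).trans (mul_le_mul_of_nonneg_left (hexp t ht) hC.le)
  have hi : IntervalIntegrable (fun s => S.weightedSignal μ v s) volume 0 t := by
    simpa using hv.intervalIntegrable_weightedSignal (μ := μ) 1 (a := 0) (b := t) (by linarith)
      (by linarith)
  have h2 : |∫ s in (0 : ℝ)..t, ∑ j, G (t - s) i j * (v s 0 0 * b j)| ≤
      ∫ s in (0 : ℝ)..t, C * β * |S.q0|⁻¹ * Real.exp (-ω * t) * S.weightedSignal μ v s := by
    rw [← Real.norm_eq_abs]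
    refine intervalIntegral.norm_integral_le_of_norm_le ht (Filter.Eventually.of_forall fun s hs => ?_)
      (hi.const_mul _)
    have hs0 : 0 ≤ s := hs.1.le
    have e1 : |v s 0 0| = |S.q0|⁻¹ * (Real.exp (-μ * s) * S.weightedSignal μ v s) := by
      rw [weightedSignal, ← mul_assoc (Real.exp _), ← Real.exp_add, signal, if_pos hs0, abs_mul]
      have : -μ * s + μ * s = 0 := by ring
      rw [this, Real.exp_zero, one_mul, inv_mul_cancel_left₀ hqp.ne']
    have hw := IsTargetSolution.weightedSignal_nonneg (S := S) (μ := μ) (v := v) s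
    have e2 : Real.exp (-ν * (t - s)) * Real.exp (-μ * s) ≤ Real.exp (-ω * t) := by
      rw [← Real.exp_add]
      refine Real.exp_le_exp.2 ?_
      nlinarith [min_le_right μ ν, min_le_left μ ν, hs.2]
    calc ‖∑ j, G (t - s) i j * (v s 0 0 * b j)‖
        ≤ ∑ j, C * Real.exp (-ν * (t - s)) * (|v s 0 0| * |b j|) := by
          refine (norm_sum_le _ _).trans (Finset.sum_le_sum fun j _ => ?_)
          rw [Real.norm_eq_abs, abs_mul, abs_mul]
          exact mul_le_mul_of_nonneg_right (hGb _ (by linarith [hs.2]) i j) (by positivity)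
      _ = C * β * |S.q0|⁻¹ * (Real.exp (-ν * (t - s)) * Real.exp (-μ * s)) *
          S.weightedSignal μ v s := by
          rw [← Finset.mul_sum, ← Finset.mul_sum, e1]; ring
      _ ≤ _ := by gcongr
  rw [intervalIntegral.integral_const_mul] at h2
  have h3 := hv.integral_weightedSignal_linear (μ := μ) hρ ht
  have h4 : t / S.loopTime + 1 ≤ (2 / (ω * S.loopTime) + 1) * Real.exp (ω * t / 2) := by
    have e1 := Real.add_one_le_exp (ω * t / 2)
    have e2 : t / S.loopTime = 2 / (ω * S.loopTime) * (ω * t / 2) := by field_simp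
    have e3 : 0 < 2 / (ω * S.loopTime) := by positivity
    rw [e2]
    have e4 : 0 ≤ ω * t / 2 := by positivity
    nlinarith
  have e5 : Real.exp (-ω * t) = Real.exp (-(ω / 2) * t) * Real.exp (-(ω / 2) * t) := by
    rw [← Real.exp_add]; congr 1; ring
  have e6 : Real.exp (-ω * t) * Real.exp (ω * t / 2) = Real.exp (-(ω / 2) * t) := by
    rw [← Real.exp_add]; congr 1; ring
  have e7 : Real.exp (-ω * t) ≤ Real.exp (-(ω / 2) * t) := by
    refine Real.exp_le_exp.2 ?_
    nlinarith [mul_nonneg hω0.le ht]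
  rw [eq_of_linear_ode (g := fun s j => v s 0 0 * b j) hG0 hG ht (fun m => hξ m t) i]
  refine (abs_add_le _ _).trans ?_
  calc _ ≤ C * Real.exp (-ω * t) * ∑ j, |ξ 0 j| +
        C * β * |S.q0|⁻¹ * Real.exp (-ω * t) * ((t / S.loopTime + 1) * W) :=
        add_le_add h1 (h2.trans (by gcongr))
    _ ≤ C * Real.exp (-(ω / 2) * t) * ∑ j, |ξ 0 j| + C * β * |S.q0|⁻¹ * Real.exp (-ω * t) *
        ((2 / (ω * S.loopTime) + 1) * Real.exp (ω * t / 2) * W) := by gcongr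
    _ = C * Real.exp (-(ω / 2) * t) * ∑ j, |ξ 0 j| +
        K * (Real.exp (-ω * t) * Real.exp (ω * t / 2)) * W := by rw [hK]; ring
    _ = C * Real.exp (-(ω / 2) * t) * ∑ j, |ξ 0 j| + K * Real.exp (-(ω / 2) * t) * W := by rw [e6]
    _ ≤ (C + K) * Real.exp (-(ω / 2) * t) * ∑ j, |ξ 0 j| +
        (C + K) * Real.exp (-(ω / 2) * t) * W := by gcongr <;> linarith
    _ = _ := by ring

end HyperbolicPDEODE

/-! ### Linear Volterra systems -/

/-- The triangle `0 ≤ ζ ≤ z ≤ T`. -/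
def timeTriangle (T : ℝ) : Set (ℝ × ℝ) := {p | 0 ≤ p.2 ∧ p.2 ≤ p.1 ∧ p.1 ≤ T}

theorem measurableSet_timeTriangle (T : ℝ) : MeasurableSet (timeTriangle T) :=
  (measurableSet_le measurable_const measurable_snd).inter
    ((measurableSet_le measurable_snd measurable_fst).inter
      (measurableSet_le measurable_fst measurable_const))

theorem integral_exp_mul_le {γ : ℝ} (hγ : 0 < γ) (a b : ℝ) :
    ∫ s in a..b, Real.exp (γ * s) ≤ Real.exp (γ * b) / γ := by
  rw [intervalIntegral.integral_comp_mul_left Real.exp hγ.ne', integral_exp, smul_eq_mul,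
    inv_mul_eq_div]
  gcongr
  linarith [Real.exp_pos (γ * a)]

/-- Linear Volterra systems with bounded kernels have bounded solutions. -/
theorem exists_volterra {ι : Type*} [Fintype ι] {T : ℝ} {L : ι → ι → ℝ → ℝ → ℝ} {g : ι → ℝ → ℝ}
    (hL : ∀ i j, BddMeasOn (fun p : ℝ × ℝ => L i j p.1 p.2) (timeTriangle T))
    (hg : ∀ i, BddMeasOn (g i) (Icc 0 T)) :
    ∃ f : ι → ℝ → ℝ, (∀ i, BddMeasOn (f i) (Icc 0 T)) ∧
      ∀ i, ∀ z ∈ Icc (0 : ℝ) T, f i z = g i z + ∫ ζ in (0 : ℝ)..z, ∑ j, L i j z ζ * f j ζ := by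
  choose hLm CL hCL using fun i j => (hL i j).indicator (measurableSet_timeTriangle T)
  choose hgm Cg hCg using fun i => (hg i).indicator measurableSet_Icc
  set B := ∑ i, ∑ j, |CL i j| with hB
  have hB0 : 0 ≤ B := Finset.sum_nonneg fun i _ => Finset.sum_nonneg fun j _ => abs_nonneg _
  set γ := 2 * B + 1 with hγ
  have hγ0 : 0 < γ := by positivity
  set Lh : ι → ι → ℝ × ℝ → ℝ := fun i j => (timeTriangle T).indicator fun p => L i j p.1 p.2 with hLh
  set w : ι → ℝ → ℝ := fun _ => (Icc 0 T).indicator fun z => Real.exp (γ * z) with hw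
  have hw0 : ∀ i z, 0 ≤ w i z := fun i z => indicator_nonneg (fun _ _ => (Real.exp_pos _).le) z
  set Tf : (ι → ℝ → ℝ) → ι → ℝ → ℝ := fun f i => (Icc 0 T).indicator fun z =>
    g i z + ∫ ζ in (0 : ℝ)..z, ∑ j, Lh i j (z, ζ) * f j ζ with hTf
  have hwexp : ∀ i z, w i z ≤ Real.exp (γ * z) := fun i z =>
    indicator_le_self' (fun _ _ => (Real.exp_pos _).le) z
  have hsum : ∀ {f : ι → ℝ → ℝ}, (∀ i, Measurable (f i)) → ∀ i,
      Measurable (Function.uncurry fun z ζ => ∑ j, Lh i j (z, ζ) * f j ζ) := fun hf i =>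
    Finset.measurable_sum _ fun j _ => (hLm i j).mul ((hf j).comp measurable_snd)
  have hbd : ∀ {f : ι → ℝ → ℝ} {C : ℝ}, 0 ≤ C → (∀ i z, |f i z| ≤ C * w i z) → ∀ i z ζ,
      |∑ j, Lh i j (z, ζ) * f j ζ| ≤ B * C * Real.exp (γ * ζ) := by
    intro f C hC hf i z ζ
    calc _ ≤ ∑ j, |CL i j| * (C * Real.exp (γ * ζ)) := by
          refine (Finset.abs_sum_le_sum_abs _ _).trans (Finset.sum_le_sum fun j _ => ?_)
          rw [abs_mul]
          exact mul_le_mul ((hCL i j _).trans (le_abs_self _)) ((hf j ζ).trans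
            (mul_le_mul_of_nonneg_left (hwexp j ζ) hC)) (abs_nonneg _) (abs_nonneg _)
      _ = (∑ j, |CL i j|) * (C * Real.exp (γ * ζ)) := by rw [Finset.sum_mul]
      _ ≤ B * (C * Real.exp (γ * ζ)) := by
          refine mul_le_mul_of_nonneg_right ?_ (by positivity)
          exact Finset.single_le_sum (f := fun i => ∑ j, |CL i j|)
            (fun i _ => Finset.sum_nonneg fun j _ => abs_nonneg _) (Finset.mem_univ i)
      _ = _ := by ring
  have hii : ∀ {f : ι → ℝ → ℝ} {C : ℝ}, 0 ≤ C → (∀ i, Measurable (f i)) →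
      (∀ i z, |f i z| ≤ C * w i z) → ∀ i z,
      IntervalIntegrable (fun ζ => ∑ j, Lh i j (z, ζ) * f j ζ) volume 0 z := by
    intro f C hC hfm hf i z
    refine IntervalIntegrable.mono_fun' (g := fun ζ => B * C * Real.exp (γ * ζ))
      (by apply Continuous.intervalIntegrable; fun_prop)
      ((hsum hfm i).comp measurable_prodMk_left).aestronglyMeasurable
      (Filter.Eventually.of_forall fun ζ => hbd hC hf i z ζ)
  have hint : ∀ {f : ι → ℝ → ℝ} {C : ℝ}, 0 ≤ C → (∀ i z, |f i z| ≤ C * w i z) → ∀ i z, 0 ≤ z →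
      |∫ ζ in (0 : ℝ)..z, ∑ j, Lh i j (z, ζ) * f j ζ| ≤ C / 2 * Real.exp (γ * z) := by
    intro f C hC hf i z hz
    refine (intervalIntegral.norm_integral_le_of_norm_le (μ := volume)
      (f := fun ζ => ∑ j, Lh i j (z, ζ) * f j ζ) hz
      (g := fun ζ => B * C * Real.exp (γ * ζ)) (Filter.Eventually.of_forall fun ζ _ =>
        hbd hC hf i z ζ) (by apply Continuous.intervalIntegrable; fun_prop)).trans ?_
    rw [intervalIntegral.integral_const_mul]
    calc _ ≤ B * C * (Real.exp (γ * z) / γ) := by gcongr; exact integral_exp_mul_le hγ0 0 z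
      _ = B / γ * (C * Real.exp (γ * z)) := by ring
      _ ≤ 1 / 2 * (C * Real.exp (γ * z)) := by
          refine mul_le_mul_of_nonneg_right ?_ (by positivity)
          rw [div_le_div_iff₀ hγ0 two_pos, hγ]; linarith
      _ = _ := by ring
  refine Exists.elim (exists_measurable_fixedPoint w hw0 Tf ?_ ?_)
    fun f ⟨hfm, ⟨C, hC⟩, hfix⟩ => ?_
  · intro f hfm ⟨C, hC⟩
    have hC' : ∀ i z, |f i z| ≤ |C| * w i z := fun i z =>
      (hC i z).trans (mul_le_mul_of_nonneg_right (le_abs_self C) (hw0 i z))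
    constructor
    · intro i
      have e : Tf f i = fun z => (Icc 0 T).indicator (g i) z + (Icc 0 T).indicator
          (fun z => ∫ ζ in (0 : ℝ)..z, ∑ j, Lh i j (z, ζ) * f j ζ) z := by
        ext z; exact congrFun (indicator_add (Icc 0 T) _ _) z
      rw [e]
      exact (hgm i).add ((measurable_intervalIntegral_param (hsum hfm i) measurable_const
        measurable_id).indicator measurableSet_Icc)
    · refine ⟨(∑ i, |Cg i|) + |C| / 2, fun i z => ?_⟩
      by_cases hz : z ∈ Icc 0 T
      · simp only [hTf, hw, indicator_of_mem hz]
        have h1 : |g i z| ≤ ∑ i, |Cg i| := by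
          have := hCg i z
          rw [indicator_of_mem hz] at this
          exact (this.trans (le_abs_self _)).trans (Finset.single_le_sum (f := fun i => |Cg i|)
            (fun i _ => abs_nonneg _) (Finset.mem_univ i))
        have h2 := hint (abs_nonneg C) hC' i z hz.1
        have h3 : 1 ≤ Real.exp (γ * z) := Real.one_le_exp (mul_nonneg hγ0.le hz.1)
        have h4 : 0 ≤ ∑ i, |Cg i| := Finset.sum_nonneg fun i _ => abs_nonneg _
        refine (abs_add_le _ _).trans ?_
        nlinarith
      · simp [hTf, hw, indicator_of_notMem hz]
  · intro f f' hfm hfm' ⟨C, hC⟩ ⟨C', hC'⟩ D hD hd i z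
    by_cases hz : z ∈ Icc 0 T
    · simp only [hTf, hw, indicator_of_mem hz]
      have i1 := hii (abs_nonneg C) hfm (fun i z =>
        (hC i z).trans (mul_le_mul_of_nonneg_right (le_abs_self C) (hw0 i z))) i z
      have i2 := hii (abs_nonneg C') hfm' (fun i z =>
        (hC' i z).trans (mul_le_mul_of_nonneg_right (le_abs_self C') (hw0 i z))) i z
      rw [add_sub_add_left_eq_sub, ← intervalIntegral.integral_sub i1 i2]
      have h1 := hint (f := fun i z => f i z - f' i z) hD hd i z hz.1
      simp only [mul_sub, Finset.sum_sub_distrib] at h1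
      exact h1
    · simp [hTf, hw, indicator_of_notMem hz]
  · refine ⟨f, fun i => BddMeasOn.of_measurable (hfm i) ⟨|C| * Real.exp (γ * T), fun z hz => ?_⟩,
      fun i z hz => ?_⟩
    · refine (hC i z).trans ?_
      calc _ ≤ |C| * w i z := mul_le_mul_of_nonneg_right (le_abs_self C) (hw0 i z)
        _ ≤ |C| * Real.exp (γ * T) := by
          refine mul_le_mul_of_nonneg_left ((hwexp i z).trans ?_) (abs_nonneg _)
          exact Real.exp_le_exp.2 (mul_le_mul_of_nonneg_left hz.2 hγ0.le)
    · conv_lhs => rw [← hfix]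
      rw [hTf]
      simp only [indicator_of_mem hz]
      congr 1
      refine intervalIntegral.integral_congr fun ζ hζ => ?_
      rw [uIcc_of_le hz.1] at hζ
      refine Finset.sum_congr rfl fun j _ => ?_
      have hm : (z, ζ) ∈ timeTriangle T := ⟨hζ.1, hζ.2, hz.2⟩
      rw [hLh]
      simp only [indicator_of_mem hm]

namespace HyperbolicPDEODE

variable {n : ℕ} {S : HyperbolicPDEODE n}

/-! ### Existence of the decoupling transformation -/

theorem exists_isDecoupling {K : ℝ → ℝ → Matrix (Fin 2) (Fin 2) ℝ} (hK : S.IsPreKernel K)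
    (k : Fin n → ℝ) : ∃ N, S.IsDecoupling k K N := by
  set M := S.F + vecMulVec S.b k with hM
  set N0 : Matrix (Fin 2) (Fin n) ℝ := Matrix.of ![k, S.c + S.q0 • k] with hN0
  have hinv : ∀ i : Fin 2, BddMeasOn (fun ζ => (charSign i * S.lam i ζ)⁻¹) (Icc 0 1) := fun i => by
    have := (bddMeasOn_div_lam (S := S) (BddMeasOn.const (s := Icc (0 : ℝ) 1) 1) i).const_mul
      (charSign i)⁻¹
    exact this.congr fun ζ _ => by rw [mul_inv, one_div]
  have hC : ∀ i m, BddMeasOn (fun ζ => S.C K ζ i m) (Icc 0 1) := fun i m =>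
    IsPreKernel.bddMeasOn_C i hK m
  have hsrc : ∀ i m, BddMeasOn (fun ζ => (charSign i * S.lam i ζ)⁻¹ * S.C K ζ i m) (Icc 0 1) :=
    fun i m => (hinv i).mul (hC i m)
  have hii : ∀ {f : ℝ → ℝ}, BddMeasOn f (Icc 0 1) → ∀ z ∈ Icc (0 : ℝ) 1,
      IntervalIntegrable f volume 0 z := fun hf z hz =>
    hf.intervalIntegrable (uIcc_subset_Icc' zero_mem_Icc hz)
  have hg : ∀ i m, BddMeasOn (fun z => N0 i m -
      ∫ ζ in (0 : ℝ)..z, (charSign i * S.lam i ζ)⁻¹ * S.C K ζ i m) (Icc 0 1) := fun i m =>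
    BddMeasOn.of_continuousOn (continuousOn_const.sub ((hsrc i m).isBddPrimitive
      (f := fun z => ∫ ζ in (0 : ℝ)..z, (charSign i * S.lam i ζ)⁻¹ * S.C K ζ i m)
      fun t _ => by simp).continuousOn) isCompact_Icc
  choose f hf hfe using fun i => exists_volterra (T := 1)
    (L := fun (m l : Fin n) _ ζ => (charSign i * S.lam i ζ)⁻¹ * M l m)
    (fun m l => ((hinv i).mul (BddMeasOn.const (M l m))).comp measurable_snd
      fun p hp => ⟨hp.1, hp.2.1.trans hp.2.2⟩) (hg i)
  have hNM : ∀ i m, BddMeasOn (fun ζ => (charSign i * S.lam i ζ)⁻¹ *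
      (Matrix.of (fun i m => f i m ζ) * M - S.C K ζ) i m) (Icc 0 1) := fun i m => by
    refine (hinv i).mul ?_
    simp only [Matrix.sub_apply, Matrix.mul_apply, Matrix.of_apply]
    exact (BddMeasOn.sum _ fun l _ => (hf i l).mul (BddMeasOn.const _)).sub (hC i m)
  have h0 : ∀ i m, f i m 0 = N0 i m := fun i m => by simpa using hfe i m 0 zero_mem_Icc
  have hode : ∀ z ∈ Icc (0 : ℝ) 1, ∀ i m, f i m z = f i m 0 + ∫ ζ in (0 : ℝ)..z,
      (charSign i * S.lam i ζ)⁻¹ * (Matrix.of (fun i m => f i m ζ) * M - S.C K ζ) i m := by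
    intro z hz i m
    have hs : BddMeasOn (fun ζ => ∑ l, (charSign i * S.lam i ζ)⁻¹ * M l m * f i l ζ) (Icc 0 1) :=
      BddMeasOn.sum _ fun l _ => ((hinv i).mul (BddMeasOn.const _)).mul (hf i l)
    rw [hfe i m z hz, h0, sub_add, sub_eq_add_neg, neg_sub,
      ← intervalIntegral.integral_sub (hii hs z hz) (hii (hsrc i m) z hz)]
    congr 1
    refine intervalIntegral.integral_congr fun ζ _ => ?_
    simp only [Matrix.sub_apply, Matrix.mul_apply, Matrix.of_apply, mul_sub, Finset.mul_sum]
    congr 1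
    exact Finset.sum_congr rfl fun l _ => by ring
  refine ⟨fun z => Matrix.of fun i m => f i m z, ?_, ?_, hode⟩
  · refine continuousOn_pi.2 fun i => continuousOn_pi.2 fun m => ?_
    exact ((hNM i m).isBddPrimitive fun z hz => hode z hz i m).continuousOn
  · ext i m; exact h0 i m

/-! ### Existence of the backstepping kernel -/

theorem exists_isBacksteppingKernel {k : Fin n → ℝ} {K : ℝ → ℝ → Matrix (Fin 2) (Fin 2) ℝ}
    {N : ℝ → Matrix (Fin 2) (Fin n) ℝ} (hN : S.IsDecoupling k K N) (hq0 : S.q0 ≠ 0) :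
    ∃ P, S.IsBacksteppingKernel N P := by
  set κ : Fin 2 → ℝ := ![1, -S.q0] with hκ
  have hκ0 : ∀ i, κ i ≠ 0 := by
    intro i; fin_cases i <;> simp [hκ, hq0]
  have hh : ∀ i, BddMeasOn (fun z => (N z *ᵥ S.b) i) (Icc 0 1) := hN.bddMeasOn_mulVec S.b
  choose f hf hfe using fun i : Fin 2 => exists_volterra (ι := Unit) (T := S.travel i 1)
    (L := fun _ _ s r => -(κ i)⁻¹ * (N (S.place i (s - r)) *ᵥ S.b) i)
    (g := fun _ s => (κ i)⁻¹ * (N (S.place i s) *ᵥ S.b) i)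
    (fun _ _ => BddMeasOn.const_mul (f := fun p : ℝ × ℝ => (N (S.place i (p.1 - p.2)) *ᵥ S.b) i)
      ((hh i).comp (h := fun p : ℝ × ℝ => S.place i (p.1 - p.2))
        ((S.continuous_place i).measurable.comp (by fun_prop)) fun p hp =>
          S.place_mem_Icc.2 ⟨by linarith [hp.2.1], by linarith [hp.1, hp.2.2]⟩) _)
    (fun _ => ((hh i).comp (S.continuous_place i).measurable fun s hs =>
      S.place_mem_Icc.2 hs).const_mul _)
  have hd : ∀ (i : Fin 2) {p : ℝ × ℝ}, p ∈ kernelTriangle →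
      S.travel i p.1 - S.travel i p.2 ∈ Icc 0 (S.travel i 1) := fun i p hp => by
    have h1 := (S.strictMono_travel i).monotone hp.2.1
    have h2 := S.travel_nonneg i hp.1
    have h3 := (S.strictMono_travel i).monotone hp.2.2
    exact ⟨by linarith, by linarith⟩
  set P : ℝ → ℝ → Matrix (Fin 2) (Fin 2) ℝ := fun z ζ =>
    diagonal fun i => f i () (S.travel i z - S.travel i ζ) * (S.speed i ζ)⁻¹ with hP
  have hPm : ∀ i j, BddMeasOn (fun p : ℝ × ℝ => P p.1 p.2 i j) kernelTriangle := by
    intro i j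
    simp only [hP, diagonal_apply]
    by_cases h : i = j
    · simp only [h, if_true]
      refine ((hf j ()).comp (h := fun p : ℝ × ℝ => S.travel j p.1 - S.travel j p.2)
        (((S.continuous_travel j).measurable.comp measurable_fst).sub
          ((S.continuous_travel j).measurable.comp measurable_snd)) fun p hp => hd j hp).mul ?_
      exact (BddMeasOn.of_continuousOn (S.continuous_inv_speed j).continuousOn
        (isCompact_Icc (a := (0 : ℝ)) (b := 1))).comp measurable_snd fun p hp =>
          (kernelTriangle.mem_Icc hp).2
    · simp only [h, if_false]; exact BddMeasOn.const 0
  refine ⟨P, ⟨fun i j => (hPm i j).meas, ?_, ?_⟩, ?_, ?_⟩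
  · choose C hC using fun i j => (hPm i j).bdd
    refine ⟨∑ i, ∑ j, |C i j|, fun i j p hp => (hC i j p hp).trans ((le_abs_self _).trans ?_)⟩
    refine (Finset.single_le_sum (f := fun j => |C i j|) (fun _ _ => abs_nonneg _)
      (Finset.mem_univ j)).trans ?_
    exact Finset.single_le_sum (f := fun i => ∑ j, |C i j|)
      (fun _ _ => Finset.sum_nonneg fun _ _ => abs_nonneg _) (Finset.mem_univ i)
  · intro i j ζ₀ ζ₁ Z hζ hZ
    have e0 := kernelTriangle.mem_Icc (hZ ζ₀ (left_mem_Icc.2 hζ)).1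
    obtain ⟨h1, h2⟩ := hZ ζ₁ (right_mem_Icc.2 hζ)
    have e1 := kernelTriangle.mem_Icc h1
    simp only [Pi.zero_apply, Matrix.zero_apply, intervalIntegral.integral_zero,
      mul_zero, add_zero]
    simp only [hP, diagonal_apply]
    by_cases h : i = j
    · subst h
      simp only [if_true]
      rw [S.phi_eq_travel i e1.1, S.phi_eq_travel i e1.2, S.phi_eq_travel i e0.1,
        S.phi_eq_travel i e0.2, ← mul_sub, ← mul_sub] at h2
      have h3 : S.travel i (Z ζ₁) - S.travel i ζ₁ = S.travel i (Z ζ₀) - S.travel i ζ₀ := by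
        have := congrArg (charSign i * ·) h2
        simpa only [← mul_assoc, charSign_mul_self, one_mul] using this
      rw [h3, S.speed_eq i e1.2, S.speed_eq i e0.2, inv_mul_cancel_right₀ (S.lam_pos i _ e1.2).ne',
        inv_mul_cancel_right₀ (S.lam_pos i _ e0.2).ne']
    · simp [h]
  · intro z _
    simp only [hP, Lam, diagonal_mul_diagonal, sub_eq_zero]
    congr 1
    ext i; ring
  · intro z hz i
    have hz' := S.travel_mem_Icc (i := i) hz
    have key := hfe i () _ hz'
    simp only [Finset.univ_unique, Finset.sum_singleton, place_travel] at key
    have e1 : ((P z 0 * S.Lam 0) *ᵥ ![1, S.q0]) i = κ i * f i () (S.travel i z) := by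
      have h0 := fun i => (S.lam_pos i 0 zero_mem_Icc).ne'
      have : (P z 0 * S.Lam 0) *ᵥ ![1, S.q0] = fun i => κ i * f i () (S.travel i z) := by
        ext i
        simp only [hP, Lam, diagonal_mul_diagonal, mulVec_diagonal, travel_zero, sub_zero,
          S.speed_eq i zero_mem_Icc]
        fin_cases i <;> simp [hκ, charSign, h0] <;> field_simp [h0]
      rw [this]
    have e2 : ∫ ζ in (0 : ℝ)..z, ((P z ζ * N ζ) *ᵥ S.b) i =
        ∫ r in (0 : ℝ)..S.travel i z, f i () r * (N (S.place i (S.travel i z - r)) *ᵥ S.b) i := by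
      have h1 := S.integral_comp_travel i (fun s => f i () (S.travel i z - s) *
        (N (S.place i s) *ᵥ S.b) i) 0 z
      rw [travel_zero] at h1
      have h2 := intervalIntegral.integral_comp_sub_left (a := 0) (b := S.travel i z)
        (fun r => f i () r * (N (S.place i (S.travel i z - r)) *ᵥ S.b) i) (S.travel i z)
      simp only [sub_sub_cancel, sub_zero, sub_self] at h2
      rw [← h2, ← h1]
      refine intervalIntegral.integral_congr fun ζ _ => ?_
      simp only [hP, ← Matrix.mulVec_mulVec, mulVec_diagonal, place_travel]
      ring
    have e3 : ∫ r in (0 : ℝ)..S.travel i z, -(κ i)⁻¹ * (N (S.place i (S.travel i z - r)) *ᵥ S.b) i *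
        f i () r = -(κ i)⁻¹ *
          ∫ r in (0 : ℝ)..S.travel i z, f i () r * (N (S.place i (S.travel i z - r)) *ᵥ S.b) i := by
      rw [← intervalIntegral.integral_const_mul]
      exact intervalIntegral.integral_congr fun r _ => by ring
    rw [e1, e2]
    rw [PUnit.default_eq_unit, e3] at key
    rw [key]
    have := hκ0 i
    field_simp
    ring

end HyperbolicPDEODE

namespace HyperbolicPDEODE

variable {n : ℕ} (S : HyperbolicPDEODE n)

/-! ### Characteristics in the triangle -/

/-- The label of the characteristic of the `(i,j)` kernel entry through `q = (z, ζ)`. -/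
def kernelLabel (i j : Fin 2) (q : ℝ × ℝ) : ℝ :=
  charSign i * S.travel i q.1 - charSign j * S.travel j q.2

/-- The characteristic of the `(i,j)` kernel entry with label `c`. -/
def kernelChar (i j : Fin 2) (c ζ : ℝ) : ℝ := S.place i (charSign i * (c + charSign j * S.travel j ζ))

theorem travel_kernelChar (i j : Fin 2) (c ζ : ℝ) :
    S.travel i (S.kernelChar i j c ζ) = charSign i * (c + charSign j * S.travel j ζ) := by
  rw [kernelChar, travel_place]

theorem kernelChar_kernelLabel (i j : Fin 2) (q : ℝ × ℝ) :
    S.kernelChar i j (S.kernelLabel i j q) q.2 = q.1 := by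
  rw [kernelChar, kernelLabel, sub_add_cancel, ← mul_assoc, charSign_mul_self, one_mul, place_travel]

theorem continuous_kernelLabel (i j : Fin 2) : Continuous (S.kernelLabel i j) :=
  (continuous_const.mul ((S.continuous_travel i).comp continuous_fst)).sub
    (continuous_const.mul ((S.continuous_travel j).comp continuous_snd))

theorem continuous_kernelChar (i j : Fin 2) :
    Continuous fun p : ℝ × ℝ => S.kernelChar i j p.1 p.2 :=
  (S.continuous_place i).comp (continuous_const.mul (continuous_fst.add
    (continuous_const.mul ((S.continuous_travel j).comp continuous_snd))))

theorem strictMono_travel_add : StrictMono fun z => S.travel 0 z + S.travel 1 z :=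
  (S.strictMono_travel 0).add (S.strictMono_travel 1)

/-- The sum of the travel times as an order isomorphism. -/
def travelAddIso : ℝ ≃o ℝ :=
  S.strictMono_travel_add.orderIsoOfSurjective _ (by
    have h0 := (S.travelIso 0)
    refine ((S.continuous_travel 0).add (S.continuous_travel 1)).surjective ?_ ?_
    · exact (S.travelIso 0).tendsto_atTop.atTop_add_atTop (S.travelIso 1).tendsto_atTop
    · exact (S.travelIso 0).tendsto_atBot.atBot_add_atBot (S.travelIso 1).tendsto_atBot)

/-- The place on the diagonal from which the characteristic of an off-diagonal entry starts. -/
def diagPlace (s : ℝ) : ℝ := S.travelAddIso.symm s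

theorem diagPlace_travel (z : ℝ) : S.diagPlace (S.travel 0 z + S.travel 1 z) = z :=
  S.travelAddIso.symm_apply_apply z

theorem continuous_diagPlace : Continuous S.diagPlace := S.travelAddIso.symm.continuous

theorem monotone_diagPlace : Monotone S.diagPlace := S.travelAddIso.symm.monotone

/-- Integration of a source `g` along the characteristics of the `(i,j)` kernel entry, from the
starting point `p` with the entry value `ent`, both functions of the label. -/
def kernelTransport (i j : Fin 2) (p ent : ℝ → ℝ) (g : ℝ × ℝ → ℝ) (q : ℝ × ℝ) : ℝ :=
  (S.speed j q.2)⁻¹ * (ent (S.kernelLabel i j q) + charSign j *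
    ∫ r in p (S.kernelLabel i j q)..q.2, g (S.kernelChar i j (S.kernelLabel i j q) r, r))

variable {S}

theorem measurable_kernelTransport (i j : Fin 2) {p ent : ℝ → ℝ} {g : ℝ × ℝ → ℝ}
    (hp : Measurable p) (hent : Measurable ent) (hg : Measurable g) :
    Measurable (S.kernelTransport i j p ent g) := by
  have hl := (S.continuous_kernelLabel i j).measurable
  refine ((S.continuous_inv_speed j).measurable.comp measurable_snd).mul
    ((hent.comp hl).add (Measurable.const_mul ?_ _))
  refine measurable_intervalIntegral_param
    (F := fun q r => g (S.kernelChar i j (S.kernelLabel i j q) r, r)) ?_ (hp.comp hl) measurable_snd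
  exact hg.comp (((S.continuous_kernelChar i j).measurable.comp
    ((hl.comp measurable_fst).prodMk measurable_snd)).prodMk measurable_snd)

theorem intervalIntegrable_kernelChar (i j : Fin 2) {g : ℝ × ℝ → ℝ} (hg : Measurable g) {C : ℝ}
    (hC : ∀ q, |g q| ≤ C) (c a b : ℝ) :
    IntervalIntegrable (fun r => g (S.kernelChar i j c r, r)) volume a b :=
  Measurable.intervalIntegrable_of_bdd (hg.comp ((((S.continuous_kernelChar i j).comp
    (continuous_const.prodMk continuous_id)).measurable).prodMk measurable_id)) fun _ _ => hC _

theorem kernelTransport_along (i j : Fin 2) {p ent : ℝ → ℝ} {g : ℝ × ℝ → ℝ} (hg : Measurable g)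
    {C : ℝ} (hC : ∀ q, |g q| ≤ C) {q₀ q₁ : ℝ × ℝ}
    (hq : S.kernelLabel i j q₁ = S.kernelLabel i j q₀) :
    S.kernelTransport i j p ent g q₁ * S.speed j q₁.2 =
      S.kernelTransport i j p ent g q₀ * S.speed j q₀.2 +
        charSign j * ∫ r in q₀.2..q₁.2, g (S.kernelChar i j (S.kernelLabel i j q₀) r, r) := by
  have h0 := (S.speed_pos j q₀.2).ne'
  have h1 := (S.speed_pos j q₁.2).ne'
  have hi := fun a b => intervalIntegrable_kernelChar (S := S) i j hg hC (S.kernelLabel i j q₀) a b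
  rw [kernelTransport, kernelTransport, hq, ← intervalIntegral.integral_add_adjacent_intervals
    (hi (p (S.kernelLabel i j q₀)) q₀.2) (hi q₀.2 q₁.2)]
  field_simp
  ring

theorem kernelTransport_sub (i j : Fin 2) {p ent ent' : ℝ → ℝ} {g g' : ℝ × ℝ → ℝ}
    (hg : Measurable g) (hg' : Measurable g') {C C' : ℝ} (hC : ∀ q, |g q| ≤ C)
    (hC' : ∀ q, |g' q| ≤ C') (q : ℝ × ℝ) :
    S.kernelTransport i j p ent g q - S.kernelTransport i j p ent' g' q =
      S.kernelTransport i j p (fun c => ent c - ent' c) (fun q => g q - g' q) q := by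
  rw [kernelTransport, kernelTransport, kernelTransport, intervalIntegral.integral_sub
    (intervalIntegrable_kernelChar i j hg hC _ _ _) (intervalIntegrable_kernelChar i j hg' hC' _ _ _)]
  ring

/-- Along the characteristics of a diagonal entry. -/
theorem travel_kernelChar_self (i : Fin 2) (q : ℝ × ℝ) (r : ℝ) :
    S.travel i (S.kernelChar i i (S.kernelLabel i i q) r) =
      S.travel i q.1 - S.travel i q.2 + S.travel i r := by
  rw [travel_kernelChar, kernelLabel]
  linear_combination (S.travel i q.1 - S.travel i q.2 + S.travel i r) * charSign_mul_self i

theorem charSign_sub (i : Fin 2) : charSign (1 - i) = -charSign i := by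
  fin_cases i <;> simp [charSign]

theorem travel_kernelChar_other (i : Fin 2) (q : ℝ × ℝ) (r : ℝ) :
    S.travel i (S.kernelChar i (1 - i) (S.kernelLabel i (1 - i) q) r) =
      S.travel i q.1 + S.travel (1 - i) q.2 - S.travel (1 - i) r := by
  rw [travel_kernelChar, kernelLabel, charSign_sub]
  linear_combination (S.travel i q.1 + S.travel (1 - i) q.2 - S.travel (1 - i) r) *
    charSign_mul_self i

theorem travel_add_travel_other (i : Fin 2) (z : ℝ) :
    S.travel i z + S.travel (1 - i) z = S.travel 0 z + S.travel 1 z := by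
  fin_cases i <;> simp [add_comm]

end HyperbolicPDEODE

theorem integral_exp_neg_mul_le {γ : ℝ} (hγ : 0 < γ) (a b : ℝ) :
    ∫ s in a..b, Real.exp (-γ * (s - a)) ≤ 1 / γ := by
  rw [intervalIntegral.integral_comp_sub_right (fun s => Real.exp (-γ * s)),
    intervalIntegral.integral_comp_mul_left Real.exp (neg_ne_zero.2 hγ.ne'), integral_exp, smul_eq_mul,
    sub_self, mul_zero, Real.exp_zero, inv_neg, one_div]
  have := Real.exp_pos (-γ * (b - a))
  have := inv_pos.2 hγ
  nlinarith

namespace HyperbolicPDEODE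

variable {n : ℕ} {S : HyperbolicPDEODE n}

/-! ### Existence of the kernel of the preliminary transformation -/

variable (S) in
/-- The weight in which the kernel equations are contractive. -/
def kernelWeight (i : Fin 2) (γ : ℝ) : ℝ × ℝ → ℝ :=
  kernelTriangle.indicator fun q => Real.exp (γ * S.travel i q.1)

theorem kernelWeight_nonneg (i : Fin 2) (γ : ℝ) (q : ℝ × ℝ) : 0 ≤ S.kernelWeight i γ q :=
  indicator_nonneg (fun _ _ => (Real.exp_pos _).le) q

theorem kernelWeight_le (i : Fin 2) (γ : ℝ) (q : ℝ × ℝ) :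
    S.kernelWeight i γ q ≤ Real.exp (γ * S.travel i q.1) :=
  indicator_le_self' (fun _ _ => (Real.exp_pos _).le) q

theorem kernelWeight_le_const (i : Fin 2) {γ : ℝ} (hγ : 0 ≤ γ) (q : ℝ × ℝ) :
    S.kernelWeight i γ q ≤ Real.exp (γ * S.travel i 1) := by
  by_cases hq : q ∈ kernelTriangle
  · exact (kernelWeight_le i γ q).trans (Real.exp_le_exp.2 (mul_le_mul_of_nonneg_left
      ((S.strictMono_travel i).monotone hq.2.2) hγ))
  · rw [kernelWeight, indicator_of_notMem hq]; positivity

variable (S) in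
/-- The diagonal entry of the `i`-th row of the kernel, as a function of the other entry. -/
def diagEntry (i : Fin 2) (κ : ℝ) (a : ℝ → ℝ) (f : ℝ × ℝ → ℝ) : ℝ × ℝ → ℝ :=
  kernelTriangle.indicator (S.kernelTransport i i (fun _ => 0)
    (fun c => κ * f (S.place i (charSign i * c), 0)) fun q => f q * a q.2)

variable (S) in
/-- The other entry of the `i`-th row of the kernel, as a function of the diagonal entry. -/
def offDiagEntry (i : Fin 2) (D : ℝ → ℝ) (a : ℝ → ℝ) (f : ℝ × ℝ → ℝ) : ℝ × ℝ → ℝ :=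
  kernelTriangle.indicator (S.kernelTransport i (1 - i) (fun c => S.diagPlace (charSign i * c))
    (fun c => D (S.diagPlace (charSign i * c))) fun q => f q * a q.2)

theorem measurable_diagEntry (i : Fin 2) (κ : ℝ) {a : ℝ → ℝ} (ha : Measurable a) {f : ℝ × ℝ → ℝ}
    (hf : Measurable f) : Measurable (S.diagEntry i κ a f) := by
  refine (measurable_kernelTransport i i measurable_const (Measurable.const_mul (hf.comp
    (((S.continuous_place i).measurable.comp (measurable_const.mul measurable_id)).prodMk
      measurable_const)) κ) ?_).indicator measurableSet_kernelTriangle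
  exact hf.mul (ha.comp measurable_snd)

theorem measurable_offDiagEntry (i : Fin 2) {D a : ℝ → ℝ} (hD : Measurable D) (ha : Measurable a)
    {f : ℝ × ℝ → ℝ} (hf : Measurable f) : Measurable (S.offDiagEntry i D a f) := by
  have hm : Measurable fun c => S.diagPlace (charSign i * c) :=
    S.continuous_diagPlace.measurable.comp (measurable_const.mul measurable_id)
  exact (measurable_kernelTransport i (1 - i) hm (hD.comp hm)
    (hf.mul (ha.comp measurable_snd))).indicator measurableSet_kernelTriangle

theorem abs_diagEntry_le {m : ℝ} (hm : 0 < m) (hmS : ∀ i z, m ≤ S.speed i z) (i : Fin 2) (κ : ℝ)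
    {a : ℝ → ℝ} {α γ : ℝ} (ha : ∀ z, |a z| ≤ α) (hγ : 0 ≤ γ) {f : ℝ × ℝ → ℝ} {C : ℝ} (hC : 0 ≤ C)
    (hf : ∀ q, |f q| ≤ C * S.kernelWeight i γ q) (q : ℝ × ℝ) :
    |S.diagEntry i κ a f q| ≤ m⁻¹ * (|κ| + α) * C * S.kernelWeight i γ q := by
  by_cases hq : q ∈ kernelTriangle
  swap
  · simp [diagEntry, kernelWeight, indicator_of_notMem hq]
  have hα : 0 ≤ α := (abs_nonneg _).trans (ha 0)
  rw [diagEntry, kernelWeight, indicator_of_mem hq, indicator_of_mem hq, kernelTransport, abs_mul]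
  set W := Real.exp (γ * S.travel i q.1) with hW
  have hfW : ∀ p : ℝ × ℝ, S.travel i p.1 ≤ S.travel i q.1 → |f p| ≤ C * W := fun p hp =>
    (hf p).trans (mul_le_mul_of_nonneg_left ((kernelWeight_le i γ p).trans
      (Real.exp_le_exp.2 (mul_le_mul_of_nonneg_left hp hγ))) hC)
  have h1 : |(S.speed i q.2)⁻¹| ≤ m⁻¹ := by
    rw [abs_of_pos (inv_pos.2 (S.speed_pos _ _))]; exact inv_anti₀ hm (hmS _ _)
  have h2 : |κ * f (S.place i (charSign i * S.kernelLabel i i q), 0)| ≤ |κ| * (C * W) := by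
    rw [abs_mul]
    refine mul_le_mul_of_nonneg_left (hfW _ ?_) (abs_nonneg _)
    rw [travel_place, kernelLabel]
    have h0 := S.travel_nonneg i hq.1
    have e : charSign i * (charSign i * S.travel i q.1 - charSign i * S.travel i q.2) =
        S.travel i q.1 - S.travel i q.2 := by
      linear_combination (S.travel i q.1 - S.travel i q.2) * charSign_mul_self i
    rw [e]
    linarith
  have h3 : |charSign i * ∫ r in (0 : ℝ)..q.2, f (S.kernelChar i i (S.kernelLabel i i q) r, r) * a r| ≤
      α * (C * W) := by
    rw [abs_mul, abs_charSign, one_mul]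
    have hb := intervalIntegral.norm_integral_le_of_norm_le_const
      (f := fun r => f (S.kernelChar i i (S.kernelLabel i i q) r, r) * a r) (a := 0) (b := q.2)
      (C := α * (C * W)) fun r hr => by
        rw [uIoc_of_le hq.1] at hr
        rw [Real.norm_eq_abs, abs_mul, mul_comm]
        refine mul_le_mul (ha r) (hfW _ ?_) (abs_nonneg _) hα
        rw [travel_kernelChar_self]
        linarith [(S.strictMono_travel i).monotone hr.2]
    rw [sub_zero, abs_of_nonneg hq.1] at hb
    exact hb.trans (mul_le_of_le_one_right (by positivity) (hq.2.1.trans hq.2.2))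
  calc _ ≤ m⁻¹ * (|κ| * (C * W) + α * (C * W)) :=
        mul_le_mul h1 ((abs_add_le _ _).trans (add_le_add h2 h3)) (abs_nonneg _) (inv_pos.2 hm).le
    _ = _ := by ring

theorem abs_offDiagEntry_le {m M : ℝ} (hm : 0 < m) (hM0 : 0 < M) (hmS : ∀ i z, m ≤ S.speed i z)
    (hM : ∀ i z, S.speed i z ≤ M) (i : Fin 2) {D a : ℝ → ℝ} {α γ δ : ℝ} (ha : ∀ z, |a z| ≤ α)
    (hD : ∀ z, |D z| ≤ δ) (hγ : 0 < γ) {f : ℝ × ℝ → ℝ} {C : ℝ} (hC : 0 ≤ C)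
    (hf : ∀ q, |f q| ≤ C * S.kernelWeight i γ q) (q : ℝ × ℝ) :
    |S.offDiagEntry i D a f q| ≤ m⁻¹ * (δ + α * C * (M / γ)) * S.kernelWeight i γ q := by
  by_cases hq : q ∈ kernelTriangle
  swap
  · simp [offDiagEntry, kernelWeight, indicator_of_notMem hq]
  have hα : 0 ≤ α := (abs_nonneg _).trans (ha 0)
  have hδ : 0 ≤ δ := (abs_nonneg _).trans (hD 0)
  rw [offDiagEntry, kernelWeight, indicator_of_mem hq, indicator_of_mem hq, kernelTransport, abs_mul]
  set W := Real.exp (γ * S.travel i q.1) with hW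
  have hW1 : 1 ≤ W := Real.one_le_exp (mul_nonneg hγ.le (S.travel_nonneg i (hq.1.trans hq.2.1)))
  have h1 : |(S.speed (1 - i) q.2)⁻¹| ≤ m⁻¹ := by
    rw [abs_of_pos (inv_pos.2 (S.speed_pos _ _))]; exact inv_anti₀ hm (hmS _ _)
  set c := S.kernelLabel i (1 - i) q with hc
  have hlab : charSign i * c = S.travel i q.1 + S.travel (1 - i) q.2 := by
    rw [hc, kernelLabel, charSign_sub]
    linear_combination (S.travel i q.1 + S.travel (1 - i) q.2) * charSign_mul_self i
  set d := S.diagPlace (charSign i * c) with hd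
  have hqd : q.2 ≤ d := by
    have h0 : S.travel i q.2 + S.travel (1 - i) q.2 ≤ charSign i * c := by
      rw [hlab]; linarith [(S.strictMono_travel i).monotone hq.2.1]
    rw [travel_add_travel_other] at h0
    simpa only [diagPlace_travel] using S.monotone_diagPlace h0
  have h3 : |charSign (1 - i) * ∫ r in d..q.2, f (S.kernelChar i (1 - i) c r, r) * a r| ≤
      α * C * W * (M / γ) := by
    rw [abs_mul, abs_charSign, one_mul, intervalIntegral.integral_symm, abs_neg]
    have hb := intervalIntegral.norm_integral_le_of_norm_le (μ := volume) hqd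
      (f := fun r => f (S.kernelChar i (1 - i) c r, r) * a r)
      (g := fun r => α * C * W * Real.exp (-(γ / M) * (r - q.2))) (Filter.Eventually.of_forall
      fun r hr => by
        rw [Real.norm_eq_abs, abs_mul, mul_comm]
        have e1 : |f (S.kernelChar i (1 - i) c r, r)| ≤
            C * (W * Real.exp (-(γ / M) * (r - q.2))) := by
          refine (hf _).trans (mul_le_mul_of_nonneg_left ((kernelWeight_le i γ _).trans ?_) hC)
          rw [hW, ← Real.exp_add, hc, travel_kernelChar_other]
          refine Real.exp_le_exp.2 ?_
          have h5 := mul_le_mul_of_nonneg_left (S.travel_sub_le hM (1 - i) hr.1.le) hγ.le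
          have h6 : γ * ((r - q.2) / M) = γ / M * (r - q.2) := by ring
          linarith
        calc _ ≤ α * (C * (W * Real.exp (-(γ / M) * (r - q.2)))) :=
              mul_le_mul (ha r) e1 (abs_nonneg _) hα
          _ = _ := by ring) (by apply Continuous.intervalIntegrable; fun_prop)
    refine hb.trans ?_
    rw [intervalIntegral.integral_const_mul]
    refine mul_le_mul_of_nonneg_left ?_ (by positivity)
    refine (integral_exp_neg_mul_le (by positivity) _ _).trans (le_of_eq ?_)
    field_simp
  calc _ ≤ m⁻¹ * (δ + α * C * W * (M / γ)) :=
        mul_le_mul h1 ((abs_add_le _ _).trans (add_le_add (hD _) h3)) (abs_nonneg _) (inv_pos.2 hm).le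
    _ ≤ m⁻¹ * (δ * W + α * C * W * (M / γ)) := by
        have := inv_pos.2 hm
        gcongr
        exact le_mul_of_one_le_right hδ hW1
    _ = _ := by ring

theorem abs_mul_le_of_kernelWeight {i : Fin 2} {γ : ℝ} (hγ : 0 ≤ γ) {f : ℝ × ℝ → ℝ} {a : ℝ → ℝ}
    {C α : ℝ} (hf : ∀ q, |f q| ≤ C * S.kernelWeight i γ q) (ha : ∀ z, |a z| ≤ α) (q : ℝ × ℝ) :
    |f q * a q.2| ≤ |C| * Real.exp (γ * S.travel i 1) * α := by
  rw [abs_mul]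
  refine mul_le_mul ((hf q).trans ?_) (ha _) (abs_nonneg _) (by positivity)
  exact mul_le_mul (le_abs_self C) (kernelWeight_le_const i hγ q) (kernelWeight_nonneg i γ q)
    (abs_nonneg _)

/-- Existence of a row of the kernel. -/
theorem exists_kernel_row (i : Fin 2) (κ : ℝ) {D a₀ a₁ : ℝ → ℝ} (hD : Measurable D)
    (ha₀ : Measurable a₀) (ha₁ : Measurable a₁) {δ α : ℝ} (hDδ : ∀ z, |D z| ≤ δ)
    (hα₀ : ∀ z, |a₀ z| ≤ α) (hα₁ : ∀ z, |a₁ z| ≤ α) :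
    ∃ f₀ f₁ : ℝ × ℝ → ℝ, Measurable f₀ ∧ Measurable f₁ ∧ (∃ C, ∀ q, |f₀ q| ≤ C ∧ |f₁ q| ≤ C) ∧
      f₀ = S.diagEntry i κ a₀ f₁ ∧ f₁ = S.offDiagEntry i D a₁ f₀ := by
  obtain ⟨m, M, hm, hM, hsp⟩ := S.exists_speed_bounds
  have hα : 0 ≤ α := (abs_nonneg _).trans (hα₀ 0)
  have hmi := inv_pos.2 hm
  set μ := m⁻¹ * (|κ| + α) with hμ
  have hμ0 : 0 ≤ μ := by positivity
  set γ := 2 * (m⁻¹ * (α * μ * M)) + 1 with hγ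
  have hγ0 : 0 < γ := by positivity
  have hA : ∀ {f : ℝ × ℝ → ℝ} {C : ℝ}, 0 ≤ C → (∀ q, |f q| ≤ C * S.kernelWeight i γ q) → ∀ q,
      |S.diagEntry i κ a₀ f q| ≤ μ * C * S.kernelWeight i γ q := fun hC hf q =>
    abs_diagEntry_le hm (fun i z => (hsp i z).1) i κ hα₀ hγ0.le hC hf q
  have hB : ∀ {D : ℝ → ℝ} {δ : ℝ} {f : ℝ × ℝ → ℝ} {C : ℝ}, (∀ z, |D z| ≤ δ) → 0 ≤ C →
      (∀ q, |f q| ≤ C * S.kernelWeight i γ q) → ∀ q,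
      |S.offDiagEntry i D a₁ f q| ≤ m⁻¹ * (δ + α * C * (M / γ)) * S.kernelWeight i γ q :=
    fun hD hC hf q => abs_offDiagEntry_le hm hM (fun i z => (hsp i z).1) (fun i z => (hsp i z).2) i
      hα₁ hD hγ0 hC hf q
  have habs : ∀ {f : ℝ × ℝ → ℝ} {C : ℝ}, (∀ q, |f q| ≤ C * S.kernelWeight i γ q) → ∀ q,
      |f q| ≤ |C| * S.kernelWeight i γ q := fun hf q => (hf q).trans
    (mul_le_mul_of_nonneg_right (le_abs_self _) (kernelWeight_nonneg i γ q))
  refine Exists.elim (exists_measurable_fixedPoint (fun _ : Unit => S.kernelWeight i γ)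
    (fun _ q => kernelWeight_nonneg i γ q)
    (fun f _ => S.offDiagEntry i D a₁ (S.diagEntry i κ a₀ (f ()))) ?_ ?_)
    fun f ⟨hfm, ⟨C, hC⟩, hfix⟩ => ?_
  · intro f hf ⟨C, hC⟩
    refine ⟨fun _ => measurable_offDiagEntry i hD ha₁ (measurable_diagEntry i κ ha₀ (hf ())),
      _, fun _ q => hB hDδ (by positivity) (hA (abs_nonneg C) (habs (hC ()))) q⟩
  · intro f f' hf hf' ⟨C, hC⟩ ⟨C', hC'⟩ E hE hd _ q
    have hdA : ∀ q, S.diagEntry i κ a₀ (f ()) q - S.diagEntry i κ a₀ (f' ()) q =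
        S.diagEntry i κ a₀ (fun q => f () q - f' () q) q := by
      intro q
      by_cases hq : q ∈ kernelTriangle
      · rw [diagEntry, diagEntry, diagEntry, indicator_of_mem hq, indicator_of_mem hq,
          indicator_of_mem hq, kernelTransport_sub i i (g := fun q => f () q * a₀ q.2)
          (g' := fun q => f' () q * a₀ q.2) ((hf ()).mul (ha₀.comp measurable_snd))
          ((hf' ()).mul (ha₀.comp measurable_snd)) (abs_mul_le_of_kernelWeight hγ0.le (hC ()) hα₀)
          (abs_mul_le_of_kernelWeight hγ0.le (hC' ()) hα₀)]
        simp only [sub_mul, mul_sub]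
      · simp [diagEntry, indicator_of_notMem hq]
    have hmA := measurable_diagEntry (S := S) i κ ha₀ (hf ())
    have hmA' := measurable_diagEntry (S := S) i κ ha₀ (hf' ())
    have hdB : S.offDiagEntry i D a₁ (S.diagEntry i κ a₀ (f ())) q -
        S.offDiagEntry i D a₁ (S.diagEntry i κ a₀ (f' ())) q =
        S.offDiagEntry i (fun _ => 0) a₁
          (fun q => S.diagEntry i κ a₀ (f ()) q - S.diagEntry i κ a₀ (f' ()) q) q := by
      by_cases hq : q ∈ kernelTriangle
      · rw [offDiagEntry, offDiagEntry, offDiagEntry, indicator_of_mem hq, indicator_of_mem hq,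
          indicator_of_mem hq, kernelTransport_sub i (1 - i)
          (g := fun q => S.diagEntry i κ a₀ (f ()) q * a₁ q.2)
          (g' := fun q => S.diagEntry i κ a₀ (f' ()) q * a₁ q.2) (hmA.mul (ha₁.comp measurable_snd))
          (hmA'.mul (ha₁.comp measurable_snd)) (abs_mul_le_of_kernelWeight hγ0.le
          (hA (abs_nonneg C) (habs (hC ()))) hα₁) (abs_mul_le_of_kernelWeight hγ0.le
          (hA (abs_nonneg C') (habs (hC' ()))) hα₁)]
        simp only [sub_mul, sub_self]
      · simp [offDiagEntry, indicator_of_notMem hq]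
    rw [hdB]
    refine (hB (δ := 0) (C := μ * E) (fun _ => by simp) (by positivity) (fun q => ?_) q).trans ?_
    · rw [hdA]; exact hA hE (hd ()) q
    · refine mul_le_mul_of_nonneg_right ?_ (kernelWeight_nonneg i γ q)
      have e : m⁻¹ * (0 + α * (μ * E) * (M / γ)) = m⁻¹ * (α * μ * M) / γ * E := by ring
      have h2 : m⁻¹ * (α * μ * M) / γ ≤ 1 / 2 := by
        rw [div_le_div_iff₀ hγ0 two_pos, hγ]; linarith
      rw [e]
      linarith [mul_le_mul_of_nonneg_right h2 hE]
  · have hC' := habs (hC ())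
    have hw := kernelWeight_le_const (S := S) i hγ0.le
    refine ⟨S.diagEntry i κ a₀ (f ()), f (), measurable_diagEntry i κ ha₀ (hfm ()), hfm (),
      ⟨(μ * |C| + |C|) * Real.exp (γ * S.travel i 1), fun q => ⟨?_, ?_⟩⟩, rfl,
      (congrFun hfix ()).symm⟩
    · refine (hA (abs_nonneg C) hC' q).trans ?_
      exact mul_le_mul (by linarith [abs_nonneg C]) (hw q) (kernelWeight_nonneg i γ q) (by positivity)
    · refine (hC' q).trans ?_
      exact mul_le_mul (by nlinarith [abs_nonneg C, mul_nonneg hμ0 (abs_nonneg C)]) (hw q)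
        (kernelWeight_nonneg i γ q) (by positivity)

end HyperbolicPDEODE

namespace HyperbolicPDEODE

variable {n : ℕ} {S : HyperbolicPDEODE n}

theorem eq_kernelChar {i j : Fin 2} {z ζ c : ℝ} (h : S.kernelLabel i j (z, ζ) = c) :
    S.kernelChar i j c ζ = z := by
  rw [← h]; exact S.kernelChar_kernelLabel i j (z, ζ)

theorem exists_isPreKernel (S : HyperbolicPDEODE n) : ∃ K, S.IsPreKernel K := by
  have hA : ∀ i j, BddMeasOn (fun z => S.Atilde z i j) (Icc 0 1) := bddMeasOn_Atilde
  have hlam : ∀ i : Fin 2, 0 < S.lam i 0 := fun i => S.lam_pos i 0 zero_mem_Icc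
  set κ : Fin 2 → ℝ := ![S.q0 * S.lam 1 0 / S.lam 0 0, S.lam 0 0 / (S.q0 * S.lam 1 0)] with hκ
  have hdiag : ∀ i : Fin 2, BddMeasOn (fun z => -(charSign i * (S.Atilde z i (1 - i) /
      (S.lam 0 z + S.lam 1 z))) * S.lam (1 - i) z) (Icc 0 1) := fun i => by
    have h1 : BddMeasOn (fun z => (S.lam 0 z + S.lam 1 z)⁻¹) (Icc 0 1) :=
      BddMeasOn.of_continuousOn (((S.lam_cont 0).add (S.lam_cont 1)).inv₀ fun z hz =>
        (add_pos (S.lam_pos 0 z hz) (S.lam_pos 1 z hz)).ne') isCompact_Icc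
    exact ((((hA i (1 - i)).mul h1).const_mul (charSign i)).neg).mul (bddMeasOn_lam (1 - i))
  choose hAm CA hCA using fun i j => (hA i j).indicator measurableSet_Icc
  choose hDm CD hCD using fun i => (hdiag i).indicator measurableSet_Icc
  set α := ∑ i, ∑ j, |CA i j| with hα
  have hCAα : ∀ i j z, |(Icc (0 : ℝ) 1).indicator (fun z => S.Atilde z i j) z| ≤ α := by
    refine fun i j z => (hCA i j z).trans ((le_abs_self _).trans ?_)
    refine (Finset.single_le_sum (f := fun j => |CA i j|) (fun _ _ => abs_nonneg _)
      (Finset.mem_univ j)).trans ?_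
    exact Finset.single_le_sum (f := fun i => ∑ j, |CA i j|)
      (fun _ _ => Finset.sum_nonneg fun _ _ => abs_nonneg _) (Finset.mem_univ i)
  choose f₀ f₁ hm₀ hm₁ hb he₀ he₁ using fun i => exists_kernel_row (S := S) i (S.speed i 0 * κ i)
    (hDm i) (hAm (1 - i) i) (hAm i (1 - i)) (hCD i) (hCAα (1 - i) i) (hCAα i (1 - i))
  choose C hC using hb
  set K : ℝ → ℝ → Matrix (Fin 2) (Fin 2) ℝ := fun z ζ => Matrix.of fun i j =>
    if j = i then f₀ i (z, ζ) else f₁ i (z, ζ) with hK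
  have hne : ∀ i : Fin 2, 1 - i ≠ i := by decide
  have hKs : ∀ i z ζ, K z ζ i i = f₀ i (z, ζ) := fun i z ζ => by simp [hK]
  have hKo : ∀ i z ζ, K z ζ i (1 - i) = f₁ i (z, ζ) := fun i z ζ => by simp [hK, hne i]
  have hj : ∀ i j : Fin 2, j = i ∨ j = 1 - i := by decide
  have hms : ∀ i z ζ, (K z ζ * S.Atilde ζ) i i = f₁ i (z, ζ) * S.Atilde ζ (1 - i) i := fun i z ζ => by
    rw [← hKo]
    fin_cases i <;> simp [Matrix.mul_apply, Fin.sum_univ_two, Atilde]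
  have hmo : ∀ i z ζ, (K z ζ * S.Atilde ζ) i (1 - i) = f₀ i (z, ζ) * S.Atilde ζ i (1 - i) :=
    fun i z ζ => by
    rw [← hKs]
    fin_cases i <;> simp [Matrix.mul_apply, Fin.sum_univ_two, Atilde]
  have hbg : ∀ (i : Fin 2) {g : ℝ × ℝ → ℝ} (i' j' : Fin 2), (∀ q, |g q| ≤ C i) → ∀ q : ℝ × ℝ,
      |g q * (Icc (0 : ℝ) 1).indicator (fun z => S.Atilde z i' j') q.2| ≤ C i * α :=
    fun i g i' j' hg q => by
      rw [abs_mul]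
      exact mul_le_mul (hg q) (hCAα i' j' _) (abs_nonneg _) ((abs_nonneg _).trans (hg q))
  have hmg : ∀ {g : ℝ × ℝ → ℝ} (i' j' : Fin 2), Measurable g → Measurable fun q : ℝ × ℝ =>
      g q * (Icc (0 : ℝ) 1).indicator (fun z => S.Atilde z i' j') q.2 := fun i' j' hg =>
    hg.mul ((hAm i' j').comp measurable_snd)
  have hent : ∀ i, ∀ z ∈ Icc (0 : ℝ) 1, K z z i (1 - i) =
      -(charSign i * (S.Atilde z i (1 - i) / (S.lam 0 z + S.lam 1 z))) := by
    intro i z hz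
    have hq : (z, z) ∈ kernelTriangle := ⟨hz.1, le_rfl, hz.2⟩
    have e : charSign i * S.kernelLabel i (1 - i) (z, z) = S.travel 0 z + S.travel 1 z := by
      rw [kernelLabel, charSign_sub, ← travel_add_travel_other i]
      linear_combination (S.travel i z + S.travel (1 - i) z) * charSign_mul_self i
    rw [hKo, he₁ i, offDiagEntry, indicator_of_mem hq, kernelTransport, e, diagPlace_travel,
      intervalIntegral.integral_same, mul_zero, add_zero, indicator_of_mem hz, S.speed_eq _ hz]
    have := (S.lam_pos (1 - i) z hz).ne'
    field_simp
  have hbc : ∀ i, ∀ z ∈ Icc (0 : ℝ) 1, K z 0 i i = κ i * K z 0 i (1 - i) := by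
    intro i z hz
    have hq : (z, 0) ∈ kernelTriangle := ⟨le_rfl, hz.1, hz.2⟩
    have e : charSign i * S.kernelLabel i i (z, 0) = S.travel i z := by
      rw [kernelLabel, travel_zero, mul_zero, sub_zero, ← mul_assoc, charSign_mul_self, one_mul]
    rw [hKo, hKs, he₀ i, diagEntry, indicator_of_mem hq, kernelTransport, e, place_travel,
      intervalIntegral.integral_same, mul_zero, add_zero]
    have := (S.speed_pos i 0).ne'
    field_simp
  refine ⟨K, ⟨fun i j => ?_, ?_, ?_⟩, ?_, ?_, ?_, ?_⟩
  · refine measurable_domRestrict_congr (f := fun p => K p.1 p.2 i j) ?_ fun _ _ => rfl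
    rcases hj i j with rfl | rfl
    · simp only [hKs]; exact hm₀ j
    · simp only [hKo]; exact hm₁ i
  · refine ⟨∑ i, |C i|, fun i j p _ => ?_⟩
    have h1 : C i ≤ ∑ i, |C i| := (le_abs_self _).trans
      (Finset.single_le_sum (f := fun i => |C i|) (fun _ _ => abs_nonneg _) (Finset.mem_univ i))
    rcases hj i j with rfl | rfl
    · rw [hKs]; exact ((hC j p).1).trans h1
    · rw [hKo]; exact ((hC i p).2).trans h1
  · intro i j ζ₀ ζ₁ Z hζ hZ
    have hZ0 := hZ ζ₀ (left_mem_Icc.2 hζ)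
    have hZ1 := hZ ζ₁ (right_mem_Icc.2 hζ)
    have hlab : ∀ ζ ∈ Icc ζ₀ ζ₁, S.kernelLabel i j (Z ζ, ζ) = S.kernelLabel i j (Z ζ₀, ζ₀) := by
      intro ζ h
      obtain ⟨h1, h2⟩ := hZ ζ h
      have e := kernelTriangle.mem_Icc h1
      have e0 := kernelTriangle.mem_Icc hZ0.1
      rwa [S.phi_eq_travel i e.1, S.phi_eq_travel j e.2, S.phi_eq_travel i e0.1,
        S.phi_eq_travel j e0.2] at h2
    have hchar : ∀ ζ ∈ Icc ζ₀ ζ₁,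
        S.kernelChar i j (S.kernelLabel i j (Z ζ₀, ζ₀)) ζ = Z ζ := fun ζ h => eq_kernelChar (hlab ζ h)
    have hind : ∀ i' j', ∀ ζ ∈ Icc ζ₀ ζ₁,
        (Icc (0 : ℝ) 1).indicator (fun z => S.Atilde z i' j') ζ = S.Atilde ζ i' j' :=
      fun i' j' ζ h => indicator_of_mem (kernelTriangle.mem_Icc (hZ ζ h).1).2 _
    rw [← S.speed_eq j (kernelTriangle.mem_Icc hZ0.1).2, ← S.speed_eq j
      (kernelTriangle.mem_Icc hZ1.1).2]
    rcases hj i j with rfl | rfl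
    · have key := kernelTransport_along (S := S) j j (p := fun _ => 0)
        (ent := fun c => S.speed j 0 * κ j * f₁ j (S.place j (charSign j * c), 0))
        (hmg (1 - j) j (hm₁ j)) (hbg j (1 - j) j fun q => (hC j q).2)
        (hlab ζ₁ (right_mem_Icc.2 hζ))
      rw [hKs, hKs, he₀ j, diagEntry, indicator_of_mem hZ1.1, indicator_of_mem hZ0.1]
      rw [key]
      congr 2
      refine intervalIntegral.integral_congr fun ζ h => ?_
      rw [uIcc_of_le hζ] at h
      simp only [hms, hchar ζ h, hind _ _ ζ h]
    · have key := kernelTransport_along (S := S) i (1 - i)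
        (p := fun c => S.diagPlace (charSign i * c))
        (ent := fun c => (Icc (0 : ℝ) 1).indicator (fun z => -(charSign i * (S.Atilde z i (1 - i) /
          (S.lam 0 z + S.lam 1 z))) * S.lam (1 - i) z) (S.diagPlace (charSign i * c)))
        (hmg i (1 - i) (hm₀ i)) (hbg i i (1 - i) fun q => (hC i q).1)
        (hlab ζ₁ (right_mem_Icc.2 hζ))
      rw [hKo, hKo, he₁ i, offDiagEntry, indicator_of_mem hZ1.1, indicator_of_mem hZ0.1]
      rw [key]
      congr 2
      refine intervalIntegral.integral_congr fun ζ h => ?_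
      rw [uIcc_of_le hζ] at h
      simp only [hmo, hchar ζ h, hind _ _ ζ h]
  · intro z hz; simpa [hκ] using hbc 0 z hz
  · intro z hz; simpa [charSign] using hent 0 z hz
  · intro z hz; simpa [charSign] using hent 1 z hz
  · intro z hz; simpa [hκ] using hbc 1 z hz

end HyperbolicPDEODE

namespace HyperbolicPDEODE

variable {n : ℕ} {S : HyperbolicPDEODE n}

/-! ### Estimates for the transformations of the state -/

/-- The sum of the absolute values of the components at a place. -/
def absSum (w : ℝ → Fin 2 → ℝ) (z : ℝ) : ℝ := |w z 0| + |w z 1|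

/-- The norm of a state in `L¹(0,1)²`. -/
def mass (w : ℝ → Fin 2 → ℝ) : ℝ := ∫ z in (0 : ℝ)..1, absSum w z

/-- The sum of the absolute values of the entries of a vector. -/
def absTotal (ξ : Fin n → ℝ) : ℝ := ∑ m, |ξ m|

theorem absSum_nonneg (w : ℝ → Fin 2 → ℝ) (z : ℝ) : 0 ≤ absSum w z :=
  add_nonneg (abs_nonneg _) (abs_nonneg _)

theorem abs_le_absSum (w : ℝ → Fin 2 → ℝ) (z : ℝ) (i : Fin 2) : |w z i| ≤ absSum w z := by
  have h0 := abs_nonneg (w z 0)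
  have h1 := abs_nonneg (w z 1)
  rw [absSum]
  fin_cases i
  · exact le_add_of_nonneg_right h1
  · exact le_add_of_nonneg_left h0

theorem mass_nonneg (w : ℝ → Fin 2 → ℝ) : 0 ≤ mass w :=
  intervalIntegral.integral_nonneg zero_le_one fun z _ => absSum_nonneg w z

theorem absTotal_nonneg (ξ : Fin n → ℝ) : 0 ≤ absTotal ξ := Finset.sum_nonneg fun _ _ => abs_nonneg _

theorem IsBddState.absSum {w : ℝ → Fin 2 → ℝ} (hw : IsBddState w) :
    BddMeasOn (absSum w) (Icc 0 1) := (hw 0).abs.add (hw 1).abs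

theorem IsBddState.intervalIntegrable_absSum {w : ℝ → Fin 2 → ℝ} (hw : IsBddState w) {z : ℝ}
    (hz : z ∈ Icc (0 : ℝ) 1) : IntervalIntegrable (HyperbolicPDEODE.absSum w) volume 0 z :=
  hw.absSum.intervalIntegrable (uIcc_subset_Icc' zero_mem_Icc hz)

theorem IsBddState.integral_absSum_le_mass {w : ℝ → Fin 2 → ℝ} (hw : IsBddState w) {z : ℝ}
    (hz : z ∈ Icc (0 : ℝ) 1) : ∫ ζ in (0 : ℝ)..z, HyperbolicPDEODE.absSum w ζ ≤ mass w :=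
  intervalIntegral.integral_mono_interval le_rfl hz.1 hz.2
    (Filter.Eventually.of_forall fun _ => absSum_nonneg w _)
    (hw.intervalIntegrable_absSum one_mem_Icc)

theorem mass_mono {w : ℝ → Fin 2 → ℝ} (hw : IsBddState w) {g : ℝ → ℝ}
    (hg : IntervalIntegrable g volume 0 1) (h : ∀ z ∈ Icc (0 : ℝ) 1, absSum w z ≤ g z) :
    mass w ≤ ∫ z in (0 : ℝ)..1, g z :=
  intervalIntegral.integral_mono_on zero_le_one (hw.intervalIntegrable_absSum one_mem_Icc) hg h

theorem IsBddState.add_const_mul {w w' : ℝ → Fin 2 → ℝ} (hw : IsBddState w) (hw' : IsBddState w')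
    (a : ℝ) : IsBddState (w + a • w') := fun i => (hw i).add ((hw' i).const_mul a)

/-- A common bound for the entries of a matrix function. -/
theorem exists_entry_bound {α : Type*} [MeasurableSpace α] {ι κ : Type*} [Finite ι] [Finite κ]
    {Q : α → Matrix ι κ ℝ} {s : Set α} (hQ : ∀ i j, BddMeasOn (fun p => Q p i j) s) :
    ∃ C, 0 ≤ C ∧ ∀ p ∈ s, ∀ i j, |Q p i j| ≤ C := by
  cases nonempty_fintype ι
  cases nonempty_fintype κ
  choose C hC using fun i j => (hQ i j).bdd
  refine ⟨∑ i, ∑ j, |C i j|, Finset.sum_nonneg fun _ _ => Finset.sum_nonneg fun _ _ => abs_nonneg _,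
    fun p hp i j => (hC i j p hp).trans ((le_abs_self _).trans ?_)⟩
  exact (Finset.single_le_sum (f := fun j => |C i j|) (fun _ _ => abs_nonneg _)
    (Finset.mem_univ j)).trans (Finset.single_le_sum (f := fun i => ∑ j, |C i j|)
      (fun _ _ => Finset.sum_nonneg fun _ _ => abs_nonneg _) (Finset.mem_univ i))

theorem exists_volterraTransform_sub_le {Q : ℝ → ℝ → Matrix (Fin 2) (Fin 2) ℝ}
    (hQ : ∀ i j, BddMeasOn (fun p : ℝ × ℝ => Q p.1 p.2 i j) kernelTriangle) :
    ∃ C, 0 ≤ C ∧ ∀ w, IsBddState w → ∀ z ∈ Icc (0 : ℝ) 1, ∀ i,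
      |volterraTransform Q w z i - w z i| ≤ C * ∫ ζ in (0 : ℝ)..z, absSum w ζ := by
  obtain ⟨C, hC0, hC⟩ := exists_entry_bound (Q := fun p : ℝ × ℝ => Q p.1 p.2) hQ
  refine ⟨C, hC0, fun w hw z hz i => ?_⟩
  rw [volterraTransform, sub_sub_cancel_left, abs_neg, ← intervalIntegral.integral_const_mul]
  refine (intervalIntegral.abs_integral_le_integral_abs hz.1).trans ?_
  refine intervalIntegral.integral_mono_on hz.1
    ((bddMeasOn_mulVec hQ hw hz i).abs.intervalIntegrable (uIcc_of_le hz.1).le)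
    ((hw.intervalIntegrable_absSum hz).const_mul C) fun ζ hζ => ?_
  have hm := hC _ (mem_kernelTriangle hz hζ)
  rw [mulVec_two, Fin.sum_univ_two, absSum, mul_add]
  refine (abs_add_le _ _).trans (add_le_add ?_ ?_)
  · rw [abs_mul]; exact mul_le_mul_of_nonneg_right (hm i 0) (abs_nonneg _)
  · rw [abs_mul]; exact mul_le_mul_of_nonneg_right (hm i 1) (abs_nonneg _)

theorem exists_absSum_le_volterraTransform {Q : ℝ → ℝ → Matrix (Fin 2) (Fin 2) ℝ}
    (hQ : ∀ i j, BddMeasOn (fun p : ℝ × ℝ => Q p.1 p.2 i j) kernelTriangle) :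
    ∃ C, 0 ≤ C ∧ ∀ w, IsBddState w → ∀ z ∈ Icc (0 : ℝ) 1,
      absSum w z ≤ absSum (volterraTransform Q w) z + C * mass (volterraTransform Q w) := by
  obtain ⟨C, hC0, hC⟩ := exists_volterraTransform_sub_le hQ
  refine ⟨2 * C * Real.exp (2 * C), by positivity, fun w hw => ?_⟩
  have hv : IsBddState (volterraTransform Q w) := bddMeasOn_volterraTransform hQ hw
  refine le_of_volterra_le (by positivity) (hw.intervalIntegrable_absSum one_mem_Icc)
    (hv.intervalIntegrable_absSum one_mem_Icc) (fun z _ => absSum_nonneg _ z) fun z hz => ?_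
  have key : ∀ i, |w z i| ≤ |volterraTransform Q w z i| + C * ∫ ζ in (0 : ℝ)..z, absSum w ζ := by
    intro i
    have h1 := hC w hw z hz i
    have h2 := abs_sub_abs_le_abs_sub (w z i) (volterraTransform Q w z i)
    rw [abs_sub_comm] at h2
    linarith
  rw [absSum, absSum]
  linarith [key 0, key 1]

theorem exists_tilde_bounds (S : HyperbolicPDEODE n) :
    ∃ C, 1 ≤ C ∧ ∀ (w : ℝ → Fin 2 → ℝ), ∀ z ∈ Icc (0 : ℝ) 1,
      absSum (S.tilde w) z ≤ C * absSum w z ∧ absSum w z ≤ C * absSum (S.tilde w) z := by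
  have h : ∀ (i : Fin 2) (a : ℝ), ∃ C, ∀ z ∈ Icc (0 : ℝ) 1, Real.exp (a * S.alpha i z) ≤ C :=
    fun i a => (bddMeasOn_scaling (S := S) i a).bdd.imp fun C hC z hz => (le_abs_self _).trans (hC z hz)
  choose G hG using h
  set C := 1 + ∑ i : Fin 2, (|G i 1| + |G i (-1)|) with hCdef
  have hCG : ∀ i, |G i 1| ≤ C ∧ |G i (-1)| ≤ C := by
    intro i
    rw [hCdef, Fin.sum_univ_two]
    have := fun i a => abs_nonneg (G i a)
    fin_cases i <;> constructor <;> simp only [Fin.zero_eta, Fin.mk_one] <;>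
      linarith [this 0 1, this 0 (-1), this 1 1, this 1 (-1)]
  have hC1 : 1 ≤ C := le_add_of_nonneg_right (Finset.sum_nonneg fun i _ => by positivity)
  have hexp : ∀ i, ∀ z ∈ Icc (0 : ℝ) 1, Real.exp (charSign i * S.alpha i z) ≤ C ∧
      Real.exp (-(charSign i * S.alpha i z)) ≤ C := by
    intro i z hz
    have h1 := (hG i 1 z hz).trans ((le_abs_self _).trans (hCG i).1)
    have h2 := (hG i (-1) z hz).trans ((le_abs_self _).trans (hCG i).2)
    rcases charSign_cases i with h | h <;> rw [h]
    · exact ⟨h1, by rwa [← neg_mul]⟩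
    · exact ⟨h2, by rwa [← neg_mul, neg_neg]⟩
  refine ⟨C, hC1, fun w z hz => ?_⟩
  have k1 : ∀ i, |S.tilde w z i| ≤ C * |w z i| := fun i => by
    rw [tilde_apply, abs_mul, Real.abs_exp]
    exact mul_le_mul_of_nonneg_right (hexp i z hz).1 (abs_nonneg _)
  have k2 : ∀ i, |w z i| ≤ C * |S.tilde w z i| := fun i => by
    have : w z i = Real.exp (-(charSign i * S.alpha i z)) * S.tilde w z i := by
      rw [tilde_apply, ← mul_assoc, ← Real.exp_add]; simp
    conv_lhs => rw [this]
    rw [abs_mul, Real.abs_exp]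
    exact mul_le_mul_of_nonneg_right (hexp i z hz).2 (abs_nonneg _)
  rw [absSum, absSum, mul_add, mul_add]
  exact ⟨add_le_add (k1 0) (k1 1), add_le_add (k2 0) (k2 1)⟩

section

variable {K P : ℝ → ℝ → Matrix (Fin 2) (Fin 2) ℝ} {N : ℝ → Matrix (Fin 2) (Fin n) ℝ}
  {k : Fin n → ℝ} {qcl : ℝ}

theorem IsDecoupling.exists_mulVec_le (hN : S.IsDecoupling k K N) :
    ∃ C, 0 ≤ C ∧ ∀ ξ, ∀ z ∈ Icc (0 : ℝ) 1, ∀ i, |(N z *ᵥ ξ) i| ≤ C * absTotal ξ := by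
  obtain ⟨C, hC0, hC⟩ := exists_entry_bound (Q := N) hN.bddMeasOn
  refine ⟨C, hC0, fun ξ z hz i => ?_⟩
  have e : (N z *ᵥ ξ) i = ∑ m, N z i m * ξ m := rfl
  rw [e, absTotal, Finset.mul_sum]
  refine (Finset.abs_sum_le_sum_abs (fun m => N z i m * ξ m) _).trans
    (Finset.sum_le_sum fun m _ => ?_)
  rw [abs_mul]
  exact mul_le_mul_of_nonneg_right (hC z hz i m) (abs_nonneg _)

theorem IsBddState.tilde {w : ℝ → Fin 2 → ℝ} (hw : IsBddState w) : IsBddState (S.tilde w) :=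
  bddMeasOn_tilde hw

theorem IsBddState.target (hK : S.IsPreKernel K) (hN : S.IsDecoupling k K N)
    (hP : S.IsBacksteppingKernel N P) {w : ℝ → Fin 2 → ℝ} (hw : IsBddState w) (ξ : Fin n → ℝ) :
    IsBddState (S.target K P N w ξ) :=
  bddMeasOn_volterraTransform hP.bddMeasOn (hw.decoupled hK hN ξ)

theorem mass_le_mul {w w' : ℝ → Fin 2 → ℝ} (hw : IsBddState w) (hw' : IsBddState w') {a b : ℝ}
    (h : ∀ z ∈ Icc (0 : ℝ) 1, absSum w z ≤ a * absSum w' z + b) : mass w ≤ a * mass w' + b := by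
  refine (mass_mono hw (((hw'.intervalIntegrable_absSum one_mem_Icc).const_mul a).add
    (_root_.intervalIntegrable_const (c := b))) h).trans ?_
  rw [intervalIntegral.integral_add ((hw'.intervalIntegrable_absSum one_mem_Icc).const_mul a)
    _root_.intervalIntegrable_const, intervalIntegral.integral_const_mul]
  simp [mass]

/-- The target state differs from the scaled state by terms without point values of the state. -/
theorem exists_target_sub_tilde_le (hK : S.IsPreKernel K) (hN : S.IsDecoupling k K N)
    (hP : S.IsBacksteppingKernel N P) :
    ∃ C, 0 ≤ C ∧ ∀ w, IsBddState w → ∀ ξ, ∀ z ∈ Icc (0 : ℝ) 1, ∀ i,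
      |S.target K P N w ξ z i - S.tilde w z i| ≤ C * (mass w + absTotal ξ) := by
  obtain ⟨C1, h10, h1⟩ := exists_volterraTransform_sub_le hK.bddMeasOn
  obtain ⟨C2, h20, h2⟩ := exists_volterraTransform_sub_le hP.bddMeasOn
  obtain ⟨C3, h30, h3⟩ := hN.exists_mulVec_le
  obtain ⟨C4, h41, h4⟩ := S.exists_tilde_bounds
  refine ⟨C1 * C4 + C3 + C2 * (C4 + 2 * (C1 * C4 + C3)), by positivity, fun w hw ξ => ?_⟩
  set R := mass w + absTotal ξ with hR
  have hm0 := mass_nonneg w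
  have hX0 := absTotal_nonneg ξ
  have hR0 : 0 ≤ R := add_nonneg hm0 hX0
  have mt : mass (S.tilde w) ≤ C4 * R := by
    have := mass_le_mul (hw.tilde (S := S)) hw (a := C4) (b := 0) fun z hz => by
      rw [add_zero]; exact (h4 w z hz).1
    rw [add_zero] at this
    exact this.trans (mul_le_mul_of_nonneg_left (le_add_of_nonneg_right hX0) (by positivity))
  have d : ∀ z ∈ Icc (0 : ℝ) 1, ∀ i,
      |S.decoupled K N w ξ z i - S.tilde w z i| ≤ (C1 * C4 + C3) * R := by
    intro z hz i
    have a1 := (h1 _ (hw.tilde (S := S)) z hz i).trans (mul_le_mul_of_nonneg_left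
      ((hw.tilde.integral_absSum_le_mass hz).trans mt) h10)
    have a2 := (h3 ξ z hz i).trans (mul_le_mul_of_nonneg_left
      (le_add_of_nonneg_left hm0 : absTotal ξ ≤ R) h30)
    rw [decoupled, Pi.sub_apply, sub_right_comm, bar_eq_volterraTransform]
    refine (abs_sub _ _).trans ?_
    linarith
  have md : mass (S.decoupled K N w ξ) ≤ (C4 + 2 * (C1 * C4 + C3)) * R := by
    have := mass_le_mul (hw.decoupled hK hN ξ) (hw.tilde (S := S)) (a := 1)
      (b := 2 * (C1 * C4 + C3) * R) fun z hz => by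
        have e : ∀ i, |S.decoupled K N w ξ z i| ≤ |S.tilde w z i| + (C1 * C4 + C3) * R := fun i => by
          have := abs_sub_abs_le_abs_sub (S.decoupled K N w ξ z i) (S.tilde w z i)
          linarith [d z hz i]
        rw [absSum, absSum]
        linarith [e 0, e 1]
    linarith
  intro z hz i
  have a1 := (h2 _ (hw.decoupled hK hN ξ) z hz i).trans (mul_le_mul_of_nonneg_left
    (((hw.decoupled hK hN ξ).integral_absSum_le_mass hz).trans md) h20)
  have e : S.target K P N w ξ z i - S.tilde w z i =
      (S.target K P N w ξ z i - S.decoupled K N w ξ z i) +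
        (S.decoupled K N w ξ z i - S.tilde w z i) := by ring
  rw [e]
  refine (abs_add_le _ _).trans ?_
  rw [target]
  linarith [d z hz i]

theorem exists_absSum_target_le (hK : S.IsPreKernel K) (hN : S.IsDecoupling k K N)
    (hP : S.IsBacksteppingKernel N P) :
    ∃ C, 0 ≤ C ∧ ∀ w, IsBddState w → ∀ ξ, ∀ z ∈ Icc (0 : ℝ) 1,
      absSum (S.target K P N w ξ) z ≤ C * (absSum w z + mass w + absTotal ξ) := by
  obtain ⟨C, h0, h⟩ := exists_target_sub_tilde_le hK hN hP
  obtain ⟨C4, h41, h4⟩ := S.exists_tilde_bounds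
  refine ⟨2 * C + C4, by positivity, fun w hw ξ z hz => ?_⟩
  have e : ∀ i, |S.target K P N w ξ z i| ≤ |S.tilde w z i| + C * (mass w + absTotal ξ) := fun i => by
    have := abs_sub_abs_le_abs_sub (S.target K P N w ξ z i) (S.tilde w z i)
    linarith [h w hw ξ z hz i]
  have e2 := (h4 w z hz).1
  have m0 := mass_nonneg w
  have x0 := absTotal_nonneg ξ
  have s0 := absSum_nonneg w z
  rw [absSum] at e2 ⊢
  have p1 : 0 ≤ C4 * (mass w + absTotal ξ) := by positivity
  have p2 : 0 ≤ C * absSum w z := by positivity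
  linarith [e 0, e 1]

theorem exists_absSum_le_target (hK : S.IsPreKernel K) (hN : S.IsDecoupling k K N)
    (hP : S.IsBacksteppingKernel N P) :
    ∃ C, 0 ≤ C ∧ ∀ w, IsBddState w → ∀ ξ, ∀ z ∈ Icc (0 : ℝ) 1,
      absSum w z ≤ C * (absSum (S.target K P N w ξ) z + mass (S.target K P N w ξ) + absTotal ξ) := by
  obtain ⟨C1, h10, h1⟩ := exists_absSum_le_volterraTransform hK.bddMeasOn
  obtain ⟨C2, h20, h2⟩ := exists_absSum_le_volterraTransform hP.bddMeasOn
  obtain ⟨C3, h30, h3⟩ := hN.exists_mulVec_le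
  obtain ⟨C4, h41, h4⟩ := S.exists_tilde_bounds
  set D := C2 + 2 * C3 with hD
  have hD0 : 0 ≤ D := by positivity
  refine ⟨C4 * (1 + D + C1 * (1 + D)), by positivity, fun w hw ξ => ?_⟩
  set v := S.target K P N w ξ with hv
  have hvb : IsBddState v := hw.target hK hN hP ξ
  set R := mass v + absTotal ξ with hR
  have hm0 := mass_nonneg v
  have hX0 := absTotal_nonneg ξ
  have hR0 : 0 ≤ R := add_nonneg hm0 hX0
  have d : ∀ z ∈ Icc (0 : ℝ) 1, absSum (S.bar K w) z ≤ 1 * absSum v z + D * R := by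
    intro z hz
    have a1 := h2 _ (hw.decoupled hK hN ξ) z hz
    have e : ∀ i, |S.bar K w z i| ≤ |S.decoupled K N w ξ z i| + C3 * absTotal ξ := fun i => by
      have h := abs_add_le (S.decoupled K N w ξ z i) ((N z *ᵥ ξ) i)
      have e : S.decoupled K N w ξ z i + (N z *ᵥ ξ) i = S.bar K w z i := by
        rw [decoupled, Pi.sub_apply, sub_add_cancel]
      rw [e] at h
      linarith [h3 ξ z hz i]
    have e' : absSum (S.bar K w) z ≤ absSum (S.decoupled K N w ξ) z + 2 * (C3 * absTotal ξ) := by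
      rw [absSum, absSum]; linarith [e 0, e 1]
    change absSum (S.decoupled K N w ξ) z ≤ absSum v z + C2 * mass v at a1
    have p1 : 0 ≤ C2 * absTotal ξ := by positivity
    have p2 : 0 ≤ C3 * mass v := by positivity
    rw [hD, hR]
    linarith
  have md := mass_le_mul (hw.bar hK) hvb d
  intro z hz
  have a1 := h1 _ (hw.tilde (S := S)) z hz
  rw [← bar_eq_volterraTransform] at a1
  refine ((h4 w z hz).2.trans (mul_le_mul_of_nonneg_left (a1.trans (add_le_add (d z hz)
    (mul_le_mul_of_nonneg_left md h10))) (by positivity))).trans ?_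
  rw [mul_assoc, add_assoc]
  refine mul_le_mul_of_nonneg_left ?_ (by positivity)
  have s0 := absSum_nonneg v z
  have p1 : 0 ≤ (D + C1 * (1 + D)) * absSum v z := by positivity
  have p2 : 0 ≤ C1 * absTotal ξ := by positivity
  rw [add_assoc (absSum v z), ← hR]
  have p3 : mass v ≤ R := le_add_of_nonneg_right hX0
  have p4 := mul_le_mul_of_nonneg_left p3 h10
  linarith

theorem target_add_const_mul (hK : S.IsPreKernel K) (hN : S.IsDecoupling k K N)
    (hP : S.IsBacksteppingKernel N P) {w w' : ℝ → Fin 2 → ℝ} (hw : IsBddState w)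
    (hw' : IsBddState w') (ξ ξ' : Fin n → ℝ) (a : ℝ) {z : ℝ} (hz : z ∈ Icc (0 : ℝ) 1) :
    S.target K P N (w + a • w') (ξ + a • ξ') z =
      S.target K P N w ξ z + a • S.target K P N w' ξ' z := by
  have e : ∀ z ∈ Icc (0 : ℝ) 1, S.decoupled K N (w + a • w') (ξ + a • ξ') z =
      (S.decoupled K N w ξ + a • S.decoupled K N w' ξ') z := by
    intro z hz
    simp only [decoupled, bar_add_const_mul hK hw hw' a hz, Pi.add_apply, Pi.smul_apply,
      Matrix.mulVec_add, Matrix.mulVec_smul]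
    module
  rw [target, target, target, ← volterraTransform_add_const_mul hP.bddMeasOn
    (hw.decoupled hK hN ξ) (hw'.decoupled hK hN ξ') a hz]
  ext i
  rw [volterraTransform, volterraTransform, e z hz]
  congr 1
  refine intervalIntegral.integral_congr fun ζ hζ => ?_
  simp only [e ζ (uIcc_subset_Icc' zero_mem_Icc hz hζ)]

theorem isLocBdd_target (hK : S.IsPreKernel K) (hN : S.IsDecoupling k K N)
    (hP : S.IsBacksteppingKernel N P) {x : ℝ → ℝ → Fin 2 → ℝ} {ξ : ℝ → Fin n → ℝ}
    (hx : ∀ i, IsLocBdd fun t z => x t z i) (hξ : ∀ T m, BddMeasOn (fun t => ξ t m) (Icc 0 T))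
    (i : Fin 2) : IsLocBdd fun t z => S.target K P N (x t) (ξ t) z i := by
  have ht : ∀ i, IsLocBdd fun t z => S.tilde (x t) z i := fun i => by
    simp only [tilde_apply]
    exact (IsLocBdd.of_space (bddMeasOn_scaling i _)).mul (hx i)
  have hd : ∀ i, IsLocBdd fun t z => S.decoupled K N (x t) (ξ t) z i := fun i =>
    ((ht i).sub (isLocBdd_volterra hK.bddMeasOn ht i)).sub (IsLocBdd.sum Finset.univ fun m _ =>
      (IsLocBdd.of_space (hN.bddMeasOn i m)).mul (IsLocBdd.of_time fun T => hξ T m))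
  exact (hd i).sub (isLocBdd_volterra hP.bddMeasOn hd i)

end

end HyperbolicPDEODE

namespace HyperbolicPDEODE

variable {n : ℕ} {S : HyperbolicPDEODE n}

/-! ### Scalar transport equations with inflow data -/

/-- The end of the spatial domain at which the `i`-th characteristics enter. -/
def inflow : Fin 2 → ℝ := ![1, 0]

theorem inflow_mem_Icc (i : Fin 2) : inflow i ∈ Icc (0 : ℝ) 1 := by
  fin_cases i <;> simp [inflow]

/-- A function on `[0,1]` that falls from `1` at the inflow end to `0` at the outflow end. -/
def inflowWeight (i : Fin 2) (z : ℝ) : ℝ := 1 - charSign i * (inflow i - z)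

theorem inflowWeight_mem_Icc (i : Fin 2) {z : ℝ} (hz : z ∈ Icc (0 : ℝ) 1) :
    inflowWeight i z ∈ Icc (0 : ℝ) 1 := by
  obtain ⟨h0, h1⟩ := hz
  fin_cases i <;> constructor <;> simp [inflowWeight, inflow, charSign] <;> linarith

variable (S) in
/-- The time at which the `i`-th characteristic with label `c` enters. -/
def inflowTime (i : Fin 2) (c : ℝ) : ℝ := c - charSign i * S.travel i (inflow i)

theorem continuous_inflowTime (i : Fin 2) : Continuous (S.inflowTime i) := by
  unfold inflowTime; fun_prop

theorem inflowTime_label_inflow (i : Fin 2) (t : ℝ) :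
    S.inflowTime i (S.label i t (inflow i)) = t := by
  rw [inflowTime, label]; ring

theorem inflowWeight_le {M : ℝ} (hM0 : 0 < M) (hM : ∀ i z, S.speed i z ≤ M) (i : Fin 2) (t : ℝ)
    {z : ℝ} (hz : z ∈ Icc (0 : ℝ) 1) :
    1 - inflowWeight i z ≤ M * (t - S.inflowTime i (S.label i t z)) := by
  obtain ⟨h0, h1⟩ := hz
  have e := S.travel_sub_le hM
  rw [inflowTime, label, inflowWeight]
  fin_cases i
  · have := e 0 h1
    rw [div_le_iff₀ hM0] at this
    simp [inflow, charSign]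
    linarith
  · have := e 1 h0
    rw [div_le_iff₀ hM0, travel_zero] at this
    simp [inflow, charSign]
    linarith

theorem inflowTime_le (i : Fin 2) (t : ℝ) {z : ℝ} (hz : z ∈ Icc (0 : ℝ) 1) :
    S.inflowTime i (S.label i t z) ≤ t := by
  obtain ⟨m, M, hm, hM, h⟩ := S.exists_speed_bounds
  have h1 := inflowWeight_le hM (fun i z => (h i z).2) i t hz
  have h2 := (inflowWeight_mem_Icc i hz).2
  have h3 : 0 ≤ M * (t - S.inflowTime i (S.label i t z)) := by linarith
  linarith [nonneg_of_mul_nonneg_right h3 hM]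

variable (S) in
/-- The solution of the `i`-th transport equation with initial value `w`, inflow value `g` and
source `h`. -/
def transportSolution (i : Fin 2) (w g : ℝ → ℝ) (h : ℝ × ℝ → ℝ) : ℝ × ℝ → ℝ :=
  (Ici (0 : ℝ) ×ˢ Icc (0 : ℝ) 1).indicator fun p =>
    (if S.inflowTime i (S.label i p.1 p.2) ≤ 0 then w (S.char i (S.label i p.1 p.2) 0)
      else g (S.inflowTime i (S.label i p.1 p.2))) +
    ∫ s in max 0 (S.inflowTime i (S.label i p.1 p.2))..p.1, h (s, S.char i (S.label i p.1 p.2) s)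

section

variable {i : Fin 2} {w g : ℝ → ℝ} {h : ℝ × ℝ → ℝ}

theorem measurable_transportSolution (hw : Measurable w) (hg : Measurable g) (hh : Measurable h) :
    Measurable (S.transportSolution i w g h) := by
  have hl : Measurable fun p : ℝ × ℝ => S.label i p.1 p.2 := (S.continuous_label i).measurable
  have hτ : Measurable fun p : ℝ × ℝ => S.inflowTime i (S.label i p.1 p.2) :=
    (continuous_inflowTime i).measurable.comp hl
  have hc0 : Measurable fun p : ℝ × ℝ => S.char i (S.label i p.1 p.2) 0 :=
    ((S.continuous_char i).comp (((S.continuous_label i).prodMk continuous_const))).measurable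
  have hcs : Measurable fun q : (ℝ × ℝ) × ℝ => S.char i (S.label i q.1.1 q.1.2) q.2 :=
    ((S.continuous_char i).comp (((S.continuous_label i).comp continuous_fst).prodMk
      continuous_snd)).measurable
  refine Measurable.indicator (Measurable.add ?_ ?_) (measurableSet_Ici.prod measurableSet_Icc)
  · exact Measurable.ite (measurableSet_le hτ measurable_const)
      (hw.comp hc0) (hg.comp hτ)
  · refine measurable_intervalIntegral_param
      (F := fun (p : ℝ × ℝ) s => h (s, S.char i (S.label i p.1 p.2) s)) ?_
      (measurable_const.max hτ) measurable_fst
    exact hh.comp (measurable_snd.prodMk hcs)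

theorem intervalIntegrable_source (hh : Measurable h) {d γ : ℝ}
    (hd : ∀ s z, |h (s, z)| ≤ d * Real.exp (γ * s)) (c a b : ℝ) :
    IntervalIntegrable (fun s => h (s, S.char i c s)) volume a b := by
  have hi : IntervalIntegrable (fun s => d * Real.exp (γ * s)) volume a b :=
    (by fun_prop : Continuous fun s => d * Real.exp (γ * s)).intervalIntegrable _ _
  refine hi.mono_fun (hh.comp (measurable_id.prodMk (S.measurable_char i c))).aestronglyMeasurable
    (Filter.Eventually.of_forall fun s => ?_)
  exact (hd s _).trans (le_abs_self _)

theorem abs_transportSolution_le {M γ D a b d : ℝ} (hM0 : 0 < M) (hM : ∀ i z, S.speed i z ≤ M)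
    (hγ : 0 < γ) (hD : 0 ≤ D) (hγD : D * M ≤ γ) (ha0 : 0 ≤ a) (hb0 : 0 ≤ b) (hd0 : 0 ≤ d)
    (ha : ∀ z, |w z| ≤ a) (hb : ∀ s, 0 ≤ s → |g s| ≤ b * Real.exp (γ * s))
    (hd : ∀ s z, |h (s, z)| ≤ d * Real.exp (γ * s)) (p : ℝ × ℝ) :
    |S.transportSolution i w g h p| ≤
      (a + b * Real.exp (-D) + d / γ) * Real.exp (γ * p.1 + D * inflowWeight i p.2) := by
  set E := Real.exp (γ * p.1 + D * inflowWeight i p.2) with hE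
  have hE0 : 0 < E := Real.exp_pos _
  by_cases hp : p ∈ Ici (0 : ℝ) ×ˢ Icc (0 : ℝ) 1
  swap
  · rw [transportSolution, indicator_of_notMem hp, abs_zero]; positivity
  obtain ⟨ht, hz⟩ := hp
  rw [transportSolution, indicator_of_mem (mk_mem_prod ht hz)]
  obtain ⟨hw0, hw1⟩ := inflowWeight_mem_Icc i hz
  have hwl := inflowWeight_le hM0 hM i p.1 hz
  have hτt := inflowTime_le (S := S) i p.1 hz
  set τ := S.inflowTime i (S.label i p.1 p.2)
  have ht' : 0 ≤ p.1 := ht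
  have hEt : Real.exp (γ * p.1) ≤ E := Real.exp_le_exp.2 (by nlinarith)
  have h1E : 1 ≤ E := by rw [hE]; exact Real.one_le_exp (by positivity)
  have e1 : |if τ ≤ 0 then w (S.char i (S.label i p.1 p.2) 0) else g τ| ≤
      (a + b * Real.exp (-D)) * E := by
    split_ifs with h0
    · refine (ha _).trans ?_
      have : 0 ≤ b * Real.exp (-D) * E := by positivity
      nlinarith
    · refine (hb τ (not_le.1 h0).le).trans ?_
      have : Real.exp (γ * τ) ≤ Real.exp (-D) * E := by
        rw [hE, ← Real.exp_add, Real.exp_le_exp]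
        have k1 : D * (1 - inflowWeight i p.2) ≤ D * (M * (p.1 - τ)) :=
          mul_le_mul_of_nonneg_left hwl hD
        have k2 : D * M * (p.1 - τ) ≤ γ * (p.1 - τ) :=
          mul_le_mul_of_nonneg_right hγD (by linarith)
        linarith
      have k3 := mul_le_mul_of_nonneg_left this hb0
      have k4 : 0 ≤ a * E := by positivity
      linarith
  have hle : max 0 τ ≤ p.1 := max_le ht hτt
  have e2 : |∫ s in max 0 τ..p.1, h (s, S.char i (S.label i p.1 p.2) s)| ≤ d / γ * E := by
    have : |∫ s in max 0 τ..p.1, h (s, S.char i (S.label i p.1 p.2) s)| ≤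
        ∫ s in max 0 τ..p.1, d * Real.exp (γ * s) :=
      intervalIntegral.norm_integral_le_of_norm_le (μ := volume)
        (f := fun s => h (s, S.char i (S.label i p.1 p.2) s)) hle
        (Filter.Eventually.of_forall fun s _ => hd s _)
        ((by fun_prop : Continuous fun s => d * Real.exp (γ * s)).intervalIntegrable _ _)
    refine this.trans ?_
    rw [intervalIntegral.integral_const_mul]
    refine (mul_le_mul_of_nonneg_left ((integral_exp_mul_le hγ _ _).trans
      (div_le_div_of_nonneg_right hEt hγ.le)) hd0).trans (le_of_eq (by ring))
  refine (abs_add_le _ _).trans ?_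
  rw [add_mul]
  exact add_le_add e1 e2

theorem transportSolution_sub {g' : ℝ → ℝ} {h' : ℝ × ℝ → ℝ} (hh : Measurable h)
    (hh' : Measurable h') {d d' γ : ℝ} (hd : ∀ s z, |h (s, z)| ≤ d * Real.exp (γ * s))
    (hd' : ∀ s z, |h' (s, z)| ≤ d' * Real.exp (γ * s)) (p : ℝ × ℝ) :
    S.transportSolution i w g h p - S.transportSolution i w g' h' p =
      S.transportSolution i (fun _ => 0) (fun s => g s - g' s) (fun q => h q - h' q) p := by
  by_cases hp : p ∈ Ici (0 : ℝ) ×ˢ Icc (0 : ℝ) 1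
  · simp only [transportSolution, indicator_of_mem hp]
    rw [intervalIntegral.integral_sub (intervalIntegrable_source hh hd _ _ _)
      (intervalIntegrable_source hh' hd' _ _ _)]
    split_ifs <;> ring
  · simp only [transportSolution, indicator_of_notMem hp, sub_zero]

theorem transportSolution_along (hh : Measurable h) {d γ : ℝ}
    (hd : ∀ s z, |h (s, z)| ≤ d * Real.exp (γ * s)) {c t₀ t₁ : ℝ} (h0 : 0 ≤ t₀) (ht : t₀ ≤ t₁)
    (hz0 : S.char i c t₀ ∈ Icc (0 : ℝ) 1) (hz1 : S.char i c t₁ ∈ Icc (0 : ℝ) 1) :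
    S.transportSolution i w g h (t₁, S.char i c t₁) =
      S.transportSolution i w g h (t₀, S.char i c t₀) + ∫ t in t₀..t₁, h (t, S.char i c t) := by
  rw [transportSolution, indicator_of_mem (mk_mem_prod (mem_Ici.2 (h0.trans ht)) hz1),
    indicator_of_mem (mk_mem_prod (mem_Ici.2 h0) hz0)]
  simp only [label_char]
  rw [← intervalIntegral.integral_add_adjacent_intervals (b := t₀)
    (intervalIntegrable_source hh hd _ _ _) (intervalIntegrable_source hh hd _ _ _)]
  ring

theorem transportSolution_zero {z : ℝ} (hz : z ∈ Icc (0 : ℝ) 1) :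
    S.transportSolution i w g h (0, z) = w z := by
  have h1 := inflowTime_le (S := S) i 0 hz
  rw [transportSolution, indicator_of_mem (mk_mem_prod self_mem_Ici hz)]
  simp only [h1, if_true, max_eq_left, intervalIntegral.integral_same, add_zero, char_label]

theorem transportSolution_inflow {t : ℝ} (ht : 0 < t) :
    S.transportSolution i w g h (t, inflow i) = g t := by
  rw [transportSolution, indicator_of_mem (mk_mem_prod (mem_Ici.2 ht.le) (inflow_mem_Icc i))]
  simp only [inflowTime_label_inflow, not_le.2 ht, if_false, max_eq_right ht.le,
    intervalIntegral.integral_same, add_zero]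

end

end HyperbolicPDEODE

/-- Measurability on all bounded intervals implies measurability on the half-line. -/
theorem measurable_indicator_Ici {g : ℝ → ℝ} (hg : ∀ T, BddMeasOn g (Icc 0 T)) :
    Measurable ((Ici (0 : ℝ)).indicator g) := by
  refine measurable_of_tendsto_metrizable (f := fun (N : ℕ) => (Icc (0 : ℝ) N).indicator g)
    (fun N => ((hg N).indicator measurableSet_Icc).1) (tendsto_pi_nhds.2 fun t => ?_)
  obtain ⟨N, hN⟩ := exists_nat_ge t
  refine tendsto_const_nhds.congr' ?_
  filter_upwards [Filter.eventually_ge_atTop N] with k hk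
  have hk' : t ≤ k := hN.trans (Nat.cast_le.2 hk)
  by_cases ht : 0 ≤ t
  · rw [indicator_of_mem (mem_Ici.2 ht), indicator_of_mem (show t ∈ Icc (0 : ℝ) k from ⟨ht, hk'⟩)]
  · rw [indicator_of_notMem (fun h => ht (mem_Ici.1 h)), indicator_of_notMem (fun h => ht h.1)]

namespace HyperbolicPDEODE

variable {n : ℕ} {S : HyperbolicPDEODE n}

/-! ### Existence of solutions under nonlocal boundary conditions -/

/-- A Lipschitz coupling of the inflow values with the state. Of the point values of the PDE state
it involves only those at the outflow ends. -/
structure IsInflowCoupling (B : Fin 2 → (ℝ → Fin 2 → ℝ) → (Fin n → ℝ) → ℝ) (L : ℝ) : Prop where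
  trace : ∀ (x : ℝ → ℝ → Fin 2 → ℝ) (ξ : ℝ → Fin n → ℝ), (∀ i, IsLocBdd fun t z => x t z i) →
    (∀ T m, BddMeasOn (fun t => ξ t m) (Icc 0 T)) →
      ∀ i T, BddMeasOn (fun t => B i (x t) (ξ t)) (Icc 0 T)
  lipschitz : ∀ w w' ξ ξ', IsBddState w → IsBddState w' → ∀ i, |B i w ξ - B i w' ξ'| ≤
    L * (|w 0 0 - w' 0 0| + |w 1 1 - w' 1 1| + mass (w + (-1 : ℝ) • w') + absTotal (ξ - ξ'))

/-- The PDE state that is encoded in a family of functions of time and place. -/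
def pdeState (f : Fin 2 ⊕ Fin n → ℝ × ℝ → ℝ) (t z : ℝ) : Fin 2 → ℝ := fun i => f (.inl i) (t, z)

/-- The ODE state that is encoded in a family of functions of time and place. -/
def odeState (f : Fin 2 ⊕ Fin n → ℝ × ℝ → ℝ) (t : ℝ) : Fin n → ℝ := fun m => f (.inr m) (t, 0)

/-- The weight of the norm in which the solution is constructed. -/
def stateWeight (γ D : ℝ) : Fin 2 ⊕ Fin n → ℝ × ℝ → ℝ
  | .inl i, p => Real.exp (γ * p.1 + D * inflowWeight i p.2)
  | .inr _, p => Real.exp (γ * p.1)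

variable (S) in
/-- The zero-order term of the PDE, continued by `0`. -/
def couplingTerm (f : Fin 2 ⊕ Fin n → ℝ × ℝ → ℝ) (i : Fin 2) (p : ℝ × ℝ) : ℝ :=
  ∑ j, (Icc (0 : ℝ) 1).indicator (fun z => S.A z i j) p.2 * f (.inl j) p

variable (S) in
/-- The right-hand side of the ODE. -/
def odeTerm (f : Fin 2 ⊕ Fin n → ℝ × ℝ → ℝ) (m : Fin n) (t : ℝ) : ℝ :=
  (∑ l, S.F m l * f (.inr l) (t, 0)) + f (.inl 0) (t, 0) * S.b m

variable (S) in
/-- The map whose fixed points are the solutions with the initial values `w`, `ξ₀`. -/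
def solutionMap (B : Fin 2 → (ℝ → Fin 2 → ℝ) → (Fin n → ℝ) → ℝ) (w : Fin 2 → ℝ → ℝ)
    (ξ₀ : Fin n → ℝ) (f : Fin 2 ⊕ Fin n → ℝ × ℝ → ℝ) : Fin 2 ⊕ Fin n → ℝ × ℝ → ℝ
  | .inl i => S.transportSolution i (w i)
      ((Ici (0 : ℝ)).indicator fun t => B i (pdeState f t) (odeState f t)) (S.couplingTerm f i)
  | .inr m => fun p => (Ici (0 : ℝ)).indicator
      (fun t => ξ₀ m + ∫ s in (0 : ℝ)..t, S.odeTerm f m s) p.1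

section

variable {f : Fin 2 ⊕ Fin n → ℝ × ℝ → ℝ} {γ D C : ℝ}

theorem stateWeight_pos (i : Fin 2 ⊕ Fin n) (p : ℝ × ℝ) : 0 < stateWeight γ D i p := by
  cases i <;> exact Real.exp_pos _

theorem stateWeight_le (hD : 0 ≤ D) (i : Fin 2 ⊕ Fin n) (t : ℝ) {z : ℝ} (hz : z ∈ Icc (0 : ℝ) 1) :
    stateWeight γ D i (t, z) ≤ Real.exp D * Real.exp (γ * t) := by
  rw [← Real.exp_add]
  cases i with
  | inl i => exact Real.exp_le_exp.2 (by nlinarith [(inflowWeight_mem_Icc i hz).2])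
  | inr m => exact Real.exp_le_exp.2 (by linarith)

theorem isLocBdd_of_stateWeight (hγ : 0 ≤ γ) (hD : 0 ≤ D) (hm : ∀ i, Measurable (f i)) (hC0 : 0 ≤ C)
    (hC : ∀ i p, |f i p| ≤ C * stateWeight γ D i p) (i : Fin 2 ⊕ Fin n) :
    IsLocBdd fun t z => f i (t, z) := by
  refine fun T => BddMeasOn.of_measurable (hm i) ⟨C * (Real.exp D * Real.exp (γ * T)), fun p hp => ?_⟩
  refine (hC i p).trans (mul_le_mul_of_nonneg_left ((stateWeight_le hD i p.1 hp.2).trans ?_) hC0)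
  refine mul_le_mul_of_nonneg_left (Real.exp_le_exp.2 ?_) (Real.exp_pos _).le
  exact mul_le_mul_of_nonneg_left hp.1.2 hγ

theorem measurable_couplingTerm (hm : ∀ i, Measurable (f i)) (i : Fin 2) :
    Measurable (S.couplingTerm f i) :=
  Finset.measurable_sum _ fun j _ =>
    ((measurable_indicator_of_domRestrict measurableSet_Icc (S.A_meas i j)).comp measurable_snd).mul
      (hm (.inl j))

theorem abs_couplingTerm_le {α : ℝ} (hα : ∀ i j, ∀ z ∈ Icc (0 : ℝ) 1, |S.A z i j| ≤ α) (hD : 0 ≤ D)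
    (hC0 : 0 ≤ C) (hC : ∀ i p, |f i p| ≤ C * stateWeight γ D i p) (i : Fin 2) (s z : ℝ) :
    |S.couplingTerm f i (s, z)| ≤ 2 * α * Real.exp D * C * Real.exp (γ * s) := by
  have hα0 : 0 ≤ α := (abs_nonneg _).trans (hα 0 0 0 zero_mem_Icc)
  have key : ∀ j, |(Icc (0 : ℝ) 1).indicator (fun z => S.A z i j) z * f (.inl j) (s, z)| ≤
      α * (C * (Real.exp D * Real.exp (γ * s))) := by
    intro j
    by_cases hz : z ∈ Icc (0 : ℝ) 1
    · rw [indicator_of_mem hz, abs_mul]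
      exact mul_le_mul (hα i j z hz) ((hC _ _).trans (mul_le_mul_of_nonneg_left
        (stateWeight_le hD _ s hz) hC0)) (abs_nonneg _) hα0
    · rw [indicator_of_notMem hz, zero_mul, abs_zero]
      positivity
  rw [couplingTerm, Fin.sum_univ_two]
  refine (abs_add_le _ _).trans ((add_le_add (key 0) (key 1)).trans (le_of_eq (by ring)))

theorem abs_odeTerm_le {Φ : ℝ} (hΦ : ∀ m, ∑ l, |S.F m l| + |S.b m| ≤ Φ)
    (hC0 : 0 ≤ C) (hC : ∀ i p, |f i p| ≤ C * stateWeight γ D i p) (m : Fin n) (s : ℝ) :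
    |S.odeTerm f m s| ≤ Φ * C * Real.exp (γ * s) := by
  have h0 : |f (.inl 0) (s, 0)| ≤ C * Real.exp (γ * s) := by
    simpa [stateWeight, inflowWeight, inflow, charSign] using hC (.inl 0) (s, 0)
  have hl : ∀ l, |f (.inr l) (s, 0)| ≤ C * Real.exp (γ * s) := fun l => hC (.inr l) (s, 0)
  have e : |∑ l, S.F m l * f (.inr l) (s, 0)| ≤ (∑ l, |S.F m l|) * (C * Real.exp (γ * s)) := by
    rw [Finset.sum_mul]
    refine (Finset.abs_sum_le_sum_abs _ _).trans (Finset.sum_le_sum fun l _ => ?_)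
    rw [abs_mul]
    exact mul_le_mul_of_nonneg_left (hl l) (abs_nonneg _)
  rw [odeTerm]
  refine (abs_add_le _ _).trans ?_
  rw [abs_mul]
  have h1 := mul_le_mul_of_nonneg_right h0 (abs_nonneg (S.b m))
  have h2 := mul_le_mul_of_nonneg_right (hΦ m) (by positivity : 0 ≤ C * Real.exp (γ * s))
  linarith

theorem measurable_odeTerm (hm : ∀ i, Measurable (f i)) (m : Fin n) :
    Measurable (S.odeTerm f m) := by
  have h : ∀ i, Measurable fun t : ℝ => f i (t, 0) := fun i =>
    (hm i).comp (measurable_id.prodMk measurable_const)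
  exact (Finset.measurable_sum _ fun l _ => measurable_const.mul (h _)).add ((h _).mul measurable_const)

theorem integral_exp_inflowWeight_le (hD : 0 < D) (i : Fin 2) :
    ∫ z in (0 : ℝ)..1, Real.exp (D * inflowWeight i z) ≤ Real.exp D / D := by
  have h := integral_exp_mul_le hD 0 1
  rw [mul_one] at h
  fin_cases i
  · simpa [inflowWeight, inflow, charSign] using h
  · have e := intervalIntegral.integral_comp_sub_left (a := 0) (b := 1) (fun z => Real.exp (D * z)) 1
    rw [sub_zero, sub_self] at e
    rw [← e] at h
    simpa [inflowWeight, inflow, charSign, sub_eq_add_neg] using h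

/-- The coupling, applied to two families whose difference is controlled by the weight. -/
theorem IsInflowCoupling.abs_sub_le {B : Fin 2 → (ℝ → Fin 2 → ℝ) → (Fin n → ℝ) → ℝ} {L : ℝ}
    (hB : IsInflowCoupling B L) (hL : 0 ≤ L) (hD : 0 < D) {f g : Fin 2 ⊕ Fin n → ℝ × ℝ → ℝ}
    (hf : ∀ i, IsLocBdd fun t z => f i (t, z)) (hg : ∀ i, IsLocBdd fun t z => g i (t, z))
    (hC0 : 0 ≤ C) (hC : ∀ i p, |f i p - g i p| ≤ C * stateWeight γ D i p) (i : Fin 2) {t : ℝ}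
    (ht : 0 ≤ t) :
    |B i (pdeState f t) (odeState f t) - B i (pdeState g t) (odeState g t)| ≤
      L * (n + 2 + 2 * (Real.exp D / D)) * C * Real.exp (γ * t) := by
  have hsf : IsBddState (pdeState f t) := fun i => (hf (.inl i)).slice ht
  have hsg : IsBddState (pdeState g t) := fun i => (hg (.inl i)).slice ht
  refine (hB.lipschitz _ _ _ _ hsf hsg i).trans ?_
  have h0 : |pdeState f t 0 0 - pdeState g t 0 0| ≤ C * Real.exp (γ * t) := by
    simpa [pdeState, stateWeight, inflowWeight, inflow, charSign] using hC (.inl 0) (t, 0)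
  have h1 : |pdeState f t 1 1 - pdeState g t 1 1| ≤ C * Real.exp (γ * t) := by
    simpa [pdeState, stateWeight, inflowWeight, inflow, charSign] using hC (.inl 1) (t, 1)
  have h2 : absTotal (odeState f t - odeState g t) ≤ n * (C * Real.exp (γ * t)) := by
    refine (Finset.sum_le_sum fun m _ => hC (.inr m) (t, 0)).trans (le_of_eq ?_)
    simp [stateWeight]
  have hE : ∀ i, Continuous fun z => Real.exp (D * inflowWeight i z) := fun i => by
    unfold inflowWeight; fun_prop
  have h3 : mass (pdeState f t + (-1 : ℝ) • pdeState g t) ≤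
      2 * (Real.exp D / D) * (C * Real.exp (γ * t)) := by
    have hi : ∀ i, IntervalIntegrable (fun z => C * Real.exp (γ * t) *
        Real.exp (D * inflowWeight i z)) volume 0 1 := fun i =>
      ((hE i).const_mul _).intervalIntegrable _ _
    refine (mass_mono (hsf.add_const_mul hsg (-1)) ((hi 0).add (hi 1)) fun z hz => ?_).trans ?_
    · have k : ∀ i, |(pdeState f t + (-1 : ℝ) • pdeState g t) z i| ≤
          C * Real.exp (γ * t) * Real.exp (D * inflowWeight i z) := fun i => by
        have := hC (.inl i) (t, z)
        rw [stateWeight, Real.exp_add, ← mul_assoc] at this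
        simpa [pdeState, sub_eq_add_neg] using this
      exact add_le_add (k 0) (k 1)
    · rw [intervalIntegral.integral_add (hi 0) (hi 1), intervalIntegral.integral_const_mul,
        intervalIntegral.integral_const_mul, ← mul_add]
      refine (mul_le_mul_of_nonneg_left (add_le_add (integral_exp_inflowWeight_le hD 0)
        (integral_exp_inflowWeight_le hD 1)) (by positivity)).trans (le_of_eq (by ring))
  refine (mul_le_mul_of_nonneg_left (add_le_add (add_le_add (add_le_add h0 h1) h3) h2) hL).trans
    (le_of_eq (by ring))

end

end HyperbolicPDEODE

namespace HyperbolicPDEODE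

variable {n : ℕ} {S : HyperbolicPDEODE n}

section

variable {γ D C : ℝ} {B : Fin 2 → (ℝ → Fin 2 → ℝ) → (Fin n → ℝ) → ℝ} {L : ℝ}

theorem abs_integral_le_exp {f : ℝ → ℝ} {d : ℝ} (hγ : 0 < γ) (hd0 : 0 ≤ d)
    (hd : ∀ s, |f s| ≤ d * Real.exp (γ * s)) {t : ℝ} (ht : 0 ≤ t) :
    |∫ s in (0 : ℝ)..t, f s| ≤ d / γ * Real.exp (γ * t) := by
  have : |∫ s in (0 : ℝ)..t, f s| ≤ ∫ s in (0 : ℝ)..t, d * Real.exp (γ * s) :=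
    intervalIntegral.norm_integral_le_of_norm_le (μ := volume) (f := f) ht
      (Filter.Eventually.of_forall fun s _ => hd s)
      ((by fun_prop : Continuous fun s => d * Real.exp (γ * s)).intervalIntegrable _ _)
  refine this.trans ?_
  rw [intervalIntegral.integral_const_mul]
  exact (mul_le_mul_of_nonneg_left (integral_exp_mul_le hγ _ _) hd0).trans (le_of_eq (by ring))

theorem intervalIntegrable_of_abs_le_exp {f : ℝ → ℝ} (hf : Measurable f) {d : ℝ}
    (hd : ∀ s, |f s| ≤ d * Real.exp (γ * s)) (a b : ℝ) : IntervalIntegrable f volume a b := by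
  refine (((by fun_prop : Continuous fun s => d * Real.exp (γ * s))).intervalIntegrable
    a b).mono_fun hf.aestronglyMeasurable (Filter.Eventually.of_forall fun s => ?_)
  exact (hd s).trans (le_abs_self _)

/-- The trace of the coupling along a family in the weighted space. -/
theorem IsInflowCoupling.bddMeasOn (hB : IsInflowCoupling B L) {f : Fin 2 ⊕ Fin n → ℝ × ℝ → ℝ}
    (hf : ∀ i, IsLocBdd fun t z => f i (t, z)) (i : Fin 2) (T : ℝ) :
    BddMeasOn (fun t => B i (pdeState f t) (odeState f t)) (Icc 0 T) :=
  hB.trace (pdeState f) (odeState f) (fun i => hf (.inl i))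
    (fun T m => (hf (.inr m)).trace zero_mem_Icc T) i T

theorem couplingTerm_sub (f g : Fin 2 ⊕ Fin n → ℝ × ℝ → ℝ) (i : Fin 2) (p : ℝ × ℝ) :
    S.couplingTerm f i p - S.couplingTerm g i p = S.couplingTerm (fun i p => f i p - g i p) i p := by
  simp only [couplingTerm, mul_sub, Finset.sum_sub_distrib]

theorem odeTerm_sub (f g : Fin 2 ⊕ Fin n → ℝ × ℝ → ℝ) (m : Fin n) (t : ℝ) :
    S.odeTerm f m t - S.odeTerm g m t = S.odeTerm (fun i p => f i p - g i p) m t := by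
  simp only [odeTerm, mul_sub, sub_mul, Finset.sum_sub_distrib]
  ring

theorem exists_solutionMap_fixedPoint (hB : IsInflowCoupling B L) (hL : 0 ≤ L)
    {w : Fin 2 → ℝ → ℝ} (hw : ∀ i, Measurable (w i)) {a : ℝ} (ha : ∀ i z, |w i z| ≤ a)
    (ξ₀ : Fin n → ℝ) :
    ∃ f γ D C, 0 < γ ∧ 0 ≤ D ∧ 0 ≤ C ∧ (∀ i, Measurable (f i)) ∧
      (∀ i p, |f i p| ≤ C * stateWeight γ D i p) ∧ S.solutionMap B w ξ₀ f = f := by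
  obtain ⟨m, M, hm, hM, hsp⟩ := S.exists_speed_bounds
  have hsM : ∀ i z, S.speed i z ≤ M := fun i z => (hsp i z).2
  obtain ⟨α, hα⟩ := S.A_bdd
  have hα0 : 0 ≤ α := (abs_nonneg _).trans (hα 0 0 0 zero_mem_Icc)
  have ha0 : 0 ≤ a := (abs_nonneg _).trans (ha 0 0)
  obtain ⟨Φ, hΦ0, hΦ⟩ : ∃ Φ, 0 ≤ Φ ∧ ∀ m, ∑ l, |S.F m l| + |S.b m| ≤ Φ :=
    ⟨∑ m, (∑ l, |S.F m l| + |S.b m|), by positivity, fun m =>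
      Finset.single_le_sum (f := fun m => ∑ l, |S.F m l| + |S.b m|)
        (fun _ _ => by positivity) (Finset.mem_univ m)⟩
  set D := 4 * (L * (n + 4)) + 1 with hD
  have hD0 : 0 < D := by positivity
  set γ := D * M + 8 * α * Real.exp D + 2 * Φ with hγ
  have hγ0 : 0 < γ := by positivity
  have hγD : D * M ≤ γ := by
    have : 0 ≤ 8 * α * Real.exp D := by positivity
    linarith
  set β := L * (n + 2 + 2 * (Real.exp D / D)) with hβ
  have hβ0 : 0 ≤ β := by positivity
  have hβD : β * Real.exp (-D) ≤ 1 / 4 := by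
    have e1 : Real.exp (-D) ≤ 1 / D := by
      rw [Real.exp_neg, ← one_div]
      exact one_div_le_one_div_of_le hD0 (by linarith [Real.add_one_le_exp D])
    have e2 : β * Real.exp (-D) = L * ((n + 2) * Real.exp (-D) + 2 * (1 / D)) := by
      have : Real.exp D * Real.exp (-D) = 1 := by rw [← Real.exp_add]; simp
      rw [hβ]
      linear_combination (2 * L / D) * this
    rw [e2]
    have e3 : L * (((n : ℝ) + 2) * Real.exp (-D) + 2 * (1 / D)) ≤ L * (n + 4) / D := by
      have : ((n : ℝ) + 2) * Real.exp (-D) + 2 * (1 / D) ≤ (n + 4) / D := by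
        have := mul_le_mul_of_nonneg_left e1 (by positivity : (0 : ℝ) ≤ n + 2)
        refine (add_le_add_left this _).trans (le_of_eq (by ring))
      exact (mul_le_mul_of_nonneg_left this hL).trans (le_of_eq (by ring))
    refine e3.trans ?_
    rw [div_le_div_iff₀ hD0 (by norm_num)]
    linarith
  have hαγ : 2 * α * Real.exp D / γ ≤ 1 / 4 := by
    rw [div_le_div_iff₀ hγ0 (by norm_num)]
    have : 0 ≤ D * M := by positivity
    linarith
  have hΦγ : Φ / γ ≤ 1 / 2 := by
    rw [div_le_div_iff₀ hγ0 (by norm_num)]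
    have : 0 ≤ D * M := by positivity
    have : 0 ≤ 8 * α * Real.exp D := by positivity
    linarith
  have habs : ∀ {f : Fin 2 ⊕ Fin n → ℝ × ℝ → ℝ} {C : ℝ}, (∀ i p, |f i p| ≤ C * stateWeight γ D i p) →
      ∀ i p, |f i p| ≤ |C| * stateWeight γ D i p := fun h i p => (h i p).trans
    (mul_le_mul_of_nonneg_right (le_abs_self _) (stateWeight_pos i p).le)
  have hloc : ∀ {f : Fin 2 ⊕ Fin n → ℝ × ℝ → ℝ}, (∀ i, Measurable (f i)) →
      (∃ C, ∀ i p, |f i p| ≤ C * stateWeight γ D i p) → ∀ i, IsLocBdd fun t z => f i (t, z) :=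
    fun hf ⟨C, hC⟩ => isLocBdd_of_stateWeight hγ0.le hD0.le hf (abs_nonneg C) (habs hC)
  have hzero : ∀ i, IsLocBdd fun t z => (0 : Fin 2 ⊕ Fin n → ℝ × ℝ → ℝ) i (t, z) :=
    fun i => IsLocBdd.zero
  refine Exists.elim (exists_measurable_fixedPoint (stateWeight γ D)
    (fun i p => (stateWeight_pos i p).le) (S.solutionMap B w ξ₀) ?_ ?_)
    fun f ⟨hfm, ⟨C, hC⟩, hfix⟩ => ⟨f, γ, D, |C|, hγ0, hD0.le, abs_nonneg C, hfm, habs hC, hfix⟩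
  · intro f hf hfC
    have hl := hloc hf hfC
    obtain ⟨C, hC⟩ := hfC
    have hC' := habs hC
    have hC0 := abs_nonneg C
    refine ⟨fun i => ?_, ?_⟩
    · cases i with
      | inl i =>
        exact measurable_transportSolution (hw i)
          (measurable_indicator_Ici fun T => hB.bddMeasOn hl i T) (measurable_couplingTerm hf i)
      | inr m =>
        have hm1 : Measurable fun t => ξ₀ m + ∫ s in (0 : ℝ)..t, S.odeTerm f m s :=
          measurable_const.add (measurable_intervalIntegral_param (F := fun _ s => S.odeTerm f m s)
            ((measurable_odeTerm hf m).comp measurable_snd) measurable_const measurable_id)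
        exact (hm1.indicator measurableSet_Ici).comp measurable_fst
    · set b := ∑ i, |B i (pdeState (0 : Fin 2 ⊕ Fin n → ℝ × ℝ → ℝ) 0)
        (odeState (0 : Fin 2 ⊕ Fin n → ℝ × ℝ → ℝ) 0)| + β * |C| with hb
      have hb0 : 0 ≤ b := by positivity
      have hbg : ∀ i s, 0 ≤ s → |(Ici (0 : ℝ)).indicator
          (fun t => B i (pdeState f t) (odeState f t)) s| ≤ b * Real.exp (γ * s) := by
        intro i s hs
        rw [indicator_of_mem (mem_Ici.2 hs)]
        have h1 := hB.abs_sub_le hL hD0 hl hzero hC0 (fun i p => by simpa using hC' i p) i hs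
        rw [← hβ] at h1
        have h2 : |B i (pdeState (0 : Fin 2 ⊕ Fin n → ℝ × ℝ → ℝ) s)
            (odeState (0 : Fin 2 ⊕ Fin n → ℝ × ℝ → ℝ) s)| ≤
            ∑ i, |B i (pdeState (0 : Fin 2 ⊕ Fin n → ℝ × ℝ → ℝ) 0)
              (odeState (0 : Fin 2 ⊕ Fin n → ℝ × ℝ → ℝ) 0)| :=
          Finset.single_le_sum (f := fun i => |B i (pdeState (0 : Fin 2 ⊕ Fin n → ℝ × ℝ → ℝ) 0)
            (odeState (0 : Fin 2 ⊕ Fin n → ℝ × ℝ → ℝ) 0)|) (fun _ _ => abs_nonneg _)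
            (Finset.mem_univ i)
        have h3 := abs_sub_abs_le_abs_sub (B i (pdeState f s) (odeState f s))
          (B i (pdeState (0 : Fin 2 ⊕ Fin n → ℝ × ℝ → ℝ) s)
            (odeState (0 : Fin 2 ⊕ Fin n → ℝ × ℝ → ℝ) s))
        have h4 : 1 ≤ Real.exp (γ * s) := Real.one_le_exp (by positivity)
        have h5 := mul_le_mul_of_nonneg_left h4
          ((abs_nonneg _).trans h2)
        rw [hb, add_mul]
        linarith
      refine ⟨a + b * Real.exp (-D) + 2 * α * Real.exp D * |C| / γ +
        (∑ m, |ξ₀ m| + Φ * |C| / γ), fun i p => ?_⟩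
      have hw0 := stateWeight_pos (γ := γ) (D := D) i p
      have q1 : 0 ≤ a + b * Real.exp (-D) + 2 * α * Real.exp D * |C| / γ := by positivity
      have q2 : 0 ≤ ∑ m, |ξ₀ m| + Φ * |C| / γ := by positivity
      cases i with
      | inl i =>
        refine (abs_transportSolution_le hM hsM hγ0 hD0.le hγD ha0 hb0 (by positivity) (ha i) (hbg i)
          (fun s z => abs_couplingTerm_le hα hD0.le hC0 hC' i s z) p).trans ?_
        exact mul_le_mul_of_nonneg_right (le_add_of_nonneg_right q2) hw0.le
      | inr m =>
        refine le_trans ?_ (mul_le_mul_of_nonneg_right (le_add_of_nonneg_left q1) hw0.le)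
        simp only [solutionMap]
        by_cases ht : 0 ≤ p.1
        · rw [indicator_of_mem (mem_Ici.2 ht), add_mul, stateWeight]
          refine (abs_add_le _ _).trans (add_le_add ?_
            (abs_integral_le_exp hγ0 (by positivity) (abs_odeTerm_le hΦ hC0 hC' m) ht))
          refine (Finset.single_le_sum (f := fun m => |ξ₀ m|) (fun _ _ => abs_nonneg _)
            (Finset.mem_univ m)).trans ?_
          exact le_mul_of_one_le_right (by positivity) (Real.one_le_exp (by positivity))
        · rw [indicator_of_notMem (fun h => ht (mem_Ici.1 h)), abs_zero]
          positivity
  · intro f g hf hg hfC hgC C hC0 hC i p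
    have hlf := hloc hf hfC
    have hlg := hloc hg hgC
    obtain ⟨Cf, hCf⟩ := hfC
    obtain ⟨Cg, hCg⟩ := hgC
    have hw0 := stateWeight_pos (γ := γ) (D := D) i p
    cases i with
    | inl i =>
      rw [solutionMap, solutionMap, transportSolution_sub (measurable_couplingTerm hf i)
        (measurable_couplingTerm hg i)
        (fun s z => abs_couplingTerm_le hα hD0.le (abs_nonneg Cf) (habs hCf) i s z)
        (fun s z => abs_couplingTerm_le hα hD0.le (abs_nonneg Cg) (habs hCg) i s z)]
      refine (abs_transportSolution_le (a := 0) (b := β * C) (d := 2 * α * Real.exp D * C) hM hsM hγ0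
        hD0.le hγD le_rfl (by positivity) (by positivity) (fun _ => by simp) (fun s hs => ?_)
        (fun s z => ?_) p).trans ?_
      · rw [indicator_of_mem (mem_Ici.2 hs), indicator_of_mem (mem_Ici.2 hs)]
        exact hB.abs_sub_le hL hD0 hlf hlg hC0 hC i hs
      · rw [couplingTerm_sub]
        exact abs_couplingTerm_le hα hD0.le hC0 hC i s z
      · refine mul_le_mul_of_nonneg_right ?_ hw0.le
        have k1 := mul_le_mul_of_nonneg_right hβD hC0
        have k2 := mul_le_mul_of_nonneg_right hαγ hC0
        have k3 : 2 * α * Real.exp D * C / γ = 2 * α * Real.exp D / γ * C := by ring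
        rw [k3]
        linarith
    | inr m =>
      simp only [solutionMap]
      by_cases ht : 0 ≤ p.1
      · rw [indicator_of_mem (mem_Ici.2 ht), indicator_of_mem (mem_Ici.2 ht), add_sub_add_left_eq_sub,
          ← intervalIntegral.integral_sub
            (intervalIntegrable_of_abs_le_exp (measurable_odeTerm hf m)
              (abs_odeTerm_le hΦ (abs_nonneg Cf) (habs hCf) m) _ _)
            (intervalIntegrable_of_abs_le_exp (measurable_odeTerm hg m)
              (abs_odeTerm_le hΦ (abs_nonneg Cg) (habs hCg) m) _ _)]
        simp only [odeTerm_sub]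
        refine (abs_integral_le_exp hγ0 (by positivity) (abs_odeTerm_le hΦ hC0 hC m) ht).trans ?_
        refine mul_le_mul_of_nonneg_right ?_ hw0.le
        have k2 := mul_le_mul_of_nonneg_right hΦγ hC0
        have k3 : Φ * C / γ = Φ / γ * C := by ring
        rw [k3]
        linarith
      · rw [indicator_of_notMem (fun h => ht (mem_Ici.1 h)),
          indicator_of_notMem (fun h => ht (mem_Ici.1 h)), sub_zero, abs_zero]
        positivity

/-- Existence of solutions when the input closes a Lipschitz coupling. -/
theorem exists_isSolution_of_inflowCoupling (hB : IsInflowCoupling B L) (hL : 0 ≤ L)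
    (hB1 : ∀ w ξ, B 1 w ξ = S.q0 * w 0 0 + S.c ⬝ᵥ ξ) {w₀ : ℝ → Fin 2 → ℝ} (hw₀ : IsBddState w₀)
    (ξ₀ : Fin n → ℝ) :
    ∃ x ξ, S.IsSolution x ξ (fun t => x t 1 0 - S.q1 * x t 1 1) ∧
      (∀ z ∈ Icc (0 : ℝ) 1, x 0 z = w₀ z) ∧ ξ 0 = ξ₀ ∧ ∀ t, 0 < t → x t 1 0 = B 0 (x t) (ξ t) := by
  have hind := fun i => (hw₀ i).indicator measurableSet_Icc
  choose a ha using fun i => (hind i).2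
  obtain ⟨f, γ, D, C, hγ, hD, hC0, hfm, hC, hfix⟩ := exists_solutionMap_fixedPoint (S := S) hB hL
    (w := fun i => (Icc (0 : ℝ) 1).indicator fun z => w₀ z i) (fun i => (hind i).1) (a := |a 0| + |a 1|)
    (fun i z => (ha i z).trans ((le_abs_self _).trans (by
      fin_cases i
      · exact le_add_of_nonneg_right (abs_nonneg _)
      · exact le_add_of_nonneg_left (abs_nonneg _)))) ξ₀
  have hloc := isLocBdd_of_stateWeight hγ.le hD hfm hC0 hC
  obtain ⟨α, hα⟩ := S.A_bdd
  have hsrc : ∀ i s z, |S.couplingTerm f i (s, z)| ≤ 2 * α * Real.exp D * C * Real.exp (γ * s) :=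
    fun i s z => abs_couplingTerm_le hα hD hC0 hC i s z
  have hx : ∀ t z i, pdeState f t z i = S.transportSolution i
      ((Icc (0 : ℝ) 1).indicator fun z => w₀ z i)
      ((Ici (0 : ℝ)).indicator fun t => B i (pdeState f t) (odeState f t)) (S.couplingTerm f i)
      (t, z) := fun t z i => (congrFun (congrFun hfix (.inl i)) (t, z)).symm
  have hode : ∀ t, 0 ≤ t → ∀ m, odeState f t m = ξ₀ m + ∫ s in (0 : ℝ)..t, S.odeTerm f m s := by
    intro t ht m
    have := congrFun (congrFun hfix (.inr m)) (t, 0)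
    simp only [solutionMap, indicator_of_mem (mem_Ici.2 ht)] at this
    exact this.symm
  have hterm : ∀ m t, S.odeTerm f m t = (S.F *ᵥ odeState f t + pdeState f t 0 0 • S.b) m :=
    fun m t => rfl
  have hcoup : ∀ t, ∀ z ∈ Icc (0 : ℝ) 1, ∀ i,
      (S.A z *ᵥ pdeState f t z) i = S.couplingTerm f i (t, z) := fun t z hz i => by
    simp only [couplingTerm, indicator_of_mem hz, mulVec_two, pdeState]
  have hξb : ∀ T m, BddMeasOn (fun t => odeState f t m) (Icc 0 T) := fun T m =>
    (hloc (.inr m)).trace zero_mem_Icc T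
  have hint : ∀ m a b, IntervalIntegrable (S.odeTerm f m) volume a b := fun m a b =>
    intervalIntegrable_of_abs_le_exp (measurable_odeTerm hfm m)
      (abs_odeTerm_le (fun m => Finset.single_le_sum (f := fun m => ∑ l, |S.F m l| + |S.b m|)
        (fun _ _ => by positivity) (Finset.mem_univ m)) hC0 hC m) a b
  have hξ0 : odeState f 0 = ξ₀ := by
    ext m; rw [hode 0 le_rfl m]; simp
  have hlocx : ∀ i, IsLocBdd fun t z => pdeState f t z i := fun i => hloc (.inl i)
  have htr : S.IsTransported (pdeState f) fun t z => S.A z *ᵥ pdeState f t z := by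
    refine ⟨hlocx, isLocBdd_mulVec (fun i j => S.isLocBdd_A i j) hlocx, ?_⟩
    intro i c t₀ t₁ h0 ht hz0 hz1
    rw [hx, hx, transportSolution_along (measurable_couplingTerm hfm i) (hsrc i) h0 ht hz0 hz1]
    congr 1
    refine intervalIntegral.integral_congr fun t htm => ?_
    exact (hcoup t _ (S.char_mem_Icc i hz0 hz1 htm) i).symm
  have hbc : ∀ t, 0 < t → ∀ i, pdeState f t (inflow i) i = B i (pdeState f t) (odeState f t) :=
    fun t ht i => by rw [hx, transportSolution_inflow ht, indicator_of_mem (mem_Ici.2 ht.le)]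
  refine ⟨pdeState f, odeState f, ⟨fun i => ?_, fun T => ?_, ?_, ?_, fun t ht => ?_, htr.pde,
    fun t _ => by ring⟩, fun z hz => ?_, hξ0, fun t ht => hbc t ht 0⟩
  · exact (hfm (.inl i)).comp measurable_subtype_coe
  · choose b hb using fun i => (hlocx i T).bdd
    refine ⟨|b 0| + |b 1|, fun t ht z hz i => (hb i (t, z) ⟨ht, hz⟩).trans
      ((le_abs_self _).trans ?_)⟩
    fin_cases i
    · exact le_add_of_nonneg_right (abs_nonneg _)
    · exact le_add_of_nonneg_left (abs_nonneg _)
  · refine continuousOn_pi.2 fun m => ContinuousOn.congr (f := fun t => ξ₀ m +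
      ∫ s in (0 : ℝ)..t, S.odeTerm f m s) (Continuous.continuousOn ?_) fun t ht => hode t ht m
    exact continuous_const.add (intervalIntegral.continuous_primitive (hint m) 0)
  · refine (ode_iff hlocx hξb).2 fun m T => (bddMeasOn_ode_rhs hlocx hξb T m).isBddPrimitive
      fun t ht => ?_
    rw [hξ0, hode t ht.1 m]
    rfl
  · rw [← hB1]
    exact hbc t ht 1
  · ext i
    rw [hx, transportSolution_zero hz, indicator_of_mem hz]

end

end HyperbolicPDEODE

namespace HyperbolicPDEODE

variable {n : ℕ} {S : HyperbolicPDEODE n}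

/-! ### Existence of closed-loop solutions -/

section

variable {K P : ℝ → ℝ → Matrix (Fin 2) (Fin 2) ℝ} {N : ℝ → Matrix (Fin 2) (Fin n) ℝ}
  {k : Fin n → ℝ} {qcl : ℝ}

variable (S) in
/-- The inflow values that are prescribed by the closed loop for the zero reference. -/
def closedLoopInflow (K P : ℝ → ℝ → Matrix (Fin 2) (Fin 2) ℝ) (N : ℝ → Matrix (Fin 2) (Fin n) ℝ)
    (qcl : ℝ) : Fin 2 → (ℝ → Fin 2 → ℝ) → (Fin n → ℝ) → ℝ :=
  ![fun w ξ => Real.exp (-S.alpha 0 1) * (qcl * S.target K P N w ξ 1 1 -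
    (S.target K P N w ξ 1 0 - S.tilde w 1 0)), fun w ξ => S.q0 * w 0 0 + S.c ⬝ᵥ ξ]

theorem exists_isInflowCoupling (hK : S.IsPreKernel K) (hN : S.IsDecoupling k K N)
    (hP : S.IsBacksteppingKernel N P) :
    ∃ L, 0 ≤ L ∧ IsInflowCoupling (S.closedLoopInflow K P N qcl) L := by
  obtain ⟨C, hC0, hC⟩ := exists_target_sub_tilde_le hK hN hP
  set E := Real.exp (-S.alpha 0 1) with hE
  have hE0 : 0 < E := Real.exp_pos _
  set G := Real.exp (-1 * S.alpha 1 1) with hG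
  have hG0 : 0 < G := Real.exp_pos _
  set L₀ := E * ((|qcl| + 1) * (C + G)) with hL₀
  set L₁ := |S.q0| + ∑ m, |S.c m| with hL₁
  have hL₀0 : 0 ≤ L₀ := by positivity
  have hL₁0 : 0 ≤ L₁ := by positivity
  refine ⟨L₀ + L₁, by positivity, ⟨fun x ξ hx hξ i T => ?_, fun w w' ξ ξ' hw hw' i => ?_⟩⟩
  · have ht : ∀ i, BddMeasOn (fun t => S.target K P N (x t) (ξ t) 1 i) (Icc 0 T) := fun i =>
      (isLocBdd_target hK hN hP hx hξ i).trace one_mem_Icc T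
    have hd : BddMeasOn (fun t => S.tilde (x t) 1 0) (Icc 0 T) := by
      simp only [tilde_apply]
      exact ((hx 0).trace one_mem_Icc T).const_mul _
    fin_cases i
    · exact (((ht 1).const_mul qcl).sub ((ht 0).sub hd)).const_mul E
    · exact (((hx 0).trace zero_mem_Icc T).const_mul S.q0).add
        (BddMeasOn.sum Finset.univ fun m _ => (hξ T m).const_mul (S.c m))
  · set d := w + (-1 : ℝ) • w' with hd
    have hη : ξ + (-1 : ℝ) • ξ' = ξ - ξ' := by module
    set η := ξ - ξ' with hηdef
    have hdb : IsBddState d := hw.add_const_mul hw' (-1)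
    have d00 : w 0 0 - w' 0 0 = d 0 0 := by simp [hd, sub_eq_add_neg]
    have d11 : w 1 1 - w' 1 1 = d 1 1 := by simp [hd, sub_eq_add_neg]
    have hm0 := mass_nonneg d
    have hX0 := absTotal_nonneg η
    have a00 := abs_nonneg (d 0 0)
    have a11 := abs_nonneg (d 1 1)
    rw [d00, d11]
    set R := |d 0 0| + |d 1 1| + mass d + absTotal η with hR
    have hR0 : 0 ≤ R := by positivity
    fin_cases i
    · have hlin : ∀ i, S.target K P N d η 1 i =
          S.target K P N w ξ 1 i - S.target K P N w' ξ' 1 i := fun i => by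
        rw [← hη, hd, target_add_const_mul hK hN hP hw hw' ξ ξ' (-1) one_mem_Icc]
        simp [sub_eq_add_neg]
      have htl : S.tilde d 1 0 = S.tilde w 1 0 - S.tilde w' 1 0 := by
        rw [hd, tilde_add_const_mul]; simp [sub_eq_add_neg]
      have e : S.closedLoopInflow K P N qcl 0 w ξ - S.closedLoopInflow K P N qcl 0 w' ξ' =
          E * (qcl * S.target K P N d η 1 1 - (S.target K P N d η 1 0 - S.tilde d 1 0)) := by
        rw [hlin, hlin, htl]
        simp only [closedLoopInflow, cons_val_zero]
        ring
      have h1 : |S.target K P N d η 1 1| ≤ (C + G) * R := by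
        have := abs_add_le (S.target K P N d η 1 1 - S.tilde d 1 1) (S.tilde d 1 1)
        rw [sub_add_cancel] at this
        have h2 := hC d hdb η 1 one_mem_Icc 1
        have h3 : |S.tilde d 1 1| = G * |d 1 1| := by
          rw [tilde_apply, abs_mul, Real.abs_exp]; rfl
        have k1 : C * (mass d + absTotal η) ≤ C * R := mul_le_mul_of_nonneg_left (by linarith) hC0
        have k2 : G * |d 1 1| ≤ G * R := mul_le_mul_of_nonneg_left (by linarith) hG0.le
        linarith
      have h2 : |S.target K P N d η 1 0 - S.tilde d 1 0| ≤ (C + G) * R := by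
        have k1 : C * (mass d + absTotal η) ≤ C * R := mul_le_mul_of_nonneg_left (by linarith) hC0
        have k2 : 0 ≤ G * R := by positivity
        linarith [hC d hdb η 1 one_mem_Icc 0]
      show |S.closedLoopInflow K P N qcl 0 w ξ - S.closedLoopInflow K P N qcl 0 w' ξ'| ≤ _
      rw [e, abs_mul, abs_of_pos hE0]
      have h3 : |qcl * S.target K P N d η 1 1 - (S.target K P N d η 1 0 - S.tilde d 1 0)| ≤
          (|qcl| + 1) * (C + G) * R := by
        refine (abs_sub _ _).trans ?_
        rw [abs_mul]
        linarith [mul_le_mul_of_nonneg_left h1 (abs_nonneg qcl)]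
      have h4 := mul_le_mul_of_nonneg_left h3 hE0.le
      have h5 : 0 ≤ L₁ * R := by positivity
      rw [add_mul, hL₀]
      linarith
    · have e : S.closedLoopInflow K P N qcl 1 w ξ - S.closedLoopInflow K P N qcl 1 w' ξ' =
          S.q0 * d 0 0 + S.c ⬝ᵥ η := by
        rw [← d00, hηdef, dotProduct_sub]
        simp only [closedLoopInflow, cons_val_one, cons_val_fin_one]
        ring
      have h1 : |S.c ⬝ᵥ η| ≤ (∑ m, |S.c m|) * absTotal η := by
        rw [dotProduct, Finset.sum_mul]
        refine (Finset.abs_sum_le_sum_abs _ _).trans (Finset.sum_le_sum fun m _ => ?_)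
        rw [abs_mul]
        exact mul_le_mul_of_nonneg_left (Finset.single_le_sum (f := fun m => |η m|)
          (fun _ _ => abs_nonneg _) (Finset.mem_univ m)) (abs_nonneg _)
      show |S.closedLoopInflow K P N qcl 1 w ξ - S.closedLoopInflow K P N qcl 1 w' ξ'| ≤ _
      rw [e]
      refine (abs_add_le _ _).trans ?_
      rw [abs_mul]
      have hc0 : 0 ≤ ∑ m, |S.c m| := by positivity
      have k1 : |S.q0| * |d 0 0| ≤ |S.q0| * R := mul_le_mul_of_nonneg_left (by linarith) (abs_nonneg _)
      have k2 : (∑ m, |S.c m|) * absTotal η ≤ (∑ m, |S.c m|) * R :=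
        mul_le_mul_of_nonneg_left (by linarith) hc0
      have h5 : 0 ≤ L₀ * R := by positivity
      rw [add_mul, hL₁]
      linarith

theorem exists_isErrorSolution (hK : S.IsPreKernel K) (hN : S.IsDecoupling k K N)
    (hP : S.IsBacksteppingKernel N P) {w₀ : ℝ → Fin 2 → ℝ} (hw₀ : IsBddState w₀) (ξ₀ : Fin n → ℝ) :
    ∃ e ξ u, S.IsErrorSolution K P N qcl e ξ u ∧ (∀ z ∈ Icc (0 : ℝ) 1, e 0 z = w₀ z) ∧ ξ 0 = ξ₀ := by
  obtain ⟨L, hL0, hL⟩ := exists_isInflowCoupling (qcl := qcl) hK hN hP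
  obtain ⟨e, ξ, hsol, he0, hξ0, hbc⟩ :=
    exists_isSolution_of_inflowCoupling (S := S) hL hL0 (fun w ξ => rfl) hw₀ ξ₀
  refine ⟨e, ξ, _, ⟨hsol, fun t ht => ?_⟩, he0, hξ0⟩
  have hw := hsol.isBddState ht.le
  have h1 := HyperbolicPDEODE.target_one (qcl := qcl) hK hN hP hw (ξ t)
  rw [bar_one hK hw (hsol.bc1 t ht)] at h1
  have h2 : S.tilde (e t) 1 0 = qcl * S.target K P N (e t) (ξ t) 1 1 -
      (S.target K P N (e t) (ξ t) 1 0 - S.tilde (e t) 1 0) := by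
    conv_lhs => rw [tilde_apply, hbc t ht]
    have h3 : Real.exp (charSign 0 * S.alpha 0 1) * Real.exp (-S.alpha 0 1) = 1 := by
      rw [← Real.exp_add]; simp [charSign]
    simp only [closedLoopInflow, cons_val_zero]
    rw [← mul_assoc, h3, one_mul]
  linarith

theorem exists_isClosedLoopSolution (hK : S.IsPreKernel K) (hN : S.IsDecoupling k K N)
    (hP : S.IsBacksteppingKernel N P) {xr : ℝ → ℝ → Fin 2 → ℝ} {ξr : ℝ → Fin n → ℝ} {ur : ℝ → ℝ}
    (hr : S.IsSolution xr ξr ur) {x₀ : ℝ → Fin 2 → ℝ} (hx₀ : IsBddState x₀) (ξ₀ : Fin n → ℝ) :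
    ∃ x ξ, S.IsClosedLoopSolution K P N qcl xr ξr ur x ξ ∧
      (∀ z ∈ Icc (0 : ℝ) 1, x 0 z = x₀ z) ∧ ξ 0 = ξ₀ := by
  obtain ⟨e, ξ, u, h, he0, hξ0⟩ := exists_isErrorSolution (qcl := qcl) hK hN hP
    (hx₀.add_const_mul (hr.isBddState le_rfl) (-1)) (ξ₀ - ξr 0)
  refine ⟨_, _, h.isClosedLoopSolution hK hr, fun z hz => ?_, ?_⟩
  · have := he0 z hz
    simp only [Pi.add_apply, Pi.smul_apply] at this ⊢
    rw [this]
    module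
  · simp only [Pi.add_apply, Pi.smul_apply, hξ0]
    module

end

end HyperbolicPDEODE

namespace HyperbolicPDEODE

variable {n : ℕ} {S : HyperbolicPDEODE n}

/-! ### Decay of the tracking error -/

/-- The squared norm of a state in `L²`, up to equivalence. -/
def energy (w : ℝ → Fin 2 → ℝ) : ℝ := ∫ z in (0 : ℝ)..1, absSum w z ^ 2

theorem energy_nonneg (w : ℝ → Fin 2 → ℝ) : 0 ≤ energy w :=
  intervalIntegral.integral_nonneg zero_le_one fun _ _ => sq_nonneg _

theorem IsBddState.intervalIntegrable_sq {w : ℝ → Fin 2 → ℝ} (hw : IsBddState w) :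
    IntervalIntegrable (fun z => HyperbolicPDEODE.absSum w z ^ 2) volume 0 1 :=
  (hw.absSum.pow 2).intervalIntegrable (uIcc_of_le zero_le_one).le

theorem IsBddState.intervalIntegrable_abs_sq {w : ℝ → Fin 2 → ℝ} (hw : IsBddState w) (i : Fin 2) :
    IntervalIntegrable (fun z => |w z i| ^ 2) volume 0 1 :=
  ((hw i).abs.pow 2).intervalIntegrable (uIcc_of_le zero_le_one).le

theorem IsBddState.mass_sq_le {w : ℝ → Fin 2 → ℝ} (hw : IsBddState w) : mass w ^ 2 ≤ energy w := by
  have hi := hw.intervalIntegrable_absSum one_mem_Icc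
  have h : 0 ≤ ∫ z in (0 : ℝ)..1, (HyperbolicPDEODE.absSum w z - mass w) ^ 2 :=
    intervalIntegral.integral_nonneg zero_le_one fun _ _ => sq_nonneg _
  have e : ∀ z, (HyperbolicPDEODE.absSum w z - mass w) ^ 2 =
      HyperbolicPDEODE.absSum w z ^ 2 - 2 * mass w * HyperbolicPDEODE.absSum w z + mass w ^ 2 :=
    fun z => by ring
  simp only [e] at h
  rw [intervalIntegral.integral_add (hw.intervalIntegrable_sq.sub (hi.const_mul _))
    _root_.intervalIntegrable_const, intervalIntegral.integral_sub hw.intervalIntegrable_sq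
    (hi.const_mul _), intervalIntegral.integral_const_mul] at h
  simp only [intervalIntegral.integral_const, sub_zero, one_smul] at h
  change 0 ≤ energy w - 2 * mass w * mass w + mass w ^ 2 at h
  linarith

theorem energy_le_of_absSum_le {w v : ℝ → Fin 2 → ℝ} (hw : IsBddState w) (hv : IsBddState v)
    {C X : ℝ} (h : ∀ z ∈ Icc (0 : ℝ) 1, absSum v z ≤ C * (absSum w z + mass w + X)) :
    energy v ≤ 6 * C ^ 2 * (energy w + X ^ 2) := by
  have hm := hw.mass_sq_le
  have h1 : energy v ≤ ∫ z in (0 : ℝ)..1, 3 * C ^ 2 * (absSum w z ^ 2 + (mass w ^ 2 + X ^ 2)) := by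
    refine intervalIntegral.integral_mono_on zero_le_one hv.intervalIntegrable_sq
      ((hw.intervalIntegrable_sq.add _root_.intervalIntegrable_const).const_mul _) fun z hz => ?_
    refine (pow_le_pow_left₀ (absSum_nonneg v z) (h z hz) 2).trans ?_
    rw [mul_pow, mul_comm 3, mul_assoc]
    refine mul_le_mul_of_nonneg_left ?_ (sq_nonneg C)
    linarith [sq_nonneg (absSum w z - mass w), sq_nonneg (absSum w z - X), sq_nonneg (mass w - X)]
  rw [intervalIntegral.integral_const_mul, intervalIntegral.integral_add hw.intervalIntegrable_sq
    _root_.intervalIntegrable_const, intervalIntegral.integral_const, sub_zero, one_smul] at h1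
  change energy v ≤ 3 * C ^ 2 * (energy w + (mass w ^ 2 + X ^ 2)) at h1
  have h2 := mul_le_mul_of_nonneg_left hm (by positivity : 0 ≤ 3 * C ^ 2)
  have h3 : 0 ≤ 3 * C ^ 2 * X ^ 2 := by positivity
  linarith

theorem IsBddState.energy_bounds {w : ℝ → Fin 2 → ℝ} (hw : IsBddState w) :
    (∫ z in (0 : ℝ)..1, |w z 0| ^ 2) + (∫ z in (0 : ℝ)..1, |w z 1| ^ 2) ≤ energy w ∧
    energy w ≤ 2 * ((∫ z in (0 : ℝ)..1, |w z 0| ^ 2) + ∫ z in (0 : ℝ)..1, |w z 1| ^ 2) := by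
  have hi := hw.intervalIntegrable_abs_sq
  rw [← intervalIntegral.integral_add (hi 0) (hi 1), ← intervalIntegral.integral_const_mul]
  constructor
  · refine intervalIntegral.integral_mono_on zero_le_one ((hi 0).add (hi 1))
      hw.intervalIntegrable_sq fun z _ => ?_
    rw [HyperbolicPDEODE.absSum]
    linarith [mul_nonneg (abs_nonneg (w z 0)) (abs_nonneg (w z 1))]
  · refine intervalIntegral.integral_mono_on zero_le_one hw.intervalIntegrable_sq
      (((hi 0).add (hi 1)).const_mul 2) fun z _ => ?_
    rw [HyperbolicPDEODE.absSum]
    linarith [sq_nonneg (|w z 0| - |w z 1|)]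

theorem stateNormL2_arg {w : ℝ → Fin 2 → ℝ} (hw : IsBddState w) (ξ : Fin n → ℝ) :
    ξ ⬝ᵥ ξ + ∫ z in (0 : ℝ)..1, w z ⬝ᵥ w z =
      ξ ⬝ᵥ ξ + ((∫ z in (0 : ℝ)..1, |w z 0| ^ 2) + ∫ z in (0 : ℝ)..1, |w z 1| ^ 2) := by
  rw [← intervalIntegral.integral_add (hw.intervalIntegrable_abs_sq 0)
    (hw.intervalIntegrable_abs_sq 1)]
  simp only [dotProduct, Fin.sum_univ_two, sq_abs]
  simp only [sq]

theorem dotProduct_self_le (ξ : Fin n → ℝ) : ξ ⬝ᵥ ξ ≤ absTotal ξ ^ 2 := by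
  rw [dotProduct, absTotal, sq, Finset.sum_mul]
  refine Finset.sum_le_sum fun m _ => ?_
  rw [← abs_mul_abs_self]
  exact mul_le_mul_of_nonneg_left (Finset.single_le_sum (f := fun m => |ξ m|)
    (fun _ _ => abs_nonneg _) (Finset.mem_univ m)) (abs_nonneg _)

theorem absTotal_sq_le (ξ : Fin n → ℝ) : absTotal ξ ^ 2 ≤ n * (ξ ⬝ᵥ ξ) := by
  have := sq_sum_le_card_mul_sum_sq (s := Finset.univ) (f := fun m => |ξ m|)
  simpa [absTotal, dotProduct, sq] using this

theorem dotProduct_self_nonneg (ξ : Fin n → ℝ) : 0 ≤ ξ ⬝ᵥ ξ :=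
  Finset.sum_nonneg fun _ _ => mul_self_nonneg _

/-- The norm on `ℝⁿ × L²`, compared with the energy. -/
theorem stateNormL2_le_of_energy_le {w w' : ℝ → Fin 2 → ℝ} (hw : IsBddState w) (hw' : IsBddState w')
    {ξ ξ' : Fin n → ℝ} {D : ℝ} (hD : 0 ≤ D)
    (h : energy w + absTotal ξ ^ 2 ≤ D ^ 2 * (energy w' + absTotal ξ' ^ 2)) :
    stateNormL2 w ξ ≤ D * Real.sqrt (n + 2) * stateNormL2 w' ξ' := by
  rw [stateNormL2, stateNormL2, stateNormL2_arg hw, stateNormL2_arg hw', mul_assoc,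
    ← Real.sqrt_mul (by positivity), ← Real.sqrt_sq hD, ← Real.sqrt_mul (sq_nonneg D)]
  refine Real.sqrt_le_sqrt ?_
  have h1 := hw.energy_bounds.1
  have h2 := hw'.energy_bounds.2
  have h3 := dotProduct_self_le ξ
  have h4 := absTotal_sq_le ξ'
  have h5 := dotProduct_self_nonneg ξ'
  set q := (∫ z in (0 : ℝ)..1, |w' z 0| ^ 2) + ∫ z in (0 : ℝ)..1, |w' z 1| ^ 2
  have hq0 : 0 ≤ q := by linarith [energy_nonneg w']
  have hn : (0 : ℝ) ≤ n := Nat.cast_nonneg n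
  have h6 : energy w' + absTotal ξ' ^ 2 ≤ (n + 2) * (ξ' ⬝ᵥ ξ' + q) := by
    linarith [mul_nonneg hn hq0]
  linarith [mul_le_mul_of_nonneg_left h6 (sq_nonneg D)]

section

variable {K P : ℝ → ℝ → Matrix (Fin 2) (Fin 2) ℝ} {N : ℝ → Matrix (Fin 2) (Fin n) ℝ}
  {k : Fin n → ℝ} {qcl : ℝ}

theorem IsErrorSolution.isTargetSolution {e : ℝ → ℝ → Fin 2 → ℝ} {ξ : ℝ → Fin n → ℝ} {u : ℝ → ℝ}
    (hq0 : S.q0 ≠ 0) (hK : S.IsPreKernel K) (hN : S.IsDecoupling k K N)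
    (hP : S.IsBacksteppingKernel N P) (h : S.IsErrorSolution K P N qcl e ξ u) :
    S.IsTargetSolution qcl fun t => S.target K P N (e t) (ξ t) :=
  ⟨h.sol.isTransported_target hq0 hK hN hP, fun t ht => by
    rw [target_zero]; exact h.sol.decoupled_zero_one hN ht, fun _ ht => h.target_one hK hN hP ht⟩

theorem IsSolution.isBddPrimitive_closedLoop {e : ℝ → ℝ → Fin 2 → ℝ} {ξ : ℝ → Fin n → ℝ} {u : ℝ → ℝ}
    (h : S.IsSolution e ξ u) (hN : S.IsDecoupling k K N) (m : Fin n) (T : ℝ) :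
    IsBddPrimitive (fun s => ξ s m) (fun s => ((S.F + vecMulVec S.b k) *ᵥ ξ s) m +
      S.target K P N (e s) (ξ s) 0 0 * S.b m) 0 T := by
  refine (h.isBddPrimitive_ode m T).congr (fun _ _ => rfl) fun s _ => ?_
  rw [target_zero, IsSolution.decoupled_zero_zero hN, Matrix.add_mulVec, Matrix.vecMulVec_mulVec]
  simp only [Pi.add_apply, Pi.smul_apply, smul_eq_mul, op_smul_eq_smul]
  ring

/-- Exponential decay of the target state and of the ODE state. -/
theorem exists_target_decay (hq0 : S.q0 ≠ 0) (hK : S.IsPreKernel K) (hN : S.IsDecoupling k K N)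
    (hP : S.IsBacksteppingKernel N P) (hk : IsHurwitz (S.F + vecMulVec S.b k))
    (hqcl : |S.q0 * qcl| < 1) :
    ∃ C ω : ℝ, 0 < C ∧ 0 < ω ∧ ∀ e ξ u, S.IsErrorSolution K P N qcl e ξ u → ∀ t, 0 ≤ t →
      absTotal (ξ t) ≤ C * Real.exp (-ω * t) *
        (absTotal (ξ 0) + mass (S.target K P N (e 0) (ξ 0))) ∧
      energy (S.target K P N (e t) (ξ t)) ≤
        (C * Real.exp (-ω * t)) ^ 2 * energy (S.target K P N (e 0) (ξ 0)) ∧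
      ∀ B, (∀ z ∈ Icc (0 : ℝ) 1, ∀ i, |S.target K P N (e 0) (ξ 0) z i| ≤ B) →
        ∀ z ∈ Icc (0 : ℝ) 1, ∀ i, |S.target K P N (e t) (ξ t) z i| ≤ C * Real.exp (-ω * t) * B := by
  obtain ⟨μ, hμ, hρ⟩ := exists_decay_rate hqcl (loopTime_pos (S := S))
  obtain ⟨C₁, ω, hC₁, hω, hωμ, hode⟩ := exists_ode_decay (S := S) hk S.b hq0 hμ hρ
  obtain ⟨m, M, hm, hM, hsp⟩ := S.exists_speed_bounds
  set a := Real.exp (μ * S.loopTime) * (1 + |S.q0|) with ha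
  set b := Real.exp (μ * S.loopTime) * (1 + |S.q0|⁻¹) with hb
  have ha0 : 0 < a := by positivity
  have hb0 : 0 < b := by positivity
  set c₁ := n * C₁ * (1 + a * m⁻¹) with hc₁
  set c₂ := 2 * b ^ 2 * M * (a ^ 2 * m⁻¹) with hc₂
  set c₃ := a * b with hc₃
  have hc₁0 : 0 ≤ c₁ := by positivity
  have hc₂0 : 0 ≤ c₂ := by positivity
  have hc₃0 : 0 < c₃ := by positivity
  refine ⟨c₁ + (c₂ + 1) + c₃, ω, by positivity, hω, fun e ξ u h t ht => ?_⟩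
  set v := fun t => S.target K P N (e t) (ξ t) with hv
  have hT : S.IsTargetSolution qcl v := h.isTargetSolution hq0 hK hN hP
  have hvb : ∀ t, 0 ≤ t → IsBddState (v t) := fun t ht => (h.sol.isBddState ht).target hK hN hP (ξ t)
  have hexp : Real.exp (-μ * t) ≤ Real.exp (-ω * t) :=
    Real.exp_le_exp.2 (by linarith [mul_le_mul_of_nonneg_right hωμ ht])
  set E := Real.exp (-ω * t) with hE
  have hE0 : 0 < E := Real.exp_pos _
  refine ⟨?_, ?_, ?_⟩
  · have h1 := hode v ξ hT (fun m T => h.sol.isBddPrimitive_closedLoop hN m T) t ht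
    have h2 := hT.integral_weightedSignal_le hμ hm (fun i z => (hsp i z).1) 1
    simp only [pow_one] at h2
    have h3 : (∫ z in (0 : ℝ)..1, |v 0 z 0|) + (∫ z in (0 : ℝ)..1, |v 0 z 1|) = mass (v 0) := by
      have hi : ∀ i, IntervalIntegrable (fun z => |v 0 z i|) volume 0 1 := fun i =>
        (hvb 0 le_rfl i).abs.intervalIntegrable (uIcc_of_le zero_le_one).le
      rw [← intervalIntegral.integral_add (hi 0) (hi 1)]
      rfl
    rw [h3] at h2
    have h4 : absTotal (ξ t) ≤ ∑ _m : Fin n, C₁ * E * (absTotal (ξ 0) + a * m⁻¹ * mass (v 0)) :=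
      Finset.sum_le_sum fun i _ => (h1 i).trans (mul_le_mul_of_nonneg_left
        (add_le_add le_rfl h2) (by positivity))
    rw [Finset.sum_const, Finset.card_univ, Fintype.card_fin, nsmul_eq_mul] at h4
    have hX := absTotal_nonneg (ξ 0)
    have hm0 := mass_nonneg (v 0)
    have h5 : absTotal (ξ 0) + a * m⁻¹ * mass (v 0) ≤ (1 + a * m⁻¹) * (absTotal (ξ 0) + mass (v 0)) := by
      have : 0 ≤ a * m⁻¹ * absTotal (ξ 0) := by positivity
      linarith
    have h6 := mul_le_mul_of_nonneg_left h5 (by positivity : 0 ≤ n * (C₁ * E))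
    have h7 : 0 ≤ (c₂ + 1 + c₃) * E * (absTotal (ξ 0) + mass (v 0)) := by positivity
    change absTotal (ξ t) ≤ (c₁ + (c₂ + 1) + c₃) * E * (absTotal (ξ 0) + mass (v 0))
    have h8 : (c₁ + (c₂ + 1) + c₃) * E * (absTotal (ξ 0) + mass (v 0)) =
        n * (C₁ * E) * ((1 + a * m⁻¹) * (absTotal (ξ 0) + mass (v 0))) +
          (c₂ + 1 + c₃) * E * (absTotal (ξ 0) + mass (v 0)) := by rw [hc₁]; ring
    rw [h8]
    linarith
  · have h1 := hT.integral_sq_le hq0 hμ (fun i z => (hsp i z).2) ht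
    have h2 := hT.integral_window_le hρ 2 ht
    have h3 := hT.integral_weightedSignal_le hμ hm (fun i z => (hsp i z).1) 2
    have h4 := (hvb t ht).energy_bounds.2
    have h5 := (hvb 0 le_rfl).energy_bounds.1
    have hen := energy_nonneg (v 0)
    have k1 := h2.trans (h3.trans (mul_le_mul_of_nonneg_left h5 (by positivity)))
    have k2 := h1.trans (mul_le_mul_of_nonneg_left k1 (by positivity))
    change energy (v t) ≤ ((c₁ + (c₂ + 1) + c₃) * E) ^ 2 * energy (v 0)
    have k3 : energy (v t) ≤ c₂ * Real.exp (-μ * t) ^ 2 * energy (v 0) := by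
      rw [hc₂]
      refine h4.trans ((mul_le_mul_of_nonneg_left k2 zero_le_two).trans (le_of_eq ?_))
      rw [← ha, ← hb]
      ring
    refine k3.trans (mul_le_mul_of_nonneg_right ?_ hen)
    rw [mul_pow]
    refine mul_le_mul ?_ (pow_le_pow_left₀ (Real.exp_pos _).le hexp 2) (by positivity) (by positivity)
    have k4 : c₂ + 1 ≤ c₁ + (c₂ + 1) + c₃ := by linarith
    refine le_trans ?_ (pow_le_pow_left₀ (by positivity) k4 2)
    linarith [sq_nonneg c₂]
  · intro B hB z hz i
    have hB0 : 0 ≤ B := (abs_nonneg _).trans (hB z hz i)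
    refine (hT.abs_le hq0 hμ hρ hB ht hz i).trans (mul_le_mul_of_nonneg_right ?_ hB0)
    have k1 : Real.exp (μ * S.loopTime) ^ 2 * (1 + |S.q0|) * (1 + |S.q0|⁻¹) = c₃ := by
      rw [hc₃, ha, hb]; ring
    rw [k1]
    exact mul_le_mul (by linarith) hexp (Real.exp_pos _).le (by positivity)

end

end HyperbolicPDEODE

namespace HyperbolicPDEODE

variable {n : ℕ} {S : HyperbolicPDEODE n}

section

variable {K P : ℝ → ℝ → Matrix (Fin 2) (Fin 2) ℝ} {N : ℝ → Matrix (Fin 2) (Fin n) ℝ}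
  {k : Fin n → ℝ} {qcl : ℝ}

theorem norm_le_absTotal (ξ : Fin n → ℝ) : ‖ξ‖ ≤ absTotal ξ :=
  (pi_norm_le_iff_of_nonneg (absTotal_nonneg ξ)).2 fun m =>
    Finset.single_le_sum (f := fun m => |ξ m|) (fun _ _ => abs_nonneg _) (Finset.mem_univ m)

theorem absTotal_le_norm (ξ : Fin n → ℝ) : absTotal ξ ≤ n * ‖ξ‖ := by
  refine (Finset.sum_le_sum fun m _ => norm_le_pi_norm ξ m).trans (le_of_eq ?_)
  simp

theorem norm_le_absSum (w : ℝ → Fin 2 → ℝ) (z : ℝ) : ‖w z‖ ≤ absSum w z :=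
  (pi_norm_le_iff_of_nonneg (absSum_nonneg w z)).2 fun i => abs_le_absSum w z i

theorem absSum_le_of_abs_le {w : ℝ → Fin 2 → ℝ} {z B : ℝ} (h : ∀ i, |w z i| ≤ B) :
    absSum w z ≤ 2 * B := by
  rw [absSum]; linarith [h 0, h 1]

theorem mass_le_of_absSum_le {w : ℝ → Fin 2 → ℝ} (hw : IsBddState w) {B : ℝ}
    (h : ∀ z ∈ Icc (0 : ℝ) 1, absSum w z ≤ B) : mass w ≤ B := by
  simpa using mass_mono hw (_root_.intervalIntegrable_const (c := B)) h

/-- Exponential decay of the tracking error in `ℝⁿ × L²` and in the maximum norm. -/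
theorem exists_error_decay (hq0 : S.q0 ≠ 0) (hK : S.IsPreKernel K) (hN : S.IsDecoupling k K N)
    (hP : S.IsBacksteppingKernel N P) (hk : IsHurwitz (S.F + vecMulVec S.b k))
    (hqcl : |S.q0 * qcl| < 1) :
    ∃ M ω : ℝ, 0 < M ∧ 0 < ω ∧ ∀ e ξ u, S.IsErrorSolution K P N qcl e ξ u →
      (∀ t, 0 ≤ t → stateNormL2 (e t) (ξ t) ≤
        M * Real.exp (-ω * t) * stateNormL2 (e 0) (ξ 0)) ∧
      ∀ B : ℝ, ‖ξ 0‖ ≤ B → (∀ z ∈ Icc (0 : ℝ) 1, ‖e 0 z‖ ≤ B) →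
        ∀ t, 0 ≤ t → ‖ξ t‖ ≤ M * Real.exp (-ω * t) * B ∧
          ∀ z ∈ Icc (0 : ℝ) 1, ‖e t z‖ ≤ M * Real.exp (-ω * t) * B := by
  obtain ⟨C, ω, hC, hω, hdecay⟩ := exists_target_decay (qcl := qcl) hq0 hK hN hP hk hqcl
  obtain ⟨G, hG0, hG⟩ := exists_absSum_target_le hK hN hP
  obtain ⟨H, hH0, hH⟩ := exists_absSum_le_target hK hN hP
  set a := Real.sqrt ((6 * H ^ 2 + 1) * (18 * G ^ 2 + 2)) with ha
  set b := G * (n + 4) with hb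
  have hb0 : 0 ≤ b := by positivity
  set m₁ := C * a * Real.sqrt (n + 2) with hm₁
  set m₂ := C * (n + b) with hm₂
  set m₃ := H * (C * (5 * b + n)) with hm₃
  have hm₁0 : 0 ≤ m₁ := by positivity
  have hm₂0 : 0 ≤ m₂ := by positivity
  have hm₃0 : 0 ≤ m₃ := by positivity
  refine ⟨m₁ + m₂ + m₃ + 1, ω, by positivity, hω, fun e ξ u h => ⟨fun t ht => ?_, fun B hξ he t ht => ?_⟩⟩
  · obtain ⟨hX, hV, -⟩ := hdecay e ξ u h t ht
    set d := C * Real.exp (-ω * t) with hd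
    have hd0 : 0 ≤ d := by positivity
    have h0 := h.sol.isBddState le_rfl
    have h1 := h.sol.isBddState ht
    have v0 := h0.target hK hN hP (ξ 0)
    have v1 := h1.target hK hN hP (ξ t)
    have k1 := energy_le_of_absSum_le h0 v0 (hG _ h0 (ξ 0))
    have k2 := energy_le_of_absSum_le v1 h1 (hH _ h1 (ξ t))
    set R := energy (e 0) + absTotal (ξ 0) ^ 2 with hR
    have hR0 : 0 ≤ R := add_nonneg (energy_nonneg _) (sq_nonneg _)
    set V := energy (S.target K P N (e 0) (ξ 0)) with hV'
    have k3 : absTotal (ξ t) ^ 2 ≤ d ^ 2 * (2 * (absTotal (ξ 0) ^ 2 + V)) := by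
      refine (pow_le_pow_left₀ (absTotal_nonneg _) hX 2).trans ?_
      rw [mul_pow]
      refine mul_le_mul_of_nonneg_left ?_ (sq_nonneg d)
      linarith [sq_nonneg (absTotal (ξ 0) - mass (S.target K P N (e 0) (ξ 0))), v0.mass_sq_le]
    have k4 : energy (S.target K P N (e t) (ξ t)) + absTotal (ξ t) ^ 2 ≤
        d ^ 2 * ((18 * G ^ 2 + 2) * R) := by
      have : V + 2 * (absTotal (ξ 0) ^ 2 + V) ≤ (18 * G ^ 2 + 2) * R := by
        linarith [energy_nonneg (e 0)]
      linarith [mul_le_mul_of_nonneg_left this (sq_nonneg d)]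
    have k5 : absTotal (ξ t) ^ 2 ≤ d ^ 2 * ((18 * G ^ 2 + 2) * R) := by
      linarith [energy_nonneg (S.target K P N (e t) (ξ t))]
    have k6 : energy (e t) + absTotal (ξ t) ^ 2 ≤ (d * a) ^ 2 * R := by
      have := mul_le_mul_of_nonneg_left k4 (by positivity : 0 ≤ 6 * H ^ 2)
      rw [mul_pow, ha, Real.sq_sqrt (by positivity)]
      linarith
    refine (stateNormL2_le_of_energy_le h1 h0 (by positivity) k6).trans ?_
    refine mul_le_mul_of_nonneg_right ?_ (Real.sqrt_nonneg _)
    have e1 : d * a * Real.sqrt (n + 2) = m₁ * Real.exp (-ω * t) := by rw [hd, hm₁]; ring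
    rw [e1]
    exact mul_le_mul_of_nonneg_right (by linarith) (Real.exp_pos _).le
  · obtain ⟨hX, -, hV⟩ := hdecay e ξ u h t ht
    set E := Real.exp (-ω * t) with hE
    have hE0 : 0 < E := Real.exp_pos _
    have hB0 : 0 ≤ B := (norm_nonneg _).trans hξ
    have h0 := h.sol.isBddState le_rfl
    have h1 := h.sol.isBddState ht
    have v0 := h0.target hK hN hP (ξ 0)
    have v1 := h1.target hK hN hP (ξ t)
    have hX0 : absTotal (ξ 0) ≤ n * B :=
      (absTotal_le_norm _).trans (mul_le_mul_of_nonneg_left hξ (Nat.cast_nonneg n))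
    have he0 : ∀ z ∈ Icc (0 : ℝ) 1, absSum (e 0) z ≤ 2 * B := fun z hz =>
      absSum_le_of_abs_le fun i => (norm_le_pi_norm (e 0 z) i).trans (he z hz)
    have hm0 := mass_le_of_absSum_le h0 he0
    have hv0 : ∀ z ∈ Icc (0 : ℝ) 1, absSum (S.target K P N (e 0) (ξ 0)) z ≤ b * B := fun z hz => by
      refine (hG _ h0 (ξ 0) z hz).trans ?_
      rw [hb, mul_assoc]
      exact mul_le_mul_of_nonneg_left (by linarith [he0 z hz]) hG0
    have hvm0 := mass_le_of_absSum_le v0 hv0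
    have hXt : absTotal (ξ t) ≤ m₂ * E * B := by
      refine hX.trans ((mul_le_mul_of_nonneg_left (add_le_add hX0 hvm0) (by positivity)).trans
        (le_of_eq ?_))
      rw [hm₂]; ring
    have hvt : ∀ z ∈ Icc (0 : ℝ) 1, absSum (S.target K P N (e t) (ξ t)) z ≤ 2 * (C * E * (b * B)) :=
      fun z hz => absSum_le_of_abs_le (hV (b * B) (fun z hz i =>
        (abs_le_absSum _ z i).trans (hv0 z hz)) z hz)
    have hvmt := mass_le_of_absSum_le v1 hvt
    have hEB : 0 ≤ E * B := by positivity
    refine ⟨(norm_le_absTotal _).trans (hXt.trans ?_), fun z hz => (norm_le_absSum _ z).trans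
      ((hH _ h1 (ξ t) z hz).trans ?_)⟩
    · have k1 := mul_le_mul_of_nonneg_right
        (by linarith : m₂ ≤ m₁ + m₂ + m₃ + 1) hEB
      linarith
    · have k1 := mul_le_mul_of_nonneg_left (add_le_add (add_le_add (hvt z hz) hvmt) hXt) hH0
      have k2 := mul_le_mul_of_nonneg_right
        (by linarith : m₃ ≤ m₁ + m₂ + m₃ + 1) hEB
      have k3 : H * (2 * (C * E * (b * B)) + 2 * (C * E * (b * B)) + m₂ * E * B) = m₃ * (E * B) := by
        rw [hm₃, hm₂]; ring
      rw [k3] at k1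
      exact k1.trans (k2.trans (le_of_eq (by ring)))

end

end HyperbolicPDEODE
end

theorem theorem2 {n : ℕ} (S : HyperbolicPDEODE n)
    (hctrl : IsControllablePair S.F S.b) (hq0 : S.q0 ≠ 0)
    (k : Fin n → ℝ) (hk : IsHurwitz (S.F + vecMulVec S.b k))
    (qcl : ℝ) (hqcl : |S.q0 * qcl| < 1) :
    -- the gains of the controller exist
    (∃ K N P, S.IsPreKernel K ∧ S.IsDecoupling k K N ∧ S.IsBacksteppingKernel N P) ∧
    -- and the controller given by them stabilizes exponentially
    ∀ K N P, S.IsPreKernel K → S.IsDecoupling k K N → S.IsBacksteppingKernel N P →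
      -- the closed loop has a solution for every reference and every initial state
      (∀ xr ξr ur, S.IsSolution xr ξr ur →
        ∀ (x₀ : ℝ → Fin 2 → ℝ) (ξ₀ : Fin n → ℝ),
          (∀ i, Measurable ((Icc (0 : ℝ) 1).domRestrict fun z => x₀ z i)) →
          (∃ B : ℝ, ∀ z ∈ Icc (0 : ℝ) 1, ∀ i, |x₀ z i| ≤ B) →
          ∃ x ξ, S.IsClosedLoopSolution K P N qcl xr ξr ur x ξ ∧
            (∀ z ∈ Icc (0 : ℝ) 1, x 0 z = x₀ z) ∧ ξ 0 = ξ₀) ∧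
      -- and the tracking error decays exponentially, in `ℝⁿ × L²` and pointwise in space
      ∃ M ω : ℝ, 0 < M ∧ 0 < ω ∧
        ∀ xr ξr ur, S.IsSolution xr ξr ur →
        ∀ x ξ, S.IsClosedLoopSolution K P N qcl xr ξr ur x ξ →
          (∀ t, 0 ≤ t → stateNormL2 (x t - xr t) (ξ t - ξr t) ≤
            M * Real.exp (-ω * t) * stateNormL2 (x 0 - xr 0) (ξ 0 - ξr 0)) ∧
          (∀ B : ℝ, ‖ξ 0 - ξr 0‖ ≤ B → (∀ z ∈ Icc (0 : ℝ) 1, ‖x 0 z - xr 0 z‖ ≤ B) →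
            ∀ t, 0 ≤ t → ‖ξ t - ξr t‖ ≤ M * Real.exp (-ω * t) * B ∧
              ∀ z ∈ Icc (0 : ℝ) 1, ‖x t z - xr t z‖ ≤ M * Real.exp (-ω * t) * B) := by
  refine ⟨?_, fun K N P hK hN hP => ⟨fun xr ξr ur hr x₀ ξ₀ hm ⟨B, hB⟩ =>
    HyperbolicPDEODE.exists_isClosedLoopSolution hK hN hP hr
      (fun i => ⟨hm i, B, fun z hz => hB z hz i⟩) ξ₀, ?_⟩⟩
  · obtain ⟨K, hK⟩ := S.exists_isPreKernel
    obtain ⟨N, hN⟩ := HyperbolicPDEODE.exists_isDecoupling hK k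
    obtain ⟨P, hP⟩ := HyperbolicPDEODE.exists_isBacksteppingKernel hN hq0
    exact ⟨K, N, P, hK, hN, hP⟩
  · obtain ⟨M, ω, hM, hω, h⟩ :=
      HyperbolicPDEODE.exists_error_decay (qcl := qcl) hq0 hK hN hP hk hqcl
    refine ⟨M, ω, hM, hω, fun xr ξr ur hr x ξ hx => ?_⟩
    obtain ⟨u, hu⟩ := hx.isErrorSolution hK hr
    have e1 : ∀ t, (x + (-1 : ℝ) • xr) t = x t - xr t := fun t => by
      simp only [Pi.add_apply, Pi.smul_apply]; module
    have e2 : ∀ t, (ξ + (-1 : ℝ) • ξr) t = ξ t - ξr t := fun t => by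
      simp only [Pi.add_apply, Pi.smul_apply]; module
    have := h _ _ _ hu
    simp only [e1, e2] at this
    exact this
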